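/- Fix an integer $n\ge 3$ and $q,d\in\mathbb C^\times$; put $q_1=q^{-1}d$, $q_2=q^2$, $q_3=q^{-1}d^{-1}$ and assume that $q_1^iq_2^j=1$ $(i,j\in\mathbb Z)$ only for $i=j=0$. For $i,j\in\mathbb Z/n\mathbb Z$ let $$g_{i,i}(z,w)=z-q^2w,\quad g_{i,i\pm1}(z,w)=z-q^{-1}d^{\pm1}w,\quad G_{i,i}(x)=q^2\tfrac{1-q^{-2}x}{1-q^2x},\quad G_{i,i\pm1}(x)=q^{-1}\tfrac{1-qd^{\pm1}x}{1-q^{-1}d^{\pm1}x}$$ and $g_{i,j}(z,w)=z-w$, $G_{i,j}=1$ otherwise, the $G_{i,j}$ being expanded in powers of $x$. Let $d_{i,j}=d^{\pm1}$ if $i=j\pm1$ and $d_{i,j}=1$ otherwise; $\delta(z)=\sum_{k\in\mathbb Z}z^k$, $[A,B]_p=AB-pBA$, and let $\mathrm{Sym}_{z_1,z_2}$ be the average over the two permutations of $z_1,z_2$. Let $P=\bigoplus_i\mathbb Z\varepsilon_i$ with $(\varepsilon_i,\varepsilon_j)=\delta_{i,j}$ and $\bar\alpha_i=\varepsilon_{i-1}-\varepsilon_i$.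 **The algebra $\mathcal E_n$** (quantum toroidal $\mathfrak{gl}_n$) has generators $e_{i,k},f_{i,k}$ $(k\in\mathbb Z)$, $h_{i,r}$ $(r\in\mathbb Z\setminus\{0\})$, $q^h$ $(h\in P)$ and central $C^{\pm1}$. With $e_i(z)=\sum_k e_{i,k}z^{-k}$, $f_i(z)=\sum_k f_{i,k}z^{-k}$ and $\psi_i^\pm(z)=q^{\pm\bar\alpha_i}\exp(\pm(q-q^{-1})\sum_{r>0}h_{i,\pm r}z^{\mp r})$ the relations are: $q^hq^{h'}=q^{h+h'}$, $q^0=1$; $q^he_i(z)q^{-h}=q^{(h,\bar\alpha_i)}e_i(z)$, $q^hf_i(z)q^{-h}=q^{-(h,\bar\alpha_i)}f_i(z)$, $q^h\psi_i^\pm(z)q^{-h}=\psi_i^\pm(z)$; $\psi_i^\pm(z)\psi_j^\pm(w)=\psi_j^\pm(w)\psi_i^\pm(z)$; $$\psi_i^+(z)\psi_j^-(w)=\psi_j^-(w)\psi_i^+(z)G_{i,j}(Cw/z)^{-1}G_{i,j}(C^{-1}w/z),$$ $$\psi_i^+(z)e_j(w)=e_j(w)\psi_i^+(z)G_{i,j}(C^{-1}w/z),\qquad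 e_j(w)\psi_i^-(z)=\psi_i^-(z)e_j(w)G_{j,i}(z/w),$$ $$\psi_i^+(z)f_j(w)=f_j(w)\psi_i^+(z)G_{i,j}(w/z)^{-1},\qquad f_j(w)\psi_i^-(z)=\psi_i^-(z)f_j(w)G_{j,i}(Cz/w)^{-1},$$ $$[e_i(z),f_j(w)]=\tfrac{\delta_{i,j}}{q-q^{-1}}\bigl(\delta(Cw/z)\psi_i^+(w)-\delta(Cz/w)\psi_i^-(z)\bigr),$$ $$d_{i,j}g_{i,j}(z,w)e_i(z)e_j(w)+g_{j,i}(w,z)e_j(w)e_i(z)=0,\qquad d_{j,i}g_{j,i}(w,z)f_i(z)f_j(w)+g_{i,j}(z,w)f_j(w)f_i(z)=0,$$ $[e_i(z),e_j(w)]=[f_i(z),f_j(w)]=0$ for $i\ne j,j\pm1$, and $\mathrm{Sym}_{z_1,z_2}[x_i(z_1),[x_i(z_2),x_{i\pm1}(w)]_q]_{q^{-1}}=0$ for $x=e,f$. Put $\tilde f_i(z)=-f_i(C^{-1}z)\psi_i^+(C^{-1}z)^{-1}$. **The algebra $\mathcal K_n$** has generators $E_{i,k}$ $(k\in\mathbb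 Z)$, $H_{i,r}$ $(r\in\mathbb Z\setminus\{0\})$, $K_{i,0}^\pm$ and central $C^{\pm1}$. With $E_i(z)=\sum_kE_{i,k}z^{-k}$ and $K_i^\pm(z)=K_{i,0}^\pm\exp(\pm(q-q^{-1})\sum_{r>0}H_{i,\pm r}z^{\mp r})$ the relations are: $K_i^\pm(z)K_j^\pm(w)=K_j^\pm(w)K_i^\pm(z)$, $$K_i^+(z)K_j^-(w)=K_j^-(w)K_i^+(z)G_{i,j}(w/z)G_{i,j}(C^2w/z),$$ $$K_i^+(z)E_j(w)=E_j(w)K_i^+(z)G_{i,j}(w/z),\qquad E_j(w)K_i^-(z)=K_i^-(z)E_j(w)G_{j,i}(z/w),$$ $$d_{i,j}g_{i,j}(z,w)E_i(z)E_j(w)+g_{j,i}(w,z)E_j(w)E_i(z)$$ $$=\tfrac{\delta_{i,j}}{q-q^{-1}}\bigl(g_{i,i}(z,w)\delta(C^2z/w)K_i^-(z)K_i^+(C^2z)+g_{i,i}(w,z)\delta(C^2w/z)K_i^-(w)K_i^+(C^2w)\bigr),$$ $E_i(z)E_j(w)=E_j(w)E_i(z)$ for $i\ne j,j\pm1$,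 and $$\mathrm{Sym}_{z_1,z_2}[E_i(z_1),[E_i(z_2),E_{i\pm1}(w)]_q]_{q^{-1}}$$ $$=-\mathrm{Sym}_{z_1,z_2}\Bigl\{\Bigl(\tfrac1{1-q^{-1}d^{\mp1}z_1/w}+\tfrac{q^{-1}d^{\pm1}w/z_2}{1-q^{-1}d^{\pm1}w/z_2}\Bigr)\delta(C^2z_1/z_2)K_i^-(z_1)E_{i\pm1}(w)K_i^+(z_2)\Bigr\},$$ the fractions being expanded in non-negative powers of $z_1/w$ and $w/z_2$. Both algebras are graded by $\deg x_{i,r}=r$ for $x=e,f,h,E,H$, the other generators having degree $0$. An **admissible module** is a $\mathbb Z$-graded complex vector space with finite-dimensional components and degrees bounded from above, with operators representing the generators, homogeneous of the respective degrees, $C$ being diagonalizable, such that all relations hold coefficient by coefficient (the infinite sums of operators that occur in them are finite on each vector). For admissible $\mathcal E_n$-modules $V_1,V_2$ on which $C$ acts by scalars $C_1,C_2$, $\mathcal E_n$ acts on $V_1\otimes V_2$ by $\Delta e_i(z)=e_i(C_2z)\otimes\psi_i^-(z)+1\otimes e_i(z)$, $\Delta f_i(z)=f_i(z)\otimes1+\psi_i^+(z)\otimes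 f_i(C_1z)$, $\Delta\psi_i^+(z)=\psi_i^+(z)\otimes\psi_i^+(C_1z)$, $\Delta\psi_i^-(z)=\psi_i^-(C_2z)\otimes\psi_i^-(z)$, $\Delta x=x\otimes x$ for $x=q^h,C$. On the trivial module $\mathbb C$ (in degree $0$), $e,f,h$ act by $0$ and $q^h,C$ by $1$. **Theorem 3.3.** Let $V$ be an admissible $\mathcal E_n$-module and $W$ an admissible $\mathcal K_n$-module on which $C$ acts by scalars $C_1$ and $C_2$ respectively. Put $C_{12}=C_1C_2$ and assume $$C_2^2\ne\pm1,\,q^{\pm2},\qquad C_{12}^2\ne\pm1,\,q^{\pm2}.$$ Then $V\otimes W$, with the tensor product grading, is an admissible $\mathcal K_n$-module by $$\Delta E_i(z)=e_i(C_2z)\otimes K_i^-(z)+1\otimes E_i(z)+\tilde f_i(C_2^{-1}z)\otimes K_i^+(z),$$ $$\Delta K_i^+(z)=\psi_i^+(C_1^{-1}C_2^{-1}z)^{-1}\otimes K_i^+(z),\qquad\Delta K_i^-(z)=\psi_i^-(C_2z)\otimes K_i^-(z),\qquad\Delta C=C_{12},$$ where each Fourier coefficient is a locally finite sum of operators. More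 precisely, $\Delta H_{i,r}=-C_{12}^rh_{i,r}\otimes1+1\otimes H_{i,r}$ and $\Delta H_{i,-r}=C_2^rh_{i,-r}\otimes1+1\otimes H_{i,-r}$ for $r>0$, and $\Delta K_{i,0}^\pm=q^{-\bar\alpha_i}\otimes K_{i,0}^\pm$; in particular $\Delta K^\pm_{i,0}$ is invertible if $K^\pm_{i,0}$ is. Moreover, if $V_1,V_2$ are admissible $\mathcal E_n$-modules and $W$ an admissible $\mathcal K_n$-module on each of which $C$ acts by a scalar, the canonical isomorphisms $$(V_1\otimes V_2)\otimes W\cong V_1\otimes(V_2\otimes W),\qquad\mathbb C\otimes W\cong W$$ preserve the gradings and identify the actions of all generators of $\mathcal K_n$ given by these formulas (coassociativity and counit property). -/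

import Mathlib

open scoped TensorProduct

noncomputable section

/-! ## Locally finite sums of operators and formal currents

A current `A(z) = ∑ A_k z^{-k}` is encoded by its coefficients `k ↦ A k`. -/

/-- A family of operators is locally finite if every vector is killed by all but finitely many. -/
def LocFin {V : Type*} [AddCommGroup V] [Module ℂ V] {ι : Type*}
    (f : ι → Module.End ℂ V) : Prop :=
  ∀ v : V, (Function.support fun i => f i v).Finite

open Classical in
/-- The sum of a locally finite family of operators, `v ↦ ∑ f i v`
(with the junk value `0` if the family is not locally finite). -/
def locSum {V : Type*} [AddCommGroup V] [Module ℂ V] {ι : Type*}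
    (f : ι → Module.End ℂ V) : Module.End ℂ V :=
  if h : LocFin f then
    { toFun := fun v => ∑ᶠ i, f i v
      map_add' := fun v w => by
        simp only [map_add]
        exact finsum_add_distrib (h v) (h w)
      map_smul' := fun c v => by
        simp only [map_smul, RingHom.id_apply]
        exact (smul_finsum' c (h v)).symm }
  else 0

/-- The current `A(cz)`. -/
def scaleCur {V : Type*} [AddCommGroup V] [Module ℂ V] (c : ℂ)
    (A : ℤ → Module.End ℂ V) : ℤ → Module.End ℂ V :=
  fun k => c ^ (-k) • A k

/-- The terms of the coefficient of `z^{-k}` in `A(z)B(z)`. -/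
def convTerms {V : Type*} [AddCommGroup V] [Module ℂ V]
    (A B : ℤ → Module.End ℂ V) (k : ℤ) : ℤ → Module.End ℂ V :=
  fun a => A a * B (k - a)

/-- The current `A(z)B(z)`. -/
def convCur {V : Type*} [AddCommGroup V] [Module ℂ V]
    (A B : ℤ → Module.End ℂ V) : ℤ → Module.End ℂ V :=
  fun k => locSum (convTerms A B k)

/-- The terms of the coefficient of `z^{-k}` in `A(z) ⊗ B(z)`. -/
def tensorTerms {V W : Type*} [AddCommGroup V] [Module ℂ V] [AddCommGroup W] [Module ℂ W]
    (A : ℤ → Module.End ℂ V) (B : ℤ → Module.End ℂ W) (k : ℤ) :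
    ℤ → Module.End ℂ (V ⊗[ℂ] W) :=
  fun a => TensorProduct.map (A a) (B (k - a))

/-- The current `A(z) ⊗ B(z)`. -/
def tensorCur {V W : Type*} [AddCommGroup V] [Module ℂ V] [AddCommGroup W] [Module ℂ W]
    (A : ℤ → Module.End ℂ V) (B : ℤ → Module.End ℂ W) : ℤ → Module.End ℂ (V ⊗[ℂ] W) :=
  fun k => locSum (tensorTerms A B k)

/-- The operator `a ⊗ 1`. -/
def opL {V : Type*} (W : Type*) [AddCommGroup V] [Module ℂ V] [AddCommGroup W] [Module ℂ W]
    (a : Module.End ℂ V) : Module.End ℂ (V ⊗[ℂ] W) :=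
  TensorProduct.map a LinearMap.id

/-- The operator `1 ⊗ b`. -/
def opR (V : Type*) {W : Type*} [AddCommGroup V] [Module ℂ V] [AddCommGroup W] [Module ℂ W]
    (b : Module.End ℂ W) : Module.End ℂ (V ⊗[ℂ] W) :=
  TensorProduct.map LinearMap.id b

/-- For `F(z,w) = ∑ F k l z^{-k} w^{-l}` and a power series `g`: the series `g(w/z) F(z,w)`. -/
def actWZ {V : Type*} [AddCommGroup V] [Module ℂ V] (g : PowerSeries ℂ)
    (F : ℤ → ℤ → Module.End ℂ V) : ℤ → ℤ → Module.End ℂ V :=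
  fun k l => locSum fun m : ℕ => PowerSeries.coeff m g • F (k - m) (l + m)

/-- For `F(z,w) = ∑ F k l z^{-k} w^{-l}` and a power series `g`: the series `g(z/w) F(z,w)`. -/
def actZW {V : Type*} [AddCommGroup V] [Module ℂ V] (g : PowerSeries ℂ)
    (F : ℤ → ℤ → Module.End ℂ V) : ℤ → ℤ → Module.End ℂ V :=
  fun k l => locSum fun m : ℕ => PowerSeries.coeff m g • F (k + m) (l - m)

/-- `exp(A)` for a formal power series `A` of operators with zero constant term: then `A ^ k`
contributes to the coefficient of `X ^ m` only for `k ≤ m`. -/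
def formalExp {V : Type*} [AddCommGroup V] [Module ℂ V]
    (A : PowerSeries (Module.End ℂ V)) : PowerSeries (Module.End ℂ V) :=
  PowerSeries.mk fun m =>
    ∑ k ∈ Finset.range (m + 1), ((k.factorial : ℂ)⁻¹) • PowerSeries.coeff m (A ^ k)

/-- The current `A(z⁻¹)`. -/
def curP {V : Type*} [AddCommGroup V] [Module ℂ V]
    (A : PowerSeries (Module.End ℂ V)) : ℤ → Module.End ℂ V :=
  fun k => if 0 ≤ k then PowerSeries.coeff k.toNat A else 0

/-- The current `A(z)`. -/
def curM {V : Type*} [AddCommGroup V] [Module ℂ V]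
    (A : PowerSeries (Module.End ℂ V)) : ℤ → Module.End ℂ V :=
  fun k => if k ≤ 0 then PowerSeries.coeff (-k).toNat A else 0

/-- `∑_{r>0} s a_r X^r`. -/
def posModes {V : Type*} [AddCommGroup V] [Module ℂ V] (s : ℂ) (a : ℤ → Module.End ℂ V) :
    PowerSeries (Module.End ℂ V) :=
  PowerSeries.mk fun r => if r = 0 then 0 else s • a r

/-- `∑_{r>0} s a_{-r} X^r`. -/
def negModes {V : Type*} [AddCommGroup V] [Module ℂ V] (s : ℂ) (a : ℤ → Module.End ℂ V) :
    PowerSeries (Module.End ℂ V) :=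
  PowerSeries.mk fun r => if r = 0 then 0 else s • a (-r)

/-- `[A, B]_p = AB - pBA`. -/
def pBracket {R : Type*} [Ring R] [Module ℂ R] (p : ℂ) (A B : R) : R := A * B - p • (B * A)

/-- The coefficient of `z₁^{-k₁} z₂^{-k₂} w^{-l}` in
`Sym_{z₁,z₂} [A(z₁), [A(z₂), B(w)]_q]_{q⁻¹}`. -/
def serreLHS {V : Type*} [AddCommGroup V] [Module ℂ V] (q : ℂ)
    (A B : ℤ → Module.End ℂ V) (k₁ k₂ l : ℤ) : Module.End ℂ V :=
  (2⁻¹ : ℂ) • (pBracket q⁻¹ (A k₁) (pBracket q (A k₂) (B l))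
    + pBracket q⁻¹ (A k₂) (pBracket q (A k₁) (B l)))

/-! ## Structure functions -/

/-- `g_{i,j}(z,w) = z - gCoef i j * w`. -/
def gCoef {n : ℕ} (q d : ℂ) (i j : ZMod n) : ℂ :=
  if j = i then q ^ 2
  else if j = i + 1 then q⁻¹ * d
  else if j = i - 1 then q⁻¹ * d⁻¹
  else 1

/-- `d_{i,j}`. -/
def dCoef {n : ℕ} (d : ℂ) (i j : ZMod n) : ℂ :=
  if i = j + 1 then d else if i = j - 1 then d⁻¹ else 1

/-- The power series of `a (1 - b x) / (1 - c x)`. -/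
def fracSeries (a b c : ℂ) : PowerSeries ℂ :=
  PowerSeries.C a * (1 - PowerSeries.C b * PowerSeries.X)
    * (1 - PowerSeries.C c * PowerSeries.X)⁻¹

/-- `G_{i,j}(x)` as a power series in `x`. -/
def GSeries {n : ℕ} (q d : ℂ) (i j : ZMod n) : PowerSeries ℂ :=
  if j = i then fracSeries (q ^ 2) (q⁻¹ ^ 2) (q ^ 2)
  else if j = i + 1 then fracSeries q⁻¹ (q * d) (q⁻¹ * d)
  else if j = i - 1 then fracSeries q⁻¹ (q * d⁻¹) (q⁻¹ * d⁻¹)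
  else 1

/-- The lattice `P`, with basis `ε_i = Pi.single i 1`. -/
abbrev LatticeP (n : ℕ) : Type := ZMod n → ℤ

/-- The bilinear form on `P` for which the `ε_i` are orthonormal. -/
def formP {n : ℕ} [NeZero n] (h h' : LatticeP n) : ℤ := ∑ j, h j * h' j

/-- `ᾱ_i = ε_{i-1} - ε_i`. -/
def alphaBar {n : ℕ} (i : ZMod n) : LatticeP n := Pi.single (i - 1) 1 - Pi.single i 1

/-! ## Admissible gradings -/

/-- A `ℤ`-grading with finite-dimensional components and degrees bounded from above. -/
structure IsAdmGrading {V : Type*} [AddCommGroup V] [Module ℂ V]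
    (𝒱 : ℤ → Submodule ℂ V) : Prop where
  internal : DirectSum.IsInternal 𝒱
  finDim : ∀ k, FiniteDimensional ℂ (𝒱 k)
  bounded : ∃ N : ℤ, ∀ k, N < k → 𝒱 k = ⊥

/-- The operator `a` is homogeneous of degree `r`. -/
def HasDegree {V : Type*} [AddCommGroup V] [Module ℂ V] (𝒱 : ℤ → Submodule ℂ V)
    (a : Module.End ℂ V) (r : ℤ) : Prop :=
  ∀ l, ∀ v ∈ 𝒱 l, a v ∈ 𝒱 (r + l)

/-- The tensor product grading. -/
def tensorGrading {V W : Type*} [AddCommGroup V] [Module ℂ V] [AddCommGroup W] [Module ℂ W]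
    (𝒱 : ℤ → Submodule ℂ V) (𝒲 : ℤ → Submodule ℂ W) : ℤ → Submodule ℂ (V ⊗[ℂ] W) :=
  fun k => ⨆ a : ℤ, Submodule.map₂ (TensorProduct.mk ℂ V W) (𝒱 a) (𝒲 (k - a))

/-! ## Modules over the quantum toroidal algebra -/

/-- The operators on `V` representing the generators `e_{i,k}`, `f_{i,k}`, `h_{i,r}` (`r ≠ 0`; the
value at `r = 0` is never used) and `q^h` (`h ∈ P`); the central element `C` acts as the scalar
`lvl`. -/
structure EnOps (n : ℕ) (V : Type*) [AddCommGroup V] [Module ℂ V] where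
  e : ZMod n → ℤ → Module.End ℂ V
  f : ZMod n → ℤ → Module.End ℂ V
  h : ZMod n → ℤ → Module.End ℂ V
  qh : LatticeP n → Module.End ℂ V
  lvl : ℂˣ

namespace EnOps

/-- `ψ_i^+(z) = q^{ᾱ_i} exp((q - q⁻¹) ∑_{r>0} h_{i,r} z^{-r})`. -/
def psiP {n : ℕ} {V : Type*} [AddCommGroup V] [Module ℂ V] (q : ℂ) (X : EnOps n V)
    (i : ZMod n) : ℤ → Module.End ℂ V :=
  curP (PowerSeries.C (X.qh (alphaBar i)) * formalExp (posModes (q - q⁻¹) (X.h i)))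

/-- `ψ_i^-(z) = q^{-ᾱ_i} exp(-(q - q⁻¹) ∑_{r>0} h_{i,-r} z^r)`. -/
def psiM {n : ℕ} {V : Type*} [AddCommGroup V] [Module ℂ V] (q : ℂ) (X : EnOps n V)
    (i : ZMod n) : ℤ → Module.End ℂ V :=
  curM (PowerSeries.C (X.qh (-alphaBar i)) * formalExp (negModes (-(q - q⁻¹)) (X.h i)))

/-- `ψ_i^+(z)⁻¹ = exp(-(q - q⁻¹) ∑_{r>0} h_{i,r} z^{-r}) q^{-ᾱ_i}`. -/
def psiPInv {n : ℕ} {V : Type*} [AddCommGroup V] [Module ℂ V] (q : ℂ) (X : EnOps n V)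
    (i : ZMod n) : ℤ → Module.End ℂ V :=
  curP (formalExp (posModes (-(q - q⁻¹)) (X.h i)) * PowerSeries.C (X.qh (-alphaBar i)))

/-- `f̃_i(z) = -f_i(C⁻¹z) ψ_i^+(C⁻¹z)⁻¹`. -/
def fTilde {n : ℕ} {V : Type*} [AddCommGroup V] [Module ℂ V] (q : ℂ) (X : EnOps n V)
    (i : ZMod n) : ℤ → Module.End ℂ V :=
  fun k => -scaleCur (X.lvl : ℂ)⁻¹ (convCur (X.f i) (X.psiPInv q i)) k

/-- `V` with the grading `𝒱` is an admissible module over the quantum toroidal algebra `ℰ_n`.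
Every relation between currents is written as the equality of all Fourier coefficients, with
`k` (or `k₁`, `k₂`) belonging to `z` (or `z₁`, `z₂`) and `l` to `w`. -/
structure IsAdmissible {n : ℕ} [NeZero n] {V : Type*} [AddCommGroup V] [Module ℂ V]
    (q d : ℂ) (X : EnOps n V) (𝒱 : ℤ → Submodule ℂ V) : Prop where
  grading : IsAdmGrading 𝒱
  deg_e : ∀ i k, HasDegree 𝒱 (X.e i k) k
  deg_f : ∀ i k, HasDegree 𝒱 (X.f i k) k
  deg_h : ∀ i r, r ≠ 0 → HasDegree 𝒱 (X.h i r) r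
  deg_qh : ∀ h, HasDegree 𝒱 (X.qh h) 0
  qh_zero : X.qh 0 = 1
  qh_add : ∀ h h', X.qh h * X.qh h' = X.qh (h + h')
  qh_e : ∀ h i k, X.qh h * X.e i k * X.qh (-h) = q ^ formP h (alphaBar i) • X.e i k
  qh_f : ∀ h i k, X.qh h * X.f i k * X.qh (-h) = q ^ (-formP h (alphaBar i)) • X.f i k
  qh_psiP : ∀ h i k, X.qh h * X.psiP q i k * X.qh (-h) = X.psiP q i k
  qh_psiM : ∀ h i k, X.qh h * X.psiM q i k * X.qh (-h) = X.psiM q i k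
  psiP_psiP : ∀ i j k l, X.psiP q i k * X.psiP q j l = X.psiP q j l * X.psiP q i k
  psiM_psiM : ∀ i j k l, X.psiM q i k * X.psiM q j l = X.psiM q j l * X.psiM q i k
  psiP_psiM : ∀ i j k l, X.psiP q i k * X.psiM q j l =
    actWZ ((PowerSeries.rescale (X.lvl : ℂ) (GSeries q d i j))⁻¹
        * PowerSeries.rescale (X.lvl : ℂ)⁻¹ (GSeries q d i j))
      (fun k' l' => X.psiM q j l' * X.psiP q i k') k l
  psiP_e : ∀ i j k l, X.psiP q i k * X.e j l =
    actWZ (PowerSeries.rescale (X.lvl : ℂ)⁻¹ (GSeries q d i j))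
      (fun k' l' => X.e j l' * X.psiP q i k') k l
  e_psiM : ∀ i j k l, X.e j l * X.psiM q i k =
    actZW (GSeries q d j i) (fun k' l' => X.psiM q i k' * X.e j l') k l
  psiP_f : ∀ i j k l, X.psiP q i k * X.f j l =
    actWZ (GSeries q d i j)⁻¹ (fun k' l' => X.f j l' * X.psiP q i k') k l
  f_psiM : ∀ i j k l, X.f j l * X.psiM q i k =
    actZW (PowerSeries.rescale (X.lvl : ℂ) (GSeries q d j i))⁻¹
      (fun k' l' => X.psiM q i k' * X.f j l') k l
  /-- Here `δ(Cw/z)ψ_i^+(w)` has coefficients `C^k ψ^+_{i,k+l}`, and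
  `δ(Cz/w)ψ_i^-(z)` has coefficients `C^l ψ^-_{i,k+l}`. -/
  e_f : ∀ i j k l, X.e i k * X.f j l - X.f j l * X.e i k =
    if i = j then (q - q⁻¹)⁻¹ • ((X.lvl : ℂ) ^ k • X.psiP q i (k + l)
      - (X.lvl : ℂ) ^ l • X.psiM q i (k + l)) else 0
  e_e_far : ∀ i j, i ≠ j → i ≠ j + 1 → i ≠ j - 1 → ∀ k l,
    X.e i k * X.e j l = X.e j l * X.e i k
  f_f_far : ∀ i j, i ≠ j → i ≠ j + 1 → i ≠ j - 1 → ∀ k l,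
    X.f i k * X.f j l = X.f j l * X.f i k
  /-- `d_{i,j} g_{i,j}(z,w) e_i(z) e_j(w) + g_{j,i}(w,z) e_j(w) e_i(z) = 0`. -/
  e_e : ∀ i j k l,
    dCoef d i j • (X.e i (k + 1) * X.e j l - gCoef q d i j • (X.e i k * X.e j (l + 1)))
      + (X.e j (l + 1) * X.e i k - gCoef q d j i • (X.e j l * X.e i (k + 1))) = 0
  /-- `d_{j,i} g_{j,i}(w,z) f_i(z) f_j(w) + g_{i,j}(z,w) f_j(w) f_i(z) = 0`. -/
  f_f : ∀ i j k l,
    dCoef d j i • (X.f i k * X.f j (l + 1) - gCoef q d j i • (X.f i (k + 1) * X.f j l))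
      + (X.f j l * X.f i (k + 1) - gCoef q d i j • (X.f j (l + 1) * X.f i k)) = 0
  serre_e : ∀ i j, (j = i + 1 ∨ j = i - 1) → ∀ k₁ k₂ l,
    serreLHS q (X.e i) (X.e j) k₁ k₂ l = 0
  serre_f : ∀ i j, (j = i + 1 ∨ j = i - 1) → ∀ k₁ k₂ l,
    serreLHS q (X.f i) (X.f j) k₁ k₂ l = 0

/-- The trivial module `ℂ`: `e`, `f`, `h` act by zero, `q^h` and `C` by one. -/
def trivial (n : ℕ) : EnOps n ℂ where
  e := fun _ _ => 0
  f := fun _ _ => 0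
  h := fun _ _ => 0
  qh := fun _ => 1
  lvl := 1

/-- The trivial module sits in degree zero. -/
def trivialGrading : ℤ → Submodule ℂ ℂ := fun k => if k = 0 then ⊤ else ⊥

/-- The action of `ℰ_n` on `V₁ ⊗ V₂` through the coproduct
`Δe_i(z) = e_i(C₂z) ⊗ ψ_i^-(z) + 1 ⊗ e_i(z)`, `Δf_i(z) = f_i(z) ⊗ 1 + ψ_i^+(z) ⊗ f_i(C₁z)`,
`Δψ_i^+(z) = ψ_i^+(z) ⊗ ψ_i^+(C₁z)`, `Δψ_i^-(z) = ψ_i^-(C₂z) ⊗ ψ_i^-(z)`, `Δx = x ⊗ x` for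
`x = q^h, C`. In terms of the `h_{i,r}` the third and fourth formula say
`Δh_{i,r} = h_{i,r} ⊗ 1 + C₁^{-r} ⊗ h_{i,r}` and
`Δh_{i,-r} = C₂^r h_{i,-r} ⊗ 1 + 1 ⊗ h_{i,-r}` for `r > 0`. -/
def tensor {n : ℕ} {V₁ V₂ : Type*} [AddCommGroup V₁] [Module ℂ V₁] [AddCommGroup V₂] [Module ℂ V₂]
    (q : ℂ) (X₁ : EnOps n V₁) (X₂ : EnOps n V₂) : EnOps n (V₁ ⊗[ℂ] V₂) where
  e := fun i k => tensorCur (scaleCur (X₂.lvl : ℂ) (X₁.e i)) (X₂.psiM q i) k + opR V₁ (X₂.e i k)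
  f := fun i k => opL V₂ (X₁.f i k) + tensorCur (X₁.psiP q i) (scaleCur (X₁.lvl : ℂ) (X₂.f i)) k
  h := fun i r =>
    if 0 < r then opL V₂ (X₁.h i r) + (X₁.lvl : ℂ) ^ (-r) • opR V₁ (X₂.h i r)
    else (X₂.lvl : ℂ) ^ (-r) • opL V₂ (X₁.h i r) + opR V₁ (X₂.h i r)
  qh := fun h => TensorProduct.map (X₁.qh h) (X₂.qh h)
  lvl := X₁.lvl * X₂.lvl

end EnOps

/-! ## Modules over the algebra `𝒦_n` -/

/-- The operators on `W` representing the generators `E_{i,k}`, `H_{i,r}` (`r ≠ 0`; the value at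
`r = 0` is never used) and `K^±_{i,0}`; the central element `C` acts as the scalar `lvl`. -/
structure KnOps (n : ℕ) (W : Type*) [AddCommGroup W] [Module ℂ W] where
  E : ZMod n → ℤ → Module.End ℂ W
  H : ZMod n → ℤ → Module.End ℂ W
  Kp0 : ZMod n → Module.End ℂ W
  Km0 : ZMod n → Module.End ℂ W
  lvl : ℂˣ

namespace KnOps

/-- `K_i^+(z) = K^+_{i,0} exp((q - q⁻¹) ∑_{r>0} H_{i,r} z^{-r})`. -/
def Kp {n : ℕ} {W : Type*} [AddCommGroup W] [Module ℂ W] (q : ℂ) (Y : KnOps n W)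
    (i : ZMod n) : ℤ → Module.End ℂ W :=
  curP (PowerSeries.C (Y.Kp0 i) * formalExp (posModes (q - q⁻¹) (Y.H i)))

/-- `K_i^-(z) = K^-_{i,0} exp(-(q - q⁻¹) ∑_{r>0} H_{i,-r} z^r)`. -/
def Km {n : ℕ} {W : Type*} [AddCommGroup W] [Module ℂ W] (q : ℂ) (Y : KnOps n W)
    (i : ZMod n) : ℤ → Module.End ℂ W :=
  curM (PowerSeries.C (Y.Km0 i) * formalExp (negModes (-(q - q⁻¹)) (Y.H i)))

/-- The coefficient of `z^{-k} w^{-l}` in `δ(C²z/w) K_i^-(z) K_i^+(C²z)`. -/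
def deltaKK {n : ℕ} {W : Type*} [AddCommGroup W] [Module ℂ W] (q : ℂ) (Y : KnOps n W)
    (i : ZMod n) (k l : ℤ) : Module.End ℂ W :=
  (Y.lvl : ℂ) ^ (2 * l) •
    convCur (Y.Km q i) (scaleCur ((Y.lvl : ℂ) ^ 2) (Y.Kp q i)) (k + l)

/-- The coefficient of `z₁^{-k₁} z₂^{-k₂} w^{-l}` in
`(1 / (1 - a z₁/w) + (b w/z₂) / (1 - b w/z₂)) δ(C²z₁/z₂) K_i^-(z₁) E_j(w) K_i^+(z₂)`,
where the first fraction is `∑_{m≥0} a^m (z₁/w)^m`, the second `∑_{m≥1} b^m (w/z₂)^m`, and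
`δ(C²z₁/z₂) = ∑_t C^{2t} (z₁/z₂)^t`. -/
def serreTerm {n : ℕ} {W : Type*} [AddCommGroup W] [Module ℂ W] (q a b : ℂ) (Y : KnOps n W)
    (i j : ZMod n) (k₁ k₂ l : ℤ) : Module.End ℂ W :=
  locSum (fun p : ℤ × ℕ => (a ^ p.2 * (Y.lvl : ℂ) ^ (2 * p.1)) •
      (Y.Km q i (k₁ + p.2 + p.1) * Y.E j (l - p.2) * Y.Kp q i (k₂ - p.1)))
    + locSum (fun p : ℤ × ℕ => (b ^ (p.2 + 1) * (Y.lvl : ℂ) ^ (2 * p.1)) •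
      (Y.Km q i (k₁ + p.1) * Y.E j (l + (p.2 + 1)) * Y.Kp q i (k₂ - (p.2 + 1) - p.1)))

/-- `W` with the grading `𝒲` is an admissible module over `𝒦_n`.
Every relation between currents is written as the equality of all Fourier coefficients, with
`k` (or `k₁`, `k₂`) belonging to `z` (or `z₁`, `z₂`) and `l` to `w`; the infinite sums are
locally finite because of the grading. -/
structure IsAdmissible {n : ℕ} {W : Type*} [AddCommGroup W] [Module ℂ W]
    (q d : ℂ) (Y : KnOps n W) (𝒲 : ℤ → Submodule ℂ W) : Prop where
  grading : IsAdmGrading 𝒲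
  deg_E : ∀ i k, HasDegree 𝒲 (Y.E i k) k
  deg_H : ∀ i r, r ≠ 0 → HasDegree 𝒲 (Y.H i r) r
  deg_Kp0 : ∀ i, HasDegree 𝒲 (Y.Kp0 i) 0
  deg_Km0 : ∀ i, HasDegree 𝒲 (Y.Km0 i) 0
  Kp_Kp : ∀ i j k l, Y.Kp q i k * Y.Kp q j l = Y.Kp q j l * Y.Kp q i k
  Km_Km : ∀ i j k l, Y.Km q i k * Y.Km q j l = Y.Km q j l * Y.Km q i k
  Kp_Km : ∀ i j k l, Y.Kp q i k * Y.Km q j l =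
    actWZ (GSeries q d i j * PowerSeries.rescale ((Y.lvl : ℂ) ^ 2) (GSeries q d i j))
      (fun k' l' => Y.Km q j l' * Y.Kp q i k') k l
  Kp_E : ∀ i j k l, Y.Kp q i k * Y.E j l =
    actWZ (GSeries q d i j) (fun k' l' => Y.E j l' * Y.Kp q i k') k l
  E_Km : ∀ i j k l, Y.E j l * Y.Km q i k =
    actZW (GSeries q d j i) (fun k' l' => Y.Km q i k' * Y.E j l') k l
  /-- `d_{i,j} g_{i,j}(z,w) E_i(z) E_j(w) + g_{j,i}(w,z) E_j(w) E_i(z) = δ_{i,j} (q - q⁻¹)⁻¹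
  (g_{i,i}(z,w) δ(C²z/w) K_i^-(z) K_i^+(C²z) + g_{i,i}(w,z) δ(C²w/z) K_i^-(w) K_i^+(C²w))`. -/
  E_E : ∀ i j k l,
    dCoef d i j • (Y.E i (k + 1) * Y.E j l - gCoef q d i j • (Y.E i k * Y.E j (l + 1)))
      + (Y.E j (l + 1) * Y.E i k - gCoef q d j i • (Y.E j l * Y.E i (k + 1))) =
    if i = j then (q - q⁻¹)⁻¹ •
      ((Y.deltaKK q i (k + 1) l - gCoef q d i i • Y.deltaKK q i k (l + 1))
        + (Y.deltaKK q i (l + 1) k - gCoef q d i i • Y.deltaKK q i l (k + 1))) else 0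
  E_E_far : ∀ i j, i ≠ j → i ≠ j + 1 → i ≠ j - 1 → ∀ k l,
    Y.E i k * Y.E j l = Y.E j l * Y.E i k
  serre_succ : ∀ i k₁ k₂ l, serreLHS q (Y.E i) (Y.E (i + 1)) k₁ k₂ l =
    -((2⁻¹ : ℂ) • (Y.serreTerm q (q⁻¹ * d⁻¹) (q⁻¹ * d) i (i + 1) k₁ k₂ l
      + Y.serreTerm q (q⁻¹ * d⁻¹) (q⁻¹ * d) i (i + 1) k₂ k₁ l))
  serre_pred : ∀ i k₁ k₂ l, serreLHS q (Y.E i) (Y.E (i - 1)) k₁ k₂ l =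
    -((2⁻¹ : ℂ) • (Y.serreTerm q (q⁻¹ * d) (q⁻¹ * d⁻¹) i (i - 1) k₁ k₂ l
      + Y.serreTerm q (q⁻¹ * d) (q⁻¹ * d⁻¹) i (i - 1) k₂ k₁ l))

/-- `T` identifies the two actions of the generators of `𝒦_n`. -/
structure Intertwines {n : ℕ} {W W' : Type*} [AddCommGroup W] [Module ℂ W]
    [AddCommGroup W'] [Module ℂ W'] (Y : KnOps n W) (Y' : KnOps n W') (T : W ≃ₗ[ℂ] W') :
    Prop where
  lvl : Y.lvl = Y'.lvl
  E : ∀ i k w, T (Y.E i k w) = Y'.E i k (T w)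
  H : ∀ i r, r ≠ 0 → ∀ w, T (Y.H i r w) = Y'.H i r (T w)
  Kp0 : ∀ i w, T (Y.Kp0 i w) = Y'.Kp0 i (T w)
  Km0 : ∀ i w, T (Y.Km0 i w) = Y'.Km0 i (T w)

/-- The action of the generators of `𝒦_n` on `V ⊗ W`:
`ΔE_i(z) = e_i(C₂z) ⊗ K_i^-(z) + 1 ⊗ E_i(z) + f̃_i(C₂⁻¹z) ⊗ K_i^+(z)`, and, for `r > 0`,
`ΔK^+_{i,0} = q^{-ᾱ_i} ⊗ K^+_{i,0}`, `ΔH_{i,r} = -(C₁C₂)^r h_{i,r} ⊗ 1 + 1 ⊗ H_{i,r}`,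
`ΔK^-_{i,0} = q^{-ᾱ_i} ⊗ K^-_{i,0}`, `ΔH_{i,-r} = C₂^r h_{i,-r} ⊗ 1 + 1 ⊗ H_{i,-r}`; the
last four are the coefficients of
`ΔK_i^+(z) = ψ_i^+(C₁⁻¹C₂⁻¹z)⁻¹ ⊗ K_i^+(z)` and `ΔK_i^-(z) = ψ_i^-(C₂z) ⊗ K_i^-(z)`. -/
def comod {n : ℕ} {V W : Type*} [AddCommGroup V] [Module ℂ V] [AddCommGroup W] [Module ℂ W]
    (q : ℂ) (X : EnOps n V) (Y : KnOps n W) : KnOps n (V ⊗[ℂ] W) where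
  E := fun i k =>
    tensorCur (scaleCur (Y.lvl : ℂ) (X.e i)) (Y.Km q i) k + opR V (Y.E i k)
      + tensorCur (scaleCur (Y.lvl : ℂ)⁻¹ (X.fTilde q i)) (Y.Kp q i) k
  H := fun i r =>
    if 0 < r then -((X.lvl * Y.lvl : ℂ) ^ r • opL W (X.h i r)) + opR V (Y.H i r)
    else (Y.lvl : ℂ) ^ (-r) • opL W (X.h i r) + opR V (Y.H i r)
  Kp0 := fun i => TensorProduct.map (X.qh (-alphaBar i)) (Y.Kp0 i)
  Km0 := fun i => TensorProduct.map (X.qh (-alphaBar i)) (Y.Km0 i)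
  lvl := X.lvl * Y.lvl

end KnOps

end

universe u v w

set_option linter.unusedSectionVars false

noncomputable section

local notation "𝓛" => Module.End ℂ
local notation "Lau" => AddMonoidAlgebra ℂ

/-! ## Locally finite sums -/

section LocallyFinite

variable {U : Type*} [AddCommGroup U] [Module ℂ U] {ι κ : Type*}

theorem locSum_apply {f : ι → 𝓛 U} (h : LocFin f) (u : U) :
    locSum f u = ∑ᶠ i, f i u := by
  simp [locSum, h]

theorem locFin_zero : LocFin (fun _ : ι => (0 : 𝓛 U)) := by
  intro v; simp

theorem locSum_zero : locSum (fun _ : ι => (0 : 𝓛 U)) = 0 := by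
  ext u; simp [locSum_apply locFin_zero]

theorem LocFin.add {f g : ι → 𝓛 U} (hf : LocFin f) (hg : LocFin g) :
    LocFin (fun i => f i + g i) := fun v =>
  ((hf v).union (hg v)).subset (Function.support_add _ _)

theorem LocFin.smul {f : ι → 𝓛 U} (hf : LocFin f) (c : ι → ℂ) :
    LocFin (fun i => c i • f i) := fun v =>
  (hf v).subset fun i hi => by
    contrapose! hi
    simp only [Function.mem_support, not_not] at hi
    simp [hi]

theorem LocFin.const_smul {f : ι → 𝓛 U} (hf : LocFin f) (c : ℂ) :
    LocFin (fun i => c • f i) := hf.smul fun _ => c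

theorem LocFin.neg {f : ι → 𝓛 U} (hf : LocFin f) : LocFin (fun i => -f i) := by
  simpa using hf.const_smul (-1)

theorem LocFin.sub {f g : ι → 𝓛 U} (hf : LocFin f) (hg : LocFin g) :
    LocFin (fun i => f i - g i) := by
  simpa [sub_eq_add_neg] using hf.add hg.neg

theorem LocFin.mul_left {f : ι → 𝓛 U} (hf : LocFin f) (a : ι → 𝓛 U) :
    LocFin (fun i => a i * f i) := fun v =>
  (hf v).subset fun i hi => by
    contrapose! hi
    simp only [Function.mem_support, not_not] at hi
    simp [hi]

theorem LocFin.mul_right {f : ι → 𝓛 U} (hf : LocFin f) (a : 𝓛 U) :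
    LocFin (fun i => f i * a) := fun v => hf (a v)

theorem LocFin.comp_injective {f : ι → 𝓛 U} (hf : LocFin f) {e : κ → ι}
    (he : Function.Injective e) : LocFin (fun i => f (e i)) := fun v =>
  ((hf v).preimage he.injOn)

theorem locSum_add {f g : ι → 𝓛 U} (hf : LocFin f) (hg : LocFin g) :
    locSum (fun i => f i + g i) = locSum f + locSum g := by
  ext u
  rw [locSum_apply (hf.add hg), LinearMap.add_apply, locSum_apply hf, locSum_apply hg]
  exact finsum_add_distrib (hf u) (hg u)

theorem locSum_smul {f : ι → 𝓛 U} (hf : LocFin f) (c : ℂ) :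
    locSum (fun i => c • f i) = c • locSum f := by
  ext u
  rw [locSum_apply (hf.const_smul c), LinearMap.smul_apply, locSum_apply hf]
  exact (smul_finsum' c (hf u)).symm

theorem locSum_neg {f : ι → 𝓛 U} (hf : LocFin f) :
    locSum (fun i => -f i) = -locSum f := by
  have := locSum_smul hf (-1)
  simpa using this

theorem locSum_sub {f g : ι → 𝓛 U} (hf : LocFin f) (hg : LocFin g) :
    locSum (fun i => f i - g i) = locSum f - locSum g := by
  simp only [sub_eq_add_neg]
  rw [locSum_add hf hg.neg, locSum_neg hg]

theorem mul_locSum {f : ι → 𝓛 U} (hf : LocFin f) (a : 𝓛 U) :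
    a * locSum f = locSum (fun i => a * f i) := by
  ext u
  rw [locSum_apply (hf.mul_left fun _ => a), Module.End.mul_apply, locSum_apply hf]
  exact a.toAddMonoidHom.map_finsum (hf u)

theorem locSum_mul {f : ι → 𝓛 U} (hf : LocFin f) (a : 𝓛 U) :
    locSum f * a = locSum (fun i => f i * a) := by
  ext u
  rw [locSum_apply (hf.mul_right a), Module.End.mul_apply, locSum_apply hf]
  rfl

theorem locSum_equiv (e : κ ≃ ι) (f : ι → 𝓛 U) :
    locSum (fun i => f (e i)) = locSum f := by
  by_cases hf : LocFin f
  · ext u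
    rw [locSum_apply (hf.comp_injective e.injective), locSum_apply hf]
    exact finsum_comp_equiv (f := fun i => f i u) e
  · have : ¬ LocFin (fun i => f (e i)) := fun h => hf <| by
      simpa using h.comp_injective e.symm.injective
    simp [locSum, hf, this]

theorem locSum_eq_sum {f : ι → 𝓛 U} (s : Finset ι) (h : ∀ i, i ∉ s → f i = 0) :
    locSum f = ∑ i ∈ s, f i := by
  have hf : LocFin f := fun v => s.finite_toSet.subset fun i hi => by
    by_contra hs
    exact hi (by simp [h i hs])
  ext u
  rw [locSum_apply hf, LinearMap.sum_apply]
  refine finsum_eq_sum_of_support_subset _ fun i hi => ?_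
  by_contra hs
  exact hi (by simp [h i hs])

theorem locFin_of_finite_support {f : ι → 𝓛 U} (s : Finset ι)
    (h : ∀ i, i ∉ s → f i = 0) : LocFin f := fun v => s.finite_toSet.subset fun i hi => by
  by_contra hs
  exact hi (by simp [h i hs])

theorem locSum_eq_single {f : ι → 𝓛 U} (i : ι) (h : ∀ j, j ≠ i → f j = 0) :
    locSum f = f i := by
  rw [locSum_eq_sum {i} (by simpa using h)]; simp

theorem LocFin.prod_left {f : ι × κ → 𝓛 U} (h : LocFin f) (i : ι) :
    LocFin (fun j => f (i, j)) :=
  h.comp_injective (e := fun j => (i, j)) fun _ _ h => (Prod.mk.inj h).2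

theorem LocFin.prod_sum {f : ι × κ → 𝓛 U} (h : LocFin f) :
    LocFin (fun i => locSum fun j => f (i, j)) := fun v => by
  refine ((h v).image Prod.fst).subset fun i hi => ?_
  rw [Function.mem_support, locSum_apply (h.prod_left i)] at hi
  by_contra hc
  apply hi
  refine (finsum_congr fun j => ?_).trans finsum_zero
  by_contra hj
  exact hc ⟨(i, j), hj, rfl⟩

theorem locSum_prod {f : ι × κ → 𝓛 U} (h : LocFin f) :
    locSum f = locSum fun i => locSum fun j => f (i, j) := by
  ext u
  rw [locSum_apply h, locSum_apply h.prod_sum, finsum_curry _ (h u)]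
  exact finsum_congr fun i => (locSum_apply (h.prod_left i) u).symm

theorem LocFin.prod_swap {f : ι × κ → 𝓛 U} (h : LocFin f) :
    LocFin (fun p : κ × ι => f (p.2, p.1)) :=
  h.comp_injective (e := fun p : κ × ι => (p.2, p.1)) fun a b h => by
    simp only [Prod.mk.injEq] at h
    exact Prod.ext h.2 h.1

theorem locSum_comm {f : ι × κ → 𝓛 U} (h : LocFin f) :
    (locSum fun i => locSum fun j => f (i, j)) = locSum fun j => locSum fun i => f (i, j) := by
  rw [← locSum_prod h, ← locSum_prod (f := fun p : κ × ι => f (p.2, p.1)) h.prod_swap]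
  exact (locSum_equiv (Equiv.prodComm κ ι) f).symm

theorem LocFin.mul {f : ι → 𝓛 U} {g : κ → 𝓛 U} (hf : LocFin f)
    (hg : LocFin g) : LocFin (fun p : ι × κ => f p.1 * g p.2) := fun v => by
  refine ((hg v).biUnion fun j _ => ((hf (g j v)).image fun i => (i, j))).subset ?_
  rintro ⟨i, j⟩ hij
  simp only [Function.mem_support, Module.End.mul_apply] at hij
  simp only [Set.mem_iUnion]
  exact ⟨j, fun h => hij (by simp [h]), i, hij, rfl⟩

theorem locSum_mul_locSum {f : ι → 𝓛 U} {g : κ → 𝓛 U} (hf : LocFin f)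
    (hg : LocFin g) : locSum f * locSum g = locSum fun p : ι × κ => f p.1 * g p.2 := by
  rw [locSum_prod (hf.mul hg), locSum_mul hf]
  congr 1; ext1 i
  exact mul_locSum hg _

end LocallyFinite

/-! ## Families of coefficients as modules over Laurent polynomials -/

/-- Formal distributions with coefficients in `E`, encoded by their coefficients. -/
abbrev Fam (Γ E : Type*) := Γ → E

section Fam

variable {Γ E : Type*} [AddCommGroup Γ] [AddCommGroup E] [Module ℂ E]

/-- Multiplication of formal distributions by monomials. -/
def shiftHom : Multiplicative Γ →* 𝓛 (Fam Γ E) where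
  toFun g := { toFun := fun X k => X (k + g.toAdd), map_add' := fun _ _ => rfl,
               map_smul' := fun _ _ => rfl }
  map_one' := by ext X k; exact congrArg X (add_zero k)
  map_mul' g h := by
    ext X k
    change X _ = X _
    congr 1
    simp only [toAdd_mul]; abel

instance (priority := 5000) famModule : Module (Lau Γ) (Fam Γ E) :=
  Module.compHom _ (AddMonoidAlgebra.lift ℂ (𝓛 (Fam Γ E)) Γ shiftHom).toRingHom

instance (priority := 5000) famSMul : SMul (Lau Γ) (Fam Γ E) :=
  famModule.toSMul

instance (priority := 5000) famDistribMulAction :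
    DistribMulAction (Lau Γ) (Fam Γ E) :=
  famModule.toDistribMulAction

instance (priority := 5000) famMulAction : MulAction (Lau Γ) (Fam Γ E) :=
  famDistribMulAction.toMulAction

instance (priority := 5000) famSemigroupAction :
    SemigroupAction (Lau Γ) (Fam Γ E) :=
  famMulAction.toSemigroupAction

/-- The monomial with exponent `g`. -/
def mono (g : Γ) : Lau Γ := AddMonoidAlgebra.of ℂ Γ (Multiplicative.ofAdd g)

/-- The constant Laurent polynomial `c`. -/
def cst (c : ℂ) : Lau Γ := algebraMap ℂ _ c

theorem lau_smul_def (r : Lau Γ) (X : Fam Γ E) :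
    r • X = AddMonoidAlgebra.lift ℂ (𝓛 (Fam Γ E)) Γ shiftHom r X := rfl

@[simp] theorem mono_smul_apply (g : Γ) (X : Fam Γ E) (k : Γ) : (mono g • X) k = X (k + g) := by
  rw [lau_smul_def, mono, AddMonoidAlgebra.lift_of]; rfl

@[simp] theorem cst_smul_apply (c : ℂ) (X : Fam Γ E) (k : Γ) :
    ((cst c : Lau Γ) • X) k = c • X k := by
  rw [lau_smul_def, cst, AlgHom.commutes]; rfl

theorem fam_add_apply (X Y : Fam Γ E) (k : Γ) : (X + Y) k = X k + Y k := rfl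
theorem fam_sub_apply (X Y : Fam Γ E) (k : Γ) : (X - Y) k = X k - Y k := rfl
theorem fam_neg_apply (X : Fam Γ E) (k : Γ) : (-X) k = -X k := rfl
theorem fam_zero_apply (k : Γ) : (0 : Fam Γ E) k = 0 := rfl
theorem fam_smul_apply (c : ℂ) (X : Fam Γ E) (k : Γ) : (c • X) k = c • X k := rfl

theorem cst_mul (a b : ℂ) : (cst (a * b) : Lau Γ) = cst a * cst b := map_mul _ _ _
theorem cst_one : (cst 1 : Lau Γ) = 1 := map_one _

theorem lau_induction {P : Lau Γ → Prop} (r : Lau Γ)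
    (hm : ∀ g, P (mono g)) (hc : ∀ c, P (cst c)) (ha : ∀ r r', P r → P r' → P (r + r'))
    (hmul : ∀ r r', P r → P r' → P (r * r')) : P r :=
  AddMonoidAlgebra.induction_on r hm ha fun c x hx => by
    rw [Algebra.smul_def]; exact hmul _ _ (hc c) hx

/-- A distribution annihilated by `α z^g - β z^h` vanishes if its coefficients vanish eventually
in the direction of `h - g`. -/
theorem fam_cancel {g h : Γ} {α β : ℂ} (hα : α ≠ 0) {X : Fam Γ E}
    (hX : ∀ k, ∃ m : ℕ, X (k + m • (h - g)) = 0)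
    (h0 : (cst α * mono g - cst β * mono h) • X = 0) : X = 0 := by
  have key : ∀ k, X k = (α⁻¹ * β) • X (k + (h - g)) := fun k => by
    have := congrFun h0 (k - g)
    simp only [sub_smul, mul_smul, fam_sub_apply, cst_smul_apply, mono_smul_apply,
      fam_zero_apply, sub_add_cancel, sub_eq_zero] at this
    rw [mul_smul, show k + (h - g) = k - g + h by abel, ← this, smul_smul, inv_mul_cancel₀ hα,
      one_smul]
  have it : ∀ (m : ℕ) k, X k = (α⁻¹ * β) ^ m • X (k + m • (h - g)) := fun m => by
    induction m with
    | zero => intro k; simp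
    | succ m ih =>
      intro k
      rw [ih k, key, smul_smul, pow_succ, succ_nsmul, add_assoc]
  funext k
  obtain ⟨m, hm⟩ := hX k
  rw [it m k, hm, smul_zero]; rfl

end Fam

/-! ## Convolutions -/

section Convolution

variable {U : Type*} [AddCommGroup U] [Module ℂ U]
variable {Γ Γ' : Type*} [AddCommGroup Γ] [AddCommGroup Γ']

/-- The product of the distributions `x` and `M`, the variables of `x` being embedded by `ι`. -/
def cv (ι : Γ' →+ Γ) (x : Γ' → 𝓛 U) (M : Fam Γ (𝓛 U)) :
    Fam Γ (𝓛 U) := fun k => locSum fun a => x a * M (k - ι a)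

/-- The sums in `cv ι x M` are locally finite. -/
def CvLF (ι : Γ' →+ Γ) (x : Γ' → 𝓛 U) (M : Fam Γ (𝓛 U)) : Prop :=
  ∀ k, LocFin fun a => x a * M (k - ι a)

/-- The product of the distributions `M` and `x`, the variables of `x` being embedded by `ι`. -/
def rcv (ι : Γ' →+ Γ) (M : Fam Γ (𝓛 U)) (x : Γ' → 𝓛 U) :
    Fam Γ (𝓛 U) := fun k => locSum fun a => M (k - ι a) * x a

/-- The sums in `rcv ι M x` are locally finite. -/
def RcvLF (ι : Γ' →+ Γ) (M : Fam Γ (𝓛 U)) (x : Γ' → 𝓛 U) : Prop :=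
  ∀ k, LocFin fun a => M (k - ι a) * x a

variable {ι : Γ' →+ Γ} {x : Γ' → 𝓛 U} {M N : Fam Γ (𝓛 U)}

theorem CvLF.smul_right (h : CvLF ι x M) (r : Lau Γ) : CvLF ι x (r • M) := by
  induction r using lau_induction generalizing M with
  | hm g =>
    intro k
    simpa [sub_add_eq_add_sub] using h (k + g)
  | hc c => intro k; simpa using (h k).const_smul c
  | ha r r' hr hr' =>
    intro k
    simpa [add_smul, mul_add] using (hr h k).add (hr' h k)
  | hmul r r' hr hr' => rw [mul_smul]; exact hr (hr' h)

theorem smul_cv (h : CvLF ι x M) (r : Lau Γ) : r • cv ι x M = cv ι x (r • M) := by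
  induction r using lau_induction generalizing M with
  | hm g =>
    funext k
    simp [cv, sub_add_eq_add_sub]
  | hc c => funext k; simp [cv, locSum_smul (h k)]
  | ha r r' hr hr' =>
    funext k
    simp only [add_smul, hr h, hr' h, fam_add_apply, cv, mul_add]
    exact (locSum_add (h.smul_right r k) (h.smul_right r' k)).symm
  | hmul r r' hr hr' => rw [mul_smul, mul_smul, hr' h, hr (h.smul_right r')]

theorem RcvLF.smul (h : RcvLF ι M x) (r : Lau Γ) : RcvLF ι (r • M) x := by
  induction r using lau_induction generalizing M with
  | hm g =>
    intro k
    simpa [sub_add_eq_add_sub] using h (k + g)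
  | hc c => intro k; simpa using (h k).const_smul c
  | ha r r' hr hr' =>
    intro k
    simpa [add_smul, add_mul] using (hr h k).add (hr' h k)
  | hmul r r' hr hr' => rw [mul_smul]; exact hr (hr' h)

theorem smul_rcv (h : RcvLF ι M x) (r : Lau Γ) :
    r • rcv ι M x = rcv ι (r • M) x := by
  induction r using lau_induction generalizing M with
  | hm g =>
    funext k
    simp [rcv, sub_add_eq_add_sub]
  | hc c => funext k; simp [rcv, locSum_smul (h k)]
  | ha r r' hr hr' =>
    funext k
    simp only [add_smul, hr h, hr' h, fam_add_apply, rcv, add_mul]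
    exact (locSum_add (h.smul r k) (h.smul r' k)).symm
  | hmul r r' hr hr' => rw [mul_smul, mul_smul, hr' h, hr (h.smul r')]

/-- Two-sided convolution in the same variables. -/
abbrev cvi (X M : Fam Γ (𝓛 U)) : Fam Γ (𝓛 U) := cv (AddMonoidHom.id Γ) X M

/-- Local finiteness for `cvi`. -/
abbrev CviLF (X M : Fam Γ (𝓛 U)) : Prop := CvLF (AddMonoidHom.id Γ) X M

theorem cviLF_iff {X M : Fam Γ (𝓛 U)} :
    CviLF X M ↔ RcvLF (AddMonoidHom.id Γ) X M := by
  have key : ∀ k, (fun a => X (k - a) * M a) = fun a => X (k - a) * M (k - (k - a)) := by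
    intro k; funext a; simp
  constructor
  · intro h k
    have := (h k).comp_injective (Equiv.subLeft k).injective
    simpa using this
  · intro h k
    have := (h k).comp_injective (Equiv.subLeft k).injective
    simpa using this

theorem cvi_apply (X M : Fam Γ (𝓛 U)) (k : Γ) :
    cvi X M k = locSum fun a => X a * M (k - a) := rfl

theorem rcv_apply (M : Fam Γ (𝓛 U)) (x : Γ' → 𝓛 U) (k : Γ) :
    rcv ι M x k = locSum fun a => M (k - ι a) * x a := rfl

theorem cvi_eq_rcv (X M : Fam Γ (𝓛 U)) :
    cvi X M = rcv (AddMonoidHom.id Γ) X M := by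
  funext k
  rw [rcv_apply, ← locSum_equiv (Equiv.subLeft k), cvi_apply]
  simp

theorem smul_cvi_left {X : Fam Γ (𝓛 U)} (h : CviLF X M) (r : Lau Γ) :
    r • cvi X M = cvi (r • X) M := by
  rw [cvi_eq_rcv, cvi_eq_rcv, smul_rcv (cviLF_iff.1 h)]

theorem cvi_relation {X X' M M' : Fam Γ (𝓛 U)} {p p' r r' : Lau Γ}
    (h : CviLF X M) (h' : CviLF X' M') (hX : p • X = p' • X') (hM : r • M = r' • M') :
    (p * r) • cvi X M = (p' * r') • cvi X' M' := by
  rw [mul_smul, mul_smul, smul_cv h, smul_cvi_left (h.smul_right r), smul_cv h',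
    smul_cvi_left (h'.smul_right r'), hX, hM]

theorem cv_relation {M M' : Fam Γ (𝓛 U)} {p p' : Lau Γ}
    (h : CvLF ι x M) (h' : CvLF ι x M') (hM : p • M = p' • M') :
    p • cv ι x M = p' • cv ι x M' := by
  rw [smul_cv h, smul_cv h', hM]

theorem rcv_relation {M M' : Fam Γ (𝓛 U)} {p p' : Lau Γ}
    (h : RcvLF ι M x) (h' : RcvLF ι M' x) (hM : p • M = p' • M') :
    p • rcv ι M x = p' • rcv ι M' x := by
  rw [smul_rcv h, smul_rcv h', hM]

theorem cvi_add_left {X Y : Fam Γ (𝓛 U)} (h : CviLF X M) (h' : CviLF Y M) :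
    cvi (X + Y) M = cvi X M + cvi Y M := by
  funext k
  simp only [cvi_apply, fam_add_apply, add_mul]
  exact locSum_add (h k) (h' k)

theorem cvi_const_smul {X : Fam Γ (𝓛 U)} (h : CviLF X M) (c : ℂ) :
    cvi (c • X) M = c • cvi X M := by
  funext k
  simp only [cvi_apply, fam_smul_apply, smul_mul_assoc]
  exact locSum_smul (h k) c

/-- The word `X(z)Y(w)`. -/
def pr (X : Γ → 𝓛 U) (Y : Γ' → 𝓛 U) : Fam (Γ × Γ') (𝓛 U) :=
  fun p => X p.1 * Y p.2

/-- The word `Y(w)X(z)`. -/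
def rp (X : Γ → 𝓛 U) (Y : Γ' → 𝓛 U) : Fam (Γ × Γ') (𝓛 U) :=
  fun p => Y p.2 * X p.1

@[simp] theorem pr_apply (X : Γ → 𝓛 U) (Y : Γ' → 𝓛 U) (k l) :
    pr X Y (k, l) = X k * Y l := rfl
@[simp] theorem rp_apply (X : Γ → 𝓛 U) (Y : Γ' → 𝓛 U) (k l) :
    rp X Y (k, l) = Y l * X k := rfl

variable {X M₁ : Fam Γ (𝓛 U)} {Y M₂ : Fam Γ' (𝓛 U)}

theorem pr_cvi_aux (hc : ∀ a b, Commute (M₁ a) (Y b)) (k : Γ) (l : Γ') (p : Γ × Γ') :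
    X p.1 * M₁ (k - p.1) * (Y p.2 * M₂ (l - p.2)) = pr X Y p * pr M₁ M₂ ((k, l) - p) := by
  simp only [pr, mul_assoc, Prod.fst_sub, Prod.snd_sub]
  rw [← mul_assoc (M₁ _), (hc _ _).eq, mul_assoc]

theorem pr_cviLF (h₁ : CviLF X M₁) (h₂ : CviLF Y M₂) (hc : ∀ a b, Commute (M₁ a) (Y b)) :
    CviLF (pr X Y) (pr M₁ M₂) := by
  rintro ⟨k, l⟩
  have := (h₁ k).mul (h₂ l)
  simp only [AddMonoidHom.id_apply] at this ⊢
  simpa only [pr_cvi_aux hc] using this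

theorem pr_cvi (h₁ : CviLF X M₁) (h₂ : CviLF Y M₂) (hc : ∀ a b, Commute (M₁ a) (Y b)) :
    pr (cvi X M₁) (cvi Y M₂) = cvi (pr X Y) (pr M₁ M₂) := by
  funext ⟨k, l⟩
  simp only [pr_apply, cvi_apply]
  rw [locSum_mul_locSum (f := fun a => X a * M₁ (k - a)) (g := fun a => Y a * M₂ (l - a)) (h₁ k) (h₂ l)]
  simp only [pr_cvi_aux hc]

theorem rp_cvi_aux (hc : ∀ a b, Commute (M₂ b) (X a)) (k : Γ) (l : Γ') (p : Γ' × Γ) :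
    Y p.1 * M₂ (l - p.1) * (X p.2 * M₁ (k - p.2)) =
      rp X Y p.swap * rp M₁ M₂ ((k, l) - p.swap) := by
  simp only [rp, mul_assoc, Prod.fst_sub, Prod.snd_sub, Prod.fst_swap, Prod.snd_swap]
  rw [← mul_assoc (M₂ _), (hc _ _).eq, mul_assoc]

theorem rp_cviLF (h₁ : CviLF X M₁) (h₂ : CviLF Y M₂) (hc : ∀ a b, Commute (M₂ b) (X a)) :
    CviLF (rp X Y) (rp M₁ M₂) := by
  rintro ⟨k, l⟩
  have := (h₂ l).mul (h₁ k)
  simp only [AddMonoidHom.id_apply, rp_cvi_aux hc] at this ⊢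
  simpa using this.comp_injective (Equiv.prodComm Γ Γ').injective

theorem rp_cvi (h₁ : CviLF X M₁) (h₂ : CviLF Y M₂) (hc : ∀ a b, Commute (M₂ b) (X a)) :
    rp (cvi X M₁) (cvi Y M₂) = cvi (rp X Y) (rp M₁ M₂) := by
  funext ⟨k, l⟩
  simp only [rp_apply, cvi_apply]
  rw [locSum_mul_locSum (f := fun a => Y a * M₂ (l - a)) (g := fun a => X a * M₁ (k - a)) (h₂ l) (h₁ k)]
  simp only [rp_cvi_aux hc]
  rw [← locSum_equiv (Equiv.prodComm Γ' Γ)]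
  rfl

/-- The delta function `∑_t c^t z^{-tσ}` times `X`. -/
def dl (c : ℂ) (σ : Γ) (X : Fam Γ (𝓛 U)) : Fam Γ (𝓛 U) :=
  fun k => locSum fun t : ℤ => c ^ t • X (k + t • σ)

/-- The sums in `dl c σ X` are locally finite. -/
def DlLF (σ : Γ) (X : Fam Γ (𝓛 U)) : Prop :=
  ∀ k, LocFin fun t : ℤ => X (k + t • σ)

variable {σ : Γ} {c : ℂ}

theorem DlLF.smul (h : DlLF σ X) (r : Lau Γ) : DlLF σ (r • X) := by
  induction r using lau_induction generalizing X with
  | hm g => intro k; simpa [add_right_comm] using h (k + g)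
  | hc c => intro k; simpa using (h k).const_smul c
  | ha r r' hr hr' => intro k; simpa [add_smul] using (hr h k).add (hr' h k)
  | hmul r r' hr hr' => rw [mul_smul]; exact hr (hr' h)

theorem smul_dl (h : DlLF σ X) (r : Lau Γ) : r • dl c σ X = dl c σ (r • X) := by
  induction r using lau_induction generalizing X with
  | hm g => funext k; simp [dl, add_right_comm]
  | hc a =>
    funext k
    simp only [cst_smul_apply, dl, smul_comm _ a]
    exact (locSum_smul ((h k).smul _) a).symm
  | ha r r' hr hr' =>
    funext k
    simp only [add_smul, hr h, hr' h, fam_add_apply, dl, smul_add]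
    exact (locSum_add ((h.smul r k).smul _) ((h.smul r' k).smul _)).symm
  | hmul r r' hr hr' => rw [mul_smul, mul_smul, hr' h, hr (h.smul r')]

theorem dl_relation {X X' : Fam Γ (𝓛 U)} {p p' : Lau Γ}
    (h : DlLF σ X) (h' : DlLF σ X') (hX : p • X = p' • X') :
    p • dl c σ X = p' • dl c σ X' := by
  rw [smul_dl h, smul_dl h', hX]

theorem dl_eigen (hc : c ≠ 0) (h : DlLF σ X) : (cst c * mono σ) • dl c σ X = dl c σ X := by
  funext k
  rw [mul_smul, cst_smul_apply, mono_smul_apply]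
  unfold dl
  have h' : LocFin fun t : ℤ => c ^ t • X (k + σ + t • σ) := (h (k + σ)).smul _
  rw [← locSum_smul h', ← locSum_equiv (Equiv.addRight (1 : ℤ)) fun t => c ^ t • X (k + t • σ)]
  congr 1; funext t
  rw [Equiv.coe_addRight, add_smul, one_smul, zpow_add_one₀ hc, smul_smul, mul_comm c,
    add_assoc, add_comm σ]

theorem cvi_dl {M : Fam Γ (𝓛 U)} (hX : DlLF σ X)
    (h : ∀ k, LocFin fun p : ℤ × Γ => X (p.2 + p.1 • σ) * M (k - p.2)) :
    cvi (dl c σ X) M = dl c σ (cvi X M) := by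
  funext k
  have h' : LocFin fun p : ℤ × Γ => c ^ p.1 • (X (p.2 + p.1 • σ) * M (k - p.2)) :=
    (h k).smul fun p : ℤ × Γ => c ^ p.1
  simp only [cvi_apply, dl]
  have e1 : ∀ a, (locSum fun t : ℤ => c ^ t • X (a + t • σ)) * M (k - a) =
      locSum fun t : ℤ => c ^ t • (X (a + t • σ) * M (k - a)) := fun a => by
    rw [locSum_mul ((hX a).smul _)]
    simp only [smul_mul_assoc]
  simp only [e1]
  rw [← locSum_comm h']
  congr 1; funext t
  refine (locSum_smul ((h k).prod_left t) (c ^ t)).trans ?_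
  congr 1
  rw [← locSum_equiv (Equiv.addRight (t • σ)) fun a => X a * M (k + t • σ - a)]
  congr 1; funext a
  simp

end Convolution

/-! ## Cancellation of polynomials and power series -/

section Series

variable {U : Type*} [AddCommGroup U] [Module ℂ U]
variable {Γ : Type*} [AddCommGroup Γ]

/-- The coefficients of `X` applied to `u`. -/
def evalAt (u : U) (X : Fam Γ (𝓛 U)) : Fam Γ U := fun k => X k u

theorem smul_evalAt (u : U) (r : Lau Γ) (X : Fam Γ (𝓛 U)) :
    r • evalAt u X = evalAt u (r • X) := by
  induction r using lau_induction generalizing X with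
  | hm g => funext k; simp [evalAt]
  | hc c => funext k; simp [evalAt]
  | ha r r' hr hr' => simp only [add_smul, hr, hr']; rfl
  | hmul r r' hr hr' => rw [mul_smul, mul_smul, hr', hr]

/-- On each vector, the coefficients of `X` vanish eventually in the direction `σ`. -/
def EvZ (σ : Γ) (X : Fam Γ (𝓛 U)) : Prop :=
  ∀ u k, ∃ M : ℕ, ∀ m, M ≤ m → X (k + m • σ) u = 0

variable {σ : Γ} {X Y : Fam Γ (𝓛 U)}

theorem EvZ.add (hX : EvZ σ X) (hY : EvZ σ Y) : EvZ σ (X + Y) := fun u k => by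
  obtain ⟨M, hM⟩ := hX u k
  obtain ⟨N, hN⟩ := hY u k
  exact ⟨max M N, fun m hm => by
    simp [hM m (le_of_max_le_left hm), hN m (le_of_max_le_right hm)]⟩

theorem EvZ.smul (hX : EvZ σ X) (r : Lau Γ) : EvZ σ (r • X) := by
  induction r using lau_induction generalizing X with
  | hm g =>
    intro u k
    obtain ⟨M, hM⟩ := hX u (k + g)
    exact ⟨M, fun m hm => by simpa [add_right_comm] using hM m hm⟩
  | hc c =>
    intro u k
    obtain ⟨M, hM⟩ := hX u k
    exact ⟨M, fun m hm => by simp [hM m hm]⟩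
  | ha r r' hr hr' => rw [add_smul]; exact (hr hX).add (hr' hX)
  | hmul r r' hr hr' => rw [mul_smul]; exact hr (hr' hX)

theorem EvZ.neg (hX : EvZ σ X) : EvZ σ (-X) := fun u k => by
  obtain ⟨M, hM⟩ := hX u k
  exact ⟨M, fun m hm => by simp [hM m hm]⟩

theorem EvZ.sub (hX : EvZ σ X) (hY : EvZ σ Y) : EvZ σ (X - Y) := by
  rw [sub_eq_add_neg]; exact hX.add hY.neg

theorem EvZ.eq_zero {g h : Γ} {α β : ℂ} (hα : α ≠ 0) (hX : EvZ (h - g) X)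
    (h0 : (cst α * mono g - cst β * mono h) • X = 0) : X = 0 := by
  funext k
  ext u
  have : evalAt u X = 0 := fam_cancel (g := g) (h := h) (β := β) hα
    (fun k => (hX u k).imp fun M hM => hM M le_rfl) <| by
      rw [smul_evalAt, h0]; rfl
  exact congrFun this k

theorem EvZ.cancel {g h : Γ} {α β : ℂ} (hα : α ≠ 0) (hX : EvZ (h - g) X) (hY : EvZ (h - g) Y)
    (h0 : (cst α * mono g - cst β * mono h) • X = (cst α * mono g - cst β * mono h) • Y) :
    X = Y :=
  sub_eq_zero.1 <| (hX.sub hY).eq_zero hα (by rw [smul_sub, h0, sub_self])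

theorem EvZ.locFin (hX : EvZ σ X) (k : Γ) : LocFin fun m : ℕ => X (k + m • σ) := fun u => by
  obtain ⟨M, hM⟩ := hX u k
  refine (Finset.range M).finite_toSet.subset fun m hm => ?_
  by_contra hc
  exact hm (hM m (by simpa using hc))

/-- The power series `g(z^σ)` times `X`. -/
def ts (g : PowerSeries ℂ) (σ : Γ) (X : Fam Γ (𝓛 U)) : Fam Γ (𝓛 U) :=
  fun k => locSum fun m : ℕ => PowerSeries.coeff m g • X (k + m • σ)

theorem ts_apply (g : PowerSeries ℂ) (hX : EvZ σ X) (k : Γ) (u : U) :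
    ts g σ X k u = ∑ᶠ m : ℕ, PowerSeries.coeff m g • X (k + m • σ) u := by
  rw [ts, locSum_apply ((hX.locFin k).smul _)]; rfl

theorem ts_add (g h : PowerSeries ℂ) (hX : EvZ σ X) : ts (g + h) σ X = ts g σ X + ts h σ X := by
  funext k
  simp only [ts, map_add, add_smul, fam_add_apply]
  exact locSum_add ((hX.locFin k).smul _) ((hX.locFin k).smul _)

theorem ts_C_mul (c : ℂ) (g : PowerSeries ℂ) (hX : EvZ σ X) :
    ts (PowerSeries.C c * g) σ X = (cst c : Lau Γ) • ts g σ X := by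
  funext k
  simp only [ts, PowerSeries.coeff_C_mul, cst_smul_apply, mul_smul]
  exact locSum_smul ((hX.locFin k).smul _) c

theorem ts_X_mul (g : PowerSeries ℂ) (hX : EvZ σ X) :
    ts (PowerSeries.X * g) σ X = mono σ • ts g σ X := by
  funext k
  ext u
  rw [mono_smul_apply, ts_apply _ hX, ts_apply _ hX]
  obtain ⟨M, hM⟩ := hX u k
  rw [finsum_eq_sum_of_support_subset (s := Finset.range (M + 1)),
    finsum_eq_sum_of_support_subset (s := Finset.range M), Finset.sum_range_succ']
  · simp only [PowerSeries.coeff_succ_X_mul, PowerSeries.coeff_zero_X_mul, zero_smul, add_zero]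
    refine Finset.sum_congr rfl fun m _ => ?_
    rw [add_assoc k, succ_nsmul']
  · intro m hm
    by_contra hc
    refine hm ?_
    simp only [Finset.coe_range, Set.mem_Iio, not_lt] at hc
    simp only
    rw [add_assoc k, ← succ_nsmul', hM _ (by omega), smul_zero]
  · intro m hm
    by_contra hc
    refine hm ?_
    simp only [Finset.coe_range, Set.mem_Iio, not_lt] at hc
    simp only
    rw [hM _ (by omega), smul_zero]

theorem ts_one : ts 1 σ X = X := by
  funext k
  rw [ts, locSum_eq_single 0 fun j hj => by simp [PowerSeries.coeff_one, hj]]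
  simp

theorem ts_linear_mul (a b : ℂ) (g : PowerSeries ℂ) (hX : EvZ σ X) :
    ts ((PowerSeries.C a - PowerSeries.C b * PowerSeries.X) * g) σ X =
      (cst a - cst b * mono σ : Lau Γ) • ts g σ X := by
  have : (PowerSeries.C a - PowerSeries.C b * PowerSeries.X) * g =
      PowerSeries.C a * g + PowerSeries.C (-b) * (PowerSeries.X * g) := by
    rw [map_neg]; ring
  rw [this, ts_add _ _ hX, ts_C_mul _ _ hX, ts_C_mul _ _ hX, ts_X_mul _ hX, sub_smul, mul_smul,
    cst, cst, cst, map_neg, neg_smul, sub_eq_add_neg]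

theorem EvZ.ts (g : PowerSeries ℂ) (hX : EvZ σ X) : EvZ σ (ts g σ X) := fun u k => by
  obtain ⟨M, hM⟩ := hX u k
  refine ⟨M, fun m hm => ?_⟩
  rw [ts_apply _ hX]
  refine (finsum_congr fun j => ?_).trans finsum_zero
  rw [add_assoc, ← add_smul, hM _ (by omega), smul_zero]

theorem linear_smul_ts {g : PowerSeries ℂ} {a b c : ℂ} (hX : EvZ σ X)
    (hg : (1 - PowerSeries.C c * PowerSeries.X) * g =
      PowerSeries.C a - PowerSeries.C b * PowerSeries.X) :
    (1 - cst c * mono σ : Lau Γ) • ts g σ X = (cst a - cst b * mono σ) • X := by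
  have h1 := ts_linear_mul (X := X) 1 c g hX
  have h2 := ts_linear_mul (X := X) a b 1 hX
  rw [map_one, hg] at h1
  rw [mul_one, ts_one] at h2
  rw [← h2, h1, cst_one]

end Series

/-! ## The structure functions -/

section StructureFunctions

variable {n : ℕ}

theorem zmod_one_ne_zero (hn : 3 ≤ n) : (1 : ZMod n) ≠ 0 := by
  have : Fact (1 < n) := ⟨by omega⟩
  exact one_ne_zero

theorem zmod_two_ne_zero (hn : 3 ≤ n) : (2 : ZMod n) ≠ 0 := by
  intro h
  have : ((2 : ℕ) : ZMod n) = 0 := by exact_mod_cast h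
  rw [ZMod.natCast_eq_zero_iff] at this
  exact absurd (Nat.le_of_dvd (by norm_num) this) (by omega)

theorem zmod_succ_ne (hn : 3 ≤ n) (i : ZMod n) : i + 1 ≠ i := by
  simpa using zmod_one_ne_zero hn

theorem zmod_pred_ne (hn : 3 ≤ n) (i : ZMod n) : i - 1 ≠ i := by
  intro h; exact zmod_one_ne_zero hn (by linear_combination -h)

theorem zmod_succ_ne_pred (hn : 3 ≤ n) (i : ZMod n) : i + 1 ≠ i - 1 := by
  intro h; exact zmod_two_ne_zero hn (by linear_combination h)

theorem adjacency_cases (i j : ZMod n) :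
    j = i ∨ j = i + 1 ∨ j = i - 1 ∨ (j ≠ i ∧ j ≠ i + 1 ∧ j ≠ i - 1) := by tauto

variable {q d : ℂ}

theorem gCoef_self (i : ZMod n) : gCoef q d i i = q ^ 2 := by simp [gCoef]
theorem gCoef_succ (hn : 3 ≤ n) (i : ZMod n) : gCoef q d i (i + 1) = q⁻¹ * d := by
  simp [gCoef, zmod_one_ne_zero hn]
theorem gCoef_pred (hn : 3 ≤ n) (i : ZMod n) : gCoef q d i (i - 1) = q⁻¹ * d⁻¹ := by
  simp [gCoef, zmod_pred_ne hn, (zmod_succ_ne_pred hn i).symm]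
theorem gCoef_far {i j : ZMod n} (h : j ≠ i) (h1 : j ≠ i + 1) (h2 : j ≠ i - 1) :
    gCoef q d i j = 1 := by simp [gCoef, h, h1, h2]

theorem dCoef_self (hn : 3 ≤ n) (i : ZMod n) : dCoef d i i = 1 := by
  simp [dCoef, zmod_one_ne_zero hn, (zmod_pred_ne hn i).symm]
theorem dCoef_succ (hn : 3 ≤ n) (i : ZMod n) : dCoef d i (i + 1) = d⁻¹ := by
  have : i ≠ i + 1 + 1 := fun h => zmod_two_ne_zero hn (by linear_combination -h)
  simp [dCoef, this]
theorem dCoef_pred (i : ZMod n) : dCoef d i (i - 1) = d := by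
  simp [dCoef]
theorem dCoef_far {i j : ZMod n} (h1 : j ≠ i + 1) (h2 : j ≠ i - 1) :
    dCoef d i j = 1 := by
  have h3 : i ≠ j + 1 := fun h => h2 (by rw [h]; ring)
  have h4 : i ≠ j - 1 := fun h => h1 (by rw [h]; ring)
  simp [dCoef, h3, h4]

theorem gCoef_succ' (hn : 3 ≤ n) (i : ZMod n) : gCoef q d (i + 1) i = q⁻¹ * d⁻¹ := by
  simpa using gCoef_pred (q := q) (d := d) hn (i + 1)
theorem gCoef_pred' (hn : 3 ≤ n) (i : ZMod n) : gCoef q d (i - 1) i = q⁻¹ * d := by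
  simpa using gCoef_succ (q := q) (d := d) hn (i - 1)
theorem dCoef_succ' (i : ZMod n) : dCoef d (i + 1) i = d := by
  simp [dCoef]
theorem dCoef_pred' (hn : 3 ≤ n) (i : ZMod n) : dCoef d (i - 1) i = d⁻¹ := by
  simpa using dCoef_succ (d := d) hn (i - 1)

theorem dCoef_mul_dCoef (hn : 3 ≤ n) (hd : d ≠ 0) (i j : ZMod n) :
    dCoef d i j * dCoef d j i = 1 := by
  rcases adjacency_cases i j with rfl | rfl | rfl | ⟨h, h1, h2⟩
  · simp [dCoef_self hn]
  · simp [dCoef_succ hn, dCoef_succ', hd]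
  · simp [dCoef_pred, dCoef_pred' hn, hd]
  · have h3 : i ≠ j + 1 := fun h => h2 (by rw [h]; ring)
    have h4 : i ≠ j - 1 := fun h => h1 (by rw [h]; ring)
    simp [dCoef_far h1 h2, dCoef_far h3 h4]

theorem gCoef_ne_zero (hq : q ≠ 0) (hd : d ≠ 0) (i j : ZMod n) : gCoef q d i j ≠ 0 := by
  unfold gCoef; split_ifs <;> simp [hq, hd]

theorem dCoef_ne_zero (hd : d ≠ 0) (i j : ZMod n) : dCoef d i j ≠ 0 := by
  unfold dCoef; split_ifs <;> simp [hd]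

theorem linear_mul_inv (c : ℂ) :
    (1 - PowerSeries.C c * PowerSeries.X) * (1 - PowerSeries.C c * PowerSeries.X)⁻¹ =
      (1 : PowerSeries ℂ) :=
  PowerSeries.mul_inv_cancel _ (by simp)

theorem linear_mul_fracSeries (a b c : ℂ) : (1 - PowerSeries.C c * PowerSeries.X) *
    fracSeries a b c = PowerSeries.C a - PowerSeries.C (a * b) * PowerSeries.X := by
  rw [fracSeries, map_mul]
  linear_combination (PowerSeries.C a * (1 - PowerSeries.C b * PowerSeries.X)) * linear_mul_inv c

/-- `G_{j,i}(t) = d_{i,j} (g_{i,j} - t) / (1 - g_{j,i} t)`. -/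
theorem linear_mul_GSeries (hn : 3 ≤ n) (hq : q ≠ 0) (hd : d ≠ 0) (i j : ZMod n) :
    (1 - PowerSeries.C (gCoef q d j i) * PowerSeries.X) * GSeries q d j i =
      PowerSeries.C (dCoef d i j * gCoef q d i j) -
        PowerSeries.C (dCoef d i j) * PowerSeries.X := by
  rcases adjacency_cases j i with rfl | rfl | rfl | ⟨h, h1, h2⟩
  · rw [gCoef_self, dCoef_self hn, GSeries, if_pos rfl, linear_mul_fracSeries]
    congr 3
    · ring
    · field_simp
  · rw [gCoef_succ hn, dCoef_succ', gCoef_succ' hn, GSeries, if_neg (zmod_succ_ne hn j),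
      if_pos rfl, linear_mul_fracSeries]
    congr 3
    · field_simp
    · field_simp
  · rw [gCoef_pred hn, dCoef_pred' hn, gCoef_pred' hn, GSeries, if_neg (zmod_pred_ne hn j),
      if_neg (zmod_succ_ne_pred hn j).symm, if_pos rfl, linear_mul_fracSeries]
    congr 3
    · field_simp
    · field_simp
  · have h3 : j ≠ i + 1 := fun h => h2 (by rw [h]; ring)
    have h4 : j ≠ i - 1 := fun h => h1 (by rw [h]; ring)
    rw [gCoef_far h h1 h2, dCoef_far h3 h4, gCoef_far (Ne.symm h) h3 h4, GSeries, if_neg h, if_neg h1, if_neg h2]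
    simp

end StructureFunctions

/-! ## Formal exponentials -/

section FormalExp

variable {V : Type*} [AddCommGroup V] [Module ℂ V]

theorem coeff_pow_of_lt {A : PowerSeries (𝓛 V)} (hA : PowerSeries.coeff 0 A = 0)
    {k m : ℕ} (h : m < k) : PowerSeries.coeff m (A ^ k) = 0 := by
  induction k generalizing m with
  | zero => omega
  | succ k ih =>
    rw [pow_succ, PowerSeries.coeff_mul]
    refine Finset.sum_eq_zero fun p hp => ?_
    rw [Finset.HasAntidiagonal.mem_antidiagonal] at hp
    by_cases h2 : p.2 = 0
    · rw [h2, hA, mul_zero]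
    · rw [ih (by omega), zero_mul]

theorem coeff_pow_mul_pow_of_lt {A B : PowerSeries (𝓛 V)}
    (hA : PowerSeries.coeff 0 A = 0) (hB : PowerSeries.coeff 0 B = 0)
    {k l m : ℕ} (h : m < k + l) : PowerSeries.coeff m (A ^ k * B ^ l) = 0 := by
  rw [PowerSeries.coeff_mul]
  refine Finset.sum_eq_zero fun p hp => ?_
  rw [Finset.HasAntidiagonal.mem_antidiagonal] at hp
  by_cases h2 : p.1 < k
  · rw [coeff_pow_of_lt hA h2, zero_mul]
  · rw [coeff_pow_of_lt hB (by omega : p.2 < l), mul_zero]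

theorem coeff_formalExp {A : PowerSeries (𝓛 V)} (hA : PowerSeries.coeff 0 A = 0)
    {m N : ℕ} (h : m ≤ N) : PowerSeries.coeff m (formalExp A) =
      ∑ k ∈ Finset.range (N + 1), ((k.factorial : ℂ)⁻¹) • PowerSeries.coeff m (A ^ k) := by
  rw [formalExp, PowerSeries.coeff_mk]
  refine Finset.sum_subset (fun k hk => ?_) fun k _ hk => ?_
  · simp only [Finset.mem_range] at hk ⊢; omega
  · rw [coeff_pow_of_lt hA (by simpa using hk), smul_zero]

theorem formalExp_add {A B : PowerSeries (𝓛 V)} (hA : PowerSeries.coeff 0 A = 0)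
    (hB : PowerSeries.coeff 0 B = 0) (hAB : Commute A B) :
    formalExp (A + B) = formalExp A * formalExp B := by
  ext1 m
  have h0 : PowerSeries.coeff 0 (A + B) = 0 := by rw [map_add, hA, hB, add_zero]
  rw [PowerSeries.coeff_mul]
  have e1 : ∀ p ∈ Finset.HasAntidiagonal.antidiagonal m,
      PowerSeries.coeff p.1 (formalExp A) * PowerSeries.coeff p.2 (formalExp B) =
      ∑ k ∈ Finset.range (m + 1), ∑ l ∈ Finset.range (m + 1),
        ((k.factorial : ℂ)⁻¹ * (l.factorial : ℂ)⁻¹) •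
          (PowerSeries.coeff p.1 (A ^ k) * PowerSeries.coeff p.2 (B ^ l)) := fun p hp => by
    rw [Finset.HasAntidiagonal.mem_antidiagonal] at hp
    rw [coeff_formalExp hA (N := m) (by omega), coeff_formalExp hB (N := m) (by omega),
      Finset.sum_mul_sum]
    simp only [smul_mul_smul_comm]
  rw [Finset.sum_congr rfl e1, Finset.sum_comm]
  have e2 : ∀ k, (∑ p ∈ Finset.HasAntidiagonal.antidiagonal m, ∑ l ∈ Finset.range (m + 1),
        ((k.factorial : ℂ)⁻¹ * (l.factorial : ℂ)⁻¹) •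
          (PowerSeries.coeff p.1 (A ^ k) * PowerSeries.coeff p.2 (B ^ l))) =
      ∑ l ∈ Finset.range (m + 1), ((k.factorial : ℂ)⁻¹ * (l.factorial : ℂ)⁻¹) •
          PowerSeries.coeff m (A ^ k * B ^ l) := fun k => by
    rw [Finset.sum_comm]
    simp only [PowerSeries.coeff_mul, Finset.smul_sum]
  simp only [e2]
  rw [coeff_formalExp h0 le_rfl]
  have e3 : ∀ K ∈ Finset.range (m + 1),
      ((K.factorial : ℂ)⁻¹) • PowerSeries.coeff m ((A + B) ^ K) =
      ∑ p ∈ Finset.HasAntidiagonal.antidiagonal K, ((p.1.factorial : ℂ)⁻¹ * (p.2.factorial : ℂ)⁻¹) •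
          PowerSeries.coeff m (A ^ p.1 * B ^ p.2) := fun K _ => by
    rw [hAB.add_pow', map_sum, Finset.smul_sum]
    refine Finset.sum_congr rfl fun p hp => ?_
    rw [Finset.HasAntidiagonal.mem_antidiagonal] at hp
    rw [map_nsmul, ← Nat.cast_smul_eq_nsmul ℂ, smul_smul, ← hp, Nat.choose_symm_add, Nat.add_choose]
    congr 1
    rw [Nat.cast_div (Nat.factorial_mul_factorial_dvd_factorial_add _ _)
      (by exact_mod_cast (Nat.mul_pos (Nat.factorial_pos _) (Nat.factorial_pos _)).ne')]
    have := Nat.factorial_ne_zero (p.1 + p.2)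
    push_cast
    field_simp
  rw [Finset.sum_congr rfl e3, Finset.sum_sigma', ← Finset.sum_product']
  refine Finset.sum_bij_ne_zero (fun x _ _ => x.2) ?_ ?_ ?_ ?_
  · rintro ⟨K, p⟩ h _
    simp only [Finset.mem_sigma, Finset.mem_range, Finset.HasAntidiagonal.mem_antidiagonal, Finset.mem_product]
      at h ⊢
    omega
  · rintro ⟨K, p⟩ h _ ⟨K', p'⟩ h' _ heq
    simp only [Finset.mem_sigma, Finset.HasAntidiagonal.mem_antidiagonal] at h h' heq
    subst heq
    obtain rfl : K = K' := by omega
    rfl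
  · rintro ⟨k, l⟩ h hne
    refine ⟨⟨k + l, (k, l)⟩, ?_, hne, rfl⟩
    simp only [Finset.mem_sigma, Finset.mem_range, Finset.HasAntidiagonal.mem_antidiagonal, and_true]
    by_contra hc
    exact hne (by rw [coeff_pow_mul_pow_of_lt hA hB (by omega), smul_zero])
  · rintro ⟨K, p⟩ h _
    rfl

theorem formalExp_zero : formalExp (0 : PowerSeries (𝓛 V)) = 1 := by
  ext1 m
  rw [coeff_formalExp (by simp) le_rfl, Finset.sum_eq_single 0]
  · simp
  · intro k _ hk; rw [zero_pow hk, map_zero, smul_zero]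
  · simp

theorem formalExp_mul_neg {A : PowerSeries (𝓛 V)} (hA : PowerSeries.coeff 0 A = 0) :
    formalExp A * formalExp (-A) = 1 := by
  rw [← formalExp_add hA (by rw [map_neg, hA, neg_zero]) (Commute.refl A).neg_right,
    add_neg_cancel, formalExp_zero]

theorem formalExp_neg_mul {A : PowerSeries (𝓛 V)} (hA : PowerSeries.coeff 0 A = 0) :
    formalExp (-A) * formalExp A = 1 := by
  have := formalExp_mul_neg (A := -A) (by rw [map_neg, hA, neg_zero])
  rwa [neg_neg] at this

theorem map_formalExp {U : Type*} [AddCommGroup U] [Module ℂ U]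
    (φ : 𝓛 V →ₐ[ℂ] 𝓛 U) (A : PowerSeries (𝓛 V)) :
    PowerSeries.map (φ : 𝓛 V →+* 𝓛 U) (formalExp A) =
      formalExp (PowerSeries.map (φ : 𝓛 V →+* 𝓛 U) A) := by
  ext1 m
  simp only [formalExp, PowerSeries.coeff_map, PowerSeries.coeff_mk, ← map_pow]
  simp

/-- The power series `A(cX)`. -/
def resc (c : ℂ) (A : PowerSeries (𝓛 V)) : PowerSeries (𝓛 V) :=
  PowerSeries.mk fun m => c ^ m • PowerSeries.coeff m A

@[simp] theorem coeff_resc (c : ℂ) (A : PowerSeries (𝓛 V)) (m : ℕ) :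
    PowerSeries.coeff m (resc c A) = c ^ m • PowerSeries.coeff m A := by simp [resc]

theorem resc_mul (c : ℂ) (A B : PowerSeries (𝓛 V)) :
    resc c (A * B) = resc c A * resc c B := by
  ext1 m
  rw [coeff_resc, PowerSeries.coeff_mul, PowerSeries.coeff_mul, Finset.smul_sum]
  refine Finset.sum_congr rfl fun p hp => ?_
  rw [Finset.HasAntidiagonal.mem_antidiagonal] at hp
  rw [coeff_resc, coeff_resc, smul_mul_smul_comm, ← pow_add, hp]

theorem resc_C (c : ℂ) (a : 𝓛 V) : resc c (PowerSeries.C a) = PowerSeries.C a := by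
  ext1 m
  rw [coeff_resc, PowerSeries.coeff_C]
  split_ifs with h <;> simp [h]

theorem resc_one (c : ℂ) : resc c (1 : PowerSeries (𝓛 V)) = 1 := by
  rw [← map_one PowerSeries.C, resc_C]

theorem resc_pow (c : ℂ) (A : PowerSeries (𝓛 V)) (k : ℕ) :
    resc c (A ^ k) = resc c A ^ k := by
  induction k with
  | zero => simp [resc_one]
  | succ k ih => rw [pow_succ, pow_succ, resc_mul, ih]

theorem resc_formalExp (c : ℂ) (A : PowerSeries (𝓛 V)) :
    resc c (formalExp A) = formalExp (resc c A) := by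
  ext1 m
  simp only [formalExp, coeff_resc, PowerSeries.coeff_mk, ← resc_pow, Finset.smul_sum,
    smul_comm (c ^ m)]

theorem scaleCur_curP {c : ℂ} (A : PowerSeries (𝓛 V)) :
    scaleCur c (curP A) = curP (resc c⁻¹ A) := by
  funext k
  simp only [scaleCur, curP]
  split_ifs with h
  · obtain ⟨m, rfl⟩ := Int.eq_ofNat_of_zero_le h
    simp
  · simp

theorem scaleCur_curM {c : ℂ} (A : PowerSeries (𝓛 V)) :
    scaleCur c (curM A) = curM (resc c A) := by
  funext k
  simp only [scaleCur, curM]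
  split_ifs with h
  · obtain ⟨m, hm⟩ := Int.eq_ofNat_of_zero_le (neg_nonneg.2 h)
    obtain rfl : k = -(m : ℤ) := by omega
    simp
  · simp

theorem curP_apply_natCast (A : PowerSeries (𝓛 V)) (m : ℕ) :
    curP A m = PowerSeries.coeff m A := by simp [curP]

theorem curP_of_neg (A : PowerSeries (𝓛 V)) {k : ℤ} (h : k < 0) : curP A k = 0 := by
  rw [curP, if_neg (by omega)]

theorem curM_of_pos (A : PowerSeries (𝓛 V)) {k : ℤ} (h : 0 < k) : curM A k = 0 := by
  rw [curM, if_neg (by omega)]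

theorem curM_eq_curP_neg (A : PowerSeries (𝓛 V)) (k : ℤ) : curM A k = curP A (-k) := by
  simp [curM, curP]

theorem convTerms_curP_eq_zero (A B : PowerSeries (𝓛 V)) (k a : ℤ)
    (h : a ∉ (Finset.HasAntidiagonal.antidiagonal k.toNat).image fun p => (p.1 : ℤ)) :
    convTerms (curP A) (curP B) k a = 0 := by
  rcases lt_or_ge a 0 with ha | ha
  · rw [convTerms, curP_of_neg A ha, zero_mul]
  rcases lt_or_ge (k - a) 0 with hb | hb
  · rw [convTerms, curP_of_neg B hb, mul_zero]
  exfalso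
  refine h (Finset.mem_image.2 ⟨(a.toNat, (k - a).toNat), ?_, by simpa using ha⟩)
  rw [Finset.HasAntidiagonal.mem_antidiagonal]; omega

theorem convCur_curP (A B : PowerSeries (𝓛 V)) :
    convCur (curP A) (curP B) = curP (A * B) := by
  funext k
  rw [convCur, locSum_eq_sum _ (convTerms_curP_eq_zero A B k),
    Finset.sum_image (fun p hp p' hp' h => by
      rw [Finset.mem_coe, Finset.HasAntidiagonal.mem_antidiagonal] at hp hp'
      exact Prod.ext (by omega) (by omega))]
  rcases lt_or_ge k 0 with hk | hk
  · rw [curP_of_neg _ hk]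
    refine Finset.sum_eq_zero fun p _ => ?_
    rw [convTerms, curP_of_neg B (by omega), mul_zero]
  · obtain ⟨m, rfl⟩ := Int.eq_ofNat_of_zero_le hk
    rw [curP_apply_natCast, PowerSeries.coeff_mul]
    refine Finset.sum_congr rfl fun p hp => ?_
    rw [Finset.HasAntidiagonal.mem_antidiagonal] at hp
    rw [convTerms, curP_apply_natCast, show (m : ℤ) - p.1 = (p.2 : ℕ) by omega,
      curP_apply_natCast]

theorem locFin_convTerms_curP (A B : PowerSeries (𝓛 V)) (k : ℤ) :
    LocFin (convTerms (curP A) (curP B) k) :=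
  locFin_of_finite_support _ (convTerms_curP_eq_zero A B k)

theorem convCur_curM (A B : PowerSeries (𝓛 V)) :
    convCur (curM A) (curM B) = curM (A * B) := by
  funext k
  rw [curM_eq_curP_neg, ← convCur_curP, convCur, convCur, ← locSum_equiv (Equiv.neg ℤ)]
  congr 1; funext a
  simp [convTerms, curM_eq_curP_neg, sub_eq_add_neg, add_comm]

end FormalExp

/-! ## Operators on the two factors of a tensor product -/

section TensorOps

variable {V W : Type*} [AddCommGroup V] [Module ℂ V] [AddCommGroup W] [Module ℂ W]

/-- `a ↦ a ⊗ 1` as an algebra homomorphism. -/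
def opLHom : 𝓛 V →ₐ[ℂ] 𝓛 (V ⊗[ℂ] W) :=
  AlgHom.ofLinearMap (LinearMap.rTensorHom W) (by ext; simp) fun a b => by ext; simp

/-- `b ↦ 1 ⊗ b` as an algebra homomorphism. -/
def opRHom : 𝓛 W →ₐ[ℂ] 𝓛 (V ⊗[ℂ] W) :=
  AlgHom.ofLinearMap (LinearMap.lTensorHom V) (by ext; simp) fun a b => by ext; simp

theorem opLHom_apply (a : 𝓛 V) : opLHom (W := W) a = opL W a := rfl
theorem opRHom_apply (b : 𝓛 W) : opRHom (V := V) b = opR V b := rfl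

theorem map_eq_opL_mul_opR (a : 𝓛 V) (b : 𝓛 W) :
    TensorProduct.map a b = opL W a * opR V b := by
  ext; simp [opL, opR]

theorem map_eq_opR_mul_opL (a : 𝓛 V) (b : 𝓛 W) :
    TensorProduct.map a b = opR V b * opL W a := by
  ext; simp [opL, opR]

theorem opL_opR_commute (a : 𝓛 V) (b : 𝓛 W) :
    Commute (opL W a) (opR V b) := by
  rw [Commute, SemiconjBy, ← map_eq_opL_mul_opR, map_eq_opR_mul_opL]

theorem tensorTerms_eq (A : ℤ → 𝓛 V) (B : ℤ → 𝓛 W) :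
    tensorTerms A B = convTerms (fun k => opL W (A k)) fun k => opR V (B k) := by
  funext k a; exact map_eq_opL_mul_opR _ _

theorem tensorCur_eq (A : ℤ → 𝓛 V) (B : ℤ → 𝓛 W) :
    tensorCur A B = convCur (fun k => opL W (A k)) fun k => opR V (B k) := by
  funext k; rw [tensorCur, tensorTerms_eq]; rfl

theorem map_curP {U : Type*} [AddCommGroup U] [Module ℂ U]
    (φ : 𝓛 V →ₐ[ℂ] 𝓛 U) (A : PowerSeries (𝓛 V)) (k : ℤ) :
    φ (curP A k) = curP (PowerSeries.map (φ : 𝓛 V →+* 𝓛 U) A) k := by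
  simp only [curP]; split_ifs <;> simp

theorem map_curM {U : Type*} [AddCommGroup U] [Module ℂ U]
    (φ : 𝓛 V →ₐ[ℂ] 𝓛 U) (A : PowerSeries (𝓛 V)) (k : ℤ) :
    φ (curM A k) = curM (PowerSeries.map (φ : 𝓛 V →+* 𝓛 U) A) k := by
  simp only [curM]; split_ifs <;> simp

/-- `A ↦ A ⊗ 1` for power series of operators. -/
abbrev serL (W : Type*) [AddCommGroup W] [Module ℂ W] (A : PowerSeries (𝓛 V)) :
    PowerSeries (𝓛 (V ⊗[ℂ] W)) :=
  PowerSeries.map ((opLHom : 𝓛 V →ₐ[ℂ] 𝓛 (V ⊗[ℂ] W)) : _ →+* _) A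

/-- `B ↦ 1 ⊗ B` for power series of operators. -/
abbrev serR (V : Type*) [AddCommGroup V] [Module ℂ V] (B : PowerSeries (𝓛 W)) :
    PowerSeries (𝓛 (V ⊗[ℂ] W)) :=
  PowerSeries.map ((opRHom : 𝓛 W →ₐ[ℂ] 𝓛 (V ⊗[ℂ] W)) : _ →+* _) B

theorem serL_serR_commute (A : PowerSeries (𝓛 V)) (B : PowerSeries (𝓛 W)) :
    Commute (serL W A) (serR V B) := by
  ext1 m
  rw [PowerSeries.coeff_mul, PowerSeries.coeff_mul, ← Finset.sum_equiv (Equiv.prodComm ℕ ℕ)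
    (s := Finset.HasAntidiagonal.antidiagonal m) (t := Finset.HasAntidiagonal.antidiagonal m)
    (g := fun p => PowerSeries.coeff p.1 (serR V B) * PowerSeries.coeff p.2 (serL W A))
    (by simp [add_comm]) fun _ _ => rfl]
  refine Finset.sum_congr rfl fun p _ => ?_
  rw [PowerSeries.coeff_map, PowerSeries.coeff_map, Equiv.prodComm_apply, Prod.fst_swap,
    Prod.snd_swap]
  exact opL_opR_commute _ _

theorem tensorCur_curP (A : PowerSeries (𝓛 V)) (B : PowerSeries (𝓛 W)) :
    tensorCur (curP A) (curP B) = curP (serL W A * serR V B) := by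
  rw [tensorCur_eq, ← convCur_curP]
  congr 1 <;> funext k
  · exact map_curP opLHom A k
  · exact map_curP opRHom B k

theorem tensorCur_curM (A : PowerSeries (𝓛 V)) (B : PowerSeries (𝓛 W)) :
    tensorCur (curM A) (curM B) = curM (serL W A * serR V B) := by
  rw [tensorCur_eq, ← convCur_curM]
  congr 1 <;> funext k
  · exact map_curM opLHom A k
  · exact map_curM opRHom B k

end TensorOps

/-! ## Filtrations -/

section Filtrations

variable {U : Type*} [AddCommGroup U] [Module ℂ U]

/-- A decreasing exhaustive filtration which vanishes eventually. -/
structure Filt (U : Type*) [AddCommGroup U] [Module ℂ U] where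
  F : ℤ → Submodule ℂ U
  anti : ∀ {p p'}, p ≤ p' → F p' ≤ F p
  exh : ∀ u, ∃ p, u ∈ F p
  vanish : ∃ N, ∀ p, N < p → F p = ⊥

/-- The operator `a` raises the filtration by `m`. -/
def Filt.Raises (Φ : Filt U) (m : ℤ) (a : 𝓛 U) : Prop :=
  ∀ p u, u ∈ Φ.F p → a u ∈ Φ.F (p + m)

variable {Φ : Filt U}

theorem Filt.Raises.mul {m m' : ℤ} {a b : 𝓛 U} (ha : Φ.Raises m a)
    (hb : Φ.Raises m' b) : Φ.Raises (m + m') (a * b) := fun p u hu => by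
  have := ha _ _ (hb p u hu)
  rwa [add_assoc, add_comm m'] at this

theorem Filt.Raises.mono {m m' : ℤ} {a : 𝓛 U} (ha : Φ.Raises m a) (h : m' ≤ m) :
    Φ.Raises m' a := fun p u hu => Φ.anti (by omega) (ha p u hu)

theorem Filt.Raises.congr {m : ℤ} {a b : 𝓛 U} (ha : Φ.Raises m a) (h : a = b) :
    Φ.Raises m b := h ▸ ha

theorem Filt.Raises.zero (m : ℤ) : Φ.Raises m 0 := fun p _ _ => (Φ.F (p + m)).zero_mem

theorem Filt.Raises.neg {m : ℤ} {a : 𝓛 U} (ha : Φ.Raises m a) : Φ.Raises m (-a) :=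
  fun p u hu => (Φ.F (p + m)).neg_mem (ha p u hu)

theorem Filt.Raises.add {m : ℤ} {a b : 𝓛 U} (ha : Φ.Raises m a)
    (hb : Φ.Raises m b) : Φ.Raises m (a + b) :=
  fun p u hu => (Φ.F (p + m)).add_mem (ha p u hu) (hb p u hu)

theorem Filt.Raises.smul {m : ℤ} {a : 𝓛 U} (c : ℂ) (ha : Φ.Raises m a) :
    Φ.Raises m (c • a) :=
  fun p u hu => (Φ.F (p + m)).smul_mem c (ha p u hu)

theorem Filt.Raises.locSum {ι : Type*} {m : ℤ} {f : ι → 𝓛 U}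
    (h : ∀ i, Φ.Raises m (f i)) : Φ.Raises m (locSum f) := by
  by_cases hf : LocFin f
  · intro p u hu
    rw [locSum_apply hf]
    exact finsum_induction (fun v => v ∈ Φ.F (p + m)) (Submodule.zero_mem _)
      (fun _ _ => Submodule.add_mem _) fun i => h i p u hu
  · rw [_root_.locSum, dif_neg hf]; exact Filt.Raises.zero m

/-- The coefficients of the current `x` kill every vector eventually. -/
def Truncated (x : ℤ → 𝓛 U) : Prop := ∀ u, ∃ N : ℤ, ∀ k, N < k → x k u = 0

/-- On each vector, the coefficients of `X` vanish when `ε k` is large. -/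
def Kills {Γ : Type*} [AddCommGroup Γ] (ε : Γ →+ ℤ) (X : Fam Γ (𝓛 U)) : Prop :=
  ∀ u, ∃ N : ℤ, ∀ k, N < ε k → X k u = 0

theorem Kills.of_raises {Γ : Type*} [AddCommGroup Γ] {ε : Γ →+ ℤ} {X : Fam Γ (𝓛 U)}
    (Φ : Filt U) (h : ∀ k, Φ.Raises (ε k) (X k)) : Kills ε X := fun u => by
  obtain ⟨p, hp⟩ := Φ.exh u
  obtain ⟨N, hN⟩ := Φ.vanish
  refine ⟨N - p, fun k hk => ?_⟩
  have := h k p u hp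
  rwa [hN _ (by omega), Submodule.mem_bot] at this

theorem Kills.evZ {Γ : Type*} [AddCommGroup Γ] {ε : Γ →+ ℤ} {X : Fam Γ (𝓛 U)}
    (h : Kills ε X) {σ : Γ} (hσ : 0 < ε σ) : EvZ σ X := fun u k => by
  obtain ⟨N, hN⟩ := h u
  refine ⟨(N - ε k + 1).toNat, fun m hm => hN _ ?_⟩
  rw [map_add, map_nsmul, nsmul_eq_mul]
  have h1 : (m : ℤ) ≤ m * ε σ := le_mul_of_one_le_right (by positivity) hσ
  have h2 : N - ε k + 1 ≤ m := by omega
  omega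

theorem Kills.mul_left {Γ : Type*} [AddCommGroup Γ] {ε : Γ →+ ℤ} {X : Fam Γ (𝓛 U)}
    (h : Kills ε X) (a : Γ → 𝓛 U) : Kills ε fun k => a k * X k := fun u => by
  obtain ⟨N, hN⟩ := h u
  exact ⟨N, fun k hk => by rw [Module.End.mul_apply, hN k hk, map_zero]⟩

theorem Kills.add {Γ : Type*} [AddCommGroup Γ] {ε : Γ →+ ℤ} {X Y : Fam Γ (𝓛 U)}
    (hX : Kills ε X) (hY : Kills ε Y) : Kills ε (X + Y) := fun u => by
  obtain ⟨M, hM⟩ := hX u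
  obtain ⟨N, hN⟩ := hY u
  exact ⟨max M N, fun k hk => by
    simp [hM k (lt_of_le_of_lt (le_max_left _ _) hk), hN k (lt_of_le_of_lt (le_max_right _ _) hk)]⟩

theorem Kills.const_smul {Γ : Type*} [AddCommGroup Γ] {ε : Γ →+ ℤ}
    {X : Fam Γ (𝓛 U)} (hX : Kills ε X) (c : ℂ) : Kills ε (c • X) := fun u => by
  obtain ⟨M, hM⟩ := hX u
  exact ⟨M, fun k hk => by simp [hM k hk]⟩

theorem Truncated.of_raises {x : ℤ → 𝓛 U} (Φ : Filt U) (h : ∀ k, Φ.Raises k (x k)) :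
    Truncated x := Kills.of_raises (ε := AddMonoidHom.id ℤ) Φ h

theorem Truncated.of_pos {x : ℤ → 𝓛 U} (h : ∀ k, 0 < k → x k = 0) : Truncated x :=
  fun u => ⟨0, fun k hk => by simp [h k hk]⟩

theorem Truncated.add {x y : ℤ → 𝓛 U} (hx : Truncated x) (hy : Truncated y) : Truncated (x + y) :=
  Kills.add (ε := AddMonoidHom.id ℤ) hx hy

theorem cviLF_of_truncated {x y : ℤ → 𝓛 U} (hx : Truncated x) (hy : Truncated y)
    (hc : ∀ a b, Commute (x a) (y b)) : CviLF x y := fun k u => by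
  obtain ⟨N, hN⟩ := hx u
  obtain ⟨M, hM⟩ := hy u
  refine (Set.finite_Icc (k - M) N).subset fun a ha => ?_
  simp only [Function.mem_support, AddMonoidHom.id_apply] at ha
  rw [Set.mem_Icc]
  refine ⟨?_, ?_⟩ <;> by_contra hlt <;> apply ha
  · rw [Module.End.mul_apply, hM _ (by omega), map_zero]
  · rw [(hc _ _).eq, Module.End.mul_apply, hN _ (by omega), map_zero]

theorem cviLF_of_nonneg {x y : ℤ → 𝓛 U} (hy : Truncated y) (h0 : ∀ k, k < 0 → y k = 0) :
    CviLF x y := fun k u => by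
  obtain ⟨M, hM⟩ := hy u
  refine (Set.finite_Icc (k - M) k).subset fun a ha => ?_
  simp only [Function.mem_support, AddMonoidHom.id_apply] at ha
  rw [Set.mem_Icc]
  refine ⟨?_, ?_⟩ <;> by_contra hlt <;> apply ha
  · rw [Module.End.mul_apply, hM _ (by omega), map_zero]
  · rw [h0 (k - a) (by omega), mul_zero, LinearMap.zero_apply]

/-- The constant current `1`. -/
def oneCur (U : Type*) [AddCommGroup U] [Module ℂ U] : ℤ → 𝓛 U := Pi.single 0 1

theorem oneCur_of_ne {k : ℤ} (h : k ≠ 0) : oneCur U k = 0 := Pi.single_eq_of_ne h _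

theorem oneCur_commute (a : 𝓛 U) (k : ℤ) : Commute (oneCur U k) a := by
  by_cases h : k = 0
  · subst h; simp [oneCur]
  · rw [oneCur_of_ne h]; exact Commute.zero_left a

theorem truncated_oneCur : Truncated (oneCur U) := Truncated.of_pos fun _ h => oneCur_of_ne h.ne'

theorem cviLF_oneCur (y : ℤ → 𝓛 U) : CviLF (oneCur U) y := fun k =>
  locFin_of_finite_support {0} fun a ha => by
    rw [oneCur_of_ne (by simpa using ha), zero_mul]

theorem cvi_oneCur (y : ℤ → 𝓛 U) : cvi (oneCur U) y = y := by
  funext k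
  rw [cvi_apply, locSum_eq_single 0 fun a ha => by rw [oneCur_of_ne ha, zero_mul]]
  simp [oneCur]

theorem pr_oneCur_right (x : ℤ → 𝓛 U) : pr x (oneCur U) = rp x (oneCur U) := by
  funext ⟨k, l⟩; exact ((oneCur_commute (x k) l).eq).symm

theorem pr_oneCur_left (x : ℤ → 𝓛 U) : pr (oneCur U) x = rp (oneCur U) x := by
  funext ⟨k, l⟩; exact (oneCur_commute (x l) k).eq

theorem rp_eq_pr {x y : ℤ → 𝓛 U} (h : ∀ k l, Commute (x k) (y l)) : rp x y = pr x y := by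
  funext ⟨k, l⟩; exact ((h k l).eq).symm

end Filtrations

/-! ## The two systems of currents -/

section Systems

/-- The Laurent polynomial `α w - β z`. -/
def lw (α β : ℂ) : Lau (ℤ × ℤ) :=
  cst α * mono ((0, 1) : ℤ × ℤ) - cst β * mono ((1, 0) : ℤ × ℤ)

/-- The numerator of `G_{j,i}(s z / w)`. -/
def num {n : ℕ} (q d : ℂ) (i j : ZMod n) (s : ℂ) : Lau (ℤ × ℤ) :=
  lw (dCoef d i j * gCoef q d i j) (dCoef d i j * s)

/-- The denominator of `G_{j,i}(s z / w)`. -/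
def den {n : ℕ} (q d : ℂ) (i j : ZMod n) (s : ℂ) : Lau (ℤ × ℤ) :=
  lw 1 (gCoef q d j i * s)

variable {U : Type*} [AddCommGroup U] [Module ℂ U]

theorem lw_smul_apply (α β : ℂ) (X : Fam (ℤ × ℤ) (𝓛 U)) (k l : ℤ) :
    (lw α β • X) (k, l) = α • X (k, l + 1) - β • X (k + 1, l) := by
  simp [lw, sub_smul, mul_smul]

theorem EvZ.cancel_lw {α β : ℂ} (hα : α ≠ 0) {X Y : Fam (ℤ × ℤ) (𝓛 U)}
    (hX : EvZ (1, -1) X) (hY : EvZ (1, -1) Y) (h : lw α β • X = lw α β • Y) : X = Y :=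
  EvZ.cancel hα (by simpa using hX) (by simpa using hY) h

variable {n : ℕ} {q d : ℂ}

theorem EvZ.cancel_den {i j : ZMod n} {s : ℂ} {X Y : Fam (ℤ × ℤ) (𝓛 U)}
    (hX : EvZ (1, -1) X) (hY : EvZ (1, -1) Y) (h : den q d i j s • X = den q d i j s • Y) :
    X = Y := EvZ.cancel_lw one_ne_zero hX hY h

theorem EvZ.cancel_num (hq : q ≠ 0) (hd : d ≠ 0) {i j : ZMod n} {s : ℂ}
    {X Y : Fam (ℤ × ℤ) (𝓛 U)}
    (hX : EvZ (1, -1) X) (hY : EvZ (1, -1) Y) (h : num q d i j s • X = num q d i j s • Y) :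
    X = Y :=
  EvZ.cancel_lw (mul_ne_zero (dCoef_ne_zero hd i j) (gCoef_ne_zero hq hd i j)) hX hY h

/-- The sum of the six words of the Serre relations. -/
def sixWords {R : Type*} [Ring R] [Algebra ℂ R] (q : ℂ) (X Y F : ℤ → R) (k₁ k₂ l : ℤ) : R :=
  X k₁ * Y k₂ * F l + Y k₂ * X k₁ * F l
    - (q + q⁻¹) • (X k₁ * F l * Y k₂ + Y k₂ * F l * X k₁)
    + F l * X k₁ * Y k₂ + F l * Y k₂ * X k₁

theorem serreLHS_eq_sixWords (hq : q ≠ 0) (A B : ℤ → 𝓛 U) (k₁ k₂ l : ℤ) :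
    serreLHS q A B k₁ k₂ l = (2⁻¹ : ℂ) • sixWords q A A B k₁ k₂ l := by
  simp only [serreLHS, pBracket, sixWords, mul_sub, sub_mul, mul_smul_comm, smul_mul_assoc,
    smul_sub, smul_smul, inv_mul_cancel₀ hq, one_smul, mul_assoc]
  module

theorem sixWords_comm {R : Type*} [Ring R] [Algebra ℂ R] (X Y F : ℤ → R) (k₁ k₂ l : ℤ) :
    sixWords q X Y F k₁ k₂ l = sixWords q Y X F k₂ k₁ l := by
  simp only [sixWords]; module

/-- The right-hand side of the Serre relations of `𝒦_n` before symmetrization. -/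
def serreTail (s a b : ℂ) (Km E Kp : ℤ → 𝓛 U) (k₁ k₂ l : ℤ) : 𝓛 U :=
  locSum (fun p : ℤ × ℕ => (a ^ p.2 * s ^ p.1) •
      (Km (k₁ + p.2 + p.1) * E (l - p.2) * Kp (k₂ - p.1)))
    + locSum (fun p : ℤ × ℕ => (b ^ (p.2 + 1) * s ^ p.1) •
      (Km (k₁ + p.1) * E (l + (p.2 + 1)) * Kp (k₂ - (p.2 + 1) - p.1)))

/-- Currents satisfying the relations of `𝒦_n` with `C^2 = s`, in polynomial form. -/
structure KSys (n : ℕ) (q d s : ℂ) (E Kp Km : ZMod n → ℤ → 𝓛 U) : Prop where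
  truncated_E : ∀ i, Truncated (E i)
  truncated_Kp : ∀ i, Truncated (Kp i)
  Kp_neg : ∀ i k, k < 0 → Kp i k = 0
  Km_pos : ∀ i k, 0 < k → Km i k = 0
  Kp_Kp : ∀ i j k l, Commute (Kp i k) (Kp j l)
  Km_Km : ∀ i j k l, Commute (Km i k) (Km j l)
  Kp_Km : ∀ i j, (den q d i j 1 * den q d i j s) • rp (Km i) (Kp j) =
    (num q d i j 1 * num q d i j s) • pr (Km i) (Kp j)
  Kp_E : ∀ i j, den q d i j 1 • rp (E i) (Kp j) = num q d i j 1 • pr (E i) (Kp j)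
  E_Km : ∀ i j, den q d i j 1 • rp (Km i) (E j) = num q d i j 1 • pr (Km i) (E j)
  E_E : ∀ i j, i ≠ j → den q d i j 1 • rp (E i) (E j) = num q d i j 1 • pr (E i) (E j)
  E_E_self : ∀ i k l, (den q d i i 1 • rp (E i) (E i) - num q d i i 1 • pr (E i) (E i)) (k, l) =
    (q - q⁻¹)⁻¹ •
      ((lw (-q ^ 2) (-1) • dl s (1, -1) (pr (Km i) (Kp i))) (k, l) +
        (lw (-q ^ 2) (-1) • dl s (1, -1) (pr (Km i) (Kp i))) (l, k))
  E_E_far : ∀ i j, i ≠ j → i ≠ j + 1 → i ≠ j - 1 → ∀ k l, Commute (E i k) (E j l)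
  serre_succ : ∀ i k₁ k₂ l, sixWords q (E i) (E i) (E (i + 1)) k₁ k₂ l =
    -(serreTail s (q⁻¹ * d⁻¹) (q⁻¹ * d) (Km i) (E (i + 1)) (Kp i) k₁ k₂ l +
      serreTail s (q⁻¹ * d⁻¹) (q⁻¹ * d) (Km i) (E (i + 1)) (Kp i) k₂ k₁ l)
  serre_pred : ∀ i k₁ k₂ l, sixWords q (E i) (E i) (E (i - 1)) k₁ k₂ l =
    -(serreTail s (q⁻¹ * d) (q⁻¹ * d⁻¹) (Km i) (E (i - 1)) (Kp i) k₁ k₂ l +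
      serreTail s (q⁻¹ * d) (q⁻¹ * d⁻¹) (Km i) (E (i - 1)) (Kp i) k₂ k₁ l)

/-- Rescaled currents `e(C₂z)`, `φ(z) = f(C₁⁻¹C₂⁻¹z)`, `ζp(z) = ψ⁺(C₁⁻¹C₂⁻¹z)`, `η = ζp⁻¹`,
`ζ(z) = ψ⁻(C₂z)` of the quantum toroidal algebra, with `s = C₂^2`, `r = C₁^2C₂^2`, and their
relations in polynomial form. -/
structure TSys (n : ℕ) (q d s r : ℂ) (e φ η ζ ζp : ZMod n → ℤ → 𝓛 U) : Prop where
  η_neg : ∀ i k, k < 0 → η i k = 0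
  ζp_neg : ∀ i k, k < 0 → ζp i k = 0
  ζ_pos : ∀ i k, 0 < k → ζ i k = 0
  ζp_η : ∀ i, cvi (ζp i) (η i) = oneCur U
  η_η : ∀ i j k l, Commute (η i k) (η j l)
  ζ_ζ : ∀ i j k l, Commute (ζ i k) (ζ j l)
  η_e : ∀ i j, num q d i j s • rp (e i) (η j) = den q d i j s • pr (e i) (η j)
  η_φ : ∀ i j, den q d i j 1 • rp (φ i) (η j) = num q d i j 1 • pr (φ i) (η j)
  e_ζ : ∀ i j, den q d i j 1 • rp (ζ i) (e j) = num q d i j 1 • pr (ζ i) (e j)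
  φ_ζ : ∀ i j, num q d i j r • rp (ζ i) (φ j) = den q d i j r • pr (ζ i) (φ j)
  η_ζ : ∀ i j, (den q d i j r * num q d i j s) • rp (ζ i) (η j) =
    (num q d i j r * den q d i j s) • pr (ζ i) (η j)
  e_φ : ∀ i j, i ≠ j → ∀ k l, Commute (e i k) (φ j l)
  e_φ_self : ∀ i k l, e i k * φ i l - φ i l * e i k =
    (q - q⁻¹)⁻¹ • (s ^ (-k) • ζp i (k + l) - r ^ l • ζ i (k + l))
  e_e : ∀ i j, den q d i j 1 • rp (e i) (e j) = num q d i j 1 • pr (e i) (e j)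
  φ_φ : ∀ i j, num q d i j 1 • rp (φ i) (φ j) = den q d i j 1 • pr (φ i) (φ j)
  e_e_far : ∀ i j, i ≠ j → i ≠ j + 1 → i ≠ j - 1 → ∀ k l, Commute (e i k) (e j l)
  φ_φ_far : ∀ i j, i ≠ j → i ≠ j + 1 → i ≠ j - 1 → ∀ k l, Commute (φ i k) (φ j l)
  serre_e : ∀ i j, (j = i + 1 ∨ j = i - 1) → ∀ k₁ k₂ l, sixWords q (e i) (e i) (e j) k₁ k₂ l = 0
  serre_φ : ∀ i j, (j = i + 1 ∨ j = i - 1) → ∀ k₁ k₂ l, sixWords q (φ i) (φ i) (φ j) k₁ k₂ l = 0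

/-- A toroidal system and a `𝒦_n`-system acting on the two factors of a tensor product, with the
filtrations by the degrees of the two factors and by the total degree. -/
structure PairSys (n : ℕ) (q d s r : ℂ) (e φ η ζ ζp E Kp Km : ZMod n → ℤ → 𝓛 U)
    (Φ Ψ Ω : Filt U) : Prop where
  T : TSys n q d s r e φ η ζ ζp
  K : KSys n q d s E Kp Km
  e_E : ∀ i j k l, Commute (e i k) (E j l)
  e_Kp : ∀ i j k l, Commute (e i k) (Kp j l)
  e_Km : ∀ i j k l, Commute (e i k) (Km j l)
  φ_E : ∀ i j k l, Commute (φ i k) (E j l)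
  φ_Kp : ∀ i j k l, Commute (φ i k) (Kp j l)
  φ_Km : ∀ i j k l, Commute (φ i k) (Km j l)
  η_E : ∀ i j k l, Commute (η i k) (E j l)
  η_Kp : ∀ i j k l, Commute (η i k) (Kp j l)
  η_Km : ∀ i j k l, Commute (η i k) (Km j l)
  ζ_E : ∀ i j k l, Commute (ζ i k) (E j l)
  ζ_Kp : ∀ i j k l, Commute (ζ i k) (Kp j l)
  ζ_Km : ∀ i j k l, Commute (ζ i k) (Km j l)
  Φ_e : ∀ i k, Φ.Raises k (e i k)
  Φ_φ : ∀ i k, Φ.Raises k (φ i k)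
  Φ_η : ∀ i k, Φ.Raises k (η i k)
  Φ_E : ∀ i k, Φ.Raises 0 (E i k)
  Φ_Kp : ∀ i k, Φ.Raises 0 (Kp i k)
  Φ_Km : ∀ i k, Φ.Raises 0 (Km i k)
  Ψ_φ : ∀ i k, Ψ.Raises 0 (φ i k)
  Ψ_η : ∀ i k, Ψ.Raises 0 (η i k)
  Ψ_E : ∀ i k, Ψ.Raises k (E i k)
  Ψ_Kp : ∀ i k, Ψ.Raises k (Kp i k)
  Ω_e : ∀ i k, Ω.Raises k (e i k)
  Ω_φ : ∀ i k, Ω.Raises k (φ i k)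
  Ω_η : ∀ i k, Ω.Raises k (η i k)
  Ω_E : ∀ i k, Ω.Raises k (E i k)
  Ω_Kp : ∀ i k, Ω.Raises k (Kp i k)
  Ω_Km : ∀ i k, Ω.Raises k (Km i k)

end Systems

/-! ## Exchange relations of products of currents -/

section Exchange

variable {U : Type*} [AddCommGroup U] [Module ℂ U]

theorem cvi_oneCur_right (y : ℤ → 𝓛 U) : cvi y (oneCur U) = y := by
  funext k
  rw [cvi_apply, locSum_eq_single k fun a ha => by
    rw [oneCur_of_ne (sub_ne_zero.2 ha.symm), mul_zero]]
  simp [oneCur]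

theorem cviLF_oneCur_right (y : ℤ → 𝓛 U) : CviLF y (oneCur U) := fun k =>
  locFin_of_finite_support {k} fun a ha => by
    rw [AddMonoidHom.id_apply, oneCur_of_ne (sub_ne_zero.2 (Ne.symm (by simpa using ha))), mul_zero]

theorem commute_locSum {ι : Type*} {f : ι → 𝓛 U} (hf : LocFin f) {b : 𝓛 U}
    (h : ∀ i, Commute (f i) b) : Commute (locSum f) b := by
  rw [Commute, SemiconjBy, locSum_mul hf, mul_locSum hf]
  simp only [(h _).eq]

theorem commute_cvi {x y : ℤ → 𝓛 U} (h : CviLF x y) {b : 𝓛 U}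
    (hx : ∀ a, Commute (x a) b) (hy : ∀ a, Commute (y a) b) (k : ℤ) : Commute (cvi x y k) b :=
  commute_locSum (h k) fun _ => (hx _).mul_left (hy _)

theorem exchange_cvi {x₁ x₂ y₁ y₂ : ℤ → 𝓛 U} {p p' r r' : Lau (ℤ × ℤ)}
    (h₁ : CviLF x₁ y₁) (h₂ : CviLF x₂ y₂) (hc : ∀ a b, Commute (y₁ a) (x₂ b))
    (hc' : ∀ a b, Commute (y₂ b) (x₁ a)) (hx : p • rp x₁ x₂ = p' • pr x₁ x₂)
    (hy : r • rp y₁ y₂ = r' • pr y₁ y₂) :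
    (p * r) • rp (cvi x₁ y₁) (cvi x₂ y₂) = (p' * r') • pr (cvi x₁ y₁) (cvi x₂ y₂) := by
  rw [rp_cvi h₁ h₂ hc', pr_cvi h₁ h₂ hc]
  exact cvi_relation (rp_cviLF h₁ h₂ hc') (pr_cviLF h₁ h₂ hc) hx hy

theorem locFin_of_nonneg_right {y : ℤ → 𝓛 U} (hy : Truncated y)
    (h0 : ∀ k, k < 0 → y k = 0) (f : ℤ → 𝓛 U) (l : ℤ) :
    LocFin fun b => f b * y (l - b) := cviLF_of_nonneg (x := f) hy h0 l

theorem locFin_of_nonneg_right' {y : ℤ → 𝓛 U} (hy : Truncated y)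
    (h0 : ∀ k, k < 0 → y k = 0) (f : ℤ → 𝓛 U) :
    LocFin fun b => f b * y b := by
  have := (locFin_of_nonneg_right hy h0 (fun b => f (-b)) 0).comp_injective (e := Neg.neg)
    neg_injective
  simpa using this

theorem exchange_right {x y₁ y₂ : ℤ → 𝓛 U} {p p' p'' : Lau (ℤ × ℤ)}
    (hy : Truncated y₂) (h0 : ∀ k, k < 0 → y₂ k = 0)
    (h₂ : p • rp x y₂ = p' • pr x y₂) (h₁ : p' • rp x y₁ = p'' • pr x y₁) :
    p • rp x (cvi y₁ y₂) = p'' • pr x (cvi y₁ y₂) := by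
  have e₁ : rp x (cvi y₁ y₂) = cv (AddMonoidHom.inr ℤ ℤ) y₁ (rp x y₂) := by
    funext ⟨k, l⟩
    rw [rp_apply, cvi_apply, locSum_mul (locFin_of_nonneg_right hy h0 _ _), cv]
    simp [mul_assoc]
  have e₂ : pr x (cvi y₁ y₂) = rcv (AddMonoidHom.inr ℤ ℤ) (pr x y₁) y₂ := by
    funext ⟨k, l⟩
    rw [pr_apply, cvi_eq_rcv, rcv_apply, mul_locSum (locFin_of_nonneg_right' hy h0 _), rcv_apply]
    simp [mul_assoc]
  have e₃ : cv (AddMonoidHom.inr ℤ ℤ) y₁ (pr x y₂) = rcv (AddMonoidHom.inr ℤ ℤ) (rp x y₁) y₂ := by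
    funext ⟨k, l⟩
    rw [rcv_apply, ← locSum_equiv (Equiv.subLeft l), cv]
    simp [mul_assoc]
  rw [e₁, e₂, cv_relation _ _ h₂, e₃, rcv_relation _ _ h₁]
  · rintro ⟨k, l⟩
    exact locFin_of_nonneg_right' hy h0 _
  · rintro ⟨k, l⟩
    exact locFin_of_nonneg_right' hy h0 _
  · rintro ⟨k, l⟩
    have := (locFin_of_nonneg_right hy h0 y₁ l).mul_right (x k)
    simpa [mul_assoc] using this
  · rintro ⟨k, l⟩
    have := locFin_of_nonneg_right hy h0 (fun b => y₁ b * x k) l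
    simpa [mul_assoc] using this

theorem exchange_left {x₁ x₂ y : ℤ → 𝓛 U} {p p' p'' : Lau (ℤ × ℤ)}
    (hx : Truncated x₂) (h0 : ∀ k, k < 0 → x₂ k = 0)
    (h₁ : p • rp x₁ y = p' • pr x₁ y) (h₂ : p' • rp x₂ y = p'' • pr x₂ y) :
    p • rp (cvi x₁ x₂) y = p'' • pr (cvi x₁ x₂) y := by
  have e₁ : rp (cvi x₁ x₂) y = rcv (AddMonoidHom.inl ℤ ℤ) (rp x₁ y) x₂ := by
    funext ⟨k, l⟩
    rw [rp_apply, cvi_eq_rcv, rcv_apply, mul_locSum (locFin_of_nonneg_right' hx h0 _), rcv_apply]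
    simp [mul_assoc]
  have e₂ : pr (cvi x₁ x₂) y = cv (AddMonoidHom.inl ℤ ℤ) x₁ (pr x₂ y) := by
    funext ⟨k, l⟩
    rw [pr_apply, cvi_apply, locSum_mul (locFin_of_nonneg_right hx h0 _ _), cv]
    simp [mul_assoc]
  have e₃ : cv (AddMonoidHom.inl ℤ ℤ) x₁ (rp x₂ y) = rcv (AddMonoidHom.inl ℤ ℤ) (pr x₁ y) x₂ := by
    funext ⟨k, l⟩
    rw [rcv_apply, ← locSum_equiv (Equiv.subLeft k), cv]
    simp [mul_assoc]
  rw [e₁, e₂, rcv_relation _ _ h₁, ← e₃, cv_relation _ _ h₂]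
  · rintro ⟨k, l⟩
    have := locFin_of_nonneg_right hx h0 (fun b => x₁ b * y l) k
    simpa [mul_assoc] using this
  · rintro ⟨k, l⟩
    have := (locFin_of_nonneg_right hx h0 x₁ k).mul_right (y l)
    simpa [mul_assoc] using this
  · rintro ⟨k, l⟩
    exact locFin_of_nonneg_right' hx h0 _
  · rintro ⟨k, l⟩
    exact locFin_of_nonneg_right' hx h0 _

theorem evZ_rp {X F : ℤ → 𝓛 U} (hX : Truncated X) : EvZ (1, -1) (rp X F) := fun u k => by
  obtain ⟨N, hN⟩ := hX u
  refine ⟨(N - k.1 + 1).toNat, fun m hm => ?_⟩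
  rw [rp, Module.End.mul_apply, hN, map_zero]
  simp
  omega

theorem evZ_pr {X F : ℤ → 𝓛 U} (Φ : Filt U) (hX : ∀ k, Φ.Raises k (X k))
    (hF : ∀ k, Φ.Raises 0 (F k)) : EvZ (1, -1) (pr X F) := fun u k => by
  obtain ⟨p, hp⟩ := Φ.exh u
  obtain ⟨N, hN⟩ := Φ.vanish
  refine ⟨(N - p - k.1 + 1).toNat, fun m hm => ?_⟩
  have h := hX (k + m • ((1, -1) : ℤ × ℤ)).1 _ _ (hF (k + m • ((1, -1) : ℤ × ℤ)).2 p u hp)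
  rw [hN, Submodule.mem_bot] at h
  · exact h
  · simp
    omega

theorem evZ_pr_of_neg {X F : ℤ → 𝓛 U} (hF : ∀ k, k < 0 → F k = 0) :
    EvZ (1, -1) (pr X F) := fun u k => by
  refine ⟨(k.2 + 1).toNat, fun m hm => ?_⟩
  rw [pr, hF, mul_zero, LinearMap.zero_apply]
  simp
  omega

theorem evZ_pr_of_pos {X F : ℤ → 𝓛 U} (hX : ∀ k, 0 < k → X k = 0) :
    EvZ (1, -1) (pr X F) := fun u k => by
  refine ⟨(-k.1 + 1).toNat, fun m hm => ?_⟩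
  rw [pr, hX, zero_mul, LinearMap.zero_apply]
  simp
  omega

theorem Filt.Raises.cvi {Φ : Filt U} {m k : ℤ} {x y : ℤ → 𝓛 U}
    (h : ∀ a b, a + b = k → Φ.Raises m (x a * y b)) : Φ.Raises m (cvi x y k) :=
  Filt.Raises.locSum fun a => h a (k - a) (by omega)

theorem Filt.Raises.cvi_add {Φ : Filt U} {x y : ℤ → 𝓛 U}
    (hx : ∀ k, Φ.Raises k (x k)) (hy : ∀ k, Φ.Raises k (y k)) (k : ℤ) :
    Φ.Raises k (_root_.cvi x y k) :=
  Filt.Raises.cvi fun a b hab => hab ▸ (hx a).mul (hy b)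

theorem Filt.Raises.cvi_pos {Φ : Filt U} {x y : ℤ → 𝓛 U}
    (hx : ∀ k, Φ.Raises k (x k)) (hy : ∀ k, Φ.Raises 0 (y k)) (h0 : ∀ k, 0 < k → y k = 0) (k : ℤ) :
    Φ.Raises k (_root_.cvi x y k) :=
  Filt.Raises.cvi fun a b hab => by
    rcases lt_or_ge 0 b with hb | hb
    · rw [h0 b hb, mul_zero]; exact Filt.Raises.zero _
    · exact ((hx a).mul (hy b)).mono (by omega)

theorem Filt.Raises.cvi_zero {Φ : Filt U} {x y : ℤ → 𝓛 U}
    (hx : ∀ k, Φ.Raises 0 (x k)) (hy : ∀ k, Φ.Raises 0 (y k)) (k : ℤ) :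
    Φ.Raises 0 (_root_.cvi x y k) :=
  Filt.Raises.cvi fun a b _ => by simpa using (hx a).mul (hy b)

theorem Filt.Raises.of_nonneg {Φ : Filt U} {y : ℤ → 𝓛 U}
    (hy : ∀ k, Φ.Raises k (y k)) (h0 : ∀ k, k < 0 → y k = 0) (k : ℤ) : Φ.Raises 0 (y k) := by
  rcases lt_or_ge k 0 with hk | hk
  · rw [h0 k hk]; exact Filt.Raises.zero _
  · exact (hy k).mono hk

/-- The filtration generated by `Φ` under the coefficients of `x`. -/
def Filt.gen (Φ : Filt U) (x : ℤ → 𝓛 U) : Filt U where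
  F p := sInf {N | Φ.F p ≤ N ∧ ∀ k, ∀ u ∈ N, x k u ∈ N}
  anti h := sInf_le_sInf fun _ hN => ⟨(Φ.anti h).trans hN.1, hN.2⟩
  exh u := by
    obtain ⟨p, hp⟩ := Φ.exh u
    exact ⟨p, (le_sInf fun N hN => hN.1 : Φ.F p ≤ _) hp⟩
  vanish := by
    obtain ⟨N, hN⟩ := Φ.vanish
    refine ⟨N, fun p hp => ?_⟩
    rw [eq_bot_iff]
    refine sInf_le ⟨(hN p hp).le, fun k u hu => ?_⟩
    rw [Submodule.mem_bot] at hu ⊢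
    rw [hu, map_zero]

theorem Filt.le_gen (Φ : Filt U) (x : ℤ → 𝓛 U) (p : ℤ) : Φ.F p ≤ (Φ.gen x).F p :=
  le_sInf fun _ hN => hN.1

theorem Filt.gen_stable (Φ : Filt U) (x : ℤ → 𝓛 U) (k : ℤ) :
    (Φ.gen x).Raises 0 (x k) := fun p u hu => by
  rw [add_zero]
  simp only [Filt.gen, Submodule.mem_sInf] at hu ⊢
  exact fun N hN => hN.2 k u (hu N hN)

theorem Filt.gen_le {Φ : Filt U} {x : ℤ → 𝓛 U} {p : ℤ} {N : Submodule ℂ U}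
    (h : Φ.F p ≤ N) (h' : ∀ k, ∀ u ∈ N, x k u ∈ N) : (Φ.gen x).F p ≤ N := sInf_le ⟨h, h'⟩

theorem Filt.Raises.gen {Φ : Filt U} {m : ℤ} {a : 𝓛 U} (ha : Φ.Raises m a)
    {x : ℤ → 𝓛 U} (hc : ∀ k, Commute a (x k)) : (Φ.gen x).Raises m a := fun p => by
  refine Filt.gen_le (N := ((Φ.gen x).F (p + m)).comap a)
    (fun u hu => Φ.le_gen x _ (ha p u hu)) fun k u hu => ?_
  rw [Submodule.mem_comap] at hu ⊢
  rw [← Module.End.mul_apply, (hc k).eq]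
  simpa using Φ.gen_stable x k _ _ hu

theorem Filt.gen_raises_of_exchange {Φ : Filt U} {x y : ℤ → 𝓛 U}
    (hy : ∀ k, Φ.Raises 0 (y k)) (h0 : ∀ k, k < 0 → y k = 0) {c a b : ℂ}
    (h : lw 1 c • rp x y = lw a b • pr x y) (l : ℤ) : (Φ.gen x).Raises 0 (y l) := by
  by_cases hl : l < 0
  · rw [h0 l hl]; exact Filt.Raises.zero 0
  have hn : ∀ m : ℕ, (Φ.gen x).Raises 0 (y (m - 1)) := fun m => by
    induction m with
    | zero => rw [h0 _ (by simp)]; exact Filt.Raises.zero 0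
    | succ m ih =>
      intro p u hu
      rw [add_zero]
      refine (Filt.gen_le (N := (Φ.gen x).F p ⊓ ((Φ.gen x).F p).comap (y ((m + 1 : ℕ) - 1)))
        (fun u hu => ⟨Φ.le_gen x _ hu, Φ.le_gen x _ (by simpa using hy _ p u hu)⟩)
        (fun k u hu => ?_) hu).2
      have hs : ∀ k, ∀ v ∈ (Φ.gen x).F p, x k v ∈ (Φ.gen x).F p := fun k v hv => by
        simpa using Φ.gen_stable x k _ _ hv
      have hi : ∀ v ∈ (Φ.gen x).F p, y (m - 1) v ∈ (Φ.gen x).F p := fun v hv => by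
        simpa using ih _ _ hv
      obtain ⟨h1, h2⟩ := hu
      refine ⟨hs k u h1, ?_⟩
      rw [SetLike.mem_coe, Submodule.mem_comap] at h2 ⊢
      have e := congrFun h (k, (m : ℤ) - 1)
      rw [lw_smul_apply, lw_smul_apply] at e
      have e' := LinearMap.congr_fun e u
      simp only [one_smul, rp_apply, pr_apply, LinearMap.sub_apply, LinearMap.smul_apply,
        Module.End.mul_apply, sub_eq_iff_eq_add] at e'
      rw [show (((m + 1 : ℕ) : ℤ) - 1) = (m : ℤ) - 1 + 1 by push_cast; ring] at h2 ⊢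
      rw [e']
      exact Submodule.add_mem _ (Submodule.sub_mem _ (Submodule.smul_mem _ _ (hs _ _ h2))
        (Submodule.smul_mem _ _ (hs _ _ (hi _ h1)))) (Submodule.smul_mem _ _ (hi _ (hs _ _ h1)))
  have := hn (l + 1).toNat
  rwa [show (((l + 1).toNat : ℤ) - 1) = l by omega] at this

end Exchange

/-! ## Exchange relations between the summands of the coaction -/

section Pairs

variable {U : Type*} [AddCommGroup U] [Module ℂ U] {n : ℕ} {q d s r : ℂ}
variable {e φ η ζ ζp E Kp Km : ZMod n → ℤ → 𝓛 U} {Φ Ψ Ω : Filt U}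

theorem rp_neg_right (x y : ℤ → 𝓛 U) : rp x (-y) = -rp x y := by
  funext ⟨k, l⟩; simp [rp]
theorem rp_neg_left (x y : ℤ → 𝓛 U) : rp (-x) y = -rp x y := by
  funext ⟨k, l⟩; simp [rp]
theorem pr_neg_right (x y : ℤ → 𝓛 U) : pr x (-y) = -pr x y := by
  funext ⟨k, l⟩; simp [pr]
theorem pr_neg_left (x y : ℤ → 𝓛 U) : pr (-x) y = -pr x y := by
  funext ⟨k, l⟩; simp [pr]

/-- The quadratic exchange relation of currents of colours `i`, `j`. -/
def QuadRel (q d : ℂ) (i j : ZMod n) (X F : ℤ → 𝓛 U) : Prop :=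
  den q d i j 1 • rp X F = num q d i j 1 • pr X F

theorem QuadRel.neg_right {i j : ZMod n} {X F : ℤ → 𝓛 U} (h : QuadRel q d i j X F) :
    QuadRel q d i j X (-F) := by
  rw [QuadRel, rp_neg_right, pr_neg_right, smul_neg, smul_neg, h]

theorem QuadRel.neg_left {i j : ZMod n} {X F : ℤ → 𝓛 U} (h : QuadRel q d i j X F) :
    QuadRel q d i j (-X) F := by
  rw [QuadRel, rp_neg_left, pr_neg_left, smul_neg, smul_neg, h]

theorem quadRel_iff {i j : ZMod n} {X F : ℤ → 𝓛 U} :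
    QuadRel q d i j X F ↔ ∀ k l,
      F (l + 1) * X k - gCoef q d j i • (F l * X (k + 1)) =
        (dCoef d i j * gCoef q d i j) • (X k * F (l + 1)) - dCoef d i j • (X (k + 1) * F l) := by
  rw [QuadRel, funext_iff, Prod.forall]
  simp only [den, num, lw_smul_apply, rp_apply, pr_apply, one_smul, mul_one]

theorem QuadRel.symm (hn : 3 ≤ n) (hd : d ≠ 0) {i j : ZMod n} {X F : ℤ → 𝓛 U}
    (h : QuadRel q d i j X F) : QuadRel q d j i F X := by
  rw [quadRel_iff] at h ⊢
  intro l k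
  have hh := h k l
  have hdd := dCoef_mul_dCoef (n := n) hn hd j i
  have h2 : dCoef d j i • (F (l + 1) * X k - gCoef q d j i • (F l * X (k + 1))) =
      gCoef q d i j • (X k * F (l + 1)) - X (k + 1) * F l := by
    rw [hh, smul_sub, smul_smul, smul_smul, ← mul_assoc, hdd, one_mul, one_smul]
  rw [← sub_eq_zero] at h2 ⊢
  rw [← h2]
  module

theorem cancel_num_den (hq : q ≠ 0) (hd : d ≠ 0) {i j i' j' : ZMod n} {a b : ℂ}
    {p p' : Lau (ℤ × ℤ)} {X Y : Fam (ℤ × ℤ) (𝓛 U)}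
    (hX : EvZ (1, -1) X) (hY : EvZ (1, -1) Y)
    (h : (num q d i j a * den q d i' j' b * p) • X = (num q d i j a * den q d i' j' b * p') • Y) :
    p • X = p' • Y := by
  rw [mul_smul, mul_smul, mul_smul, mul_smul] at h
  exact EvZ.cancel_den (hX.smul _) (hY.smul _) (EvZ.cancel_num hq hd ((hX.smul _).smul _)
    ((hY.smul _).smul _) h)

theorem commute_of_quadRel_far {i j : ZMod n} (hij : i ≠ j) (h₁ : i ≠ j + 1) (h₂ : i ≠ j - 1)
    {X F : ℤ → 𝓛 U} (h : QuadRel q d i j X F)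
    (hr : EvZ (1, -1) (rp X F)) (hp : EvZ (1, -1) (pr X F)) (k l : ℤ) : Commute (X k) (F l) := by
  have h₁' : j ≠ i - 1 := fun h => h₁ (by simp [h])
  have h₂' : j ≠ i + 1 := fun h => h₂ (by simp [h])
  have hg : gCoef q d i j = 1 := gCoef_far hij.symm h₂' h₁'
  have hg' : gCoef q d j i = 1 := gCoef_far hij h₁ h₂
  have hd1 : dCoef d i j = 1 := dCoef_far h₂' h₁'
  have : rp X F = pr X F := by
    refine EvZ.cancel_lw (α := 1) (β := 1) one_ne_zero hr hp ?_
    simpa [QuadRel, den, num, hg, hg', hd1] using h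
  exact (congrFun this (k, l)).symm

/-- The part of the coaction of `E` which involves `e`. -/
abbrev letA (e Km : ZMod n → ℤ → 𝓛 U) (i : ZMod n) : ℤ → 𝓛 U :=
  cvi (e i) (Km i)

/-- The current `φη`. -/
abbrev letT (φ η : ZMod n → ℤ → 𝓛 U) (i : ZMod n) : ℤ → 𝓛 U :=
  cvi (φ i) (η i)

/-- The part of the coaction of `E` which involves `f`. -/
abbrev letD (φ η Kp : ZMod n → ℤ → 𝓛 U) (i : ZMod n) : ℤ → 𝓛 U :=
  -cvi (letT φ η i) (Kp i)

namespace PairSys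

variable (S : PairSys n q d s r e φ η ζ ζp E Kp Km Φ Ψ Ω)
include S

theorem tr_e (i) : Truncated (e i) := Truncated.of_raises Φ (S.Φ_e i)
theorem tr_φ (i) : Truncated (φ i) := Truncated.of_raises Φ (S.Φ_φ i)
theorem tr_η (i) : Truncated (η i) := Truncated.of_raises Φ (S.Φ_η i)
theorem tr_ζ (i) : Truncated (ζ i) := Truncated.of_pos (S.T.ζ_pos i)
theorem tr_Km (i) : Truncated (Km i) := Truncated.of_pos (S.K.Km_pos i)
theorem lf_A (i) : CviLF (e i) (Km i) := cviLF_of_truncated (S.tr_e i) (S.tr_Km i) (S.e_Km i i)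
theorem lf_T (i) : CviLF (φ i) (η i) := cviLF_of_nonneg (S.tr_η i) (S.T.η_neg i)
theorem lf_D (i) : CviLF (letT φ η i) (Kp i) :=
  cviLF_of_nonneg (S.K.truncated_Kp i) (S.K.Kp_neg i)
theorem lf_κp (i) : CviLF (η i) (Kp i) := cviLF_of_nonneg (S.K.truncated_Kp i) (S.K.Kp_neg i)
theorem lf_κm (i) : CviLF (ζ i) (Km i) :=
  cviLF_of_truncated (S.tr_ζ i) (S.tr_Km i) (S.ζ_Km i i)
theorem Φ_T (i k) : Φ.Raises k (letT φ η i k) := Filt.Raises.cvi_add (S.Φ_φ i) (S.Φ_η i) k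
theorem Ω_T (i k) : Ω.Raises k (letT φ η i k) := Filt.Raises.cvi_add (S.Ω_φ i) (S.Ω_η i) k
theorem Ψ_T (i k) : Ψ.Raises 0 (letT φ η i k) := Filt.Raises.cvi_zero (S.Ψ_φ i) (S.Ψ_η i) k
theorem T_E (i j k l) : Commute (letT φ η i k) (E j l) :=
  commute_cvi (S.lf_T i) (fun a => S.φ_E i j a l) (fun a => S.η_E i j a l) k
theorem T_Kp (i j k l) : Commute (letT φ η i k) (Kp j l) :=
  commute_cvi (S.lf_T i) (fun a => S.φ_Kp i j a l) (fun a => S.η_Kp i j a l) k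
theorem T_Km (i j k l) : Commute (letT φ η i k) (Km j l) :=
  commute_cvi (S.lf_T i) (fun a => S.φ_Km i j a l) (fun a => S.η_Km i j a l) k
theorem Φ_A (i k) : Φ.Raises k (letA e Km i k) :=
  Filt.Raises.cvi_pos (S.Φ_e i) (S.Φ_Km i) (S.K.Km_pos i) k
theorem Ω_D (i k) : Ω.Raises k (letD φ η Kp i k) :=
  (Filt.Raises.cvi_add (S.Ω_T i) (S.Ω_Kp i) k).neg
theorem Ψ_D (i k) : Ψ.Raises 0 (letD φ η Kp i k) :=
  (Filt.Raises.cvi_zero (S.Ψ_T i) (Filt.Raises.of_nonneg (S.Ψ_Kp i) (S.K.Kp_neg i)) k).neg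
theorem Ω_κp (i k) : Ω.Raises k (cvi (η i) (Kp i) k) :=
  Filt.Raises.cvi_add (S.Ω_η i) (S.Ω_Kp i) k
theorem tr_A (i) : Truncated (letA e Km i) := Truncated.of_raises Φ (S.Φ_A i)
theorem tr_D (i) : Truncated (letD φ η Kp i) := Truncated.of_raises Ω (S.Ω_D i)
theorem tr_κp (i) : Truncated (cvi (η i) (Kp i)) := Truncated.of_raises Ω (S.Ω_κp i)

theorem κp_neg (i k) (hk : k < 0) : cvi (η i) (Kp i) k = 0 := by
  rw [cvi_apply, ← locSum_zero (ι := ℤ)]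
  congr 1; funext a
  rcases lt_or_ge a 0 with ha | ha
  · rw [S.T.η_neg i a ha, zero_mul]
  · rw [S.K.Kp_neg i _ (by omega), mul_zero]

theorem κm_pos (i k) (hk : 0 < k) : cvi (ζ i) (Km i) k = 0 := by
  rw [cvi_apply, ← locSum_zero (ι := ℤ)]
  congr 1; funext a
  rcases lt_or_ge 0 a with ha | ha
  · rw [S.T.ζ_pos i a ha, zero_mul]
  · rw [S.K.Km_pos i _ (by omega), mul_zero]

theorem T_η (i j) : QuadRel q d i j (letT φ η i) (η j) := by
  have := exchange_cvi (x₁ := φ i) (y₁ := η i) (x₂ := η j) (y₂ := oneCur U) (S.lf_T i)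
    (cviLF_oneCur_right _) (S.T.η_η i j) (fun _ _ => oneCur_commute _ _) (S.T.η_φ i j)
    (r := 1) (r' := 1) (by rw [pr_oneCur_right])
  rwa [cvi_oneCur_right, mul_one, mul_one] at this

theorem η_φ_swap (hn : 3 ≤ n) (hd : d ≠ 0) (i j) :
    QuadRel q d i j (η i) (φ j) := QuadRel.symm hn hd (S.T.η_φ j i)

theorem T_T (hn : 3 ≤ n) (hd : d ≠ 0) (i j) :
    QuadRel q d i j (letT φ η i) (letT φ η j) := by
  refine exchange_right (S.tr_η j) (S.T.η_neg j) (S.T_η i j) ?_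
  exact exchange_left (S.tr_η i) (S.T.η_neg i) (S.T.φ_φ i j) (S.η_φ_swap hn hd i j)

theorem ζ_T (i j) :
    num q d i j s • rp (ζ i) (letT φ η j) = den q d i j s • pr (ζ i) (letT φ η j) := by
  have h := exchange_right (x := ζ i) (S.tr_η j) (S.T.η_neg j) (S.T.η_ζ i j)
    (y₁ := φ j) (p'' := den q d i j r * den q d i j s) (by
      rw [mul_comm, mul_smul, S.T.φ_ζ i j, ← mul_smul, mul_comm])
  rw [mul_smul, mul_smul] at h
  exact EvZ.cancel_den ((evZ_rp (S.tr_ζ i)).smul _) ((evZ_pr_of_pos (S.T.ζ_pos i)).smul _) h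

theorem e_T {i j : ZMod n} (hij : i ≠ j) :
    num q d i j s • rp (e i) (letT φ η j) = den q d i j s • pr (e i) (letT φ η j) :=
  exchange_right (S.tr_η j) (S.T.η_neg j) (S.T.η_e i j)
    (by rw [rp_eq_pr (S.T.e_φ i j hij)])

/-! ### Filtrations generated by `φ` -/

theorem gen_η {Ξ : Filt U} (hη : ∀ i k, Ξ.Raises 0 (η i k)) (i j k) :
    (Ξ.gen (φ j)).Raises 0 (η i k) :=
  Filt.gen_raises_of_exchange (hη i) (S.T.η_neg i) (S.T.η_φ j i) k

theorem gen_D {Ξ : Filt U} (hη : ∀ i k, Ξ.Raises 0 (η i k)) (hK : ∀ i k, Ξ.Raises 0 (Kp i k))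
    (j k) : (Ξ.gen (φ j)).Raises 0 (letD φ η Kp j k) :=
  (Filt.Raises.cvi_zero (Filt.Raises.cvi_zero (Ξ.gen_stable (φ j)) (S.gen_η hη j j))
    (fun k => (hK j k).gen fun _ => (S.φ_Kp _ _ _ _).symm) k).neg

theorem Φη (i k) : Φ.Raises 0 (η i k) := Filt.Raises.of_nonneg (S.Φ_η i) (S.T.η_neg i) k
theorem Ωη (i k) : Ω.Raises 0 (η i k) := Filt.Raises.of_nonneg (S.Ω_η i) (S.T.η_neg i) k
theorem ΩKp (i k) : Ω.Raises 0 (Kp i k) := Filt.Raises.of_nonneg (S.Ω_Kp i) (S.K.Kp_neg i) k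

theorem genΦ_e {i j : ZMod n} (hij : i ≠ j) (k) : (Φ.gen (φ j)).Raises k (e i k) :=
  (S.Φ_e i k).gen fun _ => S.T.e_φ i j hij _ _
theorem genΦ_Km (i j k) : (Φ.gen (φ j)).Raises 0 (Km i k) :=
  (S.Φ_Km i k).gen fun _ => (S.φ_Km _ _ _ _).symm
theorem genΦ_Kp (i j k) : (Φ.gen (φ j)).Raises 0 (Kp i k) :=
  (S.Φ_Kp i k).gen fun _ => (S.φ_Kp _ _ _ _).symm
theorem genΦ_A {i j : ZMod n} (hij : i ≠ j) (k) : (Φ.gen (φ j)).Raises k (letA e Km i k) :=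
  Filt.Raises.cvi_pos (S.genΦ_e hij) (S.genΦ_Km i j) (S.K.Km_pos i) k
theorem genΦ_E (i j k) : (Φ.gen (φ j)).Raises 0 (E i k) :=
  (S.Φ_E i k).gen fun _ => (S.φ_E _ _ _ _).symm
theorem genΦ_D (j k) : (Φ.gen (φ j)).Raises 0 (letD φ η Kp j k) := S.gen_D S.Φη S.Φ_Kp j k

theorem genΩ_A {i j : ZMod n} (hij : i ≠ j) (k) : (Ω.gen (φ j)).Raises k (letA e Km i k) :=
  Filt.Raises.cvi_add (fun k => (S.Ω_e i k).gen fun _ => S.T.e_φ i j hij _ _)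
    (fun k => (S.Ω_Km i k).gen fun _ => (S.φ_Km _ _ _ _).symm) k
theorem genΩ_E (i j k) : (Ω.gen (φ j)).Raises k (E i k) :=
  (S.Ω_E i k).gen fun _ => (S.φ_E _ _ _ _).symm
theorem genΩ_D (j k) : (Ω.gen (φ j)).Raises 0 (letD φ η Kp j k) := S.gen_D S.Ωη S.ΩKp j k

/-! ### Exchange relations of the letters -/

theorem A_A (i j) : QuadRel q d i j (letA e Km i) (letA e Km j) := by
  have := exchange_cvi (S.lf_A i) (S.lf_A j) (fun a b => (S.e_Km j i b a).symm)
    (fun a b => (S.e_Km i j a b).symm) (S.T.e_e i j) (r := 1) (r' := 1)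
    (by rw [rp_eq_pr (S.K.Km_Km i j)])
  rwa [mul_one, mul_one] at this

theorem A_B (i j) : QuadRel q d i j (letA e Km i) (E j) := by
  have := exchange_cvi (x₂ := oneCur U) (y₂ := E j) (S.lf_A i) (cviLF_oneCur _)
    (fun _ _ => (oneCur_commute _ _).symm) (fun a b => (S.e_E i j a b).symm)
    (p := 1) (p' := 1) (by rw [pr_oneCur_right]) (S.K.E_Km i j)
  rwa [cvi_oneCur, one_mul, one_mul] at this

theorem B_D (i j) : QuadRel q d i j (E i) (letD φ η Kp j) := by
  have := exchange_cvi (x₁ := oneCur U) (y₁ := E i) (cviLF_oneCur _) (S.lf_D j)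
    (fun a b => (S.T_E j i b a).symm) (fun _ _ => (oneCur_commute _ _).symm)
    (p := 1) (p' := 1) (by rw [pr_oneCur_left]) (S.K.Kp_E i j)
  rw [cvi_oneCur, one_mul, one_mul] at this
  exact QuadRel.neg_right this

theorem D_D (hn : 3 ≤ n) (hd : d ≠ 0) (i j) :
    QuadRel q d i j (letD φ η Kp i) (letD φ η Kp j) := by
  have := exchange_cvi (S.lf_D i) (S.lf_D j) (fun a b => (S.T_Kp j i b a).symm)
    (fun a b => (S.T_Kp i j a b).symm) (S.T_T hn hd i j) (r := 1) (r' := 1)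
    (by rw [rp_eq_pr (S.K.Kp_Kp i j)])
  rw [mul_one, mul_one] at this
  exact (QuadRel.neg_left this).neg_right

theorem A_D (hq : q ≠ 0) (hd : d ≠ 0) {i j : ZMod n} (hij : i ≠ j) :
    QuadRel q d i j (letA e Km i) (letD φ η Kp j) := by
  have := exchange_cvi (S.lf_A i) (S.lf_D j) (fun a b => (S.T_Km j i b a).symm)
    (fun a b => (S.e_Kp i j a b).symm) (S.e_T hij) (S.K.Kp_Km i j)
  refine QuadRel.neg_right (F := cvi (letT φ η j) (Kp j)) ?_
  refine cancel_num_den hq hd (i := i) (j := j) (i' := i) (j' := j) (a := s) (b := s)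
    (evZ_rp (S.tr_A i)) (evZ_pr _ (S.genΦ_A hij) fun k => ?_) ?_
  · have := (S.genΦ_D j k).neg
    rwa [letD, Pi.neg_apply, neg_neg] at this
  · convert this using 2 <;> ring

theorem A_κp (hq : q ≠ 0) (hd : d ≠ 0) (i j) :
    QuadRel q d i j (letA e Km i) (cvi (η j) (Kp j)) := by
  have := exchange_cvi (S.lf_A i) (S.lf_κp j) (fun a b => (S.η_Km j i b a).symm)
    (fun a b => (S.e_Kp i j a b).symm) (S.T.η_e i j) (S.K.Kp_Km i j)
  refine cancel_num_den hq hd (i := i) (j := j) (i' := i) (j' := j) (a := s) (b := s)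
    (evZ_rp (S.tr_A i)) (evZ_pr_of_neg (S.κp_neg j)) ?_
  convert this using 2 <;> ring

theorem B_κp (i j) : QuadRel q d i j (E i) (cvi (η j) (Kp j)) := by
  have := exchange_cvi (x₁ := oneCur U) (y₁ := E i) (cviLF_oneCur _) (S.lf_κp j)
    (fun a b => (S.η_E j i b a).symm) (fun _ _ => (oneCur_commute _ _).symm)
    (p := 1) (p' := 1) (by rw [pr_oneCur_left]) (S.K.Kp_E i j)
  rwa [cvi_oneCur, one_mul, one_mul] at this

theorem D_κp (i j) : QuadRel q d i j (letD φ η Kp i) (cvi (η j) (Kp j)) := by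
  have := exchange_cvi (S.lf_D i) (S.lf_κp j) (fun a b => (S.η_Kp j i b a).symm)
    (fun a b => (S.T_Kp i j a b).symm) (S.T_η i j) (r := 1) (r' := 1)
    (by rw [rp_eq_pr (S.K.Kp_Kp i j)])
  rw [mul_one, mul_one] at this
  exact QuadRel.neg_left this

theorem κm_A (i j) : QuadRel q d i j (cvi (ζ i) (Km i)) (letA e Km j) := by
  have := exchange_cvi (S.lf_κm i) (S.lf_A j) (fun a b => (S.e_Km j i b a).symm)
    (fun a b => (S.ζ_Km i j a b).symm) (S.T.e_ζ i j) (r := 1) (r' := 1)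
    (by rw [rp_eq_pr (S.K.Km_Km i j)])
  rwa [mul_one, mul_one] at this

theorem κm_B (i j) : QuadRel q d i j (cvi (ζ i) (Km i)) (E j) := by
  have := exchange_cvi (x₂ := oneCur U) (y₂ := E j) (S.lf_κm i) (cviLF_oneCur _)
    (fun _ _ => (oneCur_commute _ _).symm) (fun a b => (S.ζ_E i j a b).symm)
    (p := 1) (p' := 1) (by rw [pr_oneCur_right]) (S.K.E_Km i j)
  rwa [cvi_oneCur, one_mul, one_mul] at this

theorem κm_D (hq : q ≠ 0) (hd : d ≠ 0) (i j) :
    QuadRel q d i j (cvi (ζ i) (Km i)) (letD φ η Kp j) := by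
  have := exchange_cvi (S.lf_κm i) (S.lf_D j) (fun a b => (S.T_Km j i b a).symm)
    (fun a b => (S.ζ_Kp i j a b).symm) (S.ζ_T i j) (S.K.Kp_Km i j)
  refine QuadRel.neg_right (F := cvi (letT φ η j) (Kp j)) ?_
  refine cancel_num_den hq hd (i := i) (j := j) (i' := i) (j' := j) (a := s) (b := s)
    (evZ_rp (Truncated.of_pos (S.κm_pos i))) (evZ_pr_of_pos (S.κm_pos i)) ?_
  convert this using 2 <;> ring

theorem κm_κp (hq : q ≠ 0) (hd : d ≠ 0) (i j) :
    (den q d i j 1 * den q d i j r) • rp (cvi (ζ i) (Km i)) (cvi (η j) (Kp j)) =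
      (num q d i j 1 * num q d i j r) • pr (cvi (ζ i) (Km i)) (cvi (η j) (Kp j)) := by
  have := exchange_cvi (S.lf_κm i) (S.lf_κp j) (fun a b => (S.η_Km j i b a).symm)
    (fun a b => (S.ζ_Kp i j a b).symm) (S.T.η_ζ i j) (S.K.Kp_Km i j)
  refine cancel_num_den hq hd (i := i) (j := j) (i' := i) (j' := j) (a := s) (b := s)
    (evZ_rp (Truncated.of_pos (S.κm_pos i))) (evZ_pr_of_pos (S.κm_pos i)) ?_
  convert this using 2 <;> ring

theorem κp_comm (i j k l) : Commute (cvi (η i) (Kp i) k) (cvi (η j) (Kp j) l) :=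
  commute_cvi (S.lf_κp i)
    (fun a => (commute_cvi (S.lf_κp j) (fun b => S.T.η_η j i b a)
      (fun b => (S.η_Kp i j a b).symm) l).symm)
    (fun a => (commute_cvi (S.lf_κp j) (fun b => S.η_Kp j i b a)
      (fun b => S.K.Kp_Kp j i b a) l).symm) k

theorem κm_comm (i j k l) : Commute (cvi (ζ i) (Km i) k) (cvi (ζ j) (Km j) l) :=
  commute_cvi (S.lf_κm i)
    (fun a => (commute_cvi (S.lf_κm j) (fun b => S.T.ζ_ζ j i b a)
      (fun b => (S.ζ_Km i j a b).symm) l).symm)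
    (fun a => (commute_cvi (S.lf_κm j) (fun b => S.ζ_Km j i b a)
      (fun b => S.K.Km_Km j i b a) l).symm) k

end PairSys

end Pairs

/-! ## The exchange of the summands containing `e` and `f` -/

section Contraction

variable {U : Type*} [AddCommGroup U] [Module ℂ U] {n : ℕ} {q d s r : ℂ}
variable {e φ η ζ ζp E Kp Km : ZMod n → ℤ → 𝓛 U} {Φ Ψ Ω : Filt U}

theorem locSum_mem {ι : Type*} {f : ι → 𝓛 U} {u : U} {N : Submodule ℂ U}
    (h : ∀ i, f i u ∈ N) : locSum f u ∈ N := by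
  by_cases hf : LocFin f
  · rw [locSum_apply hf]
    exact finsum_induction (fun v => v ∈ N) N.zero_mem (fun _ _ => N.add_mem) h
  · rw [locSum, dif_neg hf]; exact N.zero_mem

/-- The words `φ_j(w) e_i(z) η_j(w)`. -/
def letZ (e φ η : ZMod n → ℤ → 𝓛 U) (i j : ZMod n) : Fam (ℤ × ℤ) (𝓛 U) :=
  cv (AddMonoidHom.inr ℤ ℤ) (φ j) (pr (e i) (η j))

/-- The normally ordered product of the summands containing `e_i(z)` and `f_j(w)`. -/
def letY (e φ η Kp Km : ZMod n → ℤ → 𝓛 U) (i j : ZMod n) :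
    Fam (ℤ × ℤ) (𝓛 U) :=
  -cvi (letZ e φ η i j) (pr (Km i) (Kp j))

theorem letZ_apply (i j : ZMod n) (k l : ℤ) :
    letZ e φ η i j (k, l) = locSum fun b => φ j b * (e i k * η j (l - b)) := by
  simp [letZ, cv]

theorem dl_oneOne (k l : ℤ) :
    dl s (1, -1) (pr (oneCur U) (oneCur U)) (k, l) = s ^ (-k) • oneCur U (k + l) := by
  rw [dl, locSum_eq_single (-k)]
  · simp [pr, oneCur, add_comm]
  · intro t ht
    simp only [pr, Prod.smul_mk, Prod.mk_add_mk, smul_eq_mul, mul_one]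
    rw [oneCur_of_ne (k := k + t) (by omega), zero_mul, smul_zero]

theorem cvi_sub_left {Γ : Type*} [AddCommGroup Γ] {X Y M : Fam Γ (𝓛 U)}
    (h : CviLF X M) (h' : CviLF Y M) : cvi (X - Y) M = cvi X M - cvi Y M := by
  funext k
  simp only [cvi_apply, fam_sub_apply, sub_mul]
  exact locSum_sub (h k) (h' k)

theorem dlLF_of_truncated {x y : ℤ → 𝓛 U} (hx : ∀ k, 0 < k → x k = 0)
    (hy : Truncated y) : DlLF (1, -1) (pr x y) := fun k u => by
  obtain ⟨M, hM⟩ := hy u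
  refine (Set.finite_Icc (k.2 - M) (-k.1)).subset fun t ht => ?_
  simp only [Function.mem_support, pr, Prod.snd_add, Prod.fst_add, Prod.smul_fst, Prod.smul_snd,
    smul_eq_mul, mul_one] at ht
  rw [Set.mem_Icc]
  refine ⟨?_, ?_⟩ <;> by_contra hlt <;> apply ht
  · rw [Module.End.mul_apply, hM _ (by omega), map_zero]
  · rw [hx _ (by omega), zero_mul, LinearMap.zero_apply]

namespace PairSys

variable (S : PairSys n q d s r e φ η ζ ζp E Kp Km Φ Ψ Ω)
include S

omit S in
theorem letZ_mem {Ξ : Filt U} {i j : ZMod n} (he : ∀ k, Ξ.Raises k (e i k))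
    (hη : ∀ k, Ξ.Raises 0 (η j k)) {p : ℤ} {u : U} (hu : u ∈ Ξ.F p) (k l : ℤ) :
    letZ e φ η i j (k, l) u ∈ (Ξ.gen (φ j)).F (p + k) := by
  rw [letZ_apply]
  refine locSum_mem fun b => ?_
  have h := Ξ.le_gen (φ j) _ (((he k).mul (hη (l - b))) p u hu)
  have := Ξ.gen_stable (φ j) b _ _ h
  simpa using this

theorem letY_mem {Ξ : Filt U} {i j : ZMod n} (he : ∀ k, Ξ.Raises k (e i k))
    (hη : ∀ k, Ξ.Raises 0 (η j k)) (hKm : ∀ k, Ξ.Raises 0 (Km i k))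
    (hKp : ∀ k, Ξ.Raises 0 (Kp j k)) {p : ℤ} {u : U} (hu : u ∈ Ξ.F p) (k l : ℤ) :
    letY e φ η Kp Km i j (k, l) u ∈ (Ξ.gen (φ j)).F (p + k) := by
  refine Submodule.neg_mem _ (locSum_mem fun a => ?_)
  rcases lt_or_ge 0 (k - a.1) with h | h
  · rw [pr, show (((k, l) : ℤ × ℤ) - AddMonoidHom.id _ a).1 = k - a.1 from rfl,
      S.K.Km_pos i _ h, zero_mul, mul_zero]
    exact Submodule.zero_mem _
  · have h1 := ((hKm (k - a.1)).mul (hKp (l - a.2))) p u hu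
    exact (Ξ.gen (φ j)).anti (by omega) (letZ_mem he hη h1 a.1 a.2)

theorem lf_Y (i j) : CviLF (letZ e φ η i j) (pr (Km i) (Kp j)) := fun k u => by
  obtain ⟨p, hp⟩ := Φ.exh u
  obtain ⟨N, hN⟩ := (Φ.gen (φ j)).vanish
  obtain ⟨M, hM⟩ := S.K.truncated_Kp j u
  refine ((Set.finite_Icc k.1 (N - p)).prod (Set.finite_Icc (k.2 - M) k.2)).subset fun a ha => ?_
  simp only [Function.mem_support, AddMonoidHom.id_apply, pr, Prod.fst_sub, Prod.snd_sub] at ha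
  simp only [Set.mem_prod, Set.mem_Icc]
  refine ⟨⟨?_, ?_⟩, ?_, ?_⟩ <;> by_contra hlt <;> apply ha
  · rw [S.K.Km_pos i _ (by omega), zero_mul, mul_zero, LinearMap.zero_apply]
  · have h1 := ((S.Φ_Km i (k.1 - a.1)).mul (S.Φ_Kp j (k.2 - a.2))) p u hp
    have h2 := letZ_mem (φ := φ) (S.Φ_e i) (S.Φη j) h1 a.1 a.2
    rw [hN _ (by omega), Submodule.mem_bot] at h2
    exact h2
  · rw [Module.End.mul_apply, Module.End.mul_apply, hM _ (by omega), map_zero, map_zero]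
  · rw [S.K.Kp_neg j _ (by omega), mul_zero, mul_zero, LinearMap.zero_apply]

theorem letY_eq_zero (i j) (u : U) : ∃ N : ℤ, ∀ k l, N < k → letY e φ η Kp Km i j (k, l) u = 0 := by
  obtain ⟨p, hp⟩ := Φ.exh u
  obtain ⟨N, hN⟩ := (Φ.gen (φ j)).vanish
  refine ⟨N - p, fun k l hk => ?_⟩
  have := S.letY_mem (S.Φ_e i) (S.Φη j) (S.Φ_Km i) (S.Φ_Kp j) hp k l
  rwa [hN _ (by omega), Submodule.mem_bot] at this

theorem evZ_Y (i j) : EvZ (1, -1) (letY e φ η Kp Km i j) := fun u k => by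
  obtain ⟨N, hN⟩ := S.letY_eq_zero i j u
  refine ⟨(N - k.1 + 1).toNat, fun m hm => hN _ _ ?_⟩
  simp
  omega

theorem rp_e_T (i j) :
    num q d i j s • rp (e i) (letT φ η j) = den q d i j s • letZ e φ η i j := by
  have e₁ : rp (e i) (letT φ η j) = cv (AddMonoidHom.inr ℤ ℤ) (φ j) (rp (e i) (η j)) := by
    funext ⟨k, l⟩
    rw [rp_apply, letT, cvi_apply,
      locSum_mul (locFin_of_nonneg_right (S.tr_η j) (S.T.η_neg j) _ _), cv]
    simp [mul_assoc]
  rw [e₁, letZ]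
  refine cv_relation ?_ ?_ (S.T.η_e i j)
  · rintro ⟨k, l⟩
    have := (locFin_of_nonneg_right (S.tr_η j) (S.T.η_neg j) (φ j) l).mul_right (e i k)
    simpa [mul_assoc] using this
  · rintro ⟨k, l⟩
    have := locFin_of_nonneg_right (S.tr_η j) (S.T.η_neg j) (fun b => φ j b * e i k) l
    simpa [mul_assoc] using this

theorem D_A (hq : q ≠ 0) (hd : d ≠ 0) (i j) :
    den q d i j 1 • rp (letA e Km i) (letD φ η Kp j) =
      num q d i j 1 • letY e φ η Kp Km i j := by
  have hc : ∀ a b, Commute (Kp j b) (e i a) := fun a b => (S.e_Kp i j a b).symm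
  have h := cvi_relation (rp_cviLF (S.lf_A i) (S.lf_D j) hc) (S.lf_Y i j) (S.rp_e_T i j)
    (S.K.Kp_Km i j)
  rw [← rp_cvi (S.lf_A i) (S.lf_D j) hc] at h
  have hE : EvZ (1, -1) (cvi (letZ e φ η i j) (pr (Km i) (Kp j))) := by
    have := (S.evZ_Y i j).neg
    rwa [letY, neg_neg] at this
  have := cancel_num_den hq hd (i := i) (j := j) (i' := i) (j' := j) (a := s) (b := s)
    (p := den q d i j 1) (p' := num q d i j 1)
    (evZ_rp (S.tr_A i)) hE (by convert h using 2 <;> ring)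
  rw [rp_neg_right, letY, smul_neg, smul_neg, this]

theorem pr_e_T_self (i) :
    pr (e i) (letT φ η i) = letZ e φ η i i + (q - q⁻¹)⁻¹ •
      (dl s (1, -1) (pr (oneCur U) (oneCur U)) - dl r (1, -1) (pr (ζ i) (η i))) := by
  funext ⟨k, l⟩
  have hη := fun f l => locFin_of_nonneg_right (S.tr_η i) (S.T.η_neg i) f l
  rw [fam_add_apply, fam_smul_apply, fam_sub_apply, dl_oneOne, ← S.T.ζp_η i, letZ_apply,
    pr_apply, letT, cvi_apply (φ i), mul_locSum (hη _ _)]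
  have h1 : cvi (ζp i) (η i) (k + l) = locSum fun b => ζp i (k + b) * η i (l - b) := by
    rw [cvi_apply, ← locSum_equiv (Equiv.addLeft k)]
    congr 1; funext b
    rw [Equiv.coe_addLeft, show k + l - (k + b) = l - b by ring]
  have h2 : dl r (1, -1) (pr (ζ i) (η i)) (k, l) =
      locSum fun b => (r ^ b • ζ i (k + b)) * η i (l - b) := by
    simp [dl, pr, sub_eq_add_neg]
  have l1 := hη (fun b => ζp i (k + b)) l
  have l2 := hη (fun b => r ^ b • ζ i (k + b)) l
  have l3 := hη (fun b => φ i b * e i k) l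
  simp only [mul_assoc] at l3
  rw [h1, h2, ← locSum_smul l1, ← locSum_sub (l1.const_smul _) l2,
    ← locSum_smul ((l1.const_smul _).sub l2), ← locSum_add l3 (((l1.const_smul _).sub l2).const_smul _)]
  congr 1; funext b
  rw [← mul_assoc, eq_add_of_sub_eq (S.T.e_φ_self i k b), add_mul, smul_mul_assoc, sub_mul,
    smul_mul_assoc, add_comm, mul_assoc]

theorem A_D_self (i) :
    pr (letA e Km i) (letD φ η Kp i) = letY e φ η Kp Km i i - (q - q⁻¹)⁻¹ •
      (dl s (1, -1) (pr (Km i) (Kp i)) -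
        dl r (1, -1) (pr (cvi (ζ i) (Km i)) (cvi (η i) (Kp i)))) := by
  have hc : ∀ a b, Commute (Km i a) (letT φ η i b) := fun a b => (S.T_Km i i b a).symm
  have lone : ∀ k, LocFin fun p : ℤ × ℤ × ℤ =>
      pr (oneCur U) (oneCur U) (p.2 + p.1 • ((1, -1) : ℤ × ℤ)) * pr (Km i) (Kp i) (k - p.2) := by
    intro k u
    obtain ⟨M, hM⟩ := S.K.truncated_Kp i u
    refine ((Set.finite_Icc (k.2 - M) (-k.1)).image fun t => (t, ((-t, t) : ℤ × ℤ))).subset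
      fun ⟨t, a, b⟩ hp => ?_
    simp only [Function.mem_support, pr, Prod.snd_add, Prod.fst_add, Prod.smul_fst, Prod.smul_snd,
      smul_eq_mul, mul_one, Prod.fst_sub, Prod.snd_sub] at hp
    by_cases ha : a = -t
    · by_cases hb : b = t
      · subst ha hb
        refine ⟨b, ?_, rfl⟩
        rw [Set.mem_Icc]
        refine ⟨?_, ?_⟩ <;> by_contra hlt <;> apply hp
        · simp only [Module.End.mul_apply]; rw [hM _ (by omega)]; simp
        · rw [S.K.Km_pos i _ (by omega), zero_mul, mul_zero, LinearMap.zero_apply]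
      · exact absurd (by rw [oneCur_of_ne (k := b + t * -1) (by omega), mul_zero, zero_mul,
          LinearMap.zero_apply]) hp
    · exact absurd (by rw [oneCur_of_ne (k := a + t) (by omega), zero_mul, zero_mul,
          LinearMap.zero_apply]) hp
  have lζη : ∀ k, LocFin fun p : ℤ × ℤ × ℤ =>
      pr (ζ i) (η i) (p.2 + p.1 • ((1, -1) : ℤ × ℤ)) * pr (Km i) (Kp i) (k - p.2) := by
    intro k u
    obtain ⟨M, hM⟩ := S.K.truncated_Kp i u
    obtain ⟨M', hM'⟩ := S.tr_η i u
    have hcc : ∀ a b c, Commute (η i a) (Km i b * Kp i c) := fun a b c =>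
      (S.η_Km i i a b).mul_right (S.η_Kp i i a c)
    refine ((Set.finite_Icc (k.2 - M - M') (-k.1)).prod ((Set.finite_Icc k.1 (M + M' - k.2)).prod
      (Set.finite_Icc (k.2 - M) k.2))).subset fun ⟨t, a, b⟩ hp => ?_
    simp only [Function.mem_support, pr, Prod.snd_add, Prod.fst_add, Prod.smul_fst, Prod.smul_snd,
      smul_eq_mul, mul_one, Prod.fst_sub, Prod.snd_sub] at hp
    have f1 : a + t ≤ 0 := by
      by_contra h; exact hp (by rw [S.T.ζ_pos i _ (by omega)]; simp)
    have f2 : 0 ≤ b + t * -1 := by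
      by_contra h; exact hp (by rw [S.T.η_neg i _ (by omega)]; simp)
    have f3 : k.1 - a ≤ 0 := by
      by_contra h; exact hp (by rw [S.K.Km_pos i _ (by omega)]; simp)
    have f4 : 0 ≤ k.2 - b := by
      by_contra h; exact hp (by rw [S.K.Kp_neg i _ (by omega)]; simp)
    have f5 : k.2 - b ≤ M := by
      by_contra h
      exact hp (by simp only [Module.End.mul_apply]; rw [hM _ (by omega)]; simp)
    have f6 : b + t * -1 ≤ M' := by
      by_contra h
      exact hp (by rw [mul_assoc, (hcc _ _ _).eq, Module.End.mul_apply, Module.End.mul_apply,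
        hM' _ (by omega)]; simp)
    simp only [Set.mem_prod, Set.mem_Icc]
    omega
  have d1 : DlLF (1, -1) (pr (oneCur U) (oneCur U)) :=
    dlLF_of_truncated (fun _ h => oneCur_of_ne h.ne') truncated_oneCur
  have d2 : DlLF (1, -1) (pr (ζ i) (η i)) := dlLF_of_truncated (S.T.ζ_pos i) (S.tr_η i)
  have c1 : CviLF (dl s (1, -1) (pr (oneCur U) (oneCur U))) (pr (Km i) (Kp i)) := fun k => by
    have h := ((lone k).smul fun p => s ^ p.1).prod_swap.prod_sum
    refine (show (fun a => _) = _ from funext fun a => ?_) ▸ h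
    rw [dl, AddMonoidHom.id_apply, locSum_mul ((d1 a).smul _)]
    simp only [smul_mul_assoc]
  have c2 : CviLF (dl r (1, -1) (pr (ζ i) (η i))) (pr (Km i) (Kp i)) := fun k => by
    have h := ((lζη k).smul fun p => r ^ p.1).prod_swap.prod_sum
    refine (show (fun a => _) = _ from funext fun a => ?_) ▸ h
    rw [dl, AddMonoidHom.id_apply, locSum_mul ((d2 a).smul _)]
    simp only [smul_mul_assoc]
  have c12 : ∀ k, LocFin fun a => (dl s (1, -1) (pr (oneCur U) (oneCur U)) -
      dl r (1, -1) (pr (ζ i) (η i))) a * pr (Km i) (Kp i) (k - a) := fun k => by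
    simpa only [fam_sub_apply, sub_mul, AddMonoidHom.id_apply] using (c1 k).sub (c2 k)
  have e12 : cvi (dl s (1, -1) (pr (oneCur U) (oneCur U)) -
      dl r (1, -1) (pr (ζ i) (η i))) (pr (Km i) (Kp i)) =
      dl s (1, -1) (pr (Km i) (Kp i)) -
        dl r (1, -1) (pr (cvi (ζ i) (Km i)) (cvi (η i) (Kp i))) := by
    rw [cvi_sub_left c1 c2, cvi_dl d1 lone, cvi_dl d2 lζη, ← pr_cvi (cviLF_oneCur (Km i))
      (cviLF_oneCur (Kp i)) fun _ _ => (oneCur_commute _ _).symm, cvi_oneCur, cvi_oneCur,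
      ← pr_cvi (S.lf_κm i) (S.lf_κp i) fun a b => (S.η_Km i i b a).symm]
  rw [pr_neg_right, pr_cvi (S.lf_A i) (S.lf_D i) hc, S.pr_e_T_self i, cvi_add_left (S.lf_Y i i)]
  · rw [cvi_const_smul c12, e12, letY, neg_add, ← sub_eq_add_neg]
  · intro k
    simpa only [fam_smul_apply, smul_mul_assoc, AddMonoidHom.id_apply] using (c12 k).const_smul _

end PairSys

end Contraction

/-! ## Serre combinations in modules over commutative rings -/

section SerreAlgebra

variable {A M : Type*} [CommRing A] [AddCommGroup M] [Module A M]

/-- `q` times the Serre combination of six words. -/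
def serreComb (q : A) (xyf yxf xfy yfx fxy fyx : M) : M :=
  q • xyf + q • yxf - (q ^ 2 + 1) • (xfy + yfx) + q • fxy + q • fyx

variable {q z₁ z₂ W : A} {xyf yxf xfy yfx fxy fyx R : M}

theorem serreComb_third_right
    (h₁ : (q * W - z₂) • xfy = (W - q * z₂) • xyf) (h₂ : (q * W - z₁) • yfx = (W - q * z₁) • yxf)
    (h₃ : (q * W - z₁) • fxy = (W - q * z₁) • xfy) (h₄ : (q * W - z₂) • fyx = (W - q * z₂) • yfx)
    (h : (z₂ - q ^ 2 * z₁) • yxf = (q ^ 2 * z₂ - z₁) • xyf + R) :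
    (q * W - z₁) • (q * W - z₂) • serreComb q xyf yxf xfy yfx fxy fyx =
      -(((q ^ 2 - 1) * W) • R) := by
  rw [serreComb]
  linear_combination (norm := module)
    (-(q ^ 2 + 1) * (q * W - z₁) + q * (W - q * z₁)) • h₁
      + (-(q ^ 2 + 1) * (q * W - z₂) + q * (W - q * z₂)) • h₂
      + (q * (q * W - z₂)) • h₃ + (q * (q * W - z₁)) • h₄ - ((q ^ 2 - 1) * W) • h

theorem serreComb_third_left
    (h₁ : (q * W - z₂) • xfy = (W - q * z₂) • xyf) (h₂ : (q * W - z₁) • yfx = (W - q * z₁) • yxf)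
    (h₃ : (q * W - z₁) • fxy = (W - q * z₁) • xfy) (h₄ : (q * W - z₂) • fyx = (W - q * z₂) • yfx)
    (h : (z₂ - q ^ 2 * z₁) • fyx = (q ^ 2 * z₂ - z₁) • fxy + R) :
    (W - q * z₁) • (W - q * z₂) • serreComb q xyf yxf xfy yfx fxy fyx =
      -(((q ^ 2 - 1) * W) • R) := by
  rw [serreComb]
  linear_combination (norm := module)
    (-(q * (W - q * z₁))) • h₁ - (q * (W - q * z₂)) • h₂
      + (-(q * (q * W - z₂)) + (q ^ 2 + 1) * (W - q * z₂)) • h₃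
      + (-(q * (q * W - z₁)) + (q ^ 2 + 1) * (W - q * z₁)) • h₄ - ((q ^ 2 - 1) * W) • h

theorem serreComb_first_left
    (h₁ : (q * W - z₂) • xfy = (W - q * z₂) • xyf) (h₂ : (q * W - z₁) • yfx = (W - q * z₁) • yxf)
    (h₃ : (q * W - z₁) • fxy = (W - q * z₁) • xfy)
    (h : (z₂ - q ^ 2 * z₁) • yxf = (q ^ 2 * z₂ - z₁) • xyf)
    (h' : (z₂ - q ^ 2 * z₁) • fyx = (q ^ 2 * z₂ - z₁) • fxy) :
    (z₂ - q ^ 2 * z₁) • (q * W - z₁) • serreComb q xyf yxf xfy yfx fxy fyx = 0 := by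
  rw [serreComb]
  linear_combination (norm := module)
    ((q ^ 4 - 1) * z₁) • h₁ - ((q ^ 2 + 1) * (z₂ - q ^ 2 * z₁)) • h₂
      + (q * (z₂ - q ^ 2 * z₁) + q * (q ^ 2 * z₂ - z₁)) • h₃
      + (q * (q * W - z₁) - (q ^ 2 + 1) * (W - q * z₁)) • h + (q * (q * W - z₁)) • h'

theorem serreComb_first_right
    (h₂ : (q * W - z₁) • yfx = (W - q * z₁) • yxf)
    (h₃ : (q * W - z₁) • fxy = (W - q * z₁) • xfy)
    (h₄ : (q * W - z₂) • fyx = (W - q * z₂) • yfx)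
    (h : (z₂ - q ^ 2 * z₁) • yxf = (q ^ 2 * z₂ - z₁) • xyf)
    (h' : (z₂ - q ^ 2 * z₁) • fyx = (q ^ 2 * z₂ - z₁) • fxy) :
    (q ^ 2 * z₂ - z₁) • (W - q * z₁) • serreComb q xyf yxf xfy yfx fxy fyx = 0 := by
  rw [serreComb]
  linear_combination (norm := module)
    (-(q * (z₂ - q ^ 2 * z₁)) - q * (q ^ 2 * z₂ - z₁)) • h₂
      + ((q ^ 2 + 1) * (q ^ 2 * z₂ - z₁)) • h₃ + ((q ^ 4 - 1) * z₁) • h₄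
      - (q * (W - q * z₁)) • h + ((q ^ 2 + 1) * (q * W - z₁) - q * (W - q * z₁)) • h'

/-- The contribution of a contraction `θ` of `x` and `y` to the Serre combination. -/
theorem serreTail_mul {θf nn fθ : M} (h₁ : (q * W - z₁) • fθ = (W - q * z₁) • nn)
    (h₂ : (q * W - z₂) • nn = (W - q * z₂) • θf) :
    (q * W - z₁) • (q * W - z₂) • (q • θf - (q ^ 2 + 1) • nn + q • fθ) =
      ((q ^ 2 - 1) * W) • (q ^ 2 * z₂ - z₁) • θf := by
  linear_combination (norm := module)
    (q * (q * W - z₂)) • h₁ + (-(q ^ 2 + 1) * (q * W - z₁) + q * (W - q * z₁)) • h₂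

theorem serreTail_mul' {θf nn fθ : M} (h₁ : (q * W - z₁) • fθ = (W - q * z₁) • nn)
    (h₂ : (q * W - z₂) • nn = (W - q * z₂) • θf) :
    (W - q * z₁) • (W - q * z₂) • (q • θf - (q ^ 2 + 1) • nn + q • fθ) =
      ((q ^ 2 - 1) * W) • (q ^ 2 * z₂ - z₁) • fθ := by
  linear_combination (norm := module)
    (-(q * (W - q * z₁))) • h₂ + (-(q * (q * W - z₂)) + (q ^ 2 + 1) * (W - q * z₂)) • h₁

end SerreAlgebra

/-! ## Words in three currents -/

section Words

variable {U : Type*} [AddCommGroup U] [Module ℂ U]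

/-- The exponents of monomials in `z₁`, `z₂`, `w`. -/
abbrev Exp3 : Type := ℤ × ℤ × ℤ

/-- The variable `z₁`. -/
def vz₁ : Lau Exp3 := mono (1, 0, 0)
/-- The variable `z₂`. -/
def vz₂ : Lau Exp3 := mono (0, 1, 0)
/-- The rescaled variable `δw`. -/
def vw (δ : ℂ) : Lau Exp3 := cst δ * mono (0, 0, 1)

section Cancel

variable {Γ : Type*} [AddCommGroup Γ]

theorem EvZ.eq_zero_of_smul {σ : Γ} {X : Fam Γ (𝓛 U)} (hX : EvZ σ X) {g h : Γ} {α β : ℂ}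
    (hσ : h - g = σ) (hα : α ≠ 0) {p : Lau Γ}
    (hp : p = cst α * mono g - cst β * mono h) (h0 : p • X = 0) : X = 0 := by
  subst hσ hp; exact hX.eq_zero hα h0

theorem EvZ.eq_zero_of_smul' {σ : Γ} {X : Fam Γ (𝓛 U)} (hX : EvZ σ X) {g h : Γ}
    {α β : ℂ} (hσ : g - h = σ) (hβ : β ≠ 0) {p : Lau Γ}
    (hp : p = cst α * mono g - cst β * mono h) (h0 : p • X = 0) : X = 0 := by
  subst hσ
  refine hX.eq_zero hβ (β := α) ?_
  rw [← neg_eq_zero, ← neg_smul, neg_sub, ← hp, h0]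

theorem EvZ.eq_of_smul {σ : Γ} {X Y : Fam Γ (𝓛 U)} (hX : EvZ σ X) (hY : EvZ σ Y)
    {p : Lau Γ} (hc : ∀ Z : Fam Γ (𝓛 U), EvZ σ Z → p • Z = 0 → Z = 0)
    (h : p • X = p • Y) : X = Y :=
  sub_eq_zero.1 <| hc _ (hX.sub hY) (by rw [smul_sub, h, sub_self])

end Cancel

variable {q δ : ℂ} {X : Fam Exp3 (𝓛 U)}

theorem form_u₁ : cst q * vw δ - vz₁ = cst (q * δ) * mono (0, 0, 1) - cst 1 * mono (1, 0, 0) := by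
  rw [vw, vz₁, cst_mul, cst_one, one_mul, mul_assoc]
theorem form_u₂ : cst q * vw δ - vz₂ = cst (q * δ) * mono (0, 0, 1) - cst 1 * mono (0, 1, 0) := by
  rw [vw, vz₂, cst_mul, cst_one, one_mul, mul_assoc]
theorem form_v₁ : vw δ - cst q * vz₁ = cst δ * mono (0, 0, 1) - cst q * mono (1, 0, 0) := rfl
theorem form_v₂ : vw δ - cst q * vz₂ = cst δ * mono (0, 0, 1) - cst q * mono (0, 1, 0) := rfl
theorem form_p : vz₂ - cst q ^ 2 * vz₁ =
    cst 1 * mono (0, 1, 0) - cst (q ^ 2) * mono (1, 0, 0) := by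
  rw [vz₂, vz₁, cst_one, one_mul, sq, sq, cst_mul]
theorem form_p' : cst q ^ 2 * vz₂ - vz₁ =
    cst (q ^ 2) * mono (0, 1, 0) - cst 1 * mono (1, 0, 0) := by
  rw [vz₂, vz₁, cst_one, one_mul, sq, sq, cst_mul]

theorem cancel_u₁ (hq : q ≠ 0) (hδ : δ ≠ 0) (hX : EvZ (1, 0, -1) X)
    (h : (cst q * vw δ - vz₁) • X = 0) : X = 0 :=
  hX.eq_zero_of_smul (by simp) (mul_ne_zero hq hδ) form_u₁ h
theorem cancel_u₂ (hq : q ≠ 0) (hδ : δ ≠ 0) (hX : EvZ (0, 1, -1) X)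
    (h : (cst q * vw δ - vz₂) • X = 0) : X = 0 :=
  hX.eq_zero_of_smul (by simp) (mul_ne_zero hq hδ) form_u₂ h
theorem cancel_u₂' (hX : EvZ (0, -1, 1) X) (h : (cst q * vw δ - vz₂) • X = 0) : X = 0 :=
  hX.eq_zero_of_smul' (by simp) one_ne_zero form_u₂ h
theorem cancel_v₁ (hq : q ≠ 0) (hX : EvZ (-1, 0, 1) X)
    (h : (vw δ - cst q * vz₁) • X = 0) : X = 0 :=
  hX.eq_zero_of_smul' (by simp) hq form_v₁ h
theorem cancel_v₁' (hδ : δ ≠ 0) (hX : EvZ (1, 0, -1) X)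
    (h : (vw δ - cst q * vz₁) • X = 0) : X = 0 :=
  hX.eq_zero_of_smul (by simp) hδ form_v₁ h
theorem cancel_v₂ (hq : q ≠ 0) (hX : EvZ (0, -1, 1) X)
    (h : (vw δ - cst q * vz₂) • X = 0) : X = 0 :=
  hX.eq_zero_of_smul' (by simp) hq form_v₂ h
theorem cancel_p (hX : EvZ (1, -1, 0) X) (h : (vz₂ - cst q ^ 2 * vz₁) • X = 0) : X = 0 :=
  hX.eq_zero_of_smul (by simp) one_ne_zero form_p h
theorem cancel_p' (hX : EvZ (-1, 1, 0) X) (h : (cst q ^ 2 * vz₂ - vz₁) • X = 0) : X = 0 :=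
  hX.eq_zero_of_smul' (by simp) one_ne_zero form_p' h

theorem vz₁_smul (X : Fam Exp3 (𝓛 U)) (k₁ k₂ l : ℤ) :
    (vz₁ • X) (k₁, k₂, l) = X (k₁ + 1, k₂, l) := by simp [vz₁]
theorem vz₂_smul (X : Fam Exp3 (𝓛 U)) (k₁ k₂ l : ℤ) :
    (vz₂ • X) (k₁, k₂, l) = X (k₁, k₂ + 1, l) := by simp [vz₂]
theorem vw_smul (X : Fam Exp3 (𝓛 U)) (k₁ k₂ l : ℤ) :
    (vw δ • X) (k₁, k₂, l) = δ • X (k₁, k₂, l + 1) := by simp [vw, mul_smul]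

section General

variable {R : Type*} [Ring R] [Algebra ℂ R]

/-- The exchange relation of a current `X` and a current `F` of an adjacent colour. -/
def SerreRel (q δ : ℂ) (X F : ℤ → R) : Prop := ∀ k l,
  q • δ • (F (l + 1) * X k) - F l * X (k + 1) = δ • (X k * F (l + 1)) - q • (X (k + 1) * F l)

/-- The exchange relation of two currents of the same colour. -/
def SelfRel (q : ℂ) (X Y : ℤ → R) : Prop := ∀ k l,
  Y (l + 1) * X k - q ^ 2 • (Y l * X (k + 1)) = q ^ 2 • (X k * Y (l + 1)) - X (k + 1) * Y l

variable (ev : R →ₗ[ℂ] 𝓛 U) (X Y F : ℤ → R)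

/-- The word `XYF`. -/
def wXYF : Fam Exp3 (𝓛 U) := fun k => ev (X k.1 * Y k.2.1 * F k.2.2)
/-- The word `YXF`. -/
def wYXF : Fam Exp3 (𝓛 U) := fun k => ev (Y k.2.1 * X k.1 * F k.2.2)
/-- The word `XFY`. -/
def wXFY : Fam Exp3 (𝓛 U) := fun k => ev (X k.1 * F k.2.2 * Y k.2.1)
/-- The word `YFX`. -/
def wYFX : Fam Exp3 (𝓛 U) := fun k => ev (Y k.2.1 * F k.2.2 * X k.1)
/-- The word `FXY`. -/
def wFXY : Fam Exp3 (𝓛 U) := fun k => ev (F k.2.2 * X k.1 * Y k.2.1)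
/-- The word `FYX`. -/
def wFYX : Fam Exp3 (𝓛 U) := fun k => ev (F k.2.2 * Y k.2.1 * X k.1)

/-- The Serre combination of three currents. -/
def serreFam (q : ℂ) : Fam Exp3 (𝓛 U) := fun k => ev (sixWords q X Y F k.1 k.2.1 k.2.2)

theorem cst_smul_eq {Γ : Type*} [AddCommGroup Γ] (c : ℂ) (X : Fam Γ (𝓛 U)) :
    (cst c : Lau Γ) • X = c • X := by
  funext k; simp

theorem serreFam_eq (hq : q ≠ 0) : (cst q : Lau Exp3) • serreFam ev X Y F q =
    serreComb (cst q : Lau Exp3) (wXYF ev X Y F) (wYXF ev X Y F) (wXFY ev X Y F) (wYFX ev X Y F)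
      (wFXY ev X Y F) (wFYX ev X Y F) := by
  have h2 : (cst q ^ 2 + 1 : Lau Exp3) = cst (q ^ 2 + 1) := by
    rw [cst, cst, map_add, map_pow, map_one]
  funext k
  rw [serreComb, h2]
  simp only [cst_smul_apply, fam_add_apply, fam_sub_apply, serreFam, sixWords, wXYF, wYXF, wXFY,
    wYFX, wFXY, wFYX, map_add, map_sub, map_smul, smul_add, smul_sub, smul_smul]
  have h : q * (q + q⁻¹) = q ^ 2 + 1 := by field_simp
  rw [h]

variable {ev X Y F}

theorem serreFam_eq_zero (hq : q ≠ 0) (h : (cst q : Lau Exp3) • serreFam ev X Y F q = 0) (k₁ k₂ l : ℤ) :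
    ev (sixWords q X Y F k₁ k₂ l) = 0 := by
  rw [cst_smul_eq] at h
  have := congrFun h (k₁, k₂, l)
  rwa [fam_smul_apply, fam_zero_apply, smul_eq_zero_iff_right hq] at this

theorem SerreRel.word_XFY (h : SerreRel q δ Y F) :
    (cst q * vw δ - vz₂) • wXFY ev X Y F = (vw δ - cst q * vz₂) • wXYF ev X Y F := by
  funext ⟨k₁, k₂, l⟩
  have := congrArg (fun t => ev (X k₁ * t)) (h k₂ l)
  simpa only [sub_smul, mul_smul, fam_sub_apply, cst_smul_apply, vw_smul, vz₂_smul, wXFY, wXYF,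
    mul_sub, map_sub, mul_smul_comm, map_smul, mul_assoc] using this

theorem SerreRel.word_FYX (h : SerreRel q δ Y F) :
    (cst q * vw δ - vz₂) • wFYX ev X Y F = (vw δ - cst q * vz₂) • wYFX ev X Y F := by
  funext ⟨k₁, k₂, l⟩
  have := congrArg (fun t => ev (t * X k₁)) (h k₂ l)
  simpa only [sub_smul, mul_smul, fam_sub_apply, cst_smul_apply, vw_smul, vz₂_smul, wFYX, wYFX,
    sub_mul, map_sub, smul_mul_assoc, map_smul, mul_assoc] using this

theorem SerreRel.word_YFX (h : SerreRel q δ X F) :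
    (cst q * vw δ - vz₁) • wYFX ev X Y F = (vw δ - cst q * vz₁) • wYXF ev X Y F := by
  funext ⟨k₁, k₂, l⟩
  have := congrArg (fun t => ev (Y k₂ * t)) (h k₁ l)
  simpa only [sub_smul, mul_smul, fam_sub_apply, cst_smul_apply, vw_smul, vz₁_smul, wYFX, wYXF,
    mul_sub, map_sub, mul_smul_comm, map_smul, mul_assoc] using this

theorem SerreRel.word_FXY (h : SerreRel q δ X F) :
    (cst q * vw δ - vz₁) • wFXY ev X Y F = (vw δ - cst q * vz₁) • wXFY ev X Y F := by
  funext ⟨k₁, k₂, l⟩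
  have := congrArg (fun t => ev (t * Y k₂)) (h k₁ l)
  simpa only [sub_smul, mul_smul, fam_sub_apply, cst_smul_apply, vw_smul, vz₁_smul, wFXY, wXFY,
    sub_mul, map_sub, smul_mul_assoc, map_smul, mul_assoc] using this

theorem cst_sq_smul_apply (X : Fam Exp3 (𝓛 U)) (k : Exp3) :
    ((cst q ^ 2 : Lau Exp3) • X) k = q ^ 2 • X k := by
  rw [sq, ← cst_mul, cst_smul_apply, sq]

theorem SelfRel.word_YXF (h : SelfRel q X Y) :
    (vz₂ - cst q ^ 2 * vz₁) • wYXF ev X Y F = (cst q ^ 2 * vz₂ - vz₁) • wXYF ev X Y F := by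
  funext ⟨k₁, k₂, l⟩
  have := congrArg (fun t => ev (t * F l)) (h k₁ k₂)
  simpa only [sub_smul, mul_smul, fam_sub_apply, cst_sq_smul_apply, vz₂_smul, vz₁_smul, wYXF, wXYF,
    sub_mul, map_sub, smul_mul_assoc, map_smul, mul_assoc] using this

theorem SelfRel.word_FYX (h : SelfRel q X Y) :
    (vz₂ - cst q ^ 2 * vz₁) • wFYX ev X Y F = (cst q ^ 2 * vz₂ - vz₁) • wFXY ev X Y F := by
  funext ⟨k₁, k₂, l⟩
  have := congrArg (fun t => ev (F l * t)) (h k₁ k₂)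
  simpa only [sub_smul, mul_smul, fam_sub_apply, cst_sq_smul_apply, vz₂_smul, vz₁_smul, wFYX, wFXY,
    mul_sub, map_sub, mul_smul_comm, map_smul, mul_assoc] using this

variable (hq : q ≠ 0) (hδ : δ ≠ 0) (hX : SerreRel q δ X F) (hY : SerreRel q δ Y F)
include hq hδ hX hY

theorem serre_third_right (hP : SelfRel q X Y) (h₁ : EvZ (1, 0, -1) (serreFam ev X Y F q))
    (h₂ : EvZ (0, 1, -1) (serreFam ev X Y F q)) (k₁ k₂ l : ℤ) :
    ev (sixWords q X Y F k₁ k₂ l) = 0 := by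
  have h := serreComb_third_right (R := 0) (hY.word_XFY (ev := ev))
    (hX.word_YFX (ev := ev)) (hX.word_FXY (ev := ev)) (hY.word_FYX (ev := ev)) (by rw [add_zero, hP.word_YXF])
  rw [smul_zero, neg_zero, ← serreFam_eq _ _ _ _ hq] at h
  exact serreFam_eq_zero hq (cancel_u₂ hq hδ (h₂.smul _)
    (cancel_u₁ hq hδ ((h₁.smul _).smul _) h)) k₁ k₂ l

theorem serre_third_left (hP : SelfRel q X Y) (h₁ : EvZ (-1, 0, 1) (serreFam ev X Y F q))
    (h₂ : EvZ (0, -1, 1) (serreFam ev X Y F q)) (k₁ k₂ l : ℤ) :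
    ev (sixWords q X Y F k₁ k₂ l) = 0 := by
  have h := serreComb_third_left (R := 0) (hY.word_XFY (ev := ev))
    (hX.word_YFX (ev := ev)) (hX.word_FXY (ev := ev)) (hY.word_FYX (ev := ev)) (by rw [add_zero, hP.word_FYX])
  rw [smul_zero, neg_zero, ← serreFam_eq _ _ _ _ hq] at h
  exact serreFam_eq_zero hq (cancel_v₂ hq (h₂.smul _)
    (cancel_v₁ hq ((h₁.smul _).smul _) h)) k₁ k₂ l

theorem serre_first_left (hP : SelfRel q X Y) (h₁ : EvZ (1, 0, -1) (serreFam ev X Y F q))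
    (h₂ : EvZ (1, -1, 0) (serreFam ev X Y F q)) (k₁ k₂ l : ℤ) :
    ev (sixWords q X Y F k₁ k₂ l) = 0 := by
  have h := serreComb_first_left (hY.word_XFY (ev := ev))
    (hX.word_YFX (ev := ev)) (hX.word_FXY (ev := ev)) hP.word_YXF hP.word_FYX
  rw [← serreFam_eq _ _ _ _ hq] at h
  exact serreFam_eq_zero hq (cancel_u₁ hq hδ (h₁.smul _)
    (cancel_p ((h₂.smul _).smul _) h)) k₁ k₂ l

omit hδ in
theorem serre_first_right (hP : SelfRel q X Y) (h₁ : EvZ (-1, 0, 1) (serreFam ev X Y F q))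
    (h₂ : EvZ (-1, 1, 0) (serreFam ev X Y F q)) (k₁ k₂ l : ℤ) :
    ev (sixWords q X Y F k₁ k₂ l) = 0 := by
  have h := serreComb_first_right (hX.word_YFX (ev := ev))
    (hX.word_FXY (ev := ev)) (hY.word_FYX (ev := ev)) hP.word_YXF hP.word_FYX
  rw [← serreFam_eq _ _ _ _ hq] at h
  exact serreFam_eq_zero hq (cancel_v₁ hq (h₁.smul _)
    (cancel_p' ((h₂.smul _).smul _) h)) k₁ k₂ l

end General

/-- The Serre combination vanishes eventually if the total degree by which its words raise a
filtration tends to infinity. -/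
theorem evZ_serreFam (Ξ : Filt U) {X Y F : ℤ → 𝓛 U} {a b c : ℤ → ℤ}
    (hX : ∀ k, Ξ.Raises (a k) (X k)) (hY : ∀ k, Ξ.Raises (b k) (Y k))
    (hF : ∀ k, Ξ.Raises (c k) (F k)) {σ₁ σ₂ σ₃ : ℤ}
    (h : ∀ k₁ k₂ l : ℤ, ∃ C : ℤ, ∀ m : ℤ, m + C ≤ a (k₁ + m * σ₁) + b (k₂ + m * σ₂) + c (l + m * σ₃)) :
    EvZ (σ₁, σ₂, σ₃) (serreFam LinearMap.id X Y F q) := fun u k => by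
  obtain ⟨p, hp⟩ := Ξ.exh u
  obtain ⟨N, hN⟩ := Ξ.vanish
  obtain ⟨C, hC⟩ := h k.1 k.2.1 k.2.2
  refine ⟨(N - p - C + 1).toNat, fun m hm => ?_⟩
  have hm' := hC m
  set k₁ := k.1 + m * σ₁
  set k₂ := k.2.1 + m * σ₂
  set l := k.2.2 + m * σ₃
  have e : serreFam LinearMap.id X Y F q (k + m • (σ₁, σ₂, σ₃)) = sixWords q X Y F k₁ k₂ l := by
    simp [serreFam, k₁, k₂, l]
  have hs : Ξ.Raises (m + C) (sixWords q X Y F k₁ k₂ l) := by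
    have w : ∀ {x y z : 𝓛 U} {i j t : ℤ}, Ξ.Raises i x → Ξ.Raises j y → Ξ.Raises t z →
        m + C ≤ i + j + t → Ξ.Raises (m + C) (x * y * z) := fun h₁ h₂ h₃ h => ((h₁.mul h₂).mul h₃).mono h
    refine (((((w (hX k₁) (hY k₂) (hF l) ?_).add (w (hY k₂) (hX k₁) (hF l) ?_)).add
      (Filt.Raises.smul (q + q⁻¹)
        ((w (hX k₁) (hF l) (hY k₂) ?_).add (w (hY k₂) (hF l) (hX k₁) ?_))).neg).add
      (w (hF l) (hX k₁) (hY k₂) ?_)).add (w (hF l) (hY k₂) (hX k₁) ?_)).congr ?_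
    all_goals try linarith
    simp only [sixWords]; abel
  have := hs p u hp
  rw [hN _ (by omega), Submodule.mem_bot] at this
  rw [e, this]

end Words

/-! ## Serre relations of products of currents -/

section Triple

variable {U : Type*} [AddCommGroup U] [Module ℂ U] {q δ : ℂ}

theorem word_cvi {x₁ x₂ x₃ y₁ y₂ y₃ : ℤ → 𝓛 U} (h₁ : CviLF x₁ y₁) (h₂ : CviLF x₂ y₂)
    (h₃ : CviLF x₃ y₃) (c₁₂ : ∀ a b, Commute (y₁ a) (x₂ b)) (c₁₃ : ∀ a b, Commute (y₁ a) (x₃ b))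
    (c₂₃ : ∀ a b, Commute (y₂ a) (x₃ b)) (k₁ k₂ k₃ : ℤ) :
    (LocFin fun p : ℤ × ℤ × ℤ => x₁ p.1 * x₂ p.2.1 * x₃ p.2.2 *
      (y₁ (k₁ - p.1) * y₂ (k₂ - p.2.1) * y₃ (k₃ - p.2.2))) ∧
    cvi x₁ y₁ k₁ * cvi x₂ y₂ k₂ * cvi x₃ y₃ k₃ = locSum fun p : ℤ × ℤ × ℤ =>
      x₁ p.1 * x₂ p.2.1 * x₃ p.2.2 * (y₁ (k₁ - p.1) * y₂ (k₂ - p.2.1) * y₃ (k₃ - p.2.2)) := by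
  have e : (fun p : ℤ × ℤ × ℤ => x₁ p.1 * y₁ (k₁ - p.1) *
      (x₂ p.2.1 * y₂ (k₂ - p.2.1) * (x₃ p.2.2 * y₃ (k₃ - p.2.2)))) = fun p : ℤ × ℤ × ℤ =>
      x₁ p.1 * x₂ p.2.1 * x₃ p.2.2 * (y₁ (k₁ - p.1) * y₂ (k₂ - p.2.1) * y₃ (k₃ - p.2.2)) := by
    funext p
    simp only [mul_assoc]
    rw [← mul_assoc (y₂ _) (x₃ _), (c₂₃ _ _).eq, ← mul_assoc (y₁ _) (x₂ _), (c₁₂ _ _).eq,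
      mul_assoc (x₂ _), mul_assoc (x₃ _), ← mul_assoc (y₁ _) (x₃ _), (c₁₃ _ _).eq]
    simp only [mul_assoc]
  have l₁ : LocFin fun a => x₁ a * y₁ (k₁ - a) := h₁ k₁
  have l₂ : LocFin fun a => x₂ a * y₂ (k₂ - a) := h₂ k₂
  have l₃ : LocFin fun a => x₃ a * y₃ (k₃ - a) := h₃ k₃
  have h := l₁.mul (l₂.mul l₃)
  rw [← e]
  refine ⟨h, ?_⟩
  rw [cvi_apply, cvi_apply, cvi_apply, mul_assoc, locSum_mul_locSum l₂ l₃,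
    locSum_mul_locSum l₁ (l₂.mul l₃)]

/-- A linear combination of expansions which vanishes with the Serre combination of `x₁`, `x₂`,
`x₃`. -/
theorem sixWords_expand {x₁ x₂ x₃ : ℤ → 𝓛 U}
    (h : ∀ k₁ k₂ k₃, sixWords q x₁ x₂ x₃ k₁ k₂ k₃ = 0) (K : ℤ × ℤ × ℤ → 𝓛 U)
    (l123 : LocFin fun p : ℤ × ℤ × ℤ => x₁ p.1 * x₂ p.2.1 * x₃ p.2.2 * K p)
    (l213 : LocFin fun p : ℤ × ℤ × ℤ => x₂ p.1 * x₁ p.2.1 * x₃ p.2.2 * K (p.2.1, p.1, p.2.2))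
    (l132 : LocFin fun p : ℤ × ℤ × ℤ => x₁ p.1 * x₃ p.2.1 * x₂ p.2.2 * K (p.1, p.2.2, p.2.1))
    (l231 : LocFin fun p : ℤ × ℤ × ℤ => x₂ p.1 * x₃ p.2.1 * x₁ p.2.2 * K (p.2.2, p.1, p.2.1))
    (l312 : LocFin fun p : ℤ × ℤ × ℤ => x₃ p.1 * x₁ p.2.1 * x₂ p.2.2 * K (p.2.1, p.2.2, p.1))
    (l321 : LocFin fun p : ℤ × ℤ × ℤ => x₃ p.1 * x₂ p.2.1 * x₁ p.2.2 * K (p.2.2, p.2.1, p.1)) :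
    (locSum fun p : ℤ × ℤ × ℤ => x₁ p.1 * x₂ p.2.1 * x₃ p.2.2 * K p) +
      (locSum fun p : ℤ × ℤ × ℤ => x₂ p.1 * x₁ p.2.1 * x₃ p.2.2 * K (p.2.1, p.1, p.2.2)) -
      (q + q⁻¹) •
        ((locSum fun p : ℤ × ℤ × ℤ => x₁ p.1 * x₃ p.2.1 * x₂ p.2.2 * K (p.1, p.2.2, p.2.1)) +
        locSum fun p : ℤ × ℤ × ℤ => x₂ p.1 * x₃ p.2.1 * x₁ p.2.2 * K (p.2.2, p.1, p.2.1)) +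
      (locSum fun p : ℤ × ℤ × ℤ => x₃ p.1 * x₁ p.2.1 * x₂ p.2.2 * K (p.2.1, p.2.2, p.1)) +
      (locSum fun p : ℤ × ℤ × ℤ => x₃ p.1 * x₂ p.2.1 * x₁ p.2.2 * K (p.2.2, p.2.1, p.1)) = 0 := by
  let t213 : ℤ × ℤ × ℤ ≃ ℤ × ℤ × ℤ :=
    ⟨fun p => (p.2.1, p.1, p.2.2), fun p => (p.2.1, p.1, p.2.2), fun _ => rfl, fun _ => rfl⟩
  let t132 : ℤ × ℤ × ℤ ≃ ℤ × ℤ × ℤ :=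
    ⟨fun p => (p.1, p.2.2, p.2.1), fun p => (p.1, p.2.2, p.2.1), fun _ => rfl, fun _ => rfl⟩
  let t231 : ℤ × ℤ × ℤ ≃ ℤ × ℤ × ℤ :=
    ⟨fun p => (p.2.1, p.2.2, p.1), fun p => (p.2.2, p.1, p.2.1), fun _ => rfl, fun _ => rfl⟩
  let t321 : ℤ × ℤ × ℤ ≃ ℤ × ℤ × ℤ :=
    ⟨fun p => (p.2.2, p.2.1, p.1), fun p => (p.2.2, p.2.1, p.1), fun _ => rfl, fun _ => rfl⟩
  replace l213 := l213.comp_injective t213.injective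
  replace l132 := l132.comp_injective t132.injective
  replace l231 := l231.comp_injective t231.injective
  replace l312 := l312.comp_injective t231.symm.injective
  replace l321 := l321.comp_injective t321.injective
  rw [← locSum_equiv t213 fun p => x₂ p.1 * x₁ p.2.1 * x₃ p.2.2 * _,
    ← locSum_equiv t132 fun p => x₁ p.1 * x₃ p.2.1 * x₂ p.2.2 * _,
    ← locSum_equiv t231 fun p => x₂ p.1 * x₃ p.2.1 * x₁ p.2.2 * _,
    ← locSum_equiv t231.symm fun p => x₃ p.1 * x₁ p.2.1 * x₂ p.2.2 * _,
    ← locSum_equiv t321 fun p => x₃ p.1 * x₂ p.2.1 * x₁ p.2.2 * _]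
  simp only [t213, t132, t231, t321, Equiv.coe_fn_mk, Equiv.coe_fn_symm_mk, Prod.mk.eta]
    at l213 l132 l231 l312 l321 ⊢
  rw [← locSum_add l123 l213,
    ← locSum_add l132 l231, ← locSum_smul (l132.add l231),
    ← locSum_sub (l123.add l213) ((l132.add l231).const_smul _),
    ← locSum_add ((l123.add l213).sub ((l132.add l231).const_smul _)) l312,
    ← locSum_add (((l123.add l213).sub ((l132.add l231).const_smul _)).add l312) l321,
    ← locSum_zero (ι := ℤ × ℤ × ℤ)]
  congr 1
  funext p
  have := congrArg (· * K p) (h p.1 p.2.1 p.2.2)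
  simpa only [sixWords, add_mul, sub_mul, smul_mul_assoc, zero_mul] using this

theorem sixWords_cvi {x₁ x₂ x₃ y₁ y₂ y₃ : ℤ → 𝓛 U} (h₁ : CviLF x₁ y₁)
    (h₂ : CviLF x₂ y₂) (h₃ : CviLF x₃ y₃) (c₁₂ : ∀ a b, Commute (y₁ a) (x₂ b))
    (c₁₃ : ∀ a b, Commute (y₁ a) (x₃ b)) (c₂₃ : ∀ a b, Commute (y₂ a) (x₃ b))
    (c₂₁ : ∀ a b, Commute (y₂ a) (x₁ b)) (c₃₁ : ∀ a b, Commute (y₃ a) (x₁ b))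
    (c₃₂ : ∀ a b, Commute (y₃ a) (x₂ b)) (d₁₂ : ∀ a b, Commute (y₁ a) (y₂ b))
    (d₁₃ : ∀ a b, Commute (y₁ a) (y₃ b)) (d₂₃ : ∀ a b, Commute (y₂ a) (y₃ b))
    (h : ∀ k₁ k₂ k₃, sixWords q x₁ x₂ x₃ k₁ k₂ k₃ = 0) (k₁ k₂ k₃ : ℤ) :
    sixWords q (cvi x₁ y₁) (cvi x₂ y₂) (cvi x₃ y₃) k₁ k₂ k₃ = 0 := by
  set K : ℤ × ℤ × ℤ → 𝓛 U := fun p =>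
    y₁ (k₁ - p.1) * y₂ (k₂ - p.2.1) * y₃ (k₃ - p.2.2) with hK
  obtain ⟨l123, w123⟩ := word_cvi h₁ h₂ h₃ c₁₂ c₁₃ c₂₃ k₁ k₂ k₃
  obtain ⟨l213, w213⟩ := word_cvi h₂ h₁ h₃ c₂₁ c₂₃ c₁₃ k₂ k₁ k₃
  obtain ⟨l132, w132⟩ := word_cvi h₁ h₃ h₂ c₁₃ c₁₂ c₃₂ k₁ k₃ k₂
  obtain ⟨l231, w231⟩ := word_cvi h₂ h₃ h₁ c₂₃ c₂₁ c₃₁ k₂ k₃ k₁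
  obtain ⟨l312, w312⟩ := word_cvi h₃ h₁ h₂ c₃₁ c₃₂ c₁₂ k₃ k₁ k₂
  obtain ⟨l321, w321⟩ := word_cvi h₃ h₂ h₁ c₃₂ c₃₁ c₂₁ k₃ k₂ k₁
  have f213 : ∀ a b c, y₂ b * y₁ a * y₃ c = y₁ a * y₂ b * y₃ c := fun a b c => by
    rw [(d₁₂ a b).eq]
  have f132 : ∀ a b c, y₁ a * y₃ c * y₂ b = y₁ a * y₂ b * y₃ c := fun a b c => by
    rw [mul_assoc, mul_assoc, (d₂₃ b c).eq]
  have f231 : ∀ a b c, y₂ b * y₃ c * y₁ a = y₁ a * y₂ b * y₃ c := fun a b c => by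
    rw [mul_assoc (y₁ a), ((d₁₂ a b).mul_right (d₁₃ a c)).eq]
  have f312 : ∀ a b c, y₃ c * y₁ a * y₂ b = y₁ a * y₂ b * y₃ c := fun a b c => by
    rw [mul_assoc, ((d₁₃ a c).mul_left (d₂₃ b c)).eq]
  have f321 : ∀ a b c, y₃ c * y₂ b * y₁ a = y₁ a * y₂ b * y₃ c := fun a b c => by
    rw [← f312, mul_assoc, mul_assoc, (d₁₂ a b).eq]
  simp only [f213, f132, f231, f312, f321] at l213 l132 l231 l312 l321 w213 w132 w231 w312 w321
  rw [sixWords, w123, w213, w132, w231, w312, w321]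
  exact sixWords_expand h K l123 l213 l132 l231 l312 l321

theorem sixWords_neg {R : Type*} [Ring R] [Algebra ℂ R] (X Y F : ℤ → R) (k₁ k₂ l : ℤ) :
    sixWords q (-X) (-Y) (-F) k₁ k₂ l = -sixWords q X Y F k₁ k₂ l := by
  simp only [sixWords, Pi.neg_apply, neg_mul, mul_neg, neg_neg]; module

theorem sixWords_add_left {R : Type*} [Ring R] [Algebra ℂ R] (X X' Y F : ℤ → R) (k₁ k₂ l : ℤ) :
    sixWords q (X + X') Y F k₁ k₂ l = sixWords q X Y F k₁ k₂ l + sixWords q X' Y F k₁ k₂ l := by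
  simp only [sixWords, Pi.add_apply, add_mul, mul_add]; module

theorem sixWords_add_mid {R : Type*} [Ring R] [Algebra ℂ R] (X Y Y' F : ℤ → R) (k₁ k₂ l : ℤ) :
    sixWords q X (Y + Y') F k₁ k₂ l = sixWords q X Y F k₁ k₂ l + sixWords q X Y' F k₁ k₂ l := by
  simp only [sixWords, Pi.add_apply, add_mul, mul_add]; module

theorem sixWords_add_right {R : Type*} [Ring R] [Algebra ℂ R] (X Y F F' : ℤ → R) (k₁ k₂ l : ℤ) :
    sixWords q X Y (F + F') k₁ k₂ l = sixWords q X Y F k₁ k₂ l + sixWords q X Y F' k₁ k₂ l := by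
  simp only [sixWords, Pi.add_apply, add_mul, mul_add]; module

/-! ### From colours to Serre relations -/

/-- The parameter of the Serre relation of the colours `i` and `j`. -/
def serreParam {n : ℕ} (d : ℂ) (i j : ZMod n) : ℂ := if j = i + 1 then d else d⁻¹

variable {n : ℕ} {d : ℂ}

/-- The quadratic exchange relation in an arbitrary algebra. -/
def QuadRelIn {R : Type*} [Ring R] [Algebra ℂ R] (q d : ℂ) (i j : ZMod n) (X F : ℤ → R) : Prop :=
  ∀ k l, F (l + 1) * X k - gCoef q d j i • (F l * X (k + 1)) =
    (dCoef d i j * gCoef q d i j) • (X k * F (l + 1)) - dCoef d i j • (X (k + 1) * F l)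

theorem QuadRelIn.serreRel {R : Type*} [Ring R] [Algebra ℂ R] (hn : 3 ≤ n) (hq : q ≠ 0)
    (hd : d ≠ 0) {i j : ZMod n} (hij : j = i + 1 ∨ j = i - 1) {X F : ℤ → R}
    (h : QuadRelIn q d i j X F) : SerreRel q (serreParam d i j) X F := by
  intro k l
  have hh := congrArg (fun t => (q * serreParam d i j) • t) (h k l)
  rw [← sub_eq_zero] at hh ⊢
  rw [← hh]
  rcases hij with rfl | rfl
  · simp only [serreParam, gCoef_succ hn, gCoef_succ' hn, dCoef_succ hn, if_pos]
    simp only [smul_sub, smul_smul]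
    match_scalars <;> field_simp
  · simp only [serreParam, gCoef_pred hn, gCoef_pred' hn, dCoef_pred,
      (zmod_succ_ne_pred hn i).symm, if_false]
    simp only [smul_sub, smul_smul]
    match_scalars <;> field_simp

theorem QuadRelIn.selfRel {R : Type*} [Ring R] [Algebra ℂ R] (hn : 3 ≤ n)
    {i : ZMod n} {X F : ℤ → R}
    (h : QuadRelIn q d i i X F) : SelfRel q X F := by
  intro k l
  simpa [gCoef_self, dCoef_self hn] using h k l

end Triple

/-! ## Serre relations for `φη` -/

section Sandwich

variable {U : Type*} [AddCommGroup U] [Module ℂ U] {q d s r : ℂ} {n : ℕ}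

/-- The operators `x ↦ ∑ φ_a x η_{k-a}`. -/
def sandwich {η : ℤ → 𝓛 U} (hη : Truncated η) (h0 : ∀ k, k < 0 → η k = 0)
    (φ : ℤ → 𝓛 U) (k : ℤ) : 𝓛 (𝓛 U) where
  toFun x := locSum fun a => φ a * x * η (k - a)
  map_add' x y := by
    simp only [mul_add, add_mul]
    exact locSum_add (locFin_of_nonneg_right hη h0 _ k) (locFin_of_nonneg_right hη h0 _ k)
  map_smul' c x := by
    simp only [mul_smul_comm, smul_mul_assoc, RingHom.id_apply]
    exact locSum_smul (locFin_of_nonneg_right hη h0 _ k) c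

variable {η η₁ η₂ η₃ : ℤ → 𝓛 U} {hη : Truncated η} {h0 : ∀ k, k < 0 → η k = 0}
  {hη₁ : Truncated η₁} {h0₁ : ∀ k, k < 0 → η₁ k = 0}
  {hη₂ : Truncated η₂} {h0₂ : ∀ k, k < 0 → η₂ k = 0}
  {hη₃ : Truncated η₃} {h0₃ : ∀ k, k < 0 → η₃ k = 0}
  {φ φ₁ φ₂ φ₃ : ℤ → 𝓛 U}

theorem sandwich_apply (k : ℤ) (x : 𝓛 U) :
    sandwich hη h0 φ k x = locSum fun a => φ a * x * η (k - a) := rfl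

theorem sandwich_locSum {κ : Type*} {f : κ → 𝓛 U} (hf : LocFin f) (k : ℤ) :
    (LocFin fun p : ℤ × κ => φ p.1 * f p.2 * η (k - p.1)) ∧
    sandwich hη h0 φ k (locSum f) = locSum fun p : ℤ × κ => φ p.1 * f p.2 * η (k - p.1) := by
  have h : LocFin fun p : ℤ × κ => φ p.1 * f p.2 * η (k - p.1) := fun u => by
    have hS := locFin_of_nonneg_right hη h0 (fun _ => 1) k u
    refine (hS.biUnion fun a _ => (Set.finite_singleton a).prod (hf (η (k - a) u))).subset ?_
    rintro ⟨a, j⟩ hp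
    simp only [Function.mem_support, Module.End.mul_apply] at hp
    simp only [Set.mem_iUnion, Set.mem_prod, Set.mem_singleton_iff, Function.mem_support,
      Module.End.mul_apply, Module.End.one_apply, exists_prop]
    refine ⟨a, fun h => hp (by rw [h, map_zero, map_zero]), rfl, fun h => hp (by rw [h, map_zero])⟩
  refine ⟨h, ?_⟩
  rw [sandwich_apply, locSum_prod h]
  congr 1; funext a
  rw [mul_locSum hf, locSum_mul]
  exact hf.mul_left _

theorem sandwich_sandwich (k₁ k₂ : ℤ) (x : 𝓛 U) :
    (LocFin fun p : ℤ × ℤ => φ₁ p.1 * φ₂ p.2 * x * (η₂ (k₂ - p.2) * η₁ (k₁ - p.1))) ∧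
    sandwich hη₁ h0₁ φ₁ k₁ (sandwich hη₂ h0₂ φ₂ k₂ x) =
      locSum fun p : ℤ × ℤ => φ₁ p.1 * φ₂ p.2 * x * (η₂ (k₂ - p.2) * η₁ (k₁ - p.1)) := by
  rw [sandwich_apply (hη := hη₂) (h0 := h0₂) (φ := φ₂)]
  have := sandwich_locSum (hη := hη₁) (h0 := h0₁) (φ := φ₁)
    (locFin_of_nonneg_right hη₂ h0₂ (fun a => φ₂ a * x) k₂) k₁
  simpa only [mul_assoc] using this

theorem sandwich_triple (k₁ k₂ k₃ : ℤ) :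
    (LocFin fun p : ℤ × ℤ × ℤ => φ₁ p.1 * φ₂ p.2.1 * φ₃ p.2.2 *
      (η₃ (k₃ - p.2.2) * η₂ (k₂ - p.2.1) * η₁ (k₁ - p.1))) ∧
    sandwich hη₁ h0₁ φ₁ k₁ (sandwich hη₂ h0₂ φ₂ k₂ (sandwich hη₃ h0₃ φ₃ k₃ 1)) =
      locSum fun p : ℤ × ℤ × ℤ => φ₁ p.1 * φ₂ p.2.1 * φ₃ p.2.2 *
        (η₃ (k₃ - p.2.2) * η₂ (k₂ - p.2.1) * η₁ (k₁ - p.1)) := by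
  obtain ⟨h, e⟩ := sandwich_sandwich (hη₁ := hη₂) (h0₁ := h0₂) (hη₂ := hη₃) (h0₂ := h0₃)
    (φ₁ := φ₂) (φ₂ := φ₃) k₂ k₃ 1
  rw [e]
  have := sandwich_locSum (hη := hη₁) (h0 := h0₁) (φ := φ₁) h k₁
  simpa only [mul_assoc, mul_one, one_mul] using this

/-- The algebra of operators on operators, with the multiplication reversed. -/
abbrev OpAlg (U : Type*) [AddCommGroup U] [Module ℂ U] : Type _ :=
  (𝓛 (𝓛 U))ᵐᵒᵖ

/-- Evaluation at the identity operator. -/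
def evOne (U : Type*) [AddCommGroup U] [Module ℂ U] : OpAlg U →ₗ[ℂ] 𝓛 U where
  toFun x := x.unop 1
  map_add' _ _ := rfl
  map_smul' _ _ := rfl

/-- The letter acting by `x ↦ ∑ φ_a x η_{k-a}`. -/
def opLam (hη : Truncated η) (h0 : ∀ k, k < 0 → η k = 0) (φ : ℤ → 𝓛 U) :
    ℤ → OpAlg U := fun k => MulOpposite.op (sandwich hη h0 φ k)

/-- The letter acting by `x ↦ -x T_k`. -/
def opRho (T : ℤ → 𝓛 U) : ℤ → OpAlg U :=
  fun k => MulOpposite.op (-LinearMap.mulRight ℂ (T k))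

theorem opRho_opRho {i j : ZMod n} {T T' : ℤ → 𝓛 U} (h : QuadRel q d i j T T') :
    QuadRelIn q d i j (opRho T) (opRho T') := fun k l => by
  apply MulOpposite.unop_injective
  ext1 x
  have := congrArg (x * ·) (quadRel_iff.1 h k l)
  simpa [opRho, mul_sub, mul_assoc] using this

theorem opRho_opLam {i j : ZMod n} {T : ℤ → 𝓛 U} (h : QuadRel q d i j T η) :
    QuadRelIn q d i j (opRho T) (opLam hη h0 φ) := fun k l => by
  apply MulOpposite.unop_injective
  ext1 x
  have l₁ : ∀ l k, LocFin fun a => φ a * x * (η (l - a) * T k) := fun l k => by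
    have := (locFin_of_nonneg_right hη h0 (fun a => φ a * x) l).mul_right (T k)
    simpa only [mul_assoc] using this
  have l₂ : ∀ l k, LocFin fun a => φ a * x * (T k * η (l - a)) := fun l k => by
    have := locFin_of_nonneg_right hη h0 (fun a => φ a * x * T k) l
    simpa only [mul_assoc] using this
  have e₁ : ∀ l k, (sandwich hη h0 φ l x) * T k = locSum fun a => φ a * x * (η (l - a) * T k) :=
    fun l k => by
      rw [sandwich_apply, locSum_mul (locFin_of_nonneg_right hη h0 _ l)]
      simp only [mul_assoc]
  have e₂ : ∀ l k, (sandwich hη h0 φ l (x * T k)) =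
      locSum fun a => φ a * x * (T k * η (l - a)) := fun l k => by
    rw [sandwich_apply]; simp only [mul_assoc]
  simp only [opRho, opLam, MulOpposite.unop_sub, MulOpposite.unop_smul, MulOpposite.unop_mul,
    MulOpposite.unop_op, LinearMap.sub_apply, LinearMap.smul_apply, Module.End.mul_apply,
    LinearMap.neg_apply, LinearMap.mulRight_apply, map_neg, e₁, e₂]
  simp only [← locSum_neg (l₁ _ _),
    ← locSum_neg (l₂ _ _), ← locSum_smul (l₁ _ _).neg, ← locSum_smul (l₂ _ _).neg]
  rw [← locSum_sub (l₁ _ _).neg ((l₁ _ _).neg.const_smul _),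
    ← locSum_sub ((l₂ _ _).neg.const_smul _) ((l₂ _ _).neg.const_smul _)]
  congr 1; funext a
  have := congrArg (fun t => -(φ a * x * t)) (quadRel_iff.1 h k (l - a))
  rw [show l + 1 - a = l - a + 1 by ring]
  simp only [mul_sub, mul_smul_comm, neg_sub] at this
  simp only [smul_neg, sub_neg_eq_add]
  rw [neg_add_eq_sub, neg_add_eq_sub]
  exact this

theorem opLam_opLam {i j : ZMod n} (hc : ∀ a b, Commute (η₁ a) (η₂ b))
    (h : num q d i j 1 • rp φ₁ φ₂ = den q d i j 1 • pr φ₁ φ₂) :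
    QuadRelIn q d i j (opLam hη₁ h0₁ φ₁) (opLam hη₂ h0₂ φ₂) := fun k l => by
  apply MulOpposite.unop_injective
  ext1 x
  have f₁ := fun k l => sandwich_sandwich (hη₁ := hη₁) (h0₁ := h0₁) (hη₂ := hη₂) (h0₂ := h0₂)
    (φ₁ := φ₁) (φ₂ := φ₂) k l x
  have f₂ := fun k l => sandwich_sandwich (hη₁ := hη₂) (h0₁ := h0₂) (hη₂ := hη₁) (h0₂ := h0₁)
    (φ₁ := φ₂) (φ₂ := φ₁) l k x
  set P : Fam (ℤ × ℤ) (𝓛 U) := fun p => φ₁ p.1 * φ₂ p.2 * x with hP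
  set Q : Fam (ℤ × ℤ) (𝓛 U) := fun p => φ₂ p.2 * φ₁ p.1 * x with hQ
  have hPQ : num q d i j 1 • Q = den q d i j 1 • P := by
    funext ⟨k, l⟩
    have := congrArg (· * x) (congrFun h (k, l))
    simpa only [num, den, lw_smul_apply, rp_apply, pr_apply, sub_mul, smul_mul_assoc] using this
  have lP : CviLF P (pr η₁ η₂) := fun ⟨k, l⟩ => by
    have := (f₁ k l).1
    simpa only [hP, pr, AddMonoidHom.id_apply, Prod.fst_sub, Prod.snd_sub, (hc _ _).eq] using this
  have lQ : CviLF Q (pr η₁ η₂) := fun ⟨k, l⟩ => by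
    have := (f₂ k l).1.prod_swap
    simpa only [hQ, pr, AddMonoidHom.id_apply, Prod.fst_sub, Prod.snd_sub] using this
  have g₁ : ∀ k l, sandwich hη₁ h0₁ φ₁ k (sandwich hη₂ h0₂ φ₂ l x) = cvi P (pr η₁ η₂) (k, l) :=
    fun k l => by
      rw [(f₁ k l).2, cvi_apply]
      simp only [hP, pr, Prod.fst_sub, Prod.snd_sub, (hc _ _).eq]
  have g₂ : ∀ k l, sandwich hη₂ h0₂ φ₂ l (sandwich hη₁ h0₁ φ₁ k x) = cvi Q (pr η₁ η₂) (k, l) :=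
    fun k l => by
      rw [(f₂ k l).2, cvi_apply, ← locSum_equiv (Equiv.prodComm ℤ ℤ)]
      simp only [hQ, pr, Prod.fst_sub, Prod.snd_sub, Equiv.prodComm_apply, Prod.fst_swap,
        Prod.snd_swap]
  have := congrFun (cvi_relation lQ lP hPQ (r := 1) (r' := 1) rfl) (k, l)
  rw [mul_one, mul_one] at this
  simp only [num, den, lw_smul_apply, one_smul, mul_one] at this
  simp only [opLam, MulOpposite.unop_sub, MulOpposite.unop_smul, MulOpposite.unop_mul,
    MulOpposite.unop_op, LinearMap.sub_apply, LinearMap.smul_apply, Module.End.mul_apply, g₁, g₂]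
  exact this.symm

theorem evOne_sixWords_opLam (hc₁₂ : ∀ a b, Commute (η₁ a) (η₂ b))
    (hc₁₃ : ∀ a b, Commute (η₁ a) (η₃ b)) (hc₂₃ : ∀ a b, Commute (η₂ a) (η₃ b))
    (h : ∀ k₁ k₂ l, sixWords q φ₁ φ₂ φ₃ k₁ k₂ l = 0) (k₁ k₂ l : ℤ) :
    evOne U (sixWords q (opLam hη₁ h0₁ φ₁) (opLam hη₂ h0₂ φ₂) (opLam hη₃ h0₃ φ₃) k₁ k₂ l) = 0 := by
  have f213 : ∀ a b c, η₂ b * η₁ a * η₃ c = η₁ a * η₂ b * η₃ c := fun a b c => by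
    rw [(hc₁₂ a b).eq]
  have f132 : ∀ a b c, η₁ a * η₃ c * η₂ b = η₁ a * η₂ b * η₃ c := fun a b c => by
    rw [mul_assoc, mul_assoc, (hc₂₃ b c).eq]
  have f231 : ∀ a b c, η₂ b * η₃ c * η₁ a = η₁ a * η₂ b * η₃ c := fun a b c => by
    rw [mul_assoc (η₁ a), ((hc₁₂ a b).mul_right (hc₁₃ a c)).eq]
  have f312 : ∀ a b c, η₃ c * η₁ a * η₂ b = η₁ a * η₂ b * η₃ c := fun a b c => by
    rw [mul_assoc, ((hc₁₃ a c).mul_left (hc₂₃ b c)).eq]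
  have f321 : ∀ a b c, η₃ c * η₂ b * η₁ a = η₁ a * η₂ b * η₃ c := fun a b c => by
    rw [← f312, mul_assoc, mul_assoc, (hc₁₂ a b).eq]
  obtain ⟨l123, w123⟩ := sandwich_triple (hη₁ := hη₁) (h0₁ := h0₁) (hη₂ := hη₂) (h0₂ := h0₂)
    (hη₃ := hη₃) (h0₃ := h0₃) (φ₁ := φ₁) (φ₂ := φ₂) (φ₃ := φ₃) k₁ k₂ l
  obtain ⟨l213, w213⟩ := sandwich_triple (hη₁ := hη₂) (h0₁ := h0₂) (hη₂ := hη₁) (h0₂ := h0₁)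
    (hη₃ := hη₃) (h0₃ := h0₃) (φ₁ := φ₂) (φ₂ := φ₁) (φ₃ := φ₃) k₂ k₁ l
  obtain ⟨l132, w132⟩ := sandwich_triple (hη₁ := hη₁) (h0₁ := h0₁) (hη₂ := hη₃) (h0₂ := h0₃)
    (hη₃ := hη₂) (h0₃ := h0₂) (φ₁ := φ₁) (φ₂ := φ₃) (φ₃ := φ₂) k₁ l k₂
  obtain ⟨l231, w231⟩ := sandwich_triple (hη₁ := hη₂) (h0₁ := h0₂) (hη₂ := hη₃) (h0₂ := h0₃)
    (hη₃ := hη₁) (h0₃ := h0₁) (φ₁ := φ₂) (φ₂ := φ₃) (φ₃ := φ₁) k₂ l k₁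
  obtain ⟨l312, w312⟩ := sandwich_triple (hη₁ := hη₃) (h0₁ := h0₃) (hη₂ := hη₁) (h0₂ := h0₁)
    (hη₃ := hη₂) (h0₃ := h0₂) (φ₁ := φ₃) (φ₂ := φ₁) (φ₃ := φ₂) l k₁ k₂
  obtain ⟨l321, w321⟩ := sandwich_triple (hη₁ := hη₃) (h0₁ := h0₃) (hη₂ := hη₂) (h0₂ := h0₂)
    (hη₃ := hη₁) (h0₃ := h0₁) (φ₁ := φ₃) (φ₂ := φ₂) (φ₃ := φ₁) l k₂ k₁
  simp only [f213, f132, f231, f312, f321] at l123 l213 l132 l231 l312 l321 w123 w213 w132 w231 w312 w321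
  have := sixWords_expand h (fun p => η₁ (k₁ - p.1) * η₂ (k₂ - p.2.1) * η₃ (l - p.2.2))
    l123 l213 l132 l231 l312 l321
  dsimp only at this
  rw [← w123, ← w213, ← w132, ← w231, ← w312, ← w321] at this
  simp only [sixWords, evOne, opLam, LinearMap.coe_mk, AddHom.coe_mk, MulOpposite.unop_sub,
    MulOpposite.unop_smul, MulOpposite.unop_mul, MulOpposite.unop_add,
    MulOpposite.unop_op, LinearMap.sub_apply, LinearMap.smul_apply, LinearMap.add_apply,
    Module.End.mul_apply]
  rw [← this]
  module

/-- The operators on `U` which kill the vectors of degree above `N - m`. -/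
def vanishBelow (Φ : Filt U) (m : ℤ) : Submodule ℂ (𝓛 U) where
  carrier := {x | ∀ p u, u ∈ Φ.F p → Φ.F (p + m) = ⊥ → x u = 0}
  zero_mem' := fun _ _ _ _ => rfl
  add_mem' := fun hx hy p u hu h => by rw [LinearMap.add_apply, hx p u hu h, hy p u hu h, add_zero]
  smul_mem' := fun c x hx p u hu h => by rw [LinearMap.smul_apply, hx p u hu h, smul_zero]

theorem one_mem_vanishBelow (Φ : Filt U) : (1 : 𝓛 U) ∈ vanishBelow Φ 0 :=
  fun p u hu h => by
    rw [add_zero] at h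
    rwa [h, Submodule.mem_bot] at hu

theorem vanishBelow_anti (Φ : Filt U) {m m' : ℤ} (h : m ≤ m') :
    vanishBelow Φ m' ≤ vanishBelow Φ m := fun x hx p u hu hp =>
  hx p u hu (le_bot_iff.1 ((Φ.anti (by omega)).trans hp.le))

/-- The letter `x` raises the filtration `vanishBelow` by `a`. -/
def OpRaises (Φ : Filt U) (a : ℤ) (x : OpAlg U) : Prop :=
  ∀ m, ∀ y ∈ vanishBelow Φ m, x.unop y ∈ vanishBelow Φ (m + a)

theorem OpRaises.mul {Φ : Filt U} {a b : ℤ} {x y : OpAlg U} (hx : OpRaises Φ a x)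
    (hy : OpRaises Φ b y) : OpRaises Φ (a + b) (x * y) := fun m z hz => by
  have := hy _ _ (hx m z hz)
  rwa [add_assoc] at this

theorem opRaises_opRho {Φ : Filt U} {T : ℤ → 𝓛 U} (h : ∀ k, Φ.Raises k (T k)) (k : ℤ) :
    OpRaises Φ k (opRho T k) := fun m x hx p u hu hp => by
  rw [← neg_zero]
  exact congrArg Neg.neg (hx (p + k) (T k u) (h k p u hu) (by rwa [add_assoc, add_comm k]))

theorem opRaises_opLam {Φ : Filt U} (h : ∀ k, Φ.Raises 0 (η k)) (k : ℤ) :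
    OpRaises Φ 0 (opLam hη h0 φ k) := fun m x hx p u hu hp => by
  rw [add_zero] at hp
  rw [opLam, MulOpposite.unop_op, sandwich_apply, ← Submodule.mem_bot ℂ]
  refine locSum_mem fun a => ?_
  rw [Submodule.mem_bot, mul_assoc, Module.End.mul_apply, Module.End.mul_apply,
    hx p _ (by simpa using h (k - a) p u hu) hp, map_zero]

theorem evZ_serreFam_op (Φ : Filt U) {X Y F : ℤ → OpAlg U} {a b c : ℤ → ℤ}
    (hX : ∀ k, OpRaises Φ (a k) (X k)) (hY : ∀ k, OpRaises Φ (b k) (Y k))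
    (hF : ∀ k, OpRaises Φ (c k) (F k)) {σ₁ σ₂ σ₃ : ℤ}
    (h : ∀ k₁ k₂ l : ℤ, ∃ C : ℤ, ∀ m : ℤ,
      m + C ≤ a (k₁ + m * σ₁) + b (k₂ + m * σ₂) + c (l + m * σ₃)) :
    EvZ (σ₁, σ₂, σ₃) (serreFam (evOne U) X Y F q) := fun u k => by
  obtain ⟨p, hp⟩ := Φ.exh u
  obtain ⟨N, hN⟩ := Φ.vanish
  obtain ⟨C, hC⟩ := h k.1 k.2.1 k.2.2
  refine ⟨(N - p - C + 1).toNat, fun m hm => ?_⟩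
  have hm' := hC m
  set k₁ := k.1 + m * σ₁
  set k₂ := k.2.1 + m * σ₂
  set l := k.2.2 + m * σ₃
  have e : serreFam (evOne U) X Y F q (k + m • (σ₁, σ₂, σ₃)) =
      evOne U (sixWords q X Y F k₁ k₂ l) := by
    simp [serreFam, k₁, k₂, l]
  have w : ∀ {x y z : OpAlg U} {i j t : ℤ}, OpRaises Φ i x → OpRaises Φ j y → OpRaises Φ t z →
      m + C ≤ i + j + t → evOne U (x * y * z) ∈ vanishBelow Φ (m + C) := fun h₁ h₂ h₃ h =>
    vanishBelow_anti Φ (by simpa using h) (((h₁.mul h₂).mul h₃) 0 1 (one_mem_vanishBelow Φ))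
  have hs : evOne U (sixWords q X Y F k₁ k₂ l) ∈ vanishBelow Φ (m + C) := by
    rw [sixWords]
    simp only [map_add, map_sub, map_smul]
    refine add_mem (add_mem (sub_mem (add_mem (w (hX k₁) (hY k₂) (hF l) ?_)
      (w (hY k₂) (hX k₁) (hF l) ?_)) (Submodule.smul_mem _ _ (add_mem
      (w (hX k₁) (hF l) (hY k₂) ?_) (w (hY k₂) (hF l) (hX k₁) ?_))))
      (w (hF l) (hX k₁) (hY k₂) ?_)) (w (hF l) (hY k₂) (hX k₁) ?_)
    all_goals linarith
  rw [e]
  exact hs p u hp (hN _ (by omega))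

end Sandwich

section SerreT

variable {U : Type*} [AddCommGroup U] [Module ℂ U] {n : ℕ} {q d s r : ℂ}
variable {e φ η ζ ζp E Kp Km : ZMod n → ℤ → 𝓛 U} {Φ Ψ Ω : Filt U}

theorem serreParam_ne_zero (hd : d ≠ 0) (i j : ZMod n) : serreParam d i j ≠ 0 := by
  unfold serreParam; split_ifs <;> simp [hd]

namespace PairSys

variable (S : PairSys n q d s r e φ η ζ ζp E Kp Km Φ Ψ Ω)
include S

theorem serre_T (hn : 3 ≤ n) (hq : q ≠ 0) (hd : d ≠ 0) {i j : ZMod n}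
    (hij : j = i + 1 ∨ j = i - 1) (k₁ k₂ l : ℤ) :
    sixWords q (letT φ η i) (letT φ η i) (letT φ η j) k₁ k₂ l = 0 := by
  have hδ : serreParam d i j ≠ 0 := serreParam_ne_zero hd i j
  let L : ZMod n → ℤ → OpAlg U := fun i => opLam (S.tr_η i) (S.T.η_neg i) (φ i)
  let R : ZMod n → ℤ → OpAlg U := fun i => opRho (letT φ η i)
  have oL : ∀ i k, OpRaises Φ 0 (L i k) := fun i => opRaises_opLam (S.Φη i)
  have oR : ∀ i k, OpRaises Φ k (R i k) := fun i => opRaises_opRho (S.Φ_T i)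
  have LL : ∀ i j, QuadRelIn q d i j (L i) (L j) := fun i j =>
    opLam_opLam (S.T.η_η i j) (S.T.φ_φ i j)
  have RR : ∀ i j, QuadRelIn q d i j (R i) (R j) := fun i j => opRho_opRho (S.T_T hn hd i j)
  have RL : ∀ i j, QuadRelIn q d i j (R i) (L j) := fun i j => opRho_opLam (S.T_η i j)
  have LR : ∀ i j, QuadRelIn q d i j (L i) (R j) := fun i j k l => by
    have hh := RL j i l k
    have hdd := dCoef_mul_dCoef (n := n) hn hd i j
    have h2 := congrArg (fun t => dCoef d i j • t) hh
    simp only [smul_sub, smul_smul, ← mul_assoc, hdd, one_mul, one_smul] at h2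
    rw [← sub_eq_zero] at h2 ⊢
    rw [← h2]
    module
  have ff := fun {X F : ℤ → OpAlg U} (h : QuadRelIn q d i j X F) => h.serreRel hn hq hd hij
  have fs := fun {X F : ℤ → OpAlg U} (h : QuadRelIn q d i i X F) => h.selfRel hn
  have z1 := serre_third_right (ev := evOne U) hq hδ (ff (RL i j)) (ff (RL i j)) (fs (RR i i))
    (evZ_serreFam_op Φ (oR i) (oR i) (oL j) fun k₁ k₂ l => ⟨k₁ + k₂, fun m => by linarith⟩)
    (evZ_serreFam_op Φ (oR i) (oR i) (oL j) fun k₁ k₂ l => ⟨k₁ + k₂, fun m => by linarith⟩) k₁ k₂ l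
  have z2 := serre_third_left (ev := evOne U) hq hδ (ff (LR i j)) (ff (LR i j)) (fs (LL i i))
    (evZ_serreFam_op Φ (oL i) (oL i) (oR j) fun k₁ k₂ l => ⟨l, fun m => by linarith⟩)
    (evZ_serreFam_op Φ (oL i) (oL i) (oR j) fun k₁ k₂ l => ⟨l, fun m => by linarith⟩) k₁ k₂ l
  have z3 := fun k₁ k₂ => serre_first_left (ev := evOne U) hq hδ (ff (RL i j)) (ff (LL i j))
    (fs (RL i i))
    (evZ_serreFam_op Φ (oR i) (oL i) (oL j) fun k₁ k₂ l => ⟨k₁, fun m => by linarith⟩)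
    (evZ_serreFam_op Φ (oR i) (oL i) (oL j) fun k₁ k₂ l => ⟨k₁, fun m => by linarith⟩) k₁ k₂ l
  have z4 := fun k₁ k₂ => serre_first_right (ev := evOne U) hq (ff (LR i j)) (ff (RR i j))
    (fs (LR i i))
    (evZ_serreFam_op Φ (oL i) (oR i) (oR j) fun k₁ k₂ l => ⟨k₂ + l, fun m => by linarith⟩)
    (evZ_serreFam_op Φ (oL i) (oR i) (oR j) fun k₁ k₂ l => ⟨k₂ + l, fun m => by linarith⟩) k₁ k₂ l
  have z5 := evOne_sixWords_opLam (hη₁ := S.tr_η i) (h0₁ := S.T.η_neg i) (hη₂ := S.tr_η i)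
    (h0₂ := S.T.η_neg i) (hη₃ := S.tr_η j) (h0₃ := S.T.η_neg j) (S.T.η_η i i) (S.T.η_η i j)
    (S.T.η_η i j) (S.T.serre_φ i j hij) k₁ k₂ l
  have z3' := z3 k₂ k₁
  have z4' := z4 k₂ k₁
  rw [sixWords_comm] at z3' z4'
  have one : ∀ i k, (L i + R i) k = (L i + R i) k ∧ evOne U ((L i + R i) k) = 0 := fun i k => by
    refine ⟨rfl, ?_⟩
    simp [L, R, evOne, opLam, opRho, sandwich_apply, letT, cvi_apply]
  have kill : ∀ i k x, evOne U ((L i + R i) k * x) = 0 := fun i k x => by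
    have h : evOne U ((L i + R i) k * x) = x.unop (evOne U ((L i + R i) k)) := rfl
    rw [h, (one i k).2, map_zero]
  have total : evOne U (sixWords q (L i + R i) (L i + R i) (L j + R j) k₁ k₂ l) = 0 := by
    simp only [sixWords, map_add, map_sub, map_smul, mul_assoc, kill, add_zero, smul_zero, sub_zero]
  simp only [sixWords_add_left, sixWords_add_mid, sixWords_add_right, map_add, L, R] at total
  simp only [L, R] at z1 z2 z3 z4 z3' z4' z5
  rw [z1, z2, z3, z4, z3', z4', z5] at total
  simp only [zero_add, add_zero] at total
  have fin : evOne U (sixWords q (opRho (letT φ η i)) (opRho (letT φ η i)) (opRho (letT φ η j))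
      k₁ k₂ l) = -sixWords q (letT φ η i) (letT φ η i) (letT φ η j) k₁ k₂ l := by
    simp [sixWords, evOne, opRho]
    module
  rw [fin, neg_eq_zero] at total
  exact total

theorem serre_D (hn : 3 ≤ n) (hq : q ≠ 0) (hd : d ≠ 0) {i j : ZMod n}
    (hij : j = i + 1 ∨ j = i - 1) (k₁ k₂ l : ℤ) :
    sixWords q (letD φ η Kp i) (letD φ η Kp i) (letD φ η Kp j) k₁ k₂ l = 0 := by
  have c := fun i j a b => (S.T_Kp i j b a).symm
  rw [sixWords_neg, neg_eq_zero]
  exact sixWords_cvi (S.lf_D i) (S.lf_D i) (S.lf_D j) (c i i) (c j i) (c j i) (c i i) (c i j)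
    (c i j) (S.K.Kp_Kp i i) (S.K.Kp_Kp i j) (S.K.Kp_Kp i j) (S.serre_T hn hq hd hij) k₁ k₂ l

theorem serre_A {i j : ZMod n}
    (hij : j = i + 1 ∨ j = i - 1) (k₁ k₂ l : ℤ) :
    sixWords q (letA e Km i) (letA e Km i) (letA e Km j) k₁ k₂ l = 0 := by
  have c := fun i j a b => (S.e_Km i j b a).symm
  exact sixWords_cvi (S.lf_A i) (S.lf_A i) (S.lf_A j) (c i i) (c j i) (c j i) (c i i) (c i j)
    (c i j) (S.K.Km_Km i i) (S.K.Km_Km i j) (S.K.Km_Km i j) (S.T.serre_e i j hij) k₁ k₂ l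

end PairSys

end SerreT

/-! ## Contractions of two currents in the presence of a third one -/

section Contraction

variable {U : Type*} [AddCommGroup U] [Module ℂ U] {q δ s : ℂ}

/-- The degree in `z₁` and `z₂`. -/
def deg12 : Exp3 →+ ℤ where
  toFun k := k.1 + k.2.1
  map_zero' := rfl
  map_add' k k' := by simp only [Prod.fst_add, Prod.snd_add]; ring

/-- The degree in `w`. -/
def deg3 : Exp3 →+ ℤ where
  toFun k := k.2.2
  map_zero' := rfl
  map_add' _ _ := rfl

/-- The exchange relations of a contraction of two currents with a third current: `X₀`, `X₁`,
`X₂` are the products in which the third current stands on the right, in the middle and on the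
left. -/
structure Contr (q δ : ℂ) (X₀ X₁ X₂ : Fam Exp3 (𝓛 U)) : Prop where
  left : (cst q * vw δ - vz₁) • X₂ = (vw δ - cst q * vz₁) • X₁
  right : (cst q * vw δ - vz₂) • X₁ = (vw δ - cst q * vz₂) • X₀

/-- The Serre combination of a contraction with a third current. -/
def contrComb (q : ℂ) (X₀ X₁ X₂ : Fam Exp3 (𝓛 U)) : Fam Exp3 (𝓛 U) :=
  X₀ - (q + q⁻¹) • X₁ + X₂

variable {X₀ X₁ X₂ : Fam Exp3 (𝓛 U)}

theorem contrComb_eq (hq : q ≠ 0) : (cst q : Lau Exp3) • contrComb q X₀ X₁ X₂ =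
    (cst q : Lau Exp3) • X₀ - (cst q ^ 2 + 1 : Lau Exp3) • X₁ +
      (cst q : Lau Exp3) • X₂ := by
  have h2 : (cst q ^ 2 + 1 : Lau Exp3) = cst (q ^ 2 + 1) := by
    rw [cst, cst, map_add, map_pow, map_one]
  have h : q * (q + q⁻¹) = q ^ 2 + 1 := by field_simp
  rw [h2, contrComb]
  simp only [cst_smul_eq, smul_add, smul_sub, smul_smul, h]

/-- The distribution with `z₁` and `z₂` exchanged. -/
def swapFam (X : Fam Exp3 (𝓛 U)) : Fam Exp3 (𝓛 U) :=
  fun k => X (k.2.1, k.1, k.2.2)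

theorem swapFam_vz₁ (X : Fam Exp3 (𝓛 U)) : swapFam (vz₁ • X) = vz₂ • swapFam X := by
  funext ⟨a, b, c⟩; simp only [swapFam, vz₁_smul, vz₂_smul]

theorem swapFam_vz₂ (X : Fam Exp3 (𝓛 U)) : swapFam (vz₂ • X) = vz₁ • swapFam X := by
  funext ⟨a, b, c⟩; simp only [swapFam, vz₁_smul, vz₂_smul]

theorem swapFam_vw (X : Fam Exp3 (𝓛 U)) : swapFam (vw δ • X) = vw δ • swapFam X := by
  funext ⟨a, b, c⟩; simp only [swapFam, vw_smul]

theorem swapFam_cst (c : ℂ) (X : Fam Exp3 (𝓛 U)) :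
    swapFam ((cst c : Lau Exp3) • X) =
      (cst c : Lau Exp3) • swapFam X := by
  funext k; simp only [swapFam, cst_smul_apply]

theorem swapFam_sub (X Y : Fam Exp3 (𝓛 U)) :
    swapFam (X - Y) = swapFam X - swapFam Y := rfl

theorem swapFam_add (X Y : Fam Exp3 (𝓛 U)) :
    swapFam (X + Y) = swapFam X + swapFam Y := rfl

theorem Kills.swap {X : Fam Exp3 (𝓛 U)} (h : Kills deg12 X) :
    Kills deg12 (swapFam X) := fun u => by
  obtain ⟨N, hN⟩ := h u
  refine ⟨N, fun k hk => hN _ ?_⟩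
  simp only [deg12, AddMonoidHom.coe_mk, ZeroHom.coe_mk] at hk ⊢
  omega

theorem Kills.swap' {X : Fam Exp3 (𝓛 U)} (h : Kills deg3 X) :
    Kills deg3 (swapFam X) := fun u => by
  obtain ⟨N, hN⟩ := h u
  exact ⟨N, fun k hk => hN _ hk⟩

theorem Kills.smul_lau {Γ : Type*} [AddCommGroup Γ] {ε : Γ →+ ℤ} {X : Fam Γ (𝓛 U)}
    (h : Kills ε X) (r : Lau Γ) : Kills ε (r • X) := by
  induction r using lau_induction generalizing X with
  | hm g =>
    intro u
    obtain ⟨M, hM⟩ := h u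
    exact ⟨M - ε g, fun k hk => by
      rw [mono_smul_apply]; exact hM _ (by rw [map_add]; omega)⟩
  | hc c =>
    intro u
    obtain ⟨M, hM⟩ := h u
    exact ⟨M, fun m hm => by simp [hM m hm]⟩
  | ha r r' hr hr' => rw [add_smul]; exact (hr h).add (hr' h)
  | hmul r r' hr hr' => rw [mul_smul]; exact hr (hr' h)

theorem Kills.contrComb {ε : Exp3 →+ ℤ} (h₀ : Kills ε X₀) (h₁ : Kills ε X₁) (h₂ : Kills ε X₂) :
    Kills ε (contrComb q X₀ X₁ X₂) := by
  have := (h₀.add (h₁.const_smul (-(q + q⁻¹)))).add h₂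
  rwa [neg_smul, ← sub_eq_add_neg] at this

namespace Contr

theorem smul (h : Contr q δ X₀ X₁ X₂) (c : ℂ) : Contr q δ (c • X₀) (c • X₁) (c • X₂) := by
  constructor
  · rw [← cst_smul_eq, ← cst_smul_eq, smul_comm, h.left, smul_comm]
  · rw [← cst_smul_eq, ← cst_smul_eq, smul_comm, h.right, smul_comm]

theorem sub {Y₀ Y₁ Y₂ : Fam Exp3 (𝓛 U)} (h : Contr q δ X₀ X₁ X₂)
    (h' : Contr q δ Y₀ Y₁ Y₂) : Contr q δ (X₀ - Y₀) (X₁ - Y₁) (X₂ - Y₂) :=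
  ⟨by rw [smul_sub, smul_sub, h.left, h'.left], by rw [smul_sub, smul_sub, h.right, h'.right]⟩

theorem mul_right_eq (hq : q ≠ 0) (h : Contr q δ X₀ X₁ X₂) :
    (cst q * vw δ - vz₁) • (cst q * vw δ - vz₂) •
      (cst q : Lau Exp3) • contrComb q X₀ X₁ X₂ =
      ((cst q ^ 2 - 1) * vw δ) • (cst q ^ 2 * vz₂ - vz₁) • X₀ := by
  rw [contrComb_eq hq]
  exact serreTail_mul h.left h.right

theorem mul_left_eq (hq : q ≠ 0) (h : Contr q δ X₀ X₁ X₂) :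
    (vw δ - cst q * vz₁) • (vw δ - cst q * vz₂) •
      (cst q : Lau Exp3) • contrComb q X₀ X₁ X₂ =
      ((cst q ^ 2 - 1) * vw δ) • (cst q ^ 2 * vz₂ - vz₁) • X₂ := by
  rw [contrComb_eq hq]
  exact serreTail_mul' h.left h.right

theorem mul_right_eq_swap (hq : q ≠ 0) (h : Contr q δ X₀ X₁ X₂) :
    (cst q * vw δ - vz₁) • (cst q * vw δ - vz₂) •
      (cst q : Lau Exp3) • swapFam (contrComb q X₀ X₁ X₂) =
      ((cst q ^ 2 - 1) * vw δ) • (cst q ^ 2 * vz₁ - vz₂) • swapFam X₀ := by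
  have := congrArg swapFam (h.mul_right_eq hq)
  rw [smul_comm]
  simpa only [sub_smul, mul_smul, swapFam_sub, swapFam_vz₁, swapFam_vz₂, swapFam_vw, swapFam_cst,
    sq, one_smul] using this

theorem mul_left_eq_swap (hq : q ≠ 0) (h : Contr q δ X₀ X₁ X₂) :
    (vw δ - cst q * vz₁) • (vw δ - cst q * vz₂) •
      (cst q : Lau Exp3) • swapFam (contrComb q X₀ X₁ X₂) =
      ((cst q ^ 2 - 1) * vw δ) • (cst q ^ 2 * vz₁ - vz₂) • swapFam X₂ := by
  have := congrArg swapFam (h.mul_left_eq hq)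
  rw [smul_comm]
  simpa only [sub_smul, mul_smul, swapFam_sub, swapFam_vz₁, swapFam_vz₂, swapFam_vw, swapFam_cst,
    sq, one_smul] using this

end Contr

/-- Division by `α z^g - β z^h`, expanded in the direction of `h - g`. -/
theorem exists_divide {Γ : Type*} [AddCommGroup Γ] {ε : Γ →+ ℤ} {X : Fam Γ (𝓛 U)}
    (hX : Kills ε X) {g h : Γ} (hε : 0 < ε (h - g)) {α β : ℂ} (hα : α ≠ 0) (α' β' : ℂ) :
    ∃ Y : Fam Γ (𝓛 U), Kills ε Y ∧
      (cst α * mono g - cst β * mono h : Lau Γ) • Y =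
        (cst α' * mono g - cst β' * mono h : Lau Γ) • X := by
  set σ := h - g with hσ
  have hE : EvZ σ X := hX.evZ hε
  set G : PowerSeries ℂ := (1 - PowerSeries.C (α⁻¹ * β) * PowerSeries.X)⁻¹ *
    (PowerSeries.C (α⁻¹ * α') - PowerSeries.C (α⁻¹ * β') * PowerSeries.X) with hG
  refine ⟨ts G σ X, fun u => ?_, ?_⟩
  · obtain ⟨N, hN⟩ := hX u
    refine ⟨N, fun k hk => ?_⟩
    rw [ts_apply _ hE]
    refine (finsum_congr fun m => ?_).trans finsum_zero
    rw [hN, smul_zero]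
    rw [map_add, map_nsmul, nsmul_eq_mul]
    have : 0 ≤ (m : ℤ) * ε σ := by positivity
    omega
  · have := linear_smul_ts hE (a := α⁻¹ * α') (b := α⁻¹ * β') (c := α⁻¹ * β) (g := G) (by
      rw [hG, ← mul_assoc, PowerSeries.mul_inv_cancel _ (by simp), one_mul])
    have e : ∀ a b : ℂ, (cst a * mono g - cst b * mono h : Lau Γ) =
        (cst α * mono g) * (cst (α⁻¹ * a) - cst (α⁻¹ * b) * mono σ) := fun a b => by
      have m : (mono h : Lau Γ) = mono g * mono σ := by
        rw [mono, mono, mono, ← map_mul, ← ofAdd_add, hσ, add_sub_cancel]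
      have c : ∀ a : ℂ, (cst a : Lau Γ) = cst α * cst (α⁻¹ * a) := fun a => by
        rw [← cst_mul, mul_inv_cancel_left₀ hα]
      rw [m, c a, c b]
      ring
    rw [e α β, e α' β', inv_mul_cancel₀ hα, cst_one, mul_smul _ (1 - _), this,
      mul_smul _ (cst _ - _)]

theorem deg12_u : 0 < deg12 (((1, 0, 0) : Exp3) - (0, 0, 1)) := by simp [deg12]
theorem deg3_u : 0 < deg3 (((0, 0, 1) : Exp3) - (0, 1, 0)) := by simp [deg3]

theorem Contr.exists_of_left (hδ : δ ≠ 0) (h₂ : Kills deg12 X₂) (h₀ : Kills deg12 X₀)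
    (h : (cst q * vw δ - vz₁) • (cst q * vw δ - vz₂) • X₂ =
      (vw δ - cst q * vz₁) • (vw δ - cst q * vz₂) • X₀) :
    ∃ X₁, Contr q δ X₀ X₁ X₂ ∧ Kills deg12 X₁ := by
  obtain ⟨Y, hY, e⟩ := exists_divide h₂ deg12_u hδ (β := q) (q * δ) 1
  rw [← form_v₁, ← form_u₁] at e
  refine ⟨Y, ⟨e.symm, ?_⟩, hY⟩
  have c := fun {X : Fam Exp3 (𝓛 U)} (h : Kills deg12 X) => h.evZ deg12_u
  refine EvZ.eq_of_smul (c (hY.smul_lau _)) (c (h₀.smul_lau _)) (p := vw δ - cst q * vz₁)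
    (fun Z hZ h0 => cancel_v₁' hδ (by simpa using hZ) h0) ?_
  rw [← h, smul_comm, e, smul_comm]

theorem Contr.exists_of_right (h₀ : Kills deg3 X₀) (h₂ : Kills deg3 X₂)
    (h : (cst q * vw δ - vz₁) • (cst q * vw δ - vz₂) • X₂ =
      (vw δ - cst q * vz₁) • (vw δ - cst q * vz₂) • X₀) :
    ∃ X₁, Contr q δ X₀ X₁ X₂ ∧ Kills deg3 X₁ := by
  obtain ⟨Y, hY, e⟩ := exists_divide h₀ deg3_u (one_ne_zero (α := ℂ)) (β := q * δ) q δ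
  have e' : (cst q * vw δ - vz₂) • Y = (vw δ - cst q * vz₂) • X₀ := by
    rw [form_u₂, form_v₂, ← neg_inj, ← neg_smul, ← neg_smul, neg_sub, neg_sub, e]
  refine ⟨Y, ⟨?_, e'⟩, hY⟩
  have c := fun {X : Fam Exp3 (𝓛 U)} (h : Kills deg3 X) => h.evZ deg3_u
  refine EvZ.eq_of_smul (c (h₂.smul_lau _)) (c (hY.smul_lau _)) (p := cst q * vw δ - vz₂)
    (fun Z hZ h0 => cancel_u₂' (by simpa using hZ) h0) ?_
  rw [smul_comm, h, smul_comm (cst q * vw δ - vz₂), e']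

/-! ### Contractions by delta functions -/

/-- The product of a distribution in `z₁`, `z₂` and a current in `w`. -/
def famR (Θ : Fam (ℤ × ℤ) (𝓛 U)) (F : ℤ → 𝓛 U) : Fam Exp3 (𝓛 U) :=
  fun k => Θ (k.1, k.2.1) * F k.2.2

/-- The product of a current in `w` and a distribution in `z₁`, `z₂`. -/
def famL (Θ : Fam (ℤ × ℤ) (𝓛 U)) (F : ℤ → 𝓛 U) : Fam Exp3 (𝓛 U) :=
  fun k => F k.2.2 * Θ (k.1, k.2.1)

variable {K K' F : ℤ → 𝓛 U}

/-- The direction of the delta function in `z₁ / z₂`. -/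
abbrev dir12 : Exp3 := (1, -1, 0)

theorem dlLF_XYF (hK : ∀ k, 0 < k → K k = 0) (hK' : Truncated K') :
    DlLF dir12 (wXYF LinearMap.id K K' F) := fun k u => by
  have := dlLF_of_truncated hK hK' (k.1, k.2.1) (F k.2.2 u)
  simpa [wXYF, pr] using this

theorem dlLF_FXY (hK : ∀ k, 0 < k → K k = 0) (hK' : Truncated K') :
    DlLF dir12 (wFXY LinearMap.id K K' F) := fun k => by
  have := (dlLF_of_truncated hK hK' (k.1, k.2.1)).mul_left fun _ => F k.2.2
  simpa [wFXY, pr, mul_assoc] using this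

theorem dlLF_XFY (hK : ∀ k, 0 < k → K k = 0) (hK' : Truncated K') :
    DlLF dir12 (wXFY LinearMap.id K K' F) := fun k u => by
  obtain ⟨M, hM⟩ := hK' u
  refine (Set.finite_Icc (k.2.1 - M) (-k.1)).subset fun t ht => ?_
  simp only [Function.mem_support, wXFY, LinearMap.id_apply, Prod.snd_add, Prod.fst_add,
    Prod.smul_fst, Prod.smul_snd, smul_eq_mul, mul_one] at ht
  rw [Set.mem_Icc]
  refine ⟨?_, ?_⟩ <;> by_contra hlt <;> apply ht
  · rw [Module.End.mul_apply, hM _ (by omega), map_zero]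
  · rw [hK _ (by omega), zero_mul, zero_mul, LinearMap.zero_apply]

theorem famR_dl (hK : ∀ k, 0 < k → K k = 0) (hK' : Truncated K') :
    famR (dl s (1, -1) (pr K K')) F = dl s dir12 (wXYF LinearMap.id K K' F) := by
  funext k
  simp only [famR, dl]
  rw [locSum_mul ((dlLF_of_truncated hK hK' (k.1, k.2.1)).smul _)]
  simp [wXYF, pr]

theorem famL_dl (hK : ∀ k, 0 < k → K k = 0) (hK' : Truncated K') :
    famL (dl s (1, -1) (pr K K')) F = dl s dir12 (wFXY LinearMap.id K K' F) := by
  funext k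
  simp only [famL, dl]
  rw [mul_locSum ((dlLF_of_truncated hK hK' (k.1, k.2.1)).smul _)]
  simp [wFXY, pr, mul_assoc]

theorem contr_dl (hK : ∀ k, 0 < k → K k = 0) (hK' : Truncated K') (h : SerreRel q δ K F)
    (h' : SerreRel q δ K' F) :
    Contr q δ (famR (dl s (1, -1) (pr K K')) F) (dl s dir12 (wXFY LinearMap.id K K' F))
      (famL (dl s (1, -1) (pr K K')) F) := by
  rw [famR_dl hK hK', famL_dl hK hK']
  exact ⟨dl_relation (dlLF_FXY hK hK') (dlLF_XFY hK hK') h.word_FXY,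
    dl_relation (dlLF_XFY hK hK') (dlLF_XYF hK hK') h'.word_XFY⟩

theorem kills_dl_XFY (hK : ∀ k, 0 < k → K k = 0) (hK' : Truncated K') :
    Kills deg12 (dl s dir12 (wXFY LinearMap.id K K' F)) := fun u => by
  obtain ⟨M, hM⟩ := hK' u
  refine ⟨M, fun k hk => ?_⟩
  rw [dl, locSum_apply ((dlLF_XFY hK hK' k).smul _)]
  refine (finsum_congr fun t => ?_).trans finsum_zero
  simp only [deg12, AddMonoidHom.coe_mk, ZeroHom.coe_mk] at hk
  simp only [wXFY, LinearMap.id_apply, Prod.snd_add, Prod.fst_add, LinearMap.smul_apply,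
    Prod.smul_fst, Prod.smul_snd, smul_eq_mul, mul_one]
  by_cases h : 0 < k.1 + t
  · rw [hK _ h, zero_mul, zero_mul, LinearMap.zero_apply, smul_zero]
  · rw [Module.End.mul_apply, hM _ (by omega), map_zero, smul_zero]

theorem dl_apply_eq_zero (hK : ∀ k, 0 < k → K k = 0) {u : U} {M : ℤ}
    (hM : ∀ k, M < k → K' k u = 0) {k l : ℤ} (hk : M < k + l) (hK' : Truncated K') :
    dl s (1, -1) (pr K K') (k, l) u = 0 := by
  rw [dl, locSum_apply ((dlLF_of_truncated hK hK' (k, l)).smul _)]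
  refine (finsum_congr fun t => ?_).trans finsum_zero
  simp only [pr, Prod.snd_add, Prod.fst_add, LinearMap.smul_apply,
    Prod.smul_fst, Prod.smul_snd, smul_eq_mul, mul_one]
  by_cases h : 0 < k + t
  · rw [hK _ h, zero_mul, LinearMap.zero_apply, smul_zero]
  · rw [Module.End.mul_apply, hM _ (by omega), map_zero, smul_zero]

theorem kills_famL (hK : ∀ k, 0 < k → K k = 0) (hK' : Truncated K') :
    Kills deg12 (famL (dl s (1, -1) (pr K K')) F) := fun u => by
  obtain ⟨M, hM⟩ := hK' u
  refine ⟨M, fun k hk => ?_⟩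
  rw [famL, Module.End.mul_apply, dl_apply_eq_zero hK hM hk hK', map_zero]

end Contraction

/-! ## The right-hand sides of the Serre relations -/

section Tail

variable {U : Type*} [AddCommGroup U] [Module ℂ U] {q δ s : ℂ} {K K' F : ℤ → 𝓛 U}

theorem evZ_dl_XFY (hK' : Truncated K') (h0 : ∀ k, k < 0 → K' k = 0) (hF : Truncated F)
    (hK : ∀ k, 0 < k → K k = 0) :
    EvZ (0, -1, 1) (dl s dir12 (wXFY LinearMap.id K K' F)) := fun u k => by
  obtain ⟨M, hM⟩ := hK' u
  choose N hN using fun b : ℤ => hF (K' b u)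
  obtain ⟨B, hB⟩ := ((Set.finite_Icc (0 : ℤ) M).image N).bddAbove
  refine ⟨(B - k.2.2 + 1).toNat, fun m hm => ?_⟩
  rw [dl, locSum_apply ((dlLF_XFY hK hK' _).smul _)]
  refine (finsum_congr fun t => ?_).trans finsum_zero
  simp only [wXFY, LinearMap.id_apply, Prod.snd_add, Prod.fst_add, LinearMap.smul_apply,
    Prod.smul_mk, smul_eq_mul, mul_one, smul_zero, mul_neg, mul_zero, add_zero]
  simp only [nsmul_eq_mul, mul_neg, mul_one]
  set b := k.2.1 + -(m : ℤ) + -t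
  rw [Module.End.mul_apply, Module.End.mul_apply]
  rcases lt_or_ge b 0 with hb | hb
  · rw [h0 b hb]; simp
  rcases lt_or_ge M b with hb' | hb'
  · rw [hM b hb']; simp
  · rw [hN b _ (lt_of_le_of_lt (hB ⟨b, ⟨hb, hb'⟩, rfl⟩) (by omega)), map_zero, smul_zero]

theorem evZ_famR {Θ : Fam (ℤ × ℤ) (𝓛 U)} (hF : Truncated F) :
    EvZ (0, -1, 1) (famR Θ F) := fun u k => by
  obtain ⟨N, hN⟩ := hF u
  refine ⟨(N - k.2.2 + 1).toNat, fun m hm => ?_⟩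
  rw [famR, Module.End.mul_apply, hN, map_zero]
  simp
  omega

theorem linear_mul_geom (c : ℂ) : (1 - PowerSeries.C c * PowerSeries.X) *
    PowerSeries.mk (fun m => c ^ m) = 1 := by
  ext m
  rw [sub_mul, one_mul, mul_assoc, map_sub, PowerSeries.coeff_C_mul]
  cases m with
  | zero => simp
  | succ m =>
    rw [PowerSeries.coeff_succ_X_mul, PowerSeries.coeff_mk, PowerSeries.coeff_mk, pow_succ',
      sub_self, PowerSeries.coeff_one, if_neg (Nat.succ_ne_zero m)]

theorem Contr.left_eq_ts {X₀ X₁ X₂ : Fam Exp3 (𝓛 U)} (hq : q ≠ 0) (hδ : δ ≠ 0)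
    (h : Contr q δ X₀ X₁ X₂) (kn' : EvZ (1, 0, -1) X₁) (kl' : EvZ (1, 0, -1) X₂) :
    X₂ = q • X₁ + (q⁻¹ - q) •
      ts (PowerSeries.mk fun m => (q⁻¹ * δ⁻¹) ^ m) (1, 0, -1) X₁ := by
  have hL := h.left
  set a := q⁻¹ * δ⁻¹ with ha
  have t₁ := linear_smul_ts kn' (a := 1) (b := 0) (c := a)
    (g := (PowerSeries.mk fun m => a ^ m)) (by rw [linear_mul_geom]; simp)
  have eT := kn'.ts (PowerSeries.mk fun m => a ^ m)
  generalize ts (PowerSeries.mk fun m => a ^ m) (1, 0, -1) X₁ = T₁ at t₁ eT ⊢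
  rw [← cst_smul_eq (Γ := Exp3) q, ← cst_smul_eq (Γ := Exp3) (q⁻¹ - q)]
  refine EvZ.eq_of_smul kl' ((kn'.smul _).add (eT.smul _))
    (p := cst q * vw δ - vz₁) (fun Z hZ h0 => cancel_u₁ hq hδ hZ h0) ?_
  have hu : (cst q * vw δ - vz₁ : Lau Exp3) =
      (cst q * vw δ) * (1 - cst a * mono (1, 0, -1)) := by
    have hw : (mono (0, 0, 1) * mono (1, 0, -1) : Lau Exp3) = mono (1, 0, 0) := by
      rw [mono, mono, mono, ← map_mul]; rfl
    have hc : (cst q * cst δ * cst a : Lau Exp3) = 1 := by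
      rw [← cst_mul, ← cst_mul, ← cst_one]
      congr 1
      rw [ha]; field_simp
    rw [vw, vz₁, ← hw]
    linear_combination (mono (0, 0, 1) * mono (1, 0, -1) : Lau Exp3) * hc
  have hT : (cst q * vw δ - vz₁ : Lau Exp3) • T₁ = (cst q * vw δ) • X₁ := by
    have h0 : (cst 0 : Lau Exp3) = 0 := map_zero _
    rw [hu, mul_smul, t₁, cst_one, h0, zero_mul, sub_zero, one_smul]
  have hqq : (cst q * cst (q⁻¹ - q) : Lau Exp3) = 1 - cst q * cst q := by
    rw [← cst_mul, ← cst_mul, ← cst_one, mul_sub, mul_inv_cancel₀ hq]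
    simp [cst, map_sub]
  rw [hL, smul_add, smul_comm _ (cst (q⁻¹ - q)), hT, smul_smul, smul_smul, ← add_smul]
  congr 1
  linear_combination -(vw δ) * hqq

theorem Contr.right_eq_ts {X₀ X₁ X₂ : Fam Exp3 (𝓛 U)} (hq : q ≠ 0)
    (h : Contr q δ X₀ X₁ X₂) (en : EvZ (0, -1, 1) X₁) (er : EvZ (0, -1, 1) X₀) :
    X₀ = q⁻¹ • X₁ + (q⁻¹ - q) •
      ts (PowerSeries.C (q⁻¹ * δ) * PowerSeries.X * PowerSeries.mk fun m => (q⁻¹ * δ) ^ m)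
          (0, -1, 1) X₁ := by
  have hR := h.right
  set b := q⁻¹ * δ with hb
  have t₂ := linear_smul_ts en (a := 0) (b := -b) (c := b)
    (g := (PowerSeries.C b * PowerSeries.X) * (PowerSeries.mk fun m => b ^ m)) (by
      rw [mul_left_comm, linear_mul_geom]; simp)
  have eT := en.ts ((PowerSeries.C b * PowerSeries.X) * (PowerSeries.mk fun m => b ^ m))
  generalize ts ((PowerSeries.C b * PowerSeries.X) * (PowerSeries.mk fun m => b ^ m))
    (0, -1, 1) X₁ = T₂ at t₂ eT ⊢
  rw [← cst_smul_eq (Γ := Exp3) q⁻¹, ← cst_smul_eq (Γ := Exp3) (q⁻¹ - q)]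
  refine EvZ.eq_of_smul er ((en.smul _).add (eT.smul _))
    (p := vw δ - cst q * vz₂) (fun Z hZ h0 => cancel_v₂ hq hZ h0) ?_
  have hu : (vw δ - cst q * vz₂ : Lau Exp3) =
      -(cst q * vz₂) * (1 - cst b * mono (0, -1, 1)) := by
    have hw : (mono (0, 1, 0) * mono (0, -1, 1) : Lau Exp3) = mono (0, 0, 1) := by
      rw [mono, mono, mono, ← map_mul]; rfl
    have hc : (cst q * cst b : Lau Exp3) = cst δ := by
      rw [← cst_mul]
      congr 1
      rw [hb]; field_simp
    rw [vw, vz₂, ← hw, ← hc]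
    ring
  have hT : (vw δ - cst q * vz₂ : Lau Exp3) • T₂ = -(vw δ) • X₁ := by
    have h2 : (cst 0 - cst (-b) * mono (0, -1, 1) : Lau Exp3) =
        cst b * mono (0, -1, 1) := by simp [cst]
    have h3 : vw δ = cst q * vz₂ * (cst b * mono (0, -1, 1)) := by linear_combination hu
    rw [hu, mul_smul, t₂, h2, smul_smul, h3]
    congr 1
    ring
  have hqq : (cst (q⁻¹ - q) : Lau Exp3) = cst q⁻¹ - cst q := by
    simp [cst, map_sub]
  have hq1 : (cst q * cst q⁻¹ : Lau Exp3) = 1 := by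
    rw [← cst_mul, mul_inv_cancel₀ hq, cst_one]
  rw [← hR, smul_add, smul_comm _ (cst (q⁻¹ - q)), hT, smul_smul, smul_smul, ← add_smul]
  congr 1
  linear_combination (vw δ) * hqq + vz₂ * hq1

theorem Contr.contrComb_eq_ts {X₀ X₁ X₂ : Fam Exp3 (𝓛 U)} (hq : q ≠ 0) (hδ : δ ≠ 0)
    (h : Contr q δ X₀ X₁ X₂) (kn' : EvZ (1, 0, -1) X₁) (kl' : EvZ (1, 0, -1) X₂)
    (en : EvZ (0, -1, 1) X₁) (er : EvZ (0, -1, 1) X₀) :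
    contrComb q X₀ X₁ X₂ = (q⁻¹ - q) •
      (ts (PowerSeries.mk fun m => (q⁻¹ * δ⁻¹) ^ m) (1, 0, -1) X₁ +
        ts (PowerSeries.C (q⁻¹ * δ) * PowerSeries.X * PowerSeries.mk fun m => (q⁻¹ * δ) ^ m)
          (0, -1, 1) X₁) := by
  have e₁ := h.left_eq_ts hq hδ kn' kl'
  have e₂ := h.right_eq_ts hq en er
  generalize ts (PowerSeries.mk fun m => (q⁻¹ * δ⁻¹) ^ m) (1, 0, -1) X₁ = T₁ at e₁ ⊢
  generalize ts (PowerSeries.C (q⁻¹ * δ) * PowerSeries.X * PowerSeries.mk fun m => (q⁻¹ * δ) ^ m)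
    (0, -1, 1) X₁ = T₂ at e₂ ⊢
  rw [contrComb, e₁, e₂]
  module

theorem locFin_serreTail_left (a s : ℂ) (hK : ∀ k, 0 < k → K k = 0) (hK' : Truncated K')
    (F : ℤ → 𝓛 U) (k₁ k₂ l : ℤ) :
    LocFin fun p : ℕ × ℤ => (a ^ p.1 * s ^ p.2) •
        (K (k₁ + p.1 + p.2) * F (l - p.1) * K' (k₂ - p.2)) := by
  refine LocFin.smul (fun u => ?_) _
  obtain ⟨M, hM⟩ := hK' u
  refine ((Set.finite_Iic (-k₁ - k₂ + M).toNat).prod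
    (Set.finite_Icc (k₂ - M) (-k₁))).subset fun p hp => ?_
  simp only [Function.mem_support] at hp
  have f1 : k₁ + p.1 + p.2 ≤ 0 := by
    by_contra h; exact hp (by rw [hK _ (by omega)]; simp)
  have f2 : k₂ - p.2 ≤ M := by
    by_contra h
    exact hp (by rw [Module.End.mul_apply, hM _ (by omega), map_zero])
  simp only [Set.mem_prod, Set.mem_Icc, Set.mem_Iic]
  omega

theorem locFin_serreTail_right (b s : ℂ) (hK : ∀ k, 0 < k → K k = 0) (hK' : Truncated K')
    (h0 : ∀ k, k < 0 → K' k = 0) (hF : Truncated F) (k₁ k₂ l : ℤ) :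
    LocFin fun p : ℕ × ℤ => (b ^ (p.1 + 1) * s ^ p.2) •
        (K (k₁ + p.2) * F (l + (p.1 + 1)) * K' (k₂ - (p.1 + 1) - p.2)) := by
  refine LocFin.smul (fun u => ?_) _
  obtain ⟨M, hM⟩ := hK' u
  choose N hN using fun b : ℤ => hF (K' b u)
  obtain ⟨B, hB⟩ := ((Set.finite_Icc (0 : ℤ) M).image N).bddAbove
  refine ((Set.finite_Iic (B - l).toNat).prod
    (Set.finite_Icc (k₂ - 1 - M - (B - l).toNat) (-k₁))).subset fun p hp => ?_
  simp only [Function.mem_support] at hp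
  have f1 : k₁ + p.2 ≤ 0 := by
    by_contra h; exact hp (by rw [hK _ (by omega)]; simp)
  have f2 : k₂ - (p.1 + 1) - p.2 ≤ M := by
    by_contra h
    exact hp (by rw [Module.End.mul_apply, hM _ (by omega), map_zero])
  have f3 : 0 ≤ k₂ - (p.1 + 1) - p.2 := by
    by_contra h; exact hp (by rw [h0 _ (by omega)]; simp)
  have f4 : l + (p.1 + 1) ≤ B := by
    by_contra h
    refine hp ?_
    rw [Module.End.mul_apply, Module.End.mul_apply,
      hN _ _ (lt_of_le_of_lt (hB ⟨_, ⟨f3, f2⟩, rfl⟩) (by omega)), map_zero]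
  simp only [Set.mem_prod, Set.mem_Icc, Set.mem_Iic]
  omega

theorem serreTail_eq_ts (a b : ℂ) (hK : ∀ k, 0 < k → K k = 0) (hK' : Truncated K')
    (h0 : ∀ k, k < 0 → K' k = 0) (hF : Truncated F) (k₁ k₂ l : ℤ) :
    (ts (PowerSeries.mk fun m => a ^ m) (1, 0, -1) (dl s dir12 (wXFY LinearMap.id K K' F)) +
      ts (PowerSeries.C b * PowerSeries.X * PowerSeries.mk fun m => b ^ m) (0, -1, 1)
        (dl s dir12 (wXFY LinearMap.id K K' F))) (k₁, k₂, l) = serreTail s a b K F K' k₁ k₂ l := by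
  have en := evZ_dl_XFY (s := s) hK' h0 hF hK
  rw [fam_add_apply, serreTail]
  congr 1
  · have lf := locFin_serreTail_left a s hK hK' F k₁ k₂ l
    rw [← locSum_equiv (Equiv.prodComm ℕ ℤ)]
    simp only [Equiv.prodComm_apply, Prod.fst_swap, Prod.snd_swap]
    rw [locSum_prod lf, ts]
    congr 1
    funext m
    rw [PowerSeries.coeff_mk, dl, ← locSum_smul ((dlLF_XFY hK hK' _).smul _)]
    simp [wXFY, smul_smul, sub_eq_add_neg, add_assoc]
  · have lf := locFin_serreTail_right b s hK hK' h0 hF k₁ k₂ l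
    rw [← locSum_equiv (Equiv.prodComm ℕ ℤ)]
    simp only [Equiv.prodComm_apply, Prod.fst_swap, Prod.snd_swap]
    rw [locSum_prod lf, mul_assoc, ts_C_mul _ _ en, ts_X_mul _ en, cst_smul_apply,
      mono_smul_apply, ts, ← locSum_smul ((en.locFin _).smul _)]
    congr 1
    funext m
    rw [PowerSeries.coeff_mk, dl, smul_smul, ← pow_succ',
      ← locSum_smul ((dlLF_XFY hK hK' _).smul _)]
    congr 1
    funext t
    simp only [wXFY, smul_smul, LinearMap.id_apply, Prod.mk_add_mk, Prod.smul_mk, smul_eq_mul,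
      nsmul_eq_mul, mul_one, mul_zero, add_zero, smul_zero, mul_neg]
    congr 4 <;> ring

theorem contrComb_dl (hq : q ≠ 0) (hδ : δ ≠ 0) (hK : ∀ k, 0 < k → K k = 0) (hK' : Truncated K')
    (h0 : ∀ k, k < 0 → K' k = 0) (hF : Truncated F) (h : SerreRel q δ K F)
    (h' : SerreRel q δ K' F) (k₁ k₂ l : ℤ) :
    contrComb q (famR (dl s (1, -1) (pr K K')) F) (dl s dir12 (wXFY LinearMap.id K K' F))
      (famL (dl s (1, -1) (pr K K')) F) (k₁, k₂, l) =
    -((q - q⁻¹) • serreTail s (q⁻¹ * δ⁻¹) (q⁻¹ * δ) K F K' k₁ k₂ l) := by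
  have kn := (kills_dl_XFY (s := s) (F := F) hK hK').evZ deg12_u
  have kl := (kills_famL (s := s) (F := F) hK hK').evZ deg12_u
  rw [(contr_dl (s := s) hK hK' h h').contrComb_eq_ts hq hδ (by simpa using kn) (by simpa using kl)
    (evZ_dl_XFY hK' h0 hF hK) (evZ_famR hF), fam_smul_apply, serreTail_eq_ts _ _ hK hK' h0 hF]
  module

end Tail

/-! ## Exchange of contractions with the summands of the coaction -/

section Combined

variable {U : Type*} [AddCommGroup U] [Module ℂ U] {n : ℕ} {q d s r : ℂ}
variable {e φ η ζ ζp E Kp Km : ZMod n → ℤ → 𝓛 U} {Φ Ψ Ω : Filt U}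

theorem QuadRel.serreRel (hn : 3 ≤ n) (hq : q ≠ 0) (hd : d ≠ 0) {i j : ZMod n}
    (hij : j = i + 1 ∨ j = i - 1) {X F : ℤ → 𝓛 U} (h : QuadRel q d i j X F) :
    SerreRel q (serreParam d i j) X F :=
  QuadRelIn.serreRel hn hq hd hij (quadRel_iff.1 h)

theorem QuadRel.selfRel (hn : 3 ≤ n) {i : ZMod n} {X F : ℤ → 𝓛 U}
    (h : QuadRel q d i i X F) : SelfRel q X F :=
  QuadRelIn.selfRel hn (quadRel_iff.1 h)

theorem den_adj (hn : 3 ≤ n) {i j : ZMod n} (hij : j = i + 1 ∨ j = i - 1) (s : ℂ) :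
    den q d i j s = lw 1 (q⁻¹ * (serreParam d i j)⁻¹ * s) := by
  rcases hij with rfl | rfl
  · rw [den, gCoef_succ' hn, serreParam, if_pos rfl]
  · rw [den, gCoef_pred' hn, serreParam, if_neg (zmod_succ_ne_pred hn i).symm, inv_inv]

theorem num_adj (hn : 3 ≤ n) (hd : d ≠ 0) {i j : ZMod n} (hij : j = i + 1 ∨ j = i - 1) (s : ℂ) :
    num q d i j s = lw q⁻¹ ((serreParam d i j)⁻¹ * s) := by
  rcases hij with rfl | rfl
  · rw [num, gCoef_succ hn, dCoef_succ hn, serreParam, if_pos rfl]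
    congr 1; field_simp
  · rw [num, gCoef_pred hn, dCoef_pred, serreParam, if_neg (zmod_succ_ne_pred hn i).symm, inv_inv]
    congr 1; field_simp

theorem adj_symm {i j : ZMod n} (hij : j = i + 1 ∨ j = i - 1) : i = j + 1 ∨ i = j - 1 := by
  rcases hij with rfl | rfl <;> simp

theorem serreParam_symm (hn : 3 ≤ n) {i j : ZMod n} (hij : j = i + 1 ∨ j = i - 1) :
    serreParam d j i = (serreParam d i j)⁻¹ := by
  rcases hij with rfl | rfl
  · have : i ≠ i + 1 + 1 := fun h => zmod_two_ne_zero hn (by linear_combination -h)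
    simp [serreParam, this]
  · simp [serreParam, (zmod_succ_ne_pred hn i).symm]

theorem dl_vz (hs : s ≠ 0) {X : Fam Exp3 (𝓛 U)} (hX : DlLF dir12 X) :
    vz₂ • dl s dir12 X = (cst s * vz₁) • dl s dir12 X := by
  have h : (cst s * vz₁ : Lau Exp3) = vz₂ * (cst s * mono dir12) := by
    have hw : (mono (0, 1, 0) * mono dir12 : Lau Exp3) = mono (1, 0, 0) := by
      rw [mono, mono, mono, ← map_mul]; rfl
    rw [vz₁, vz₂, ← hw]; ring
  rw [h, mul_smul, dl_eigen hs hX]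

theorem slice_left (a : ℤ → 𝓛 U) (α β : ℂ) (X : Fam (ℤ × ℤ) (𝓛 U)) :
    (fun k : Exp3 => (lw α β • X) (k.1, k.2.2) * a k.2.1) =
      (cst α * mono (0, 0, 1) - cst β * mono (1, 0, 0) : Lau Exp3) •
        fun k : Exp3 => X (k.1, k.2.2) * a k.2.1 := by
  funext ⟨k₁, k₂, l⟩
  simp [lw_smul_apply, sub_smul, mul_smul, sub_mul]

theorem slice_right (a : ℤ → 𝓛 U) (α β : ℂ) (X : Fam (ℤ × ℤ) (𝓛 U)) :
    (fun k : Exp3 => a k.1 * (lw α β • X) (k.2.2, k.2.1)) =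
      (cst α * mono (0, 1, 0) - cst β * mono (0, 0, 1) : Lau Exp3) •
        fun k : Exp3 => a k.1 * X (k.2.2, k.2.1) := by
  funext ⟨k₁, k₂, l⟩
  simp [lw_smul_apply, sub_smul, mul_smul, mul_sub]

theorem cst_mul_sub {Γ : Type*} [AddCommGroup Γ] (a b c : ℂ) (m m' : Lau Γ) :
    cst a * (cst b * m - cst c * m') = cst (a * b) * m - cst (a * c) * m' := by
  rw [cst_mul, cst_mul]; ring

/-- The exchange relation between a current and a contraction, without the middle product. -/
def CombRel (q δ : ℂ) (Θ : Fam (ℤ × ℤ) (𝓛 U)) (F : ℤ → 𝓛 U) : Prop :=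
  (cst q * vw δ - vz₁) • (cst q * vw δ - vz₂) • famL Θ F =
    (vw δ - cst q * vz₁) • (vw δ - cst q * vz₂) • famR Θ F

theorem CombRel.neg {δ : ℂ} {Θ : Fam (ℤ × ℤ) (𝓛 U)} {F : ℤ → 𝓛 U}
    (h : CombRel q δ Θ F) : CombRel q δ Θ (-F) := by
  have e₁ : famL Θ (-F) = -famL Θ F := by funext k; simp [famL]
  have e₂ : famR Θ (-F) = -famR Θ F := by funext k; simp [famR]
  rw [CombRel, e₁, e₂]
  simp only [smul_neg]
  rw [show _ = _ from h]

theorem CombRel.cvi {δ : ℂ} {Θ : Fam (ℤ × ℤ) (𝓛 U)} {x G : ℤ → 𝓛 U}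
    (h : CombRel q δ Θ G) (hx : CviLF x G) (hc : ∀ k a, Commute (Θ k) (x a)) :
    CombRel q δ Θ (cvi x G) := by
  let ι : ℤ →+ Exp3 := (AddMonoidHom.inr ℤ (ℤ × ℤ)).comp (AddMonoidHom.inr ℤ ℤ)
  have l₁ : CvLF ι x (famL Θ G) := fun k => by
    have := (hx k.2.2).mul_right (Θ (k.1, k.2.1))
    simpa [famL, ι, mul_assoc] using this
  have l₂ : CvLF ι x (famR Θ G) := fun k => by
    have := (hx k.2.2).mul_left fun _ => Θ (k.1, k.2.1)
    simpa [famR, ι, ← mul_assoc, (hc _ _).eq] using this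
  have e₁ : famL Θ (_root_.cvi x G) = cv ι x (famL Θ G) := by
    funext k
    rw [famL, cvi_apply, cv]
    refine (locSum_mul (hx k.2.2) _).trans ?_
    simp [famL, ι, mul_assoc]
  have e₂ : famR Θ (_root_.cvi x G) = cv ι x (famR Θ G) := by
    funext k
    rw [famR, cvi_apply, cv]
    refine (mul_locSum (hx k.2.2) _).trans ?_
    simp [famR, ι, ← mul_assoc, (hc _ _).eq]
  rw [CombRel, e₁, e₂, ← mul_smul, ← mul_smul]
  exact cv_relation l₁ l₂ (by rw [mul_smul, mul_smul]; exact h)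

namespace PairSys

variable (S : PairSys n q d s r e φ η ζ ζp E Kp Km Φ Ψ Ω)
include S

theorem combRel_Kp (hn : 3 ≤ n) (hq : q ≠ 0) (hd : d ≠ 0) (hs : s ≠ 0) {i j : ZMod n}
    (hij : j = i + 1 ∨ j = i - 1) :
    CombRel q (serreParam d i j) (dl s (1, -1) (pr (Km i) (Kp i))) (Kp j) := by
  have hδ : serreParam d i j ≠ 0 := serreParam_ne_zero hd i j
  have hK := S.K.Km_pos i
  have hK' := S.K.truncated_Kp i
  have h := S.K.Kp_Km i j
  have h' := congrArg (fun X : Fam (ℤ × ℤ) (𝓛 U) =>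
    (fun k : Exp3 => X (k.1, k.2.2) * Kp i k.2.1)) h
  simp only [den_adj hn hij, num_adj hn hd hij, mul_smul, slice_left] at h'
  generalize serreParam d i j = δ at *
  have eL : (fun k : Exp3 => rp (Km i) (Kp j) (k.1, k.2.2) * Kp i k.2.1) =
      wFXY LinearMap.id (Km i) (Kp i) (Kp j) := rfl
  have eR : (fun k : Exp3 => pr (Km i) (Kp j) (k.1, k.2.2) * Kp i k.2.1) =
      wXYF LinearMap.id (Km i) (Kp i) (Kp j) := by
    funext k
    simp only [pr, wXYF, LinearMap.id_apply, mul_assoc, (S.K.Kp_Kp i j _ _).eq]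
  rw [eL, eR, ← mul_smul, ← mul_smul] at h'
  have h2 := dl_relation (c := s) (dlLF_FXY (F := Kp j) hK hK') (dlLF_XYF (F := Kp j) hK hK') h'
  rw [CombRel, famR_dl hK hK', famL_dl hK hK']
  have zL := dl_vz hs (dlLF_FXY (F := Kp j) hK hK')
  have zR := dl_vz hs (dlLF_XYF (F := Kp j) hK hK')
  generalize dl s dir12 (wFXY LinearMap.id (Km i) (Kp i) (Kp j)) = L at *
  generalize dl s dir12 (wXYF LinearMap.id (Km i) (Kp i) (Kp j)) = R at *
  have c₁ : (cst (q * δ) * (cst 1 * mono (0, 0, 1) - cst (q⁻¹ * δ⁻¹ * 1) * mono (1, 0, 0)) :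
      Lau Exp3) = cst q * vw δ - vz₁ := by
    rw [cst_mul_sub, show q * δ * (q⁻¹ * δ⁻¹ * 1) = 1 by field_simp, mul_one, vw, vz₁, cst_mul,
      cst_one]
    ring
  have c₂ : (cst (q * δ) * (cst 1 * mono (0, 0, 1) - cst (q⁻¹ * δ⁻¹ * s) * mono (1, 0, 0)) :
      Lau Exp3) = cst q * vw δ - cst s * vz₁ := by
    rw [cst_mul_sub, show q * δ * (q⁻¹ * δ⁻¹ * s) = s by field_simp, mul_one, vw, vz₁, cst_mul]
    ring
  have c₃ : (cst (q * δ) * (cst q⁻¹ * mono (0, 0, 1) - cst (δ⁻¹ * 1) * mono (1, 0, 0)) :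
      Lau Exp3) = vw δ - cst q * vz₁ := by
    rw [cst_mul_sub, show q * δ * q⁻¹ = δ by field_simp,
      show q * δ * (δ⁻¹ * 1) = q by field_simp, vw, vz₁]
  have c₄ : (cst (q * δ) * (cst q⁻¹ * mono (0, 0, 1) - cst (δ⁻¹ * s) * mono (1, 0, 0)) :
      Lau Exp3) = vw δ - cst q * (cst s * vz₁) := by
    rw [cst_mul_sub, show q * δ * q⁻¹ = δ by field_simp,
      show q * δ * (δ⁻¹ * s) = q * s by field_simp, vw, vz₁, cst_mul]
    ring
  have h3 := congrArg (fun X => (cst (q * δ) * cst (q * δ) : Lau Exp3) • X) h2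
  simp only [← mul_smul] at h3
  rw [mul_mul_mul_comm, c₁, c₂, mul_mul_mul_comm, c₃, c₄] at h3
  linear_combination (norm := module) h3 - (cst q * vw δ - vz₁ : Lau Exp3) • zL +
    ((vw δ - cst q * vz₁) * cst q : Lau Exp3) • zR

theorem combRel_Km (hn : 3 ≤ n) (hq : q ≠ 0) (hd : d ≠ 0) (hs : s ≠ 0) {i j : ZMod n}
    (hij : j = i + 1 ∨ j = i - 1) :
    CombRel q (serreParam d i j) (dl s (1, -1) (pr (Km i) (Kp i))) (Km j) := by
  have hK := S.K.Km_pos i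
  have hK' := S.K.truncated_Kp i
  have h := S.K.Kp_Km j i
  have h' := congrArg (fun X : Fam (ℤ × ℤ) (𝓛 U) =>
    (fun k : Exp3 => Km i k.1 * X (k.2.2, k.2.1))) h
  simp only [den_adj hn (adj_symm hij), num_adj hn hd (adj_symm hij), mul_smul, slice_right,
    serreParam_symm hn hij, inv_inv] at h'
  generalize serreParam d i j = δ at *
  have eR : (fun k : Exp3 => Km i k.1 * rp (Km j) (Kp i) (k.2.2, k.2.1)) =
      wXYF LinearMap.id (Km i) (Kp i) (Km j) := by
    funext k
    simp only [rp, wXYF, LinearMap.id_apply, mul_assoc]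
  have eL : (fun k : Exp3 => Km i k.1 * pr (Km j) (Kp i) (k.2.2, k.2.1)) =
      wFXY LinearMap.id (Km i) (Kp i) (Km j) := by
    funext k
    simp only [pr, wFXY, LinearMap.id_apply, ← mul_assoc, (S.K.Km_Km i j _ _).eq]
  rw [eL, eR, ← mul_smul, ← mul_smul] at h'
  have h2 := dl_relation (c := s) (dlLF_XYF (F := Km j) hK hK') (dlLF_FXY (F := Km j) hK hK') h'
  rw [CombRel, famR_dl hK hK', famL_dl hK hK']
  have zL := dl_vz hs (dlLF_FXY (F := Km j) hK hK')
  have zR := dl_vz hs (dlLF_XYF (F := Km j) hK hK')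
  generalize dl s dir12 (wFXY LinearMap.id (Km i) (Kp i) (Km j)) = L at *
  generalize dl s dir12 (wXYF LinearMap.id (Km i) (Kp i) (Km j)) = R at *
  have c₁ : (cst q * (cst 1 * mono (0, 1, 0) - cst (q⁻¹ * δ * 1) * mono (0, 0, 1)) :
      Lau Exp3) = cst q * vz₂ - vw δ := by
    rw [cst_mul_sub, show q * (q⁻¹ * δ * 1) = δ by field_simp, mul_one, vw, vz₂]
  have c₂ : (cst q * (cst 1 * mono (0, 1, 0) - cst (q⁻¹ * δ * s) * mono (0, 0, 1)) :
      Lau Exp3) = cst q * vz₂ - cst s * vw δ := by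
    rw [cst_mul_sub, show q * (q⁻¹ * δ * s) = s * δ by field_simp, mul_one, vw, vz₂, cst_mul]
    ring
  have c₃ : (cst q * (cst q⁻¹ * mono (0, 1, 0) - cst (δ * 1) * mono (0, 0, 1)) :
      Lau Exp3) = vz₂ - cst q * vw δ := by
    rw [cst_mul_sub, mul_inv_cancel₀ hq, mul_one, vw, vz₂, cst_mul, cst_one]
    ring
  have c₄ : (cst q * (cst q⁻¹ * mono (0, 1, 0) - cst (δ * s) * mono (0, 0, 1)) :
      Lau Exp3) = vz₂ - cst q * (cst s * vw δ) := by
    rw [cst_mul_sub, mul_inv_cancel₀ hq, vw, vz₂, cst_mul, cst_mul, cst_one]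
    ring
  have h3 := congrArg (fun X => (cst q * cst q : Lau Exp3) • X) h2
  simp only [← mul_smul] at h3
  rw [mul_mul_mul_comm, c₁, c₂, mul_mul_mul_comm, c₃, c₄] at h3
  have h4 : (cst s : Lau Exp3) • ((cst q * vw δ - vz₁) • (cst q * vw δ - vz₂) • L) =
      (cst s : Lau Exp3) • ((vw δ - cst q * vz₁) • (vw δ - cst q * vz₂) • R) := by
    linear_combination (norm := module) -h3 + (cst q * (cst q * vz₂ - vw δ) : Lau Exp3) • zR -
      (vz₂ - cst q * vw δ : Lau Exp3) • zL
  have h5 := congrArg (fun X => (cst s⁻¹ : Lau Exp3) • X) h4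
  simpa only [← mul_smul, ← cst_mul, ← mul_assoc, inv_mul_cancel₀ hs, cst_one, one_mul] using h5

theorem commute_dl {i : ZMod n} {x : 𝓛 U} (h : ∀ k, Commute (Km i k) x)
    (h' : ∀ k, Commute (Kp i k) x) (k : ℤ × ℤ) :
    Commute (dl s (1, -1) (pr (Km i) (Kp i)) k) x :=
  commute_locSum ((dlLF_of_truncated (S.K.Km_pos i) (S.K.truncated_Kp i) k).smul _)
    fun _ => ((h _).mul_left (h' _)).smul_left _

theorem combRel_A (hn : 3 ≤ n) (hq : q ≠ 0) (hd : d ≠ 0) (hs : s ≠ 0) {i j : ZMod n}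
    (hij : j = i + 1 ∨ j = i - 1) :
    CombRel q (serreParam d i j) (dl s (1, -1) (pr (Km i) (Kp i))) (letA e Km j) :=
  (S.combRel_Km hn hq hd hs hij).cvi (S.lf_A j) fun k a =>
    S.commute_dl (fun b => (S.e_Km j i a b).symm) (fun b => (S.e_Kp j i a b).symm) k

theorem combRel_D (hn : 3 ≤ n) (hq : q ≠ 0) (hd : d ≠ 0) (hs : s ≠ 0) {i j : ZMod n}
    (hij : j = i + 1 ∨ j = i - 1) :
    CombRel q (serreParam d i j) (dl s (1, -1) (pr (Km i) (Kp i))) (letD φ η Kp j) :=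
  ((S.combRel_Kp hn hq hd hs hij).cvi (S.lf_D j) fun k a =>
    S.commute_dl (fun b => (S.T_Km j i a b).symm) (fun b => (S.T_Kp j i a b).symm) k).neg

end PairSys

end Combined

/-! ## Serre combinations of two currents with a contraction -/

section SerreContraction

variable {U : Type*} [AddCommGroup U] [Module ℂ U] {q δ : ℂ}

/-- The operator `a` maps the filtration `Φ` to the filtration `Ξ` shifted by `m`. -/
def Filt.Maps (Φ Ξ : Filt U) (m : ℤ) (a : 𝓛 U) : Prop :=
  ∀ p u, u ∈ Φ.F p → a u ∈ Ξ.F (p + m)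

theorem Filt.Maps.mul {Φ Ξ Υ : Filt U} {m m' : ℤ} {a b : 𝓛 U} (ha : Ξ.Maps Υ m a)
    (hb : Φ.Maps Ξ m' b) : Φ.Maps Υ (m' + m) (a * b) := fun p u hu => by
  have := ha _ _ (hb p u hu)
  rwa [add_assoc] at this

theorem Filt.Raises.maps {Φ : Filt U} {m : ℤ} {a : 𝓛 U} (ha : Φ.Raises m a) :
    Φ.Maps Φ m a := ha

theorem Kills.of_maps {Γ : Type*} [AddCommGroup Γ] {ε : Γ →+ ℤ} {X : Fam Γ (𝓛 U)}
    (Φ Ξ : Filt U) {m : Γ → ℤ} (h : ∀ k, Φ.Maps Ξ (m k) (X k)) (hm : ∀ k, ε k = m k) :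
    Kills ε X := fun u => by
  obtain ⟨p, hp⟩ := Φ.exh u
  obtain ⟨N, hN⟩ := Ξ.vanish
  refine ⟨N - p, fun k hk => ?_⟩
  have := h k p u hp
  rwa [hN _ (by rw [← hm]; omega), Submodule.mem_bot] at this

theorem Kills.of_relation {Γ : Type*} [AddCommGroup Γ] {ε : Γ →+ ℤ}
    {X Z : Fam Γ (𝓛 U)} {g h τ : Γ} (hτ : h - g = τ) (hε : 0 ≤ ε τ) (hX : EvZ τ X)
    {α β : ℂ} (hα : α ≠ 0)
    (hr : (cst α * mono g - cst β * mono h : Lau Γ) • X = Z) (hZ : Kills ε Z) :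
    Kills ε X := fun u => by
  obtain ⟨N, hN⟩ := hZ u
  refine ⟨N + ε g, fun k hk => ?_⟩
  obtain ⟨T, hT⟩ := hX u k
  have key : ∀ s m : ℕ, T ≤ m + s → X (k + m • τ) u = 0 := fun s => by
    induction s with
    | zero => exact fun m hm => hT m hm
    | succ s ih =>
      intro m hm
      have h1 := ih (m + 1) (by omega)
      have e := LinearMap.congr_fun (congrFun hr (k + m • τ - g)) u
      rw [hN] at e
      · simp only [sub_smul, mul_smul, fam_sub_apply, cst_smul_apply, mono_smul_apply,
          LinearMap.sub_apply, LinearMap.smul_apply] at e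
        rw [sub_add_cancel, show k + m • τ - g + h = k + (m + 1) • τ by
          rw [← hτ, succ_nsmul]; abel, h1, smul_zero, sub_zero, smul_eq_zero] at e
        exact e.resolve_left hα
      · rw [map_sub, map_add, map_nsmul, nsmul_eq_mul]
        have : 0 ≤ (m : ℤ) * ε τ := by positivity
        omega
  simpa using key T 0 (by omega)

/-- The degree in `z₁`. -/
def deg1 : Exp3 →+ ℤ := AddMonoidHom.fst ℤ (ℤ × ℤ)

/-- The degree in `z₁` and `w`. -/
def deg13 : Exp3 →+ ℤ where
  toFun k := k.1 + k.2.2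
  map_zero' := rfl
  map_add' k k' := by simp only [Prod.fst_add, Prod.snd_add]; ring

theorem serreComb_first_right_swap {A M : Type*} [CommRing A] [AddCommGroup M] [Module A M]
    {q z₁ z₂ W : A} {xyf yxf xfy yfx fxy fyx : M}
    (h₂ : (q * W - z₂) • xfy = (W - q * z₂) • xyf)
    (h₃ : (q * W - z₂) • fyx = (W - q * z₂) • yfx)
    (h₄ : (q * W - z₁) • fxy = (W - q * z₁) • xfy)
    (h : (z₂ - q ^ 2 * z₁) • yxf = (q ^ 2 * z₂ - z₁) • xyf)
    (h' : (z₂ - q ^ 2 * z₁) • fyx = (q ^ 2 * z₂ - z₁) • fxy) :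
    (z₂ - q ^ 2 * z₁) • (W - q * z₂) • serreComb q xyf yxf xfy yfx fxy fyx = 0 := by
  have key := serreComb_first_right (z₁ := z₂) (z₂ := z₁) h₂ h₃ h₄
    (by rw [← neg_inj, ← neg_smul, ← neg_smul, neg_sub, neg_sub, h])
    (by rw [← neg_inj, ← neg_smul, ← neg_smul, neg_sub, neg_sub, h'])
  have e : serreComb q xyf yxf xfy yfx fxy fyx = serreComb q yxf xyf yfx xfy fyx fxy := by
    simp only [serreComb]; module
  rw [e, ← neg_eq_zero, ← neg_smul, neg_sub, key]

section Contracted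

variable {X Y F : ℤ → 𝓛 U} {L Θ : Fam (ℤ × ℤ) (𝓛 U)}
  {N : Fam Exp3 (𝓛 U)} {c : ℂ}

/-- The Serre combination from which contractions have been removed. -/
def serreReduced (q : ℂ) (X Y F : ℤ → 𝓛 U) (L : Fam (ℤ × ℤ) (𝓛 U))
    (M : Fam Exp3 (𝓛 U)) : Fam Exp3 (𝓛 U) :=
  famR L F + wYXF LinearMap.id X Y F - (q + q⁻¹) • (M + wYFX LinearMap.id X Y F) + famL L F +
    wFYX LinearMap.id X Y F

theorem serreReduced_eq (hq : q ≠ 0) (M : Fam Exp3 (𝓛 U)) :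
    (cst q : Lau Exp3) • serreReduced q X Y F L M =
    serreComb (cst q : Lau Exp3) (famR L F) (wYXF LinearMap.id X Y F) M
      (wYFX LinearMap.id X Y F) (famL L F) (wFYX LinearMap.id X Y F) := by
  have h2 : (cst q ^ 2 + 1 : Lau Exp3) = cst (q ^ 2 + 1) := by
    rw [cst, cst, map_add, map_pow, map_one]
  have h : q * (q + q⁻¹) = q ^ 2 + 1 := by field_simp
  rw [serreComb, h2]
  simp only [cst_smul_eq, serreReduced, smul_add, smul_sub, smul_smul, h]

theorem Kills.serreReduced {ε : Exp3 →+ ℤ} {M : Fam Exp3 (𝓛 U)}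
    (h₁ : Kills ε (famR L F)) (h₂ : Kills ε (wYXF LinearMap.id X Y F)) (h₃ : Kills ε M)
    (h₄ : Kills ε (wYFX LinearMap.id X Y F)) (h₅ : Kills ε (famL L F))
    (h₆ : Kills ε (wFYX LinearMap.id X Y F)) : Kills ε (serreReduced q X Y F L M) := by
  have := (((h₁.add h₂).add ((h₃.add h₄).const_smul (-(q + q⁻¹)))).add h₅).add h₆
  rwa [neg_smul, ← sub_eq_add_neg] at this

theorem serreFam_of_serreReduced (hXY : pr X Y = L - c • Θ)
    (h : serreReduced q X Y F L (wXFY LinearMap.id X Y F + c • N) = 0) :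
    serreFam LinearMap.id X Y F q = -(c • contrComb q (famR Θ F) N (famL Θ F)) := by
  rw [← add_eq_zero_iff_eq_neg, ← h]
  funext ⟨k₁, k₂, l⟩
  have e := congrFun hXY (k₁, k₂)
  rw [pr_apply, fam_sub_apply, fam_smul_apply] at e
  simp only [serreFam, sixWords, LinearMap.id_apply, serreReduced, contrComb, fam_add_apply,
    fam_sub_apply, fam_smul_apply, famR, famL, wYXF, wXFY, wYFX, wFYX]
  rw [e, mul_assoc (F l) (X k₁), e, sub_mul, mul_sub, smul_mul_assoc, mul_smul_comm]
  module

theorem word_rp_right (h : lw 1 (q ^ 2) • rp X Y = lw (q ^ 2) 1 • L) :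
    (vz₂ - cst q ^ 2 * vz₁) • wYXF LinearMap.id X Y F = (cst q ^ 2 * vz₂ - vz₁) • famR L F := by
  funext ⟨k₁, k₂, l⟩
  have := congrArg (fun t => t * F l) (congrFun h (k₁, k₂))
  simpa only [lw_smul_apply, sub_smul, mul_smul, fam_sub_apply, cst_sq_smul_apply, vz₂_smul,
    vz₁_smul, wYXF, famR, rp_apply, sub_mul, LinearMap.id_apply, smul_mul_assoc, mul_assoc,
    one_smul] using this

theorem word_rp_left (h : lw 1 (q ^ 2) • rp X Y = lw (q ^ 2) 1 • L) :
    (vz₂ - cst q ^ 2 * vz₁) • wFYX LinearMap.id X Y F = (cst q ^ 2 * vz₂ - vz₁) • famL L F := by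
  funext ⟨k₁, k₂, l⟩
  have := congrArg (fun t => F l * t) (congrFun h (k₁, k₂))
  simpa only [lw_smul_apply, sub_smul, mul_smul, fam_sub_apply, cst_sq_smul_apply, vz₂_smul,
    vz₁_smul, wFYX, famL, rp_apply, mul_sub, LinearMap.id_apply, mul_smul_comm, mul_assoc,
    one_smul] using this

variable (hq : q ≠ 0) (hδ : δ ≠ 0) (hX : SerreRel q δ X F) (hY : SerreRel q δ Y F)
  (hXY : pr X Y = L - c • Θ) (hYX : lw 1 (q ^ 2) • rp X Y = lw (q ^ 2) 1 • L)
  (hc : Contr q δ (famR Θ F) N (famL Θ F))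
include hXY

omit hXY in
theorem wXYF_contracted (hXY : pr X Y = L - c • Θ) :
    famR L F = wXYF LinearMap.id X Y F + c • famR Θ F := by
  funext ⟨k₁, k₂, l⟩
  have e := congrFun hXY (k₁, k₂)
  rw [pr_apply, fam_sub_apply, fam_smul_apply] at e
  simp only [wXYF, famR, fam_add_apply, fam_smul_apply, LinearMap.id_apply, e, sub_mul,
    smul_mul_assoc, sub_add_cancel]

omit hXY in
theorem wFXY_contracted (hXY : pr X Y = L - c • Θ) :
    famL L F = wFXY LinearMap.id X Y F + c • famL Θ F := by
  funext ⟨k₁, k₂, l⟩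
  have e := congrFun hXY (k₁, k₂)
  rw [pr_apply, fam_sub_apply, fam_smul_apply] at e
  simp only [wFXY, famL, fam_add_apply, fam_smul_apply, LinearMap.id_apply, mul_assoc, e, mul_sub,
    mul_smul_comm, sub_add_cancel]

include hY hc in
theorem contracted_right : (cst q * vw δ - vz₂) • (wXFY LinearMap.id X Y F + c • N) =
    (vw δ - cst q * vz₂) • famR L F := by
  rw [wXYF_contracted hXY, smul_add, smul_add, hY.word_XFY, (hc.smul c).right]

include hX hc in
theorem contracted_left : (cst q * vw δ - vz₁) • famL L F =
    (vw δ - cst q * vz₁) • (wXFY LinearMap.id X Y F + c • N) := by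
  rw [wFXY_contracted hXY, smul_add, smul_add, hX.word_FXY, (hc.smul c).left]

include hq hδ hX hY hYX hc

theorem serreFam_contracted_left (k₁ : Kills deg1 (famR L F))
    (k₂ : Kills deg1 (wYXF LinearMap.id X Y F)) (k₃ : Kills deg1 (wYFX LinearMap.id X Y F))
    (k₄ : Kills deg1 (famL L F)) (k₅ : Kills deg1 (wFYX LinearMap.id X Y F))
    (he : EvZ (1, 0, -1) (wXFY LinearMap.id X Y F + c • N)) :
    serreFam LinearMap.id X Y F q = -(c • contrComb q (famR Θ F) N (famL Θ F)) := by
  refine serreFam_of_serreReduced hXY ?_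
  have r₁ := contracted_right hY hXY hc
  have r₃ := contracted_left hX hXY hc
  generalize wXFY LinearMap.id X Y F + c • N = M at *
  have kM : Kills deg1 M := Kills.of_relation (g := (0, 0, 1)) (h := (1, 0, 0)) (by simp)
    (by simp [deg1]) he hδ (β := q) (by rw [← form_v₁]; exact r₃.symm) (k₄.smul_lau _)
  have kT : Kills deg1 (serreReduced q X Y F L M) := Kills.serreReduced k₁ k₂ kM k₃ k₄ k₅
  have h := serreComb_first_left r₁ (hX.word_YFX (ev := LinearMap.id)) r₃ (word_rp_right hYX)
    (word_rp_left hYX)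
  rw [← serreReduced_eq hq] at h
  have h0 := cancel_u₁ hq hδ ((kT.smul_lau _).evZ (by simp [deg1]))
    (cancel_p (((kT.smul_lau _).smul_lau _).evZ (by simp [deg1])) h)
  rw [cst_smul_eq, smul_eq_zero_iff_right hq] at h0
  exact h0

theorem serreFam_contracted_right (k₁ : Kills deg13 (famR L F))
    (k₂ : Kills deg13 (wYXF LinearMap.id X Y F)) (k₃ : Kills deg13 (wYFX LinearMap.id X Y F))
    (k₄ : Kills deg13 (famL L F)) (k₅ : Kills deg13 (wFYX LinearMap.id X Y F))
    (he : EvZ (0, -1, 1) (wXFY LinearMap.id X Y F + c • N)) :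
    serreFam LinearMap.id X Y F q = -(c • contrComb q (famR Θ F) N (famL Θ F)) := by
  refine serreFam_of_serreReduced hXY ?_
  have r₁ := contracted_right hY hXY hc
  have r₃ := contracted_left hX hXY hc
  generalize wXFY LinearMap.id X Y F + c • N = M at *
  have kM : Kills deg13 M := Kills.of_relation (g := (0, 1, 0)) (h := (0, 0, 1)) (by simp)
    (by simp [deg13]) he (one_ne_zero (α := ℂ)) (β := q * δ)
    (by rw [← neg_sub, ← form_u₂, neg_smul, r₁]) ((k₁.smul_lau _).smul_lau (-1)|> fun h => by
      rwa [neg_smul, one_smul] at h)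
  have kT : Kills deg13 (serreReduced q X Y F L M) := Kills.serreReduced k₁ k₂ kM k₃ k₄ k₅
  have h := serreComb_first_right_swap r₁ (hY.word_FYX (ev := LinearMap.id)) r₃ (word_rp_right hYX)
    (word_rp_left hYX)
  rw [← serreReduced_eq hq] at h
  have h0 := cancel_v₂ hq ((kT.smul_lau _).evZ (by simp [deg13]))
    (cancel_p (((kT.smul_lau _).smul_lau _).evZ (by simp [deg13])) h)
  rw [cst_smul_eq, smul_eq_zero_iff_right hq] at h0
  exact h0

end Contracted

end SerreContraction

/-! ## Serre relations of the coaction -/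

section SerreTotal

variable {U : Type*} [AddCommGroup U] [Module ℂ U] {n : ℕ} {q d s r δ : ℂ}

theorem contrComb_sub (X₀ X₁ X₂ Y₀ Y₁ Y₂ : Fam Exp3 (𝓛 U)) :
    contrComb q (X₀ - Y₀) (X₁ - Y₁) (X₂ - Y₂) = contrComb q X₀ X₁ X₂ - contrComb q Y₀ Y₁ Y₂ := by
  simp only [contrComb]; module

theorem famR_sub (Θ Θ' : Fam (ℤ × ℤ) (𝓛 U)) (F : ℤ → 𝓛 U) :
    famR (Θ - Θ') F = famR Θ F - famR Θ' F := by
  funext k; simp [famR, sub_mul]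

theorem famL_sub (Θ Θ' : Fam (ℤ × ℤ) (𝓛 U)) (F : ℤ → 𝓛 U) :
    famL (Θ - Θ') F = famL Θ F - famL Θ' F := by
  funext k; simp [famL, mul_sub]

theorem kills_dl_XFY_of_raises (Φ : Filt U) {K K' F : ℤ → 𝓛 U}
    (hF : ∀ k, Φ.Raises k (F k)) (hK' : ∀ k, Φ.Raises 0 (K' k)) :
    Kills deg3 (dl s dir12 (wXFY LinearMap.id K K' F)) := fun u => by
  obtain ⟨p, hp⟩ := Φ.exh u
  obtain ⟨N, hN⟩ := Φ.vanish
  refine ⟨N - p, fun k hk => ?_⟩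
  rw [← Submodule.mem_bot ℂ, dl]
  refine locSum_mem fun t => ?_
  have := hF (k + t • dir12).2.2 _ _ (hK' (k + t • dir12).2.1 p u hp)
  have hk' : N - p < k.2.2 := hk
  rw [hN _ (by simp; omega), Submodule.mem_bot] at this
  rw [Submodule.mem_bot, LinearMap.smul_apply, wXFY, LinearMap.id_apply, mul_assoc,
    Module.End.mul_apply, Module.End.mul_apply, this, map_zero, smul_zero]

theorem Kills.congr {Γ : Type*} [AddCommGroup Γ] {ε : Γ →+ ℤ} {X Y : Fam Γ (𝓛 U)}
    (h : Kills ε X) (e : ∀ k, X k = Y k) : Kills ε Y := funext e ▸ h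

/-- The defect of the exchange relation of the current `B` with itself. -/
def SelfDefect (q c : ℂ) (B : ℤ → 𝓛 U) (Θ : Fam (ℤ × ℤ) (𝓛 U)) : Prop :=
  ∀ k l, B (l + 1) * B k - q ^ 2 • (B l * B (k + 1)) -
      (q ^ 2 • (B k * B (l + 1)) - B (k + 1) * B l) =
    -(c • ((q ^ 2 • Θ (k, l + 1) - Θ (k + 1, l)) + (q ^ 2 • Θ (l, k + 1) - Θ (l + 1, k))))

section SelfDefect

variable {c : ℂ} {B F : ℤ → 𝓛 U} {Θ : Fam (ℤ × ℤ) (𝓛 U)}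
  {N : Fam Exp3 (𝓛 U)}

theorem SelfDefect.word_right (h : SelfDefect q c B Θ) :
    (vz₂ - cst q ^ 2 * vz₁) • wYXF LinearMap.id B B F =
      (cst q ^ 2 * vz₂ - vz₁) • wXYF LinearMap.id B B F +
        (-((cst c : Lau Exp3) • ((cst q ^ 2 * vz₂ - vz₁) • famR Θ F +
          (cst q ^ 2 * vz₁ - vz₂) • swapFam (famR Θ F)))) := by
  funext ⟨k₁, k₂, l⟩
  have := congrArg (fun t => t * F l) (sub_eq_iff_eq_add'.1 (h k₁ k₂))
  simpa only [sub_smul, mul_smul, fam_sub_apply, fam_add_apply, fam_neg_apply, cst_smul_apply,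
    cst_sq_smul_apply, vz₂_smul, vz₁_smul, wYXF, wXYF, famR, swapFam, sub_mul, add_mul, neg_mul,
    LinearMap.id_apply, smul_mul_assoc, mul_assoc] using this

theorem SelfDefect.word_left (h : SelfDefect q c B Θ) :
    (vz₂ - cst q ^ 2 * vz₁) • wFYX LinearMap.id B B F =
      (cst q ^ 2 * vz₂ - vz₁) • wFXY LinearMap.id B B F +
        (-((cst c : Lau Exp3) • ((cst q ^ 2 * vz₂ - vz₁) • famL Θ F +
          (cst q ^ 2 * vz₁ - vz₂) • swapFam (famL Θ F)))) := by
  funext ⟨k₁, k₂, l⟩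
  have := congrArg (fun t => F l * t) (sub_eq_iff_eq_add'.1 (h k₁ k₂))
  simpa only [sub_smul, mul_smul, fam_sub_apply, fam_add_apply, fam_neg_apply, cst_smul_apply,
    cst_sq_smul_apply, vz₂_smul, vz₁_smul, wFYX, wFXY, famL, swapFam, mul_sub, mul_add, mul_neg,
    LinearMap.id_apply, mul_smul_comm, mul_assoc] using this

variable (hq : q ≠ 0) (hδ : δ ≠ 0) (h : SelfDefect q c B Θ) (hB : SerreRel q δ B F)
  (hc : Contr q δ (famR Θ F) N (famL Θ F))
include hq h hB hc

include hδ in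
theorem SelfDefect.serre_right (k₀ : Kills deg12 (contrComb q (famR Θ F) N (famL Θ F)))
    (h₁ : EvZ (1, 0, -1) (serreFam LinearMap.id B B F q))
    (h₂ : EvZ (0, 1, -1) (serreFam LinearMap.id B B F q)) :
    serreFam LinearMap.id B B F q = c • (contrComb q (famR Θ F) N (famL Θ F) +
      swapFam (contrComb q (famR Θ F) N (famL Θ F))) := by
  have e := serreComb_third_right (hB.word_XFY (ev := LinearMap.id))
    (hB.word_YFX (ev := LinearMap.id)) (hB.word_FXY (ev := LinearMap.id))
    (hB.word_FYX (ev := LinearMap.id)) (h.word_right (F := F))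
  have e₁ := hc.mul_right_eq hq
  have e₂ := hc.mul_right_eq_swap hq
  rw [← serreFam_eq _ _ _ _ hq] at e
  generalize contrComb q (famR Θ F) N (famL Θ F) = Q at *
  generalize serreFam LinearMap.id B B F q = S at *
  have kQ : Kills deg12 (Q + swapFam Q) := k₀.add k₀.swap
  have key : (cst q * vw δ - vz₁ : Lau Exp3) • (cst q * vw δ - vz₂) •
      (cst q : Lau Exp3) •
        (S - (cst c : Lau Exp3) • (Q + swapFam Q)) = 0 := by
    linear_combination (norm := module) e - (cst c : Lau Exp3) • e₁ -
      (cst c : Lau Exp3) • e₂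
  have d₁ : EvZ (1, 0, -1) (S - (cst c : Lau Exp3) • (Q + swapFam Q)) :=
    h₁.sub ((kQ.evZ (by simp [deg12])).smul _)
  have d₂ : EvZ (0, 1, -1) (S - (cst c : Lau Exp3) • (Q + swapFam Q)) :=
    h₂.sub ((kQ.evZ (by simp [deg12])).smul _)
  have := cancel_u₂ hq hδ (d₂.smul _) (cancel_u₁ hq hδ ((d₁.smul _).smul _) key)
  rw [cst_smul_eq, smul_eq_zero_iff_right hq, cst_smul_eq, sub_eq_zero] at this
  exact this

theorem SelfDefect.serre_left (k₀ : Kills deg3 (contrComb q (famR Θ F) N (famL Θ F)))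
    (h₁ : EvZ (-1, 0, 1) (serreFam LinearMap.id B B F q))
    (h₂ : EvZ (0, -1, 1) (serreFam LinearMap.id B B F q)) :
    serreFam LinearMap.id B B F q = c • (contrComb q (famR Θ F) N (famL Θ F) +
      swapFam (contrComb q (famR Θ F) N (famL Θ F))) := by
  have e := serreComb_third_left (hB.word_XFY (ev := LinearMap.id))
    (hB.word_YFX (ev := LinearMap.id)) (hB.word_FXY (ev := LinearMap.id))
    (hB.word_FYX (ev := LinearMap.id)) (h.word_left (F := F))
  have e₁ := hc.mul_left_eq hq
  have e₂ := hc.mul_left_eq_swap hq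
  rw [← serreFam_eq _ _ _ _ hq] at e
  generalize contrComb q (famR Θ F) N (famL Θ F) = Q at *
  generalize serreFam LinearMap.id B B F q = S at *
  have kQ : Kills deg3 (Q + swapFam Q) := k₀.add k₀.swap'
  have key : (vw δ - cst q * vz₁ : Lau Exp3) • (vw δ - cst q * vz₂) •
      (cst q : Lau Exp3) •
        (S - (cst c : Lau Exp3) • (Q + swapFam Q)) = 0 := by
    linear_combination (norm := module) e - (cst c : Lau Exp3) • e₁ -
      (cst c : Lau Exp3) • e₂
  have d₁ : EvZ (-1, 0, 1) (S - (cst c : Lau Exp3) • (Q + swapFam Q)) :=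
    h₁.sub ((kQ.evZ (by simp [deg3])).smul _)
  have d₂ : EvZ (0, -1, 1) (S - (cst c : Lau Exp3) • (Q + swapFam Q)) :=
    h₂.sub ((kQ.evZ (by simp [deg3])).smul _)
  have := cancel_v₂ hq (d₂.smul _) (cancel_v₁ hq ((d₁.smul _).smul _) key)
  rw [cst_smul_eq, smul_eq_zero_iff_right hq, cst_smul_eq, sub_eq_zero] at this
  exact this

end SelfDefect

section Contracted

variable {X Y F : ℤ → 𝓛 U} {L Θ : Fam (ℤ × ℤ) (𝓛 U)}
  {N : Fam Exp3 (𝓛 U)} {c : ℂ}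
variable (hq : q ≠ 0) (hδ : δ ≠ 0) (hX : SerreRel q δ X F) (hY : SerreRel q δ Y F)
  (hXY : pr X Y = L - c • Θ) (hYX : lw 1 (q ^ 2) • rp X Y = lw (q ^ 2) 1 • L)
  (hc : Contr q δ (famR Θ F) N (famL Θ F))
include hq hδ hX hY hXY hYX hc

theorem serreFam_contracted_of_raises_left {Ξ Ξ' : Filt U} (rX : ∀ k, Ξ.Raises k (X k))
    (rF : ∀ k, Ξ.Raises 0 (F k)) (rL : ∀ k, Ξ.Maps Ξ' k.1 (L k)) (hN : Kills deg12 N) :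
    serreFam LinearMap.id X Y F q = -(c • contrComb q (famR Θ F) N (famL Θ F)) := by
  refine serreFam_contracted_left hq hδ hX hY hXY hYX hc ?_ ?_ ?_ ?_ ?_ (EvZ.add (fun u k => ?_) ?_)
  · exact Kills.of_maps (X := fun k : Exp3 => L (k.1, k.2.1) * F k.2.2) Ξ Ξ'
      (fun k => (rL (k.1, k.2.1)).mul (rF k.2.2).maps) fun k => by simp [deg1]
  · have := Kills.mul_left (ε := deg1) (Kills.of_maps (X := fun k : Exp3 => X k.1 * F k.2.2) Ξ Ξ
      (fun k => (rX k.1).maps.mul (rF k.2.2).maps) fun k => by simp [deg1]) (fun k : Exp3 => Y k.2.1)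
    exact this.congr fun k => (mul_assoc _ _ _).symm
  · have := Kills.mul_left (ε := deg1) (Kills.of_maps (X := fun k : Exp3 => F k.2.2 * X k.1) Ξ Ξ
      (fun k => (rF k.2.2).maps.mul (rX k.1).maps) fun k => by simp [deg1]) (fun k : Exp3 => Y k.2.1)
    exact this.congr fun k => (mul_assoc _ _ _).symm
  · exact Kills.mul_left (Kills.of_maps (X := fun k : Exp3 => L (k.1, k.2.1)) Ξ Ξ'
      (fun k => rL (k.1, k.2.1)) fun k => by simp [deg1]) _
  · exact Kills.mul_left (Kills.of_maps (X := fun k : Exp3 => X k.1) Ξ Ξ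
      (fun k => (rX k.1).maps) fun k => by simp [deg1]) _
  · obtain ⟨p, hp⟩ := Ξ.exh (Y k.2.1 u)
    obtain ⟨M, hM⟩ := Ξ.vanish
    refine ⟨(M - p - k.1 + 1).toNat, fun m hm => ?_⟩
    have := rX (k + m • ((1, 0, -1) : Exp3)).1 _ _ (rF (k + m • ((1, 0, -1) : Exp3)).2.2 _ _ hp)
    rw [hM _ (by simp; omega), Submodule.mem_bot] at this
    rw [wXFY, LinearMap.id_apply, mul_assoc, Module.End.mul_apply, Module.End.mul_apply,
      show (k + m • ((1, 0, -1) : Exp3)).2.1 = k.2.1 by simp, this]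
  · rw [← cst_smul_eq]
    exact (hN.evZ (by simp [deg12])).smul _

theorem serreFam_contracted_of_raises_right {Ξ Ξ' : Filt U} (le : ∀ p, Ξ.F p ≤ Ξ'.F p)
    (rX : ∀ k, Ξ.Raises k (X k)) (rY : ∀ k, Ξ'.Raises 0 (Y k)) (rF : ∀ k, Ξ.Raises k (F k))
    (rF' : ∀ k, Ξ'.Raises k (F k)) (rL : ∀ k, Ξ.Maps Ξ' k.1 (L k)) (hN : Kills deg3 N) :
    serreFam LinearMap.id X Y F q = -(c • contrComb q (famR Θ F) N (famL Θ F)) := by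
  refine serreFam_contracted_right hq hδ hX hY hXY hYX hc ?_ ?_ ?_ ?_ ?_ (EvZ.add ?_ ?_)
  · exact Kills.of_maps (X := fun k : Exp3 => L (k.1, k.2.1) * F k.2.2) Ξ Ξ'
      (fun k => (rL (k.1, k.2.1)).mul (rF k.2.2).maps) fun k => by simp [deg13, add_comm]
  · have := Kills.mul_left (ε := deg13) (Kills.of_maps (X := fun k : Exp3 => X k.1 * F k.2.2) Ξ Ξ
      (fun k => (rX k.1).maps.mul (rF k.2.2).maps) fun k => by simp [deg13, add_comm])
      (fun k : Exp3 => Y k.2.1)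
    exact this.congr fun k => (mul_assoc _ _ _).symm
  · have := Kills.mul_left (ε := deg13) (Kills.of_maps (X := fun k : Exp3 => F k.2.2 * X k.1) Ξ Ξ
      (fun k => (rF k.2.2).maps.mul (rX k.1).maps) fun k => by simp [deg13]) (fun k : Exp3 => Y k.2.1)
    exact this.congr fun k => (mul_assoc _ _ _).symm
  · exact Kills.of_maps (X := fun k : Exp3 => F k.2.2 * L (k.1, k.2.1)) Ξ Ξ'
      (fun k => (rF' k.2.2).maps.mul (rL (k.1, k.2.1))) fun k => by simp [deg13]
  · have := Kills.of_maps (X := fun k : Exp3 => F k.2.2 * (Y k.2.1 * X k.1)) (ε := deg13) Ξ Ξ'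
      (fun k => (rF' k.2.2).maps.mul ((rY k.2.1).maps.mul
        (show Ξ.Maps Ξ' k.1 (X k.1) from fun p u hu => le _ (rX k.1 p u hu))))
      fun k => by simp [deg13]
    exact this.congr fun k => (mul_assoc _ _ _).symm
  · have := Kills.mul_left (ε := deg3) (Kills.of_maps (X := fun k : Exp3 => F k.2.2 * Y k.2.1) Ξ' Ξ'
        (fun k => (rF' k.2.2).maps.mul (rY k.2.1).maps) fun k => by simp [deg3]) (fun k : Exp3 => X k.1)
    exact (this.congr fun k => (mul_assoc _ _ _).symm).evZ (by simp [deg3])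
  · rw [← cst_smul_eq]
    exact (hN.evZ (by simp [deg3])).smul _

end Contracted

/-- The Serre combination of a sum of three currents with one contraction. -/
theorem serre_collect {c : ℂ} {A B D F : ℤ → 𝓛 U} {Q Q' : Fam Exp3 (𝓛 U)}
    (hAA : ∀ k₁ k₂ l, sixWords q A A F k₁ k₂ l = 0) (hAB : ∀ k₁ k₂ l, sixWords q A B F k₁ k₂ l = 0)
    (hBD : ∀ k₁ k₂ l, sixWords q B D F k₁ k₂ l = 0) (hDD : ∀ k₁ k₂ l, sixWords q D D F k₁ k₂ l = 0)
    (hAD : serreFam LinearMap.id A D F q = -(c • (Q - Q')))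
    (hBB : serreFam LinearMap.id B B F q = c • (Q + swapFam Q)) (k₁ k₂ l : ℤ) :
    sixWords q (A + B + D) (A + B + D) F k₁ k₂ l = c • (Q' (k₁, k₂, l) + Q' (k₂, k₁, l)) := by
  have e₁ := congrFun hAD (k₁, k₂, l)
  have e₂ := congrFun hAD (k₂, k₁, l)
  have e₃ := congrFun hBB (k₁, k₂, l)
  simp only [serreFam, LinearMap.id_apply, fam_neg_apply, fam_smul_apply, fam_sub_apply,
    fam_add_apply, swapFam] at e₁ e₂ e₃
  simp only [sixWords_add_left, sixWords_add_mid]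
  rw [hAA, hAB, hBD, hDD, sixWords_comm B A, sixWords_comm D A, sixWords_comm D B, hAB, hBD, e₁, e₂,
    e₃]
  module

variable {e φ η ζ ζp E Kp Km : ZMod n → ℤ → 𝓛 U} {Φ Ψ Ω : Filt U}

namespace PairSys

variable (S : PairSys n q d s r e φ η ζ ζp E Kp Km Φ Ψ Ω)
include S

theorem letY_maps {Ξ : Filt U} {i j : ZMod n} (he : ∀ k, Ξ.Raises k (e i k))
    (hη : ∀ k, Ξ.Raises 0 (η j k)) (hKm : ∀ k, Ξ.Raises 0 (Km i k))
    (hKp : ∀ k, Ξ.Raises 0 (Kp j k)) (k : ℤ × ℤ) :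
    Ξ.Maps (Ξ.gen (φ j)) k.1 (letY e φ η Kp Km i j k) := fun _ _ hu =>
  S.letY_mem he hη hKm hKp hu k.1 k.2

theorem D_A_self (hn : 3 ≤ n) (hq : q ≠ 0) (hd : d ≠ 0) (i : ZMod n) :
    lw 1 (q ^ 2) • rp (letA e Km i) (letD φ η Kp i) =
      lw (q ^ 2) 1 • letY e φ η Kp Km i i := by
  have := S.D_A hq hd i i
  simpa [den, num, gCoef_self, dCoef_self hn] using this

theorem serre_AD_left (hn : 3 ≤ n) (hq : q ≠ 0) (hd : d ≠ 0) (hδ : δ ≠ 0) {i j : ZMod n}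
    (hij : i ≠ j)
    {F : ℤ → 𝓛 U} (hA : SerreRel q δ (letA e Km i) F)
    (hD : SerreRel q δ (letD φ η Kp i) F) (hF : ∀ k, (Φ.gen (φ j)).Raises 0 (F k))
    {N N' : Fam Exp3 (𝓛 U)}
    (hs : Contr q δ (famR (dl s (1, -1) (pr (Km i) (Kp i))) F) N
      (famL (dl s (1, -1) (pr (Km i) (Kp i))) F)) (hN : Kills deg12 N)
    (hr : Contr q δ (famR (dl r (1, -1) (pr (cvi (ζ i) (Km i)) (cvi (η i) (Kp i)))) F) N'
      (famL (dl r (1, -1) (pr (cvi (ζ i) (Km i)) (cvi (η i) (Kp i)))) F)) (hN' : Kills deg12 N') :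
    serreFam LinearMap.id (letA e Km i) (letD φ η Kp i) F q =
      -((q - q⁻¹)⁻¹ • (contrComb q (famR (dl s (1, -1) (pr (Km i) (Kp i))) F) N
          (famL (dl s (1, -1) (pr (Km i) (Kp i))) F) -
        contrComb q (famR (dl r (1, -1) (pr (cvi (ζ i) (Km i)) (cvi (η i) (Kp i)))) F) N'
          (famL (dl r (1, -1) (pr (cvi (ζ i) (Km i)) (cvi (η i) (Kp i)))) F))) := by
  have hc := hs.sub hr
  rw [← contrComb_sub]
  rw [← famR_sub, ← famL_sub] at hc ⊢
  have hN0 : Kills deg12 (N - N') := by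
    have := hN.add (hN'.const_smul (-1))
    rwa [neg_smul, one_smul, ← sub_eq_add_neg] at this
  exact serreFam_contracted_of_raises_left hq hδ hA hD (S.A_D_self i) (S.D_A_self hn hq hd i) hc
    (S.genΦ_A hij) hF (S.letY_maps (Ξ := Φ.gen (φ j)) (S.genΦ_e hij) (S.gen_η S.Φη i j)
      (S.genΦ_Km i j) (S.genΦ_Kp i j)) hN0

theorem serre_AD_right (hn : 3 ≤ n) (hq : q ≠ 0) (hd : d ≠ 0) (hδ : δ ≠ 0) {i : ZMod n}
    {F : ℤ → 𝓛 U} (hA : SerreRel q δ (letA e Km i) F)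
    (hD : SerreRel q δ (letD φ η Kp i) F) (hF : ∀ k, Φ.Raises k (F k))
    (hF' : ∀ k, (Φ.gen (φ i)).Raises k (F k))
    {N N' : Fam Exp3 (𝓛 U)}
    (hs : Contr q δ (famR (dl s (1, -1) (pr (Km i) (Kp i))) F) N
      (famL (dl s (1, -1) (pr (Km i) (Kp i))) F)) (hN : Kills deg3 N)
    (hr : Contr q δ (famR (dl r (1, -1) (pr (cvi (ζ i) (Km i)) (cvi (η i) (Kp i)))) F) N'
      (famL (dl r (1, -1) (pr (cvi (ζ i) (Km i)) (cvi (η i) (Kp i)))) F)) (hN' : Kills deg3 N') :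
    serreFam LinearMap.id (letA e Km i) (letD φ η Kp i) F q =
      -((q - q⁻¹)⁻¹ • (contrComb q (famR (dl s (1, -1) (pr (Km i) (Kp i))) F) N
          (famL (dl s (1, -1) (pr (Km i) (Kp i))) F) -
        contrComb q (famR (dl r (1, -1) (pr (cvi (ζ i) (Km i)) (cvi (η i) (Kp i)))) F) N'
          (famL (dl r (1, -1) (pr (cvi (ζ i) (Km i)) (cvi (η i) (Kp i)))) F))) := by
  have hc := hs.sub hr
  rw [← contrComb_sub]
  rw [← famR_sub, ← famL_sub] at hc ⊢
  have hN0 : Kills deg3 (N - N') := by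
    have := hN.add (hN'.const_smul (-1))
    rwa [neg_smul, one_smul, ← sub_eq_add_neg] at this
  exact serreFam_contracted_of_raises_right hq hδ hA hD (S.A_D_self i) (S.D_A_self hn hq hd i) hc
    (Φ.le_gen (φ i)) (S.Φ_A i) (S.genΦ_D i) hF hF'
    (S.letY_maps (Ξ := Φ) (S.Φ_e i) (S.Φη i) (S.Φ_Km i) (S.Φ_Kp i)) hN0

end PairSys

end SerreTotal

section SerreCoaction

variable {U : Type*} [AddCommGroup U] [Module ℂ U] {n : ℕ} {q d s r : ℂ}
variable {e φ η ζ ζp E Kp Km : ZMod n → ℤ → 𝓛 U} {Φ Ψ Ω : Filt U}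

/-- The coaction of the currents `E_i`. -/
abbrev coE (e φ η E Kp Km : ZMod n → ℤ → 𝓛 U) (i : ZMod n) : ℤ → 𝓛 U :=
  letA e Km i + E i + letD φ η Kp i

theorem KSys.serre_eq {E Kp Km : ZMod n → ℤ → 𝓛 U} (hn : 3 ≤ n)
    (K : KSys n q d s E Kp Km) {i j : ZMod n} (hij : j = i + 1 ∨ j = i - 1) (k₁ k₂ l : ℤ) :
    sixWords q (E i) (E i) (E j) k₁ k₂ l =
    -(serreTail s (q⁻¹ * (serreParam d i j)⁻¹) (q⁻¹ * serreParam d i j) (Km i) (E j) (Kp i) k₁ k₂ l +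
      serreTail s (q⁻¹ * (serreParam d i j)⁻¹) (q⁻¹ * serreParam d i j)
        (Km i) (E j) (Kp i) k₂ k₁ l) := by
  rcases hij with rfl | rfl
  · rw [serreParam, if_pos rfl, K.serre_succ]
  · rw [serreParam, if_neg (zmod_succ_ne_pred hn i).symm, inv_inv, K.serre_pred]

theorem KSys.selfDefect {E Kp Km : ZMod n → ℤ → 𝓛 U} (hn : 3 ≤ n)
    (K : KSys n q d s E Kp Km) (i : ZMod n) :
    SelfDefect q (q - q⁻¹)⁻¹ (E i) (dl s (1, -1) (pr (Km i) (Kp i))) := fun k l => by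
  have := K.E_E_self i k l
  simp only [fam_sub_apply, den, num, lw_smul_apply, gCoef_self, dCoef_self hn, rp_apply, pr_apply,
    one_smul, mul_one, one_mul] at this
  rw [this, ← smul_neg]
  congr 1
  module

namespace PairSys

variable (S : PairSys n q d s r e φ η ζ ζp E Kp Km Φ Ψ Ω)
include S

section

variable (hn : 3 ≤ n) (hq : q ≠ 0) (hd : d ≠ 0) (hqq : q - q⁻¹ ≠ 0) {i j : ZMod n}
  (hij : j = i + 1 ∨ j = i - 1)
include hn hq hd hqq hij

omit S hqq hd hq in
theorem ne_of_adj : i ≠ j := by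
  rcases hij with rfl | rfl <;> intro h
  · exact zmod_one_ne_zero hn (by linear_combination -h)
  · exact zmod_one_ne_zero hn (by linear_combination h)

omit hqq in
theorem contr_r {F : ℤ → 𝓛 U} (h : QuadRel q d i j (cvi (ζ i) (Km i)) F)
    (h' : QuadRel q d j i F (cvi (η i) (Kp i))) :
    Contr q (serreParam d i j)
      (famR (dl r (1, -1) (pr (cvi (ζ i) (Km i)) (cvi (η i) (Kp i)))) F)
      (dl r dir12 (wXFY LinearMap.id (cvi (ζ i) (Km i)) (cvi (η i) (Kp i)) F))
      (famL (dl r (1, -1) (pr (cvi (ζ i) (Km i)) (cvi (η i) (Kp i)))) F) :=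
  contr_dl (S.κm_pos i) (S.tr_κp i) (h.serreRel hn hq hd hij)
    ((h'.symm hn hd).serreRel hn hq hd hij)

theorem contrComb_r {F : ℤ → 𝓛 U} (hF : Truncated F)
    (h : QuadRel q d i j (cvi (ζ i) (Km i)) F)
    (h' : QuadRel q d j i F (cvi (η i) (Kp i))) (k₁ k₂ l : ℤ) :
    (q - q⁻¹)⁻¹ • (
    contrComb q (famR (dl r (1, -1) (pr (cvi (ζ i) (Km i)) (cvi (η i) (Kp i)))) F)
      (dl r dir12 (wXFY LinearMap.id (cvi (ζ i) (Km i)) (cvi (η i) (Kp i)) F))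
      (famL (dl r (1, -1) (pr (cvi (ζ i) (Km i)) (cvi (η i) (Kp i)))) F) (k₁, k₂, l) +
    contrComb q (famR (dl r (1, -1) (pr (cvi (ζ i) (Km i)) (cvi (η i) (Kp i)))) F)
      (dl r dir12 (wXFY LinearMap.id (cvi (ζ i) (Km i)) (cvi (η i) (Kp i)) F))
      (famL (dl r (1, -1) (pr (cvi (ζ i) (Km i)) (cvi (η i) (Kp i)))) F) (k₂, k₁, l)) =
    -(serreTail r (q⁻¹ * (serreParam d i j)⁻¹) (q⁻¹ * serreParam d i j)
        (cvi (ζ i) (Km i)) F (cvi (η i) (Kp i)) k₁ k₂ l +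
      serreTail r (q⁻¹ * (serreParam d i j)⁻¹) (q⁻¹ * serreParam d i j)
        (cvi (ζ i) (Km i)) F (cvi (η i) (Kp i)) k₂ k₁ l) := by
  have key := contrComb_dl (s := r) hq (serreParam_ne_zero hd i j) (S.κm_pos i) (S.tr_κp i)
    (S.κp_neg i) hF (h.serreRel hn hq hd hij) ((h'.symm hn hd).serreRel hn hq hd hij)
  rw [key, key, ← neg_add, ← smul_add, smul_neg, inv_smul_smul₀ hqq]

omit hqq in
theorem combined_A (hs : s ≠ 0) : ∃ N, Kills deg3 N ∧ Contr q (serreParam d i j)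
    (famR (dl s (1, -1) (pr (Km i) (Kp i))) (letA e Km j)) N
    (famL (dl s (1, -1) (pr (Km i) (Kp i))) (letA e Km j)) ∧
    Kills deg3 (contrComb q (famR (dl s (1, -1) (pr (Km i) (Kp i))) (letA e Km j)) N
      (famL (dl s (1, -1) (pr (Km i) (Kp i))) (letA e Km j))) := by
  have rΘ : ∀ k, Φ.Raises 0 (dl s (1, -1) (pr (Km i) (Kp i)) k) := fun k =>
    Filt.Raises.locSum fun t => ((S.Φ_Km i _).mul (S.Φ_Kp i _)).smul _
  have k₀ : Kills deg3 (famR (dl s (1, -1) (pr (Km i) (Kp i))) (letA e Km j)) :=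
    Kills.of_maps (X := fun k : Exp3 => _ * _) Φ Φ
      (fun k => (rΘ (k.1, k.2.1)).maps.mul (S.Φ_A j k.2.2).maps) fun k => by simp [deg3]
  have k₂ : Kills deg3 (famL (dl s (1, -1) (pr (Km i) (Kp i))) (letA e Km j)) :=
    Kills.of_maps (X := fun k : Exp3 => _ * _) Φ Φ
      (fun k => (S.Φ_A j k.2.2).maps.mul (rΘ (k.1, k.2.1)).maps) fun k => by simp [deg3]
  obtain ⟨N, hc, hN⟩ := Contr.exists_of_right k₀ k₂ (S.combRel_A hn hq hd hs hij)
  exact ⟨N, hN, hc, k₀.contrComb hN k₂⟩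

omit hqq in
theorem combined_D (hs : s ≠ 0) : ∃ N, Kills deg12 N ∧ Contr q (serreParam d i j)
    (famR (dl s (1, -1) (pr (Km i) (Kp i))) (letD φ η Kp j)) N
    (famL (dl s (1, -1) (pr (Km i) (Kp i))) (letD φ η Kp j)) ∧
    Kills deg12 (contrComb q (famR (dl s (1, -1) (pr (Km i) (Kp i))) (letD φ η Kp j)) N
      (famL (dl s (1, -1) (pr (Km i) (Kp i))) (letD φ η Kp j))) := by
  have rΘ : ∀ k : ℤ × ℤ, (Ω.gen (φ j)).Raises (k.1 + k.2) (dl s (1, -1) (pr (Km i) (Kp i)) k) :=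
    fun k => Filt.Raises.locSum fun t => by
      have := (((S.Ω_Km i (k + t • ((1, -1) : ℤ × ℤ)).1).mul
        (S.Ω_Kp i (k + t • ((1, -1) : ℤ × ℤ)).2)).gen
          (fun a => (((S.φ_Km j i a _).mul_right (S.φ_Kp j i a _)).symm))).smul (s ^ t)
      exact this.mono (by simp; linarith)
  have k₀ : Kills deg12 (famR (dl s (1, -1) (pr (Km i) (Kp i))) (letD φ η Kp j)) :=
    Kills.of_maps (X := fun k : Exp3 => _ * _) (Ω.gen (φ j)) (Ω.gen (φ j))
      (fun k => (rΘ (k.1, k.2.1)).maps.mul (S.genΩ_D j k.2.2).maps) fun k => by simp [deg12]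
  have k₂ : Kills deg12 (famL (dl s (1, -1) (pr (Km i) (Kp i))) (letD φ η Kp j)) :=
    kills_famL (S.K.Km_pos i) (S.K.truncated_Kp i)
  obtain ⟨N, hc, hN⟩ := Contr.exists_of_left (serreParam_ne_zero hd i j) k₂ k₀
    (S.combRel_D hn hq hd hs hij)
  exact ⟨N, hN, hc, k₀.contrComb hN k₂⟩

theorem serre_coE_A (hs : s ≠ 0) (k₁ k₂ l : ℤ) :
    sixWords q (coE e φ η E Kp Km i) (coE e φ η E Kp Km i) (letA e Km j) k₁ k₂ l =
    -(serreTail r (q⁻¹ * (serreParam d i j)⁻¹) (q⁻¹ * serreParam d i j)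
        (cvi (ζ i) (Km i)) (letA e Km j) (cvi (η i) (Kp i)) k₁ k₂ l +
      serreTail r (q⁻¹ * (serreParam d i j)⁻¹) (q⁻¹ * serreParam d i j)
        (cvi (ζ i) (Km i)) (letA e Km j) (cvi (η i) (Kp i)) k₂ k₁ l) := by
  have hδ := serreParam_ne_zero hd i j
  have hne := ne_of_adj hn hij
  have ff := fun {X F : ℤ → 𝓛 U} (h : QuadRel q d i j X F) => h.serreRel hn hq hd hij
  have fs := fun {X F : ℤ → 𝓛 U} (h : QuadRel q d i i X F) => h.selfRel hn
  obtain ⟨N, hN, hc, kC⟩ := S.combined_A hn hq hd hij hs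
  have hA := ff (S.A_A i j)
  have hB := ff ((S.A_B j i).symm hn hd)
  have hD := ff ((S.A_D hq hd hne.symm).symm hn hd)
  have gE := S.genΦ_E (j := i) i
  have gD := S.genΦ_D i
  have gA := S.genΦ_A hne.symm
  rw [serre_collect (S.serre_A hij) ?_ ?_ ?_ (S.serre_AD_right hn hq hd hδ hA hD (S.Φ_A j) gA hc hN
    (S.contr_r hn hq hd hij (S.κm_A i j) (S.A_κp hq hd j i))
    (kills_dl_XFY_of_raises Φ (S.Φ_A j)
      (Filt.Raises.cvi_zero (S.Φη i) (S.Φ_Kp i))))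
    ((S.K.selfDefect hn i).serre_left hq hB hc kC ?_ ?_)]
  · exact S.contrComb_r hn hq hd hqq hij (S.tr_A j) (S.κm_A i j) (S.A_κp hq hd j i) k₁ k₂ l
  · intro k₁ k₂ l
    rw [sixWords_comm]
    exact serre_first_right (ev := LinearMap.id) hq hB hA (fs ((S.A_B i i).symm hn hd))
      (evZ_serreFam Φ (S.Φ_E i) (S.Φ_A i) (S.Φ_A j) fun k₁ k₂ l => ⟨k₂ + l, fun m => by linarith⟩)
      (evZ_serreFam Φ (S.Φ_E i) (S.Φ_A i) (S.Φ_A j) fun k₁ k₂ l => ⟨k₂ + l, fun m => by linarith⟩)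
      k₂ k₁ l
  · exact serre_third_left (ev := LinearMap.id) hq hδ hB hD (fs (S.B_D i i))
      (evZ_serreFam _ gE gD gA fun k₁ k₂ l => ⟨l, fun m => by linarith⟩)
      (evZ_serreFam _ gE gD gA fun k₁ k₂ l => ⟨l, fun m => by linarith⟩)
  · exact serre_third_left (ev := LinearMap.id) hq hδ hD hD (fs (S.D_D hn hd i i))
      (evZ_serreFam _ gD gD gA fun k₁ k₂ l => ⟨l, fun m => by linarith⟩)
      (evZ_serreFam _ gD gD gA fun k₁ k₂ l => ⟨l, fun m => by linarith⟩)
  · exact evZ_serreFam _ gE gE gA fun k₁ k₂ l => ⟨l, fun m => by linarith⟩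
  · exact evZ_serreFam _ gE gE gA fun k₁ k₂ l => ⟨l, fun m => by linarith⟩

theorem serre_coE_D (hs : s ≠ 0) (k₁ k₂ l : ℤ) :
    sixWords q (coE e φ η E Kp Km i) (coE e φ η E Kp Km i) (letD φ η Kp j) k₁ k₂ l =
    -(serreTail r (q⁻¹ * (serreParam d i j)⁻¹) (q⁻¹ * serreParam d i j)
        (cvi (ζ i) (Km i)) (letD φ η Kp j) (cvi (η i) (Kp i)) k₁ k₂ l +
      serreTail r (q⁻¹ * (serreParam d i j)⁻¹) (q⁻¹ * serreParam d i j)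
        (cvi (ζ i) (Km i)) (letD φ η Kp j) (cvi (η i) (Kp i)) k₂ k₁ l) := by
  have hδ := serreParam_ne_zero hd i j
  have hne := ne_of_adj hn hij
  have ff := fun {X F : ℤ → 𝓛 U} (h : QuadRel q d i j X F) => h.serreRel hn hq hd hij
  have fs := fun {X F : ℤ → 𝓛 U} (h : QuadRel q d i i X F) => h.selfRel hn
  obtain ⟨N, hN, hc, kC⟩ := S.combined_D hn hq hd hij hs
  have hA := ff (S.A_D hq hd hne)
  have hB := ff (S.B_D i j)
  have hD := ff (S.D_D hn hd i j)
  have gE := S.genΩ_E (j := j) i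
  have gD := S.genΩ_D j
  have gA := S.genΩ_A hne
  rw [serre_collect ?_ ?_ ?_ (S.serre_D hn hq hd hij) (S.serre_AD_left hn hq hd hδ hne hA hD
    (S.genΦ_D j) hc hN
    (S.contr_r hn hq hd hij (S.κm_D hq hd i j) (S.D_κp j i))
    (kills_dl_XFY (S.κm_pos i) (S.tr_κp i)))
    ((S.K.selfDefect hn i).serre_right hq hδ hB hc kC ?_ ?_)]
  · exact S.contrComb_r hn hq hd hqq hij (S.tr_D j) (S.κm_D hq hd i j) (S.D_κp j i) k₁ k₂ l
  · exact serre_third_right (ev := LinearMap.id) hq hδ hA hA (fs (S.A_A i i))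
      (evZ_serreFam _ gA gA gD fun k₁ k₂ l => ⟨k₁ + k₂, fun m => by linarith⟩)
      (evZ_serreFam _ gA gA gD fun k₁ k₂ l => ⟨k₁ + k₂, fun m => by linarith⟩)
  · exact serre_third_right (ev := LinearMap.id) hq hδ hA hB (fs (S.A_B i i))
      (evZ_serreFam _ gA gE gD fun k₁ k₂ l => ⟨k₁ + k₂, fun m => by linarith⟩)
      (evZ_serreFam _ gA gE gD fun k₁ k₂ l => ⟨k₁ + k₂, fun m => by linarith⟩)
  · exact serre_first_left (ev := LinearMap.id) hq hδ hB hD (fs (S.B_D i i))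
      (evZ_serreFam Ψ (S.Ψ_E i) (S.Ψ_D i) (S.Ψ_D j) fun k₁ k₂ l => ⟨k₁, fun m => by linarith⟩)
      (evZ_serreFam Ψ (S.Ψ_E i) (S.Ψ_D i) (S.Ψ_D j) fun k₁ k₂ l => ⟨k₁, fun m => by linarith⟩)
  · exact evZ_serreFam _ gE gE gD fun k₁ k₂ l => ⟨k₁ + k₂, fun m => by linarith⟩
  · exact evZ_serreFam _ gE gE gD fun k₁ k₂ l => ⟨k₁ + k₂, fun m => by linarith⟩

theorem serre_coE_E (k₁ k₂ l : ℤ) :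
    sixWords q (coE e φ η E Kp Km i) (coE e φ η E Kp Km i) (E j) k₁ k₂ l =
    -(serreTail r (q⁻¹ * (serreParam d i j)⁻¹) (q⁻¹ * serreParam d i j)
        (cvi (ζ i) (Km i)) (E j) (cvi (η i) (Kp i)) k₁ k₂ l +
      serreTail r (q⁻¹ * (serreParam d i j)⁻¹) (q⁻¹ * serreParam d i j)
        (cvi (ζ i) (Km i)) (E j) (cvi (η i) (Kp i)) k₂ k₁ l) := by
  have hδ := serreParam_ne_zero hd i j
  have hne := ne_of_adj hn hij
  have ff := fun {X F : ℤ → 𝓛 U} (h : QuadRel q d i j X F) => h.serreRel hn hq hd hij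
  have fs := fun {X F : ℤ → 𝓛 U} (h : QuadRel q d i i X F) => h.selfRel hn
  have hKm := ff (S.K.E_Km i j)
  have hKp := ff (QuadRel.symm hn hd (S.K.Kp_E j i))
  have hc := contr_dl (s := s) (S.K.Km_pos i) (S.K.truncated_Kp i) hKm hKp
  have hcc := contrComb_dl (s := s) hq hδ (S.K.Km_pos i) (S.K.truncated_Kp i) (S.K.Kp_neg i)
    (S.K.truncated_E j) hKm hKp
  have hA := ff (S.A_B i j)
  have hD := ff ((S.B_D j i).symm hn hd)
  have hBB : serreFam LinearMap.id (E i) (E i) (E j) q = (q - q⁻¹)⁻¹ •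
      (contrComb q (famR (dl s (1, -1) (pr (Km i) (Kp i))) (E j))
        (dl s dir12 (wXFY LinearMap.id (Km i) (Kp i) (E j)))
        (famL (dl s (1, -1) (pr (Km i) (Kp i))) (E j)) +
      swapFam (contrComb q (famR (dl s (1, -1) (pr (Km i) (Kp i))) (E j))
        (dl s dir12 (wXFY LinearMap.id (Km i) (Kp i) (E j)))
        (famL (dl s (1, -1) (pr (Km i) (Kp i))) (E j)))) := by
    funext ⟨k₁, k₂, l⟩
    rw [fam_smul_apply, fam_add_apply, swapFam, hcc, hcc, ← neg_add, ← smul_add, smul_neg,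
      inv_smul_smul₀ hqq]
    exact S.K.serre_eq hn hij k₁ k₂ l
  rw [serre_collect ?_ ?_ ?_ ?_ (S.serre_AD_left hn hq hd hδ hne hA hD
    (S.genΦ_E j j) hc (kills_dl_XFY (S.K.Km_pos i) (S.K.truncated_Kp i))
    (S.contr_r hn hq hd hij (S.κm_B i j) (S.B_κp j i))
    (kills_dl_XFY (S.κm_pos i) (S.tr_κp i))) hBB]
  · exact S.contrComb_r hn hq hd hqq hij (S.K.truncated_E j) (S.κm_B i j) (S.B_κp j i) k₁ k₂ l
  · exact serre_third_right (ev := LinearMap.id) hq hδ hA hA (fs (S.A_A i i))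
      (evZ_serreFam Φ (S.Φ_A i) (S.Φ_A i) (S.Φ_E j) fun k₁ k₂ l => ⟨k₁ + k₂, fun m => by linarith⟩)
      (evZ_serreFam Φ (S.Φ_A i) (S.Φ_A i) (S.Φ_E j) fun k₁ k₂ l => ⟨k₁ + k₂, fun m => by linarith⟩)
  · exact serre_first_left (ev := LinearMap.id) hq hδ hA (ff (S.K.E_E i j hne)) (fs (S.A_B i i))
      (evZ_serreFam Φ (S.Φ_A i) (S.Φ_E i) (S.Φ_E j) fun k₁ k₂ l => ⟨k₁, fun m => by linarith⟩)
      (evZ_serreFam Φ (S.Φ_A i) (S.Φ_E i) (S.Φ_E j) fun k₁ k₂ l => ⟨k₁, fun m => by linarith⟩)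
  · intro k₁ k₂ l
    rw [sixWords_comm]
    exact serre_first_right (ev := LinearMap.id) hq hD (ff (S.K.E_E i j hne)) (fs ((S.B_D i i).symm hn hd))
      (evZ_serreFam Ψ (S.Ψ_D i) (S.Ψ_E i) (S.Ψ_E j) fun k₁ k₂ l => ⟨k₂ + l, fun m => by linarith⟩)
      (evZ_serreFam Ψ (S.Ψ_D i) (S.Ψ_E i) (S.Ψ_E j) fun k₁ k₂ l => ⟨k₂ + l, fun m => by linarith⟩)
      k₂ k₁ l
  · exact serre_third_left (ev := LinearMap.id) hq hδ hD hD (fs (S.D_D hn hd i i))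
      (evZ_serreFam Ψ (S.Ψ_D i) (S.Ψ_D i) (S.Ψ_E j) fun k₁ k₂ l => ⟨l, fun m => by linarith⟩)
      (evZ_serreFam Ψ (S.Ψ_D i) (S.Ψ_D i) (S.Ψ_E j) fun k₁ k₂ l => ⟨l, fun m => by linarith⟩)

end

end PairSys

end SerreCoaction

/-! ## The coaction satisfies the relations of `𝒦_n` -/

section Coaction

variable {U : Type*} [AddCommGroup U] [Module ℂ U] {n : ℕ} {q d s r : ℂ}

theorem QuadRel.add_left {i j : ZMod n} {X X' F : ℤ → 𝓛 U} (h : QuadRel q d i j X F)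
    (h' : QuadRel q d i j X' F) : QuadRel q d i j (X + X') F := by
  rw [quadRel_iff] at *
  intro k l
  have e := congrArg₂ (· + ·) (h k l) (h' k l)
  simp only [Pi.add_apply, mul_add, add_mul, smul_add] at e ⊢
  rw [← sub_eq_zero] at e ⊢
  rw [← e]
  abel

theorem QuadRel.add_right {i j : ZMod n} {X F F' : ℤ → 𝓛 U} (h : QuadRel q d i j X F)
    (h' : QuadRel q d i j X F') : QuadRel q d i j X (F + F') := by
  rw [quadRel_iff] at *
  intro k l
  have e := congrArg₂ (· + ·) (h k l) (h' k l)
  simp only [Pi.add_apply, mul_add, add_mul, smul_add] at e ⊢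
  rw [← sub_eq_zero] at e ⊢
  rw [← e]
  abel

/-- The defect of the exchange relation of two currents of the same colour. -/
def selfDiff (q : ℂ) (X F : ℤ → 𝓛 U) (k l : ℤ) : 𝓛 U :=
  F (l + 1) * X k - q ^ 2 • (F l * X (k + 1)) - (q ^ 2 • (X k * F (l + 1)) - X (k + 1) * F l)

theorem selfDiff_add_left (X X' F : ℤ → 𝓛 U) (k l : ℤ) :
    selfDiff q (X + X') F k l = selfDiff q X F k l + selfDiff q X' F k l := by
  simp only [selfDiff, Pi.add_apply, mul_add, add_mul, smul_add]; abel

theorem selfDiff_add_right (X F F' : ℤ → 𝓛 U) (k l : ℤ) :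
    selfDiff q X (F + F') k l = selfDiff q X F k l + selfDiff q X F' k l := by
  simp only [selfDiff, Pi.add_apply, mul_add, add_mul, smul_add]; abel

theorem selfDiff_comm (X F : ℤ → 𝓛 U) (k l : ℤ) :
    selfDiff q F X k l = selfDiff q X F l k := by
  simp only [selfDiff]; abel

theorem selfDiff_eq (hn : 3 ≤ n) (i : ZMod n) (X F : ℤ → 𝓛 U) (k l : ℤ) :
    (den q d i i 1 • rp X F - num q d i i 1 • pr X F) (k, l) = selfDiff q X F k l := by
  simp only [fam_sub_apply, den, num, lw_smul_apply, gCoef_self, dCoef_self hn, rp_apply, pr_apply,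
    one_smul, mul_one, one_mul, selfDiff]

theorem QuadRel.selfDiff_eq_zero (hn : 3 ≤ n) {i : ZMod n} {X F : ℤ → 𝓛 U}
    (h : QuadRel q d i i X F) (k l : ℤ) : selfDiff q X F k l = 0 := by
  rw [← selfDiff_eq (d := d) hn i, h, sub_self]; rfl

theorem famR_add (Θ : Fam (ℤ × ℤ) (𝓛 U)) (F F' : ℤ → 𝓛 U) :
    famR Θ (F + F') = famR Θ F + famR Θ F' := by
  funext k; simp [famR, mul_add]

theorem famL_add (Θ : Fam (ℤ × ℤ) (𝓛 U)) (F F' : ℤ → 𝓛 U) :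
    famL Θ (F + F') = famL Θ F + famL Θ F' := by
  funext k; simp [famL, add_mul]

theorem dl_XFY_add {K K' F F' : ℤ → 𝓛 U} (hK : ∀ k, 0 < k → K k = 0)
    (hK' : Truncated K') :
    dl s dir12 (wXFY LinearMap.id K K' (F + F')) =
      dl s dir12 (wXFY LinearMap.id K K' F) + dl s dir12 (wXFY LinearMap.id K K' F') := by
  funext k
  rw [fam_add_apply, dl, dl, dl,
    ← locSum_add ((dlLF_XFY hK hK' k).smul _) ((dlLF_XFY hK hK' k).smul _)]
  congr 1; funext t
  simp [wXFY, mul_add, add_mul]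

theorem contrComb_add (X₀ X₁ X₂ Y₀ Y₁ Y₂ : Fam Exp3 (𝓛 U)) :
    contrComb q (X₀ + Y₀) (X₁ + Y₁) (X₂ + Y₂) = contrComb q X₀ X₁ X₂ + contrComb q Y₀ Y₁ Y₂ := by
  simp only [contrComb]; module

variable {e φ η ζ ζp E Kp Km : ZMod n → ℤ → 𝓛 U} {Φ Ψ Ω : Filt U}

namespace PairSys

variable (S : PairSys n q d s r e φ η ζ ζp E Kp Km Φ Ψ Ω)
include S

theorem A_A_far {i j : ZMod n} (h : i ≠ j) (h₁ : i ≠ j + 1) (h₂ : i ≠ j - 1) (k l : ℤ) :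
    Commute (letA e Km i k) (letA e Km j l) :=
  commute_cvi (S.lf_A i)
    (fun a => (commute_cvi (S.lf_A j) (fun b => (S.T.e_e_far i j h h₁ h₂ a b).symm)
      (fun b => (S.e_Km i j a b).symm) l).symm)
    (fun a => (commute_cvi (S.lf_A j) (fun b => S.e_Km j i b a)
      (fun b => S.K.Km_Km j i b a) l).symm) k

theorem φ_η_far {i j : ZMod n} (h : i ≠ j) (h₁ : i ≠ j + 1) (h₂ : i ≠ j - 1) (k l : ℤ) :
    Commute (φ i k) (η j l) :=
  commute_of_quadRel_far h h₁ h₂ (S.T.η_φ i j) (evZ_rp (S.tr_φ i))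
    (evZ_pr_of_neg (S.T.η_neg j)) k l

theorem T_T_far {i j : ZMod n} (h : i ≠ j) (h₁ : i ≠ j + 1) (h₂ : i ≠ j - 1) (k l : ℤ) :
    Commute (letT φ η i k) (letT φ η j l) :=
  commute_cvi (S.lf_T i)
    (fun a => (commute_cvi (S.lf_T j) (fun b => (S.T.φ_φ_far i j h h₁ h₂ a b).symm)
      (fun b => (S.φ_η_far h h₁ h₂ a b).symm) l).symm)
    (fun a => (commute_cvi (S.lf_T j)
      (fun b => S.φ_η_far h.symm (fun h => h₂ (by simp [h])) (fun h => h₁ (by simp [h])) b a)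
      (fun b => S.T.η_η j i b a) l).symm) k

theorem D_D_far {i j : ZMod n} (h : i ≠ j) (h₁ : i ≠ j + 1) (h₂ : i ≠ j - 1) (k l : ℤ) :
    Commute (letD φ η Kp i k) (letD φ η Kp j l) :=
  ((commute_cvi (S.lf_D i)
    (fun a => (commute_cvi (S.lf_D j) (fun b => (S.T_T_far h h₁ h₂ a b).symm)
      (fun b => (S.T_Kp i j a b).symm) l).symm)
    (fun a => (commute_cvi (S.lf_D j) (fun b => S.T_Kp j i b a)
      (fun b => S.K.Kp_Kp j i b a) l).symm) k).neg_left).neg_right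

theorem A_E_far {i j : ZMod n} (h : i ≠ j) (h₁ : i ≠ j + 1) (h₂ : i ≠ j - 1) (k l : ℤ) :
    Commute (letA e Km i k) (E j l) :=
  commute_of_quadRel_far h h₁ h₂ (S.A_B i j) (evZ_rp (S.tr_A i))
    (evZ_pr Φ (S.Φ_A i) (S.Φ_E j)) k l

theorem A_D_far (hq : q ≠ 0) (hd : d ≠ 0) {i j : ZMod n} (h : i ≠ j) (h₁ : i ≠ j + 1)
    (h₂ : i ≠ j - 1) (k l : ℤ) : Commute (letA e Km i k) (letD φ η Kp j l) :=
  commute_of_quadRel_far h h₁ h₂ (S.A_D hq hd h) (evZ_rp (S.tr_A i))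
    (evZ_pr _ (S.genΦ_A h) (S.genΦ_D j)) k l

theorem E_D_far {i j : ZMod n} (h : i ≠ j) (h₁ : i ≠ j + 1) (h₂ : i ≠ j - 1) (k l : ℤ) :
    Commute (E i k) (letD φ η Kp j l) :=
  commute_of_quadRel_far h h₁ h₂ (S.B_D i j) (evZ_rp (S.K.truncated_E i))
    (evZ_pr Ψ (S.Ψ_E i) (S.Ψ_D j)) k l

theorem quadRel_coE_κp (hq : q ≠ 0) (hd : d ≠ 0) (i j) :
    QuadRel q d i j (coE e φ η E Kp Km i) (cvi (η j) (Kp j)) :=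
  ((S.A_κp hq hd i j).add_left (S.B_κp i j)).add_left (S.D_κp i j)

theorem quadRel_κm_coE (hq : q ≠ 0) (hd : d ≠ 0) (i j) :
    QuadRel q d i j (cvi (ζ i) (Km i)) (coE e φ η E Kp Km j) :=
  ((S.κm_A i j).add_right (S.κm_B i j)).add_right (S.κm_D hq hd i j)

theorem quadRel_coE_coE (hn : 3 ≤ n) (hq : q ≠ 0) (hd : d ≠ 0) {i j} (h : i ≠ j) :
    QuadRel q d i j (coE e φ η E Kp Km i) (coE e φ η E Kp Km j) := by
  have hA := ((S.A_A i j).add_right (S.A_B i j)).add_right (S.A_D hq hd h)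
  have hE : QuadRel q d i j (E i) (coE e φ η E Kp Km j) :=
    (((S.A_B j i).symm hn hd).add_right (S.K.E_E i j h)).add_right (S.B_D i j)
  have hD := (((S.A_D hq hd h.symm).symm hn hd).add_right ((S.B_D j i).symm hn hd)).add_right
    (S.D_D hn hd i j)
  exact (hA.add_left hE).add_left hD

theorem truncated_coE (i) : Truncated (coE e φ η E Kp Km i) :=
  ((S.tr_A i).add (S.K.truncated_E i)).add (S.tr_D i)

theorem selfDiff_A_D (hn : 3 ≤ n) (hq : q ≠ 0) (hd : d ≠ 0) (i k l) :
    selfDiff q (letA e Km i) (letD φ η Kp i) k l = (q - q⁻¹)⁻¹ • (lw (q ^ 2) 1 •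
      (dl s (1, -1) (pr (Km i) (Kp i)) -
        dl r (1, -1) (pr (cvi (ζ i) (Km i)) (cvi (η i) (Kp i))))) (k, l) := by
  have e₁ : den q d i i 1 = lw 1 (q ^ 2) := by simp [den, gCoef_self]
  have e₂ : num q d i i 1 = lw (q ^ 2) 1 := by simp [num, gCoef_self, dCoef_self hn]
  rw [← selfDiff_eq (d := d) hn i, e₁, e₂, S.D_A_self hn hq hd, S.A_D_self, smul_sub, sub_sub_cancel,
    ← cst_smul_eq, smul_comm, cst_smul_apply]

theorem selfDiff_coE (hn : 3 ≤ n) (hq : q ≠ 0) (hd : d ≠ 0) (i k l) :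
    selfDiff q (coE e φ η E Kp Km i) (coE e φ η E Kp Km i) k l = (q - q⁻¹)⁻¹ •
      ((lw (-q ^ 2) (-1) • dl r (1, -1) (pr (cvi (ζ i) (Km i)) (cvi (η i) (Kp i)))) (k, l) +
        (lw (-q ^ 2) (-1) • dl r (1, -1) (pr (cvi (ζ i) (Km i)) (cvi (η i) (Kp i)))) (l, k)) := by
  have z := fun {X F : ℤ → 𝓛 U} (h : QuadRel q d i i X F) => h.selfDiff_eq_zero hn k l
  have hEE := S.K.E_E_self i k l
  rw [selfDiff_eq hn] at hEE
  simp only [selfDiff_add_left, selfDiff_add_right]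
  rw [z (S.A_A i i), z (S.A_B i i), z ((S.A_B i i).symm hn hd), z (S.B_D i i),
    z ((S.B_D i i).symm hn hd), z (S.D_D hn hd i i), selfDiff_comm (letA e Km i) (letD φ η Kp i),
    S.selfDiff_A_D hn hq hd, S.selfDiff_A_D hn hq hd, hEE]
  simp only [lw_smul_apply, fam_sub_apply]
  module

theorem serre_coE (hn : 3 ≤ n) (hq : q ≠ 0) (hd : d ≠ 0) (hqq : q - q⁻¹ ≠ 0) (hs : s ≠ 0)
    {i j : ZMod n} (hij : j = i + 1 ∨ j = i - 1) (k₁ k₂ l : ℤ) :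
    sixWords q (coE e φ η E Kp Km i) (coE e φ η E Kp Km i) (coE e φ η E Kp Km j) k₁ k₂ l =
    -(serreTail r (q⁻¹ * (serreParam d i j)⁻¹) (q⁻¹ * serreParam d i j)
        (cvi (ζ i) (Km i)) (coE e φ η E Kp Km j) (cvi (η i) (Kp i)) k₁ k₂ l +
      serreTail r (q⁻¹ * (serreParam d i j)⁻¹) (q⁻¹ * serreParam d i j)
        (cvi (ζ i) (Km i)) (coE e φ η E Kp Km j) (cvi (η i) (Kp i)) k₂ k₁ l) := by
  have hA := S.contrComb_r hn hq hd hqq hij (S.tr_A j) (S.κm_A i j) (S.A_κp hq hd j i) k₁ k₂ l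
  have hE := S.contrComb_r hn hq hd hqq hij (S.K.truncated_E j) (S.κm_B i j) (S.B_κp j i) k₁ k₂ l
  have hD := S.contrComb_r hn hq hd hqq hij (S.tr_D j) (S.κm_D hq hd i j) (S.D_κp j i) k₁ k₂ l
  have hT := S.contrComb_r hn hq hd hqq hij (S.truncated_coE j) (S.quadRel_κm_coE hq hd i j)
    (S.quadRel_coE_κp hq hd j i) k₁ k₂ l
  rw [sixWords_add_right, sixWords_add_right, S.serre_coE_A hn hq hd hqq hij hs,
    S.serre_coE_E hn hq hd hqq hij, S.serre_coE_D hn hq hd hqq hij hs, ← hA, ← hE, ← hD, ← hT]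
  simp only [famR_add, famL_add, dl_XFY_add (S.κm_pos i) (S.tr_κp i), contrComb_add, fam_add_apply]
  module

theorem coaction (hn : 3 ≤ n) (hq : q ≠ 0) (hd : d ≠ 0) (hqq : q - q⁻¹ ≠ 0) (hs : s ≠ 0) :
    KSys n q d r (coE e φ η E Kp Km) (fun i => cvi (η i) (Kp i)) (fun i => cvi (ζ i) (Km i)) where
  truncated_E := S.truncated_coE
  truncated_Kp := S.tr_κp
  Kp_neg := S.κp_neg
  Km_pos := S.κm_pos
  Kp_Kp := S.κp_comm
  Km_Km := S.κm_comm
  Kp_Km := S.κm_κp hq hd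
  Kp_E := S.quadRel_coE_κp hq hd
  E_Km := S.quadRel_κm_coE hq hd
  E_E _ _ h := S.quadRel_coE_coE hn hq hd h
  E_E_self i k l := by rw [selfDiff_eq hn, S.selfDiff_coE hn hq hd]
  E_E_far i j h h₁ h₂ k l := by
    have h' := h.symm
    have h₁' : j ≠ i + 1 := fun h => h₂ (by simp [h])
    have h₂' : j ≠ i - 1 := fun h => h₁ (by simp [h])
    refine Commute.add_left (Commute.add_left (Commute.add_right (Commute.add_right ?_ ?_) ?_)
      (Commute.add_right (Commute.add_right ?_ ?_) ?_))
      (Commute.add_right (Commute.add_right ?_ ?_) ?_)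
    · exact S.A_A_far h h₁ h₂ k l
    · exact S.A_E_far h h₁ h₂ k l
    · exact S.A_D_far hq hd h h₁ h₂ k l
    · exact (S.A_E_far h' h₁' h₂' l k).symm
    · exact S.K.E_E_far i j h h₁ h₂ k l
    · exact S.E_D_far h h₁ h₂ k l
    · exact (S.A_D_far hq hd h' h₁' h₂' l k).symm
    · exact (S.E_D_far h' h₁' h₂' l k).symm
    · exact S.D_D_far h h₁ h₂ k l
  serre_succ i k₁ k₂ l := by
    have := S.serre_coE hn hq hd hqq hs (Or.inl rfl : i + 1 = i + 1 ∨ _) k₁ k₂ l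
    rwa [serreParam, if_pos rfl] at this
  serre_pred i k₁ k₂ l := by
    have := S.serre_coE hn hq hd hqq hs (Or.inr rfl : i - 1 = i + 1 ∨ _) k₁ k₂ l
    rwa [serreParam, if_neg (zmod_succ_ne_pred hn i).symm, inv_inv] at this

end PairSys

end Coaction

/-! ## Gradings -/

section Gradings

variable {U : Type*} [AddCommGroup U] [Module ℂ U]

/-- The sum of the components of degree at least `p`. -/
def tailSum (G : ℤ → Submodule ℂ U) (p : ℤ) : Submodule ℂ U := ⨆ k, ⨆ _ : p ≤ k, G k

theorem le_tailSum (G : ℤ → Submodule ℂ U) {p k : ℤ} (h : p ≤ k) : G k ≤ tailSum G p :=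
  le_iSup₂_of_le (f := fun k (_ : p ≤ k) => G k) k h le_rfl

theorem tailSum_le {G : ℤ → Submodule ℂ U} {p : ℤ} {S : Submodule ℂ U}
    (h : ∀ k, p ≤ k → G k ≤ S) : tailSum G p ≤ S := iSup₂_le h

theorem tailSum_anti (G : ℤ → Submodule ℂ U) {p p' : ℤ} (h : p ≤ p') :
    tailSum G p' ≤ tailSum G p :=
  tailSum_le fun _ hk => le_tailSum G (h.trans hk)

/-- The filtration attached to a grading with degrees bounded from above. -/
def Filt.ofGrading (G : ℤ → Submodule ℂ U) (htop : ⨆ k, G k = ⊤)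
    (hb : ∃ N : ℤ, ∀ k, N < k → G k = ⊥) : Filt U where
  F := tailSum G
  anti h := tailSum_anti G h
  exh u := by
    have hu : u ∈ ⨆ k, G k := htop ▸ Submodule.mem_top
    refine Submodule.iSup_induction G (motive := fun u => ∃ p, u ∈ tailSum G p) hu
      (fun k x hx => ⟨k, le_tailSum G le_rfl hx⟩) ⟨0, Submodule.zero_mem _⟩ ?_
    rintro x y ⟨p, hp⟩ ⟨p', hp'⟩
    exact ⟨min p p', Submodule.add_mem _ (tailSum_anti G (min_le_left _ _) hp)
      (tailSum_anti G (min_le_right _ _) hp')⟩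
  vanish := by
    obtain ⟨N, hN⟩ := hb
    exact ⟨N, fun p hp => eq_bot_iff.2 <| tailSum_le fun k hk => (hN k (by omega)).le⟩

theorem HasDegree.raises {G : ℤ → Submodule ℂ U} {htop : ⨆ k, G k = ⊤}
    {hb : ∃ N : ℤ, ∀ k, N < k → G k = ⊥} {a : 𝓛 U} {m : ℤ} (ha : HasDegree G a m) :
    (Filt.ofGrading G htop hb).Raises m a := by
  intro p u hu
  have : tailSum G p ≤ (tailSum G (p + m)).comap a :=
    tailSum_le fun k hk v hv => le_tailSum G (by omega : p + m ≤ m + k) (ha k v hv)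
  exact this hu

variable {G : ℤ → Submodule ℂ U}

theorem HasDegree.zero (m : ℤ) : HasDegree G 0 m := fun _ _ _ => Submodule.zero_mem _

theorem HasDegree.one : HasDegree G 1 0 := fun l v hv => by simpa using hv

theorem HasDegree.neg {a : 𝓛 U} {m : ℤ} (ha : HasDegree G a m) : HasDegree G (-a) m :=
  fun l v hv => Submodule.neg_mem _ (ha l v hv)

theorem HasDegree.add {a b : 𝓛 U} {m : ℤ} (ha : HasDegree G a m)
    (hb : HasDegree G b m) : HasDegree G (a + b) m :=
  fun l v hv => Submodule.add_mem _ (ha l v hv) (hb l v hv)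

theorem HasDegree.smul {a : 𝓛 U} {m : ℤ} (c : ℂ) (ha : HasDegree G a m) :
    HasDegree G (c • a) m :=
  fun l v hv => Submodule.smul_mem _ c (ha l v hv)

theorem HasDegree.mul {a b : 𝓛 U} {m m' : ℤ} (ha : HasDegree G a m)
    (hb : HasDegree G b m') : HasDegree G (a * b) (m + m') := fun l v hv => by
  rw [add_assoc]; exact ha _ _ (hb l v hv)

theorem HasDegree.congr {a : 𝓛 U} {m m' : ℤ} (ha : HasDegree G a m) (h : m = m') :
    HasDegree G a m' := h ▸ ha

theorem HasDegree.sum {ι : Type*} {s : Finset ι} {f : ι → 𝓛 U} {m : ℤ}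
    (h : ∀ i ∈ s, HasDegree G (f i) m) : HasDegree G (∑ i ∈ s, f i) m := fun l v hv => by
  rw [LinearMap.sum_apply]; exact Submodule.sum_mem _ fun i hi => h i hi l v hv

theorem HasDegree.locSum {ι : Type*} {f : ι → 𝓛 U} {m : ℤ}
    (h : ∀ i, HasDegree G (f i) m) : HasDegree G (locSum f) m := by
  by_cases hf : LocFin f
  · intro p u hu
    rw [locSum_apply hf]
    exact finsum_induction (fun v => v ∈ G (m + p)) (Submodule.zero_mem _)
      (fun _ _ => Submodule.add_mem _) fun i => h i p u hu
  · rw [_root_.locSum, dif_neg hf]; exact HasDegree.zero m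

/-- The coefficient of `X ^ m` in `A` has degree `ε m`. -/
def SerDeg (G : ℤ → Submodule ℂ U) (ε : ℤ) (A : PowerSeries (𝓛 U)) : Prop :=
  ∀ m : ℕ, HasDegree G (PowerSeries.coeff m A) (ε * m)

theorem SerDeg.mul {ε : ℤ} {A B : PowerSeries (𝓛 U)} (hA : SerDeg G ε A)
    (hB : SerDeg G ε B) : SerDeg G ε (A * B) := fun m => by
  rw [PowerSeries.coeff_mul]
  refine HasDegree.sum fun p hp => ((hA p.1).mul (hB p.2)).congr ?_
  rw [Finset.HasAntidiagonal.mem_antidiagonal] at hp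
  rw [← hp]; push_cast; ring

theorem SerDeg.C {ε : ℤ} {a : 𝓛 U} (ha : HasDegree G a 0) :
    SerDeg G ε (PowerSeries.C a) := fun m => by
  rw [PowerSeries.coeff_C]
  split_ifs with h
  · simpa [h] using ha
  · exact HasDegree.zero _

theorem SerDeg.pow {ε : ℤ} {A : PowerSeries (𝓛 U)} (hA : SerDeg G ε A) (k : ℕ) :
    SerDeg G ε (A ^ k) := by
  induction k with
  | zero => rw [pow_zero, ← map_one PowerSeries.C]; exact SerDeg.C HasDegree.one
  | succ k ih => rw [pow_succ]; exact ih.mul hA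

theorem SerDeg.formalExp {ε : ℤ} {A : PowerSeries (𝓛 U)} (hA : SerDeg G ε A) :
    SerDeg G ε (formalExp A) := fun m => by
  rw [_root_.formalExp, PowerSeries.coeff_mk]
  exact HasDegree.sum fun k _ => (hA.pow k m).smul _

theorem SerDeg.posModes {c : ℂ} {h : ℤ → 𝓛 U}
    (hd : ∀ r, r ≠ 0 → HasDegree G (h r) r) : SerDeg G 1 (posModes c h) := fun m => by
  rw [_root_.posModes, PowerSeries.coeff_mk]
  split_ifs with h0
  · exact HasDegree.zero _
  · exact ((hd m (by exact_mod_cast h0)).smul c).congr (by simp)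

theorem SerDeg.negModes {c : ℂ} {h : ℤ → 𝓛 U}
    (hd : ∀ r, r ≠ 0 → HasDegree G (h r) r) : SerDeg G (-1) (negModes c h) := fun m => by
  rw [_root_.negModes, PowerSeries.coeff_mk]
  split_ifs with h0
  · exact HasDegree.zero _
  · exact ((hd (-m) (by simpa using h0)).smul c).congr (by simp)

theorem SerDeg.curP {A : PowerSeries (𝓛 U)} (hA : SerDeg G 1 A) (k : ℤ) :
    HasDegree G (curP A k) k := by
  rw [_root_.curP]
  split_ifs with h
  · exact (hA _).congr (by omega)
  · exact HasDegree.zero _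

theorem SerDeg.curM {A : PowerSeries (𝓛 U)} (hA : SerDeg G (-1) A) (k : ℤ) :
    HasDegree G (curM A k) k := by
  rw [_root_.curM]
  split_ifs with h
  · exact (hA _).congr (by omega)
  · exact HasDegree.zero _

theorem IsAdmGrading.iSup_eq_top (h : IsAdmGrading G) : ⨆ k, G k = ⊤ :=
  h.internal.submodule_iSup_eq_top

/-- The filtration of an admissible grading. -/
def IsAdmGrading.filt (h : IsAdmGrading G) : Filt U :=
  Filt.ofGrading G h.iSup_eq_top h.bounded

theorem IsAdmGrading.bijective (h : IsAdmGrading G) :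
    Function.Bijective (DirectSum.coeLinearMap G) := h.internal

/-- The projection to a homogeneous component. -/
def IsAdmGrading.proj (h : IsAdmGrading G) (k : ℤ) : 𝓛 U :=
  (G k).subtype ∘ₗ DirectSum.component ℂ ℤ (fun k => G k) k ∘ₗ
    (LinearEquiv.ofBijective (DirectSum.coeLinearMap G) h.bijective).symm.toLinearMap

theorem IsAdmGrading.proj_of_mem (h : IsAdmGrading G) {k : ℤ} {u : U} (hu : u ∈ G k) (l : ℤ) :
    h.proj l u = if l = k then u else 0 := by
  have : (LinearEquiv.ofBijective (DirectSum.coeLinearMap G) h.bijective).symm u =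
      DirectSum.lof ℂ ℤ (fun k => G k) k ⟨u, hu⟩ := by
    rw [LinearEquiv.symm_apply_eq, LinearEquiv.ofBijective_apply]
    exact (DirectSum.coeLinearMap_lof G k ⟨u, hu⟩).symm
  simp only [proj, LinearMap.comp_apply, LinearEquiv.coe_coe, this, Submodule.subtype_apply]
  split_ifs with hl
  · subst hl; rw [DirectSum.component.lof_self]
  · rw [DirectSum.component.of, dif_neg (Ne.symm hl)]; rfl

theorem IsAdmGrading.locFin_proj (h : IsAdmGrading G) : LocFin h.proj := fun u => by
  have hu : u ∈ ⨆ k, G k := h.iSup_eq_top ▸ Submodule.mem_top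
  induction hu using Submodule.iSup_induction' with
  | mem k x hx =>
    refine (Set.finite_singleton k).subset fun l hl => ?_
    by_contra hne
    exact hl (by simp only [h.proj_of_mem hx, if_neg (show l ≠ k from hne)])
  | zero => simp
  | add x y _ _ hx hy =>
    refine (hx.union hy).subset fun l hl => ?_
    by_contra hc
    simp only [Set.mem_union, Function.mem_support, not_or, not_not] at hc
    exact hl (by simp [hc.1, hc.2])

end Gradings

section TensorGrading

variable {V W : Type*} [AddCommGroup V] [Module ℂ V] [AddCommGroup W] [Module ℂ W]
variable {𝒱 : ℤ → Submodule ℂ V} {𝒲 : ℤ → Submodule ℂ W}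

theorem LocFin.of_tmul {ι : Type*} {f : ι → 𝓛 (V ⊗[ℂ] W)}
    (h : ∀ v w, (Function.support fun i => f i (v ⊗ₜ w)).Finite) : LocFin f := fun u => by
  induction u using TensorProduct.induction_on with
  | zero => simp
  | tmul v w => exact h v w
  | add x y hx hy =>
    refine (hx.union hy).subset fun l hl => ?_
    by_contra hc
    simp only [Set.mem_union, Function.mem_support, not_or, not_not] at hc
    exact hl (by simp [hc.1, hc.2])

theorem LocFin.opR {ι : Type*} {f : ι → 𝓛 W} (h : LocFin f) :
    LocFin fun i => opR V (f i) :=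
  LocFin.of_tmul fun v w => (h w).subset fun i hi => by
    intro h0
    refine hi ?_
    simp only at h0
    simp [_root_.opR, h0]

theorem opR_locSum {ι : Type*} {f : ι → 𝓛 W} (h : LocFin f) :
    opR V (locSum f) = locSum fun i => opR V (f i) := by
  apply TensorProduct.ext'
  intro v w
  rw [locSum_apply h.opR]
  simp only [opR, TensorProduct.map_tmul, LinearMap.id_apply, locSum_apply h]
  exact map_finsum (TensorProduct.mk ℂ V W v) (h w)

theorem HasDegree.map_map₂ {a : 𝓛 V} {b : 𝓛 W} {P P' : Submodule ℂ V}
    {Q Q' : Submodule ℂ W} (ha : ∀ v ∈ P, a v ∈ P') (hb : ∀ w ∈ Q, b w ∈ Q')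
    {u : V ⊗[ℂ] W} (hu : u ∈ Submodule.map₂ (TensorProduct.mk ℂ V W) P Q) :
    TensorProduct.map a b u ∈ Submodule.map₂ (TensorProduct.mk ℂ V W) P' Q' := by
  have : Submodule.map₂ (TensorProduct.mk ℂ V W) P Q ≤
      (Submodule.map₂ (TensorProduct.mk ℂ V W) P' Q').comap (TensorProduct.map a b) :=
    Submodule.map₂_le.2 fun v hv w hw => Submodule.apply_mem_map₂ _ (ha v hv) (hb w hw)
  exact this hu

theorem HasDegree.map_tensor {a : 𝓛 V} {b : 𝓛 W} {m m' : ℤ}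
    (ha : HasDegree 𝒱 a m) (hb : HasDegree 𝒲 b m') :
    HasDegree (tensorGrading 𝒱 𝒲) (TensorProduct.map a b) (m + m') := by
  intro l u hu
  have : tensorGrading 𝒱 𝒲 l ≤
      (tensorGrading 𝒱 𝒲 (m + m' + l)).comap (TensorProduct.map a b) := by
    refine iSup_le fun x u hu => Submodule.mem_iSup_of_mem (m + x) ?_
    refine HasDegree.map_map₂ (fun v hv => ha x v hv) (fun w hw => ?_) hu
    have := hb _ w hw
    rwa [show m + m' + l - (m + x) = m' + (l - x) by ring]
  exact this hu

theorem HasDegree.opL {a : 𝓛 V} {m : ℤ} (ha : HasDegree 𝒱 a m) :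
    HasDegree (tensorGrading 𝒱 𝒲) (opL W a) m :=
  (ha.map_tensor HasDegree.one).congr (add_zero m)

theorem HasDegree.opR {b : 𝓛 W} {m : ℤ} (hb : HasDegree 𝒲 b m) :
    HasDegree (tensorGrading 𝒱 𝒲) (opR V b) m :=
  (HasDegree.one.map_tensor hb).congr (zero_add m)

theorem HasDegree.tensorCur {A : ℤ → 𝓛 V} {B : ℤ → 𝓛 W}
    (hA : ∀ k, HasDegree 𝒱 (A k) k) (hB : ∀ k, HasDegree 𝒲 (B k) k) (k : ℤ) :
    HasDegree (tensorGrading 𝒱 𝒲) (tensorCur A B k) k :=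
  HasDegree.locSum fun a => ((hA a).map_tensor (hB (k - a))).congr (by ring)

/-- The grading of the tensor product by the degree of the first factor. -/
def leftGrading (W : Type*) [AddCommGroup W] [Module ℂ W] (𝒱 : ℤ → Submodule ℂ V) (k : ℤ) :
    Submodule ℂ (V ⊗[ℂ] W) := Submodule.map₂ (TensorProduct.mk ℂ V W) (𝒱 k) ⊤

/-- The grading of the tensor product by the degree of the second factor. -/
def rightGrading (V : Type*) [AddCommGroup V] [Module ℂ V] (𝒲 : ℤ → Submodule ℂ W) (k : ℤ) :
    Submodule ℂ (V ⊗[ℂ] W) := Submodule.map₂ (TensorProduct.mk ℂ V W) ⊤ (𝒲 k)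

theorem HasDegree.opL_left {a : 𝓛 V} {m : ℤ} (ha : HasDegree 𝒱 a m) :
    HasDegree (leftGrading W 𝒱) (_root_.opL W a) m := fun l _ hu =>
  HasDegree.map_map₂ (ha l) (fun _ _ => Submodule.mem_top) hu

theorem HasDegree.opR_left (b : 𝓛 W) :
    HasDegree (leftGrading W 𝒱) (_root_.opR V b) 0 := fun l _ hu =>
  HasDegree.map_map₂ (fun v hv => by simpa using hv) (fun _ _ => Submodule.mem_top) hu

theorem HasDegree.opR_right {b : 𝓛 W} {m : ℤ} (hb : HasDegree 𝒲 b m) :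
    HasDegree (rightGrading V 𝒲) (_root_.opR V b) m := fun l _ hu =>
  HasDegree.map_map₂ (fun _ _ => Submodule.mem_top) (hb l) hu

theorem HasDegree.opL_right (a : 𝓛 V) :
    HasDegree (rightGrading V 𝒲) (_root_.opL W a) 0 := fun l _ hu =>
  HasDegree.map_map₂ (fun _ _ => Submodule.mem_top) (fun w hw => by simpa using hw) hu

/-- The filtration of a tensor product by the degree of the first factor. -/
def IsAdmGrading.leftFilt (W : Type*) [AddCommGroup W] [Module ℂ W] (h : IsAdmGrading 𝒱) :
    Filt (V ⊗[ℂ] W) :=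
  Filt.ofGrading (leftGrading W 𝒱)
    (by
      simp only [leftGrading]
      rw [← Submodule.map₂_iSup_left, h.iSup_eq_top, TensorProduct.map₂_mk_top_top_eq_top])
    (h.bounded.imp fun N hN k hk => by rw [leftGrading, hN k hk, Submodule.map₂_bot_left])

/-- The filtration of a tensor product by the degree of the second factor. -/
def IsAdmGrading.rightFilt (V : Type*) [AddCommGroup V] [Module ℂ V] (h : IsAdmGrading 𝒲) :
    Filt (V ⊗[ℂ] W) :=
  Filt.ofGrading (rightGrading V 𝒲)
    (by
      simp only [rightGrading]
      rw [← Submodule.map₂_iSup_right, h.iSup_eq_top, TensorProduct.map₂_mk_top_top_eq_top])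
    (h.bounded.imp fun N hN k hk => by rw [rightGrading, hN k hk, Submodule.map₂_bot_right])

theorem IsAdmGrading.locFin_tensor_proj (h : IsAdmGrading 𝒱) (h' : IsAdmGrading 𝒲) (k : ℤ) :
    LocFin (tensorTerms h.proj h'.proj k) :=
  LocFin.of_tmul fun v w => (h.locFin_proj v).subset fun a ha => by
    intro h0
    simp only at h0
    exact ha (by simp [tensorTerms, h0])

theorem IsAdmGrading.tensor_proj_of_mem (h : IsAdmGrading 𝒱) (h' : IsAdmGrading 𝒲) {k l : ℤ}
    {u : V ⊗[ℂ] W} (hu : u ∈ tensorGrading 𝒱 𝒲 l) :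
    tensorCur h.proj h'.proj k u = if k = l then u else 0 := by
  have main : ∀ a, ∀ v ∈ 𝒱 a, ∀ w ∈ 𝒲 (l - a), tensorCur h.proj h'.proj k (v ⊗ₜ w) =
      if k = l then v ⊗ₜ w else 0 := fun a v hv w hw => by
    rw [tensorCur, locSum_apply (h.locFin_tensor_proj h' k), finsum_eq_single _ a fun b hb => by
      simp [tensorTerms, h.proj_of_mem hv, hb]]
    simp only [tensorTerms, TensorProduct.map_tmul, h.proj_of_mem hv, h'.proj_of_mem hw]
    by_cases hk : k = l
    · simp [hk]
    · simp [hk]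
  by_cases hk : k = l
  · have : tensorGrading 𝒱 𝒲 l ≤
        LinearMap.ker (tensorCur h.proj h'.proj k - LinearMap.id) :=
      iSup_le fun a => Submodule.map₂_le.2 fun v hv w hw => by
        rw [LinearMap.mem_ker, LinearMap.sub_apply, TensorProduct.mk_apply, main a v hv w hw,
          if_pos hk, LinearMap.id_apply, sub_self]
    have := this hu
    rw [LinearMap.mem_ker, LinearMap.sub_apply, sub_eq_zero] at this
    rw [this, if_pos hk, LinearMap.id_apply]
  · have : tensorGrading 𝒱 𝒲 l ≤ LinearMap.ker (tensorCur h.proj h'.proj k) :=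
      iSup_le fun a => Submodule.map₂_le.2 fun v hv w hw => by
        rw [LinearMap.mem_ker, TensorProduct.mk_apply, main a v hv w hw, if_neg hk]
    rw [if_neg hk]
    exact this hu

theorem IsAdmGrading.tensor (h : IsAdmGrading 𝒱) (h' : IsAdmGrading 𝒲) :
    IsAdmGrading (tensorGrading 𝒱 𝒲) := by
  obtain ⟨N, hN⟩ := h.bounded
  obtain ⟨M, hM⟩ := h'.bounded
  refine ⟨?_, fun k => ?_, N + M, fun k hk => ?_⟩
  · rw [DirectSum.isInternal_submodule_iff_iSupIndep_and_iSup_eq_top]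
    constructor
    · intro k
      rw [Submodule.disjoint_def]
      intro u hu hu'
      have h1 := h.tensor_proj_of_mem h' (k := k) hu
      have : (⨆ j, ⨆ _ : j ≠ k, tensorGrading 𝒱 𝒲 j) ≤
          LinearMap.ker (tensorCur h.proj h'.proj k) :=
        iSup₂_le fun j hj x hx => by
          rw [LinearMap.mem_ker, h.tensor_proj_of_mem h' hx, if_neg (Ne.symm hj)]
      rw [if_pos rfl, LinearMap.mem_ker.1 (this hu')] at h1
      exact h1.symm
    · rw [eq_top_iff, ← TensorProduct.map₂_mk_top_top_eq_top, ← h.iSup_eq_top,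
        ← h'.iSup_eq_top, Submodule.map₂_iSup_left]
      refine iSup_le fun a => ?_
      rw [Submodule.map₂_iSup_right]
      refine iSup_le fun b => le_iSup_of_le (a + b) (le_iSup_of_le a ?_)
      rw [add_sub_cancel_left]
  · have hle : tensorGrading 𝒱 𝒲 k ≤ ⨆ a : Finset.Icc (k - M) N,
        Submodule.map₂ (TensorProduct.mk ℂ V W) (𝒱 a) (𝒲 (k - a)) := by
      refine iSup_le fun a => ?_
      by_cases ha : a ∈ Finset.Icc (k - M) N
      · exact le_iSup_of_le (⟨a, ha⟩ : Finset.Icc (k - M) N) le_rfl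
      · rw [Finset.mem_Icc, not_and_or, not_le, not_le] at ha
        rcases ha with ha | ha
        · rw [hM _ (by omega), Submodule.map₂_bot_right]; exact bot_le
        · rw [hN _ ha, Submodule.map₂_bot_left]; exact bot_le
    have : ∀ a : Finset.Icc (k - M) N, FiniteDimensional ℂ
        (Submodule.map₂ (TensorProduct.mk ℂ V W) (𝒱 a) (𝒲 (k - a))) := fun a =>
      Submodule.fg_iff_finiteDimensional _ |>.1 <| Submodule.FG.map₂ _
        ((Submodule.fg_iff_finiteDimensional _).2 (h.finDim _))
        ((Submodule.fg_iff_finiteDimensional _).2 (h'.finDim _))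
    exact Submodule.finiteDimensional_of_le hle
  · rw [eq_bot_iff]
    refine iSup_le fun a => ?_
    rcases lt_or_ge N a with ha | ha
    · rw [hN _ ha, Submodule.map₂_bot_left]
    · rw [hM _ (by omega), Submodule.map₂_bot_right]

end TensorGrading

/-! ## Relations with rational structure functions -/

section RationalRelations

variable {U : Type*} [AddCommGroup U] [Module ℂ U]

theorem actZW_eq_ts (g : PowerSeries ℂ) (X : Fam (ℤ × ℤ) (𝓛 U)) (k l : ℤ) :
    actZW g (fun k' l' => X (k', l')) k l = ts g (1, -1) X (k, l) := by
  rw [actZW, ts]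
  congr 1; funext m
  congr 2
  simp [sub_eq_add_neg]

theorem actWZ_eq_ts (g : PowerSeries ℂ) (X : Fam (ℤ × ℤ) (𝓛 U)) (k l : ℤ) :
    actWZ g (fun k' l' => X (l', k')) l k = ts g (1, -1) X (k, l) := by
  rw [actWZ, ts]
  congr 1; funext m
  congr 2
  simp [sub_eq_add_neg]

/-- The linear power series `a - b X`. -/
def linSer (a b : ℂ) : PowerSeries ℂ := PowerSeries.C a - PowerSeries.C b * PowerSeries.X

theorem lw_eq (a b : ℂ) :
    lw a b = mono ((0, 1) : ℤ × ℤ) * (cst a - cst b * mono ((1, -1) : ℤ × ℤ)) := by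
  have : (mono ((1, 0) : ℤ × ℤ) : Lau (ℤ × ℤ)) = mono (0, 1) * mono (1, -1) := by
    rw [mono, mono, mono, ← map_mul, ← ofAdd_add]; rfl
  rw [lw, this]; ring

variable {X Y : Fam (ℤ × ℤ) (𝓛 U)}

theorem lw_smul_ts (a b : ℂ) (g : PowerSeries ℂ) (hX : EvZ (1, -1) X) :
    lw a b • ts g (1, -1) X =
      (mono ((0, 1) : ℤ × ℤ) : Lau (ℤ × ℤ)) • ts (linSer a b * g) (1, -1) X := by
  rw [lw_eq, mul_smul, linSer, ts_linear_mul _ _ _ hX]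

theorem lw_lw_smul_ts (a b a' b' : ℂ) (g : PowerSeries ℂ) (hX : EvZ (1, -1) X) :
    (lw a b * lw a' b') • ts g (1, -1) X =
      (mono ((0, 1) : ℤ × ℤ) * mono ((0, 1) : ℤ × ℤ) : Lau (ℤ × ℤ)) •
        ts (linSer a b * linSer a' b' * g) (1, -1) X := by
  rw [lw_eq, lw_eq, mul_assoc (linSer a b), linSer, ts_linear_mul _ _ _ hX, linSer,
    ts_linear_mul _ _ _ hX, ← mul_smul, ← mul_smul]
  congr 1; ring

theorem relation_of_ts {g : PowerSeries ℂ} {a b a' b' : ℂ} (hX : EvZ (1, -1) X)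
    (hg : linSer a b * g = linSer a' b') (h : Y = ts g (1, -1) X) : lw a b • Y = lw a' b' • X := by
  have h1 := lw_smul_ts a' b' 1 hX
  rw [ts_one, mul_one] at h1
  rw [h, lw_smul_ts _ _ _ hX, hg, h1]

theorem relation_of_ts₂ {g : PowerSeries ℂ} {a b c e a' b' c' e' : ℂ} (hX : EvZ (1, -1) X)
    (hg : linSer a b * linSer c e * g = linSer a' b' * linSer c' e') (h : Y = ts g (1, -1) X) :
    (lw a b * lw c e) • Y = (lw a' b' * lw c' e') • X := by
  have h1 := lw_lw_smul_ts a' b' c' e' 1 hX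
  rw [ts_one, mul_one] at h1
  rw [h, lw_lw_smul_ts _ _ _ _ _ hX, hg, h1]

theorem ts_of_relation {g : PowerSeries ℂ} {a b a' b' : ℂ} (ha : a ≠ 0) (hX : EvZ (1, -1) X)
    (hY : EvZ (1, -1) Y) (hg : linSer a b * g = linSer a' b') (h : lw a b • Y = lw a' b' • X) :
    Y = ts g (1, -1) X :=
  EvZ.cancel_lw ha hY (hX.ts g) (h.trans (relation_of_ts hX hg rfl).symm)

theorem ts_of_relation₂ {g : PowerSeries ℂ} {a b c e a' b' c' e' : ℂ} (ha : a ≠ 0) (hc : c ≠ 0)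
    (hX : EvZ (1, -1) X) (hY : EvZ (1, -1) Y)
    (hg : linSer a b * linSer c e * g = linSer a' b' * linSer c' e')
    (h : (lw a b * lw c e) • Y = (lw a' b' * lw c' e') • X) : Y = ts g (1, -1) X := by
  have h2 := h.trans (relation_of_ts₂ hX hg rfl).symm
  rw [mul_smul, mul_smul] at h2
  exact EvZ.cancel_lw hc hY (hX.ts g) (EvZ.cancel_lw ha (hY.smul _) ((hX.ts g).smul _) h2)

variable {n : ℕ} {q d : ℂ}

theorem linSer_mul_rescale_GSeries (hn : 3 ≤ n) (hq : q ≠ 0) (hd : d ≠ 0) (i j : ZMod n) (s : ℂ) :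
    linSer 1 (gCoef q d j i * s) * PowerSeries.rescale s (GSeries q d j i) =
      linSer (dCoef d i j * gCoef q d i j) (dCoef d i j * s) := by
  have := congrArg (PowerSeries.rescale s) (linear_mul_GSeries hn hq hd i j)
  simp only [map_mul, map_sub, map_one, PowerSeries.rescale_X] at this
  have hC : ∀ c : ℂ, PowerSeries.rescale s (PowerSeries.C c) = PowerSeries.C c := fun c => by
    ext m
    rw [PowerSeries.coeff_rescale, PowerSeries.coeff_C]
    split_ifs with h <;> simp [h]
  simp only [hC] at this
  simp only [linSer, map_mul, map_one]
  linear_combination this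

theorem linSer_mul_inv_rescale_GSeries (hn : 3 ≤ n) (hq : q ≠ 0) (hd : d ≠ 0) (i j : ZMod n)
    (s : ℂ) :
    linSer (dCoef d i j * gCoef q d i j) (dCoef d i j * s) *
      (PowerSeries.rescale s (GSeries q d j i))⁻¹ = linSer 1 (gCoef q d j i * s) := by
  have h := linSer_mul_rescale_GSeries hn hq hd i j s
  have h0 : PowerSeries.constantCoeff (PowerSeries.rescale s (GSeries q d j i)) ≠ 0 := by
    intro h0
    have := congrArg PowerSeries.constantCoeff h
    rw [map_mul, h0, mul_zero] at this
    simp only [linSer, map_sub, map_mul, PowerSeries.constantCoeff_C, PowerSeries.constantCoeff_X,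
      mul_zero, sub_zero] at this
    exact mul_ne_zero (dCoef_ne_zero hd i j) (gCoef_ne_zero hq hd i j) this.symm
  rw [← h, mul_assoc, PowerSeries.mul_inv_cancel _ h0, mul_one]

theorem rescale_one_GSeries (i j : ZMod n) :
    PowerSeries.rescale (1 : ℂ) (GSeries q d j i) = GSeries q d j i := by simp

theorem relation_of_G (hn : 3 ≤ n) (hq : q ≠ 0) (hd : d ≠ 0) {i j : ZMod n} {s : ℂ}
    (hX : EvZ (1, -1) X) (h : Y = ts (PowerSeries.rescale s (GSeries q d j i)) (1, -1) X) :
    den q d i j s • Y = num q d i j s • X :=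
  relation_of_ts hX (linSer_mul_rescale_GSeries hn hq hd i j s) h

theorem relation_of_inv_G (hn : 3 ≤ n) (hq : q ≠ 0) (hd : d ≠ 0) {i j : ZMod n} {s : ℂ}
    (hX : EvZ (1, -1) X) (h : Y = ts (PowerSeries.rescale s (GSeries q d j i))⁻¹ (1, -1) X) :
    num q d i j s • Y = den q d i j s • X :=
  relation_of_ts hX (linSer_mul_inv_rescale_GSeries hn hq hd i j s) h

theorem relation_of_G_G (hn : 3 ≤ n) (hq : q ≠ 0) (hd : d ≠ 0) {i j : ZMod n} {s r : ℂ}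
    (hX : EvZ (1, -1) X) (h : Y = ts (PowerSeries.rescale s (GSeries q d j i) *
      PowerSeries.rescale r (GSeries q d j i)) (1, -1) X) :
    (den q d i j s * den q d i j r) • Y = (num q d i j s * num q d i j r) • X :=
  relation_of_ts₂ hX (by
    rw [← linSer_mul_rescale_GSeries hn hq hd i j s, ← linSer_mul_rescale_GSeries hn hq hd i j r]
    ring) h

theorem relation_of_inv_G_G (hn : 3 ≤ n) (hq : q ≠ 0) (hd : d ≠ 0) {i j : ZMod n} {s r : ℂ}
    (hX : EvZ (1, -1) X) (h : Y = ts ((PowerSeries.rescale s (GSeries q d j i))⁻¹ *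
      PowerSeries.rescale r (GSeries q d j i)) (1, -1) X) :
    (num q d i j s * den q d i j r) • Y = (den q d i j s * num q d i j r) • X :=
  relation_of_ts₂ hX (by
    rw [← linSer_mul_inv_rescale_GSeries hn hq hd i j s,
      ← linSer_mul_rescale_GSeries hn hq hd i j r]
    ring) h

theorem ts_G_of_relation (hn : 3 ≤ n) (hq : q ≠ 0) (hd : d ≠ 0) {i j : ZMod n} {s : ℂ}
    (hX : EvZ (1, -1) X) (hY : EvZ (1, -1) Y) (h : den q d i j s • Y = num q d i j s • X) :
    Y = ts (PowerSeries.rescale s (GSeries q d j i)) (1, -1) X :=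
  ts_of_relation one_ne_zero hX hY (linSer_mul_rescale_GSeries hn hq hd i j s) h

theorem ts_G_G_of_relation (hn : 3 ≤ n) (hq : q ≠ 0) (hd : d ≠ 0) {i j : ZMod n} {s r : ℂ}
    (hX : EvZ (1, -1) X) (hY : EvZ (1, -1) Y)
    (h : (den q d i j s * den q d i j r) • Y = (num q d i j s * num q d i j r) • X) :
    Y = ts (PowerSeries.rescale s (GSeries q d j i) *
      PowerSeries.rescale r (GSeries q d j i)) (1, -1) X :=
  ts_of_relation₂ one_ne_zero one_ne_zero hX hY (by
    rw [← linSer_mul_rescale_GSeries hn hq hd i j s, ← linSer_mul_rescale_GSeries hn hq hd i j r]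
    ring) h

theorem evZ_rp_of_neg {X F : ℤ → 𝓛 U} (hF : ∀ k, k < 0 → F k = 0) :
    EvZ (1, -1) (rp X F) := fun u k => by
  refine ⟨(k.2 + 1).toNat, fun m hm => ?_⟩
  rw [rp, hF, zero_mul, LinearMap.zero_apply]
  simp
  omega

theorem evZ_rp_of_pos {X F : ℤ → 𝓛 U} (hX : ∀ k, 0 < k → X k = 0) :
    EvZ (1, -1) (rp X F) := evZ_rp (Truncated.of_pos hX)

theorem convTerms_eq (A B : ℤ → 𝓛 U) (k : ℤ) :
    convTerms A B k = fun a => A a * B (k - a) := rfl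

/-- An exchange relation passes to the inverse of a current. -/
theorem relation_inv {x : ℤ → 𝓛 U} {A B : PowerSeries (𝓛 U)}
    (h₁ : B * A = 1) {p p' : Lau (ℤ × ℤ)} (h₂ : A * B = 1)
    (h : p • rp x (curP A) = p' • pr x (curP A)) :
    p' • rp x (curP B) = p • pr x (curP B) := by
  have cvP : ∀ (M : ℤ → PowerSeries (𝓛 U)),
      CvLF (AddMonoidHom.inr ℤ ℤ) (curP B) (fun p => curP (M p.1) p.2) ∧
      cv (AddMonoidHom.inr ℤ ℤ) (curP B) (fun p => curP (M p.1) p.2) =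
        fun p => curP (B * M p.1) p.2 := fun M => by
    refine ⟨fun k => ?_, funext fun k => ?_⟩
    · have : LocFin fun a => curP B a * curP (M k.1) (k.2 - a) :=
        locFin_convTerms_curP B (M k.1) k.2
      simpa using this
    · rw [← convCur_curP, cv]
      simp [convCur, convTerms_eq]
  have rcvP : ∀ (M : ℤ → PowerSeries (𝓛 U)),
      RcvLF (AddMonoidHom.inr ℤ ℤ) (fun p => curP (M p.1) p.2) (curP B) ∧
      rcv (AddMonoidHom.inr ℤ ℤ) (fun p => curP (M p.1) p.2) (curP B) =
        fun p => curP (M p.1 * B) p.2 := fun M => by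
    refine ⟨fun k => ?_, funext fun k => ?_⟩
    · have := (locFin_convTerms_curP (M k.1) B k.2).comp_injective (Equiv.subLeft k.2).injective
      simpa [convTerms] using this
    · rw [← convCur_curP, rcv, convCur, ← locSum_equiv (Equiv.subLeft k.2)]
      simp [convTerms_eq]
  have curP_C_mul : ∀ (a : 𝓛 U) (A : PowerSeries (𝓛 U)) (k : ℤ),
      curP (PowerSeries.C a * A) k = a * curP A k := fun a A k => by
    simp only [curP]; split_ifs <;> simp
  have curP_mul_C : ∀ (a : 𝓛 U) (A : PowerSeries (𝓛 U)) (k : ℤ),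
      curP (A * PowerSeries.C a) k = curP A k * a := fun a A k => by
    simp only [curP]; split_ifs <;> simp
  have er : ∀ A : PowerSeries (𝓛 U),
      rp x (curP A) = fun p => curP (A * PowerSeries.C (x p.1)) p.2 := fun A =>
    funext fun p => (curP_mul_C _ _ _).symm
  have ep : ∀ A : PowerSeries (𝓛 U),
      pr x (curP A) = fun p => curP (PowerSeries.C (x p.1) * A) p.2 := fun A =>
    funext fun p => (curP_C_mul _ _ _).symm
  rw [er, ep] at h
  have h3 := cv_relation (cvP fun k => A * PowerSeries.C (x k)).1
    (cvP fun k => PowerSeries.C (x k) * A).1 h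
  rw [(cvP fun k => A * PowerSeries.C (x k)).2, (cvP fun k => PowerSeries.C (x k) * A).2] at h3
  have h4 := rcv_relation (rcvP fun k => B * (A * PowerSeries.C (x k))).1
    (rcvP fun k => B * (PowerSeries.C (x k) * A)).1 h3
  rw [(rcvP fun k => B * (A * PowerSeries.C (x k))).2,
    (rcvP fun k => B * (PowerSeries.C (x k) * A)).2] at h4
  simp only [← mul_assoc, h₁, one_mul] at h4
  simp only [mul_assoc, h₂, mul_one] at h4
  rw [er, ep]
  exact h4.symm

end RationalRelations

/-! ## Modules over `𝒦_n` in polynomial form -/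

section KModules

variable {n : ℕ} {q d : ℂ} {W : Type*} [AddCommGroup W] [Module ℂ W]

theorem deltaKK_eq_dl (Y : KnOps n W) (i : ZMod n) (k l : ℤ) :
    Y.deltaKK q i k l = dl ((Y.lvl : ℂ) ^ 2) (1, -1) (pr (Y.Km q i) (Y.Kp q i)) (k, l) := by
  have hs : (Y.lvl : ℂ) ^ 2 ≠ 0 := pow_ne_zero _ Y.lvl.ne_zero
  have key : ∀ f : ℤ → 𝓛 W, (Y.lvl : ℂ) ^ (2 * l) • locSum f =
      locSum fun a => (Y.lvl : ℂ) ^ (2 * l) • f a := fun f => by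
    have h2 : (Y.lvl : ℂ) ^ (2 * l) ≠ 0 := zpow_ne_zero _ Y.lvl.ne_zero
    by_cases hf : LocFin f
    · exact (locSum_smul hf _).symm
    · have hf' : ¬ LocFin fun a => (Y.lvl : ℂ) ^ (2 * l) • f a := fun h => hf (by
        have := h.const_smul ((Y.lvl : ℂ) ^ (2 * l))⁻¹
        simpa [smul_smul, inv_mul_cancel₀ h2] using this)
      rw [locSum, dif_neg hf, locSum, dif_neg hf', smul_zero]
  rw [KnOps.deltaKK, convCur, key, dl, ← locSum_equiv (Equiv.addLeft k)]
  congr 1; funext t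
  simp only [Equiv.coe_addLeft, convTerms, scaleCur, mul_smul_comm, smul_smul, pr,
    Prod.fst_add, Prod.snd_add, Prod.smul_fst, Prod.smul_snd, smul_eq_mul, mul_one, mul_neg]
  rw [show k + l - (k + t) = l + -t by ring, zpow_mul, zpow_ofNat, ← zpow_add₀ hs]
  congr 2; ring

theorem serreTerm_eq_serreTail (a b : ℂ) (Y : KnOps n W) (i j : ZMod n) (k₁ k₂ l : ℤ) :
    Y.serreTerm q a b i j k₁ k₂ l =
      serreTail ((Y.lvl : ℂ) ^ 2) a b (Y.Km q i) (Y.E j) (Y.Kp q i) k₁ k₂ l := by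
  simp only [KnOps.serreTerm, serreTail, zpow_mul, zpow_ofNat]

theorem hasDegree_Kp {Y : KnOps n W} {𝒲 : ℤ → Submodule ℂ W}
    (hH : ∀ i r, r ≠ 0 → HasDegree 𝒲 (Y.H i r) r) (h0 : ∀ i, HasDegree 𝒲 (Y.Kp0 i) 0) (i k) :
    HasDegree 𝒲 (Y.Kp q i k) k :=
  ((SerDeg.C (h0 i)).mul (SerDeg.posModes (hH i)).formalExp).curP k

theorem hasDegree_Km {Y : KnOps n W} {𝒲 : ℤ → Submodule ℂ W}
    (hH : ∀ i r, r ≠ 0 → HasDegree 𝒲 (Y.H i r) r) (h0 : ∀ i, HasDegree 𝒲 (Y.Km0 i) 0) (i k) :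
    HasDegree 𝒲 (Y.Km q i k) k :=
  ((SerDeg.C (h0 i)).mul (SerDeg.negModes (hH i)).formalExp).curM k

theorem E_E_iff (E : ZMod n → ℤ → 𝓛 W) (i j : ZMod n) (k l : ℤ) :
    (den q d i j 1 • rp (E i) (E j) - num q d i j 1 • pr (E i) (E j)) (k, l) =
    dCoef d i j • (E i (k + 1) * E j l - gCoef q d i j • (E i k * E j (l + 1)))
      + (E j (l + 1) * E i k - gCoef q d j i • (E j l * E i (k + 1))) := by
  simp only [fam_sub_apply, den, num, lw_smul_apply, rp_apply, pr_apply, one_smul, mul_one,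
    mul_smul]
  module

theorem KnOps.IsAdmissible.kSys (hn : 3 ≤ n) (hq : q ≠ 0) (hd : d ≠ 0) {Y : KnOps n W}
    {𝒲 : ℤ → Submodule ℂ W} (h : Y.IsAdmissible q d 𝒲) :
    KSys n q d ((Y.lvl : ℂ) ^ 2) Y.E (Y.Kp q) (Y.Km q) := by
  have Kp_neg : ∀ i k, k < 0 → Y.Kp q i k = 0 := fun i k hk => curP_of_neg _ hk
  have Km_pos : ∀ i k, 0 < k → Y.Km q i k = 0 := fun i k hk => curM_of_pos _ hk
  have serre : ∀ {A B : 𝓛 W}, (2⁻¹ : ℂ) • A = -((2⁻¹ : ℂ) • B) → A = -B :=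
    fun {A B} hAB => by
      have := congrArg (fun x => (2 : ℂ) • x) hAB
      simpa [smul_smul] using this
  refine
    { truncated_E := fun i => Truncated.of_raises h.grading.filt fun k => (h.deg_E i k).raises
      truncated_Kp := fun i => Truncated.of_raises h.grading.filt fun k =>
        (hasDegree_Kp h.deg_H h.deg_Kp0 i k).raises
      Kp_neg := Kp_neg
      Km_pos := Km_pos
      Kp_Kp := h.Kp_Kp
      Km_Km := h.Km_Km
      Kp_Km := fun i j => ?_
      Kp_E := fun i j => ?_
      E_Km := fun i j => ?_
      E_E := fun i j hij => ?_
      E_E_self := fun i k l => ?_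
      E_E_far := h.E_E_far
      serre_succ := fun i k₁ k₂ l => serre ?_
      serre_pred := fun i k₁ k₂ l => serre ?_ }
  · refine relation_of_G_G hn hq hd (evZ_pr_of_pos (Km_pos i)) ?_
    funext ⟨k, l⟩
    rw [rescale_one_GSeries, ← actWZ_eq_ts]
    exact h.Kp_Km j i l k
  · refine relation_of_G hn hq hd (evZ_pr_of_neg (Kp_neg j)) ?_
    funext ⟨k, l⟩
    rw [rescale_one_GSeries, ← actWZ_eq_ts]
    exact h.Kp_E j i l k
  · refine relation_of_G hn hq hd (evZ_pr_of_pos (Km_pos i)) ?_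
    funext ⟨k, l⟩
    rw [rescale_one_GSeries, ← actZW_eq_ts]
    exact h.E_Km i j k l
  · rw [← sub_eq_zero]
    funext ⟨k, l⟩
    rw [E_E_iff, h.E_E, if_neg hij]; rfl
  · rw [E_E_iff, h.E_E, if_pos rfl]
    simp only [lw_smul_apply, ← deltaKK_eq_dl, gCoef_self]
    module
  · rw [← serreLHS_eq_sixWords hq, h.serre_succ]
    simp only [serreTerm_eq_serreTail]
  · rw [← serreLHS_eq_sixWords hq, h.serre_pred]
    simp only [serreTerm_eq_serreTail]

theorem KnOps.isAdmissible_of_kSys (hn : 3 ≤ n) (hq : q ≠ 0) (hd : d ≠ 0) {Y : KnOps n W}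
    {𝒲 : ℤ → Submodule ℂ W} (grading : IsAdmGrading 𝒲)
    (deg_E : ∀ i k, HasDegree 𝒲 (Y.E i k) k) (deg_H : ∀ i r, r ≠ 0 → HasDegree 𝒲 (Y.H i r) r)
    (deg_Kp0 : ∀ i, HasDegree 𝒲 (Y.Kp0 i) 0) (deg_Km0 : ∀ i, HasDegree 𝒲 (Y.Km0 i) 0)
    (h : KSys n q d ((Y.lvl : ℂ) ^ 2) Y.E (Y.Kp q) (Y.Km q)) : Y.IsAdmissible q d 𝒲 := by
  refine
    { grading := grading
      deg_E := deg_E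
      deg_H := deg_H
      deg_Kp0 := deg_Kp0
      deg_Km0 := deg_Km0
      Kp_Kp := h.Kp_Kp
      Km_Km := h.Km_Km
      Kp_Km := fun j i l k => ?_
      Kp_E := fun j i l k => ?_
      E_Km := fun i j k l => ?_
      E_E := fun i j k l => ?_
      E_E_far := h.E_E_far
      serre_succ := fun i k₁ k₂ l => ?_
      serre_pred := fun i k₁ k₂ l => ?_ }
  · have := ts_G_G_of_relation hn hq hd (evZ_pr_of_pos (h.Km_pos i)) (evZ_rp_of_pos (h.Km_pos i))
      (h.Kp_Km i j)
    rw [rescale_one_GSeries] at this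
    exact (congrFun this (k, l)).trans (actWZ_eq_ts _ _ k l).symm
  · have := ts_G_of_relation hn hq hd (evZ_pr_of_neg (h.Kp_neg j)) (evZ_rp_of_neg (h.Kp_neg j))
      (h.Kp_E i j)
    rw [rescale_one_GSeries] at this
    exact (congrFun this (k, l)).trans (actWZ_eq_ts _ _ k l).symm
  · have := ts_G_of_relation hn hq hd (evZ_pr_of_pos (h.Km_pos i)) (evZ_rp_of_pos (h.Km_pos i))
      (h.E_Km i j)
    rw [rescale_one_GSeries] at this
    exact (congrFun this (k, l)).trans (actZW_eq_ts _ _ k l).symm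
  · rw [← E_E_iff]
    split_ifs with hij
    · subst hij
      rw [h.E_E_self]
      simp only [lw_smul_apply, ← deltaKK_eq_dl, gCoef_self]
      module
    · rw [h.E_E i j hij, sub_self]; rfl
  · rw [serreLHS_eq_sixWords hq, h.serre_succ, smul_neg]
    simp only [serreTerm_eq_serreTail]
  · rw [serreLHS_eq_sixWords hq, h.serre_pred, smul_neg]
    simp only [serreTerm_eq_serreTail]

end KModules

/-! ## Lifting relations to a tensor product -/

section Lifting

variable {U U' : Type*} [AddCommGroup U] [Module ℂ U] [AddCommGroup U'] [Module ℂ U']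
variable {Γ : Type*} [AddCommGroup Γ] (g : 𝓛 U →ₐ[ℂ] 𝓛 U')

/-- Apply an algebra homomorphism to all coefficients. -/
def mapFam (X : Fam Γ (𝓛 U)) : Fam Γ (𝓛 U') := fun k => g (X k)

theorem mapFam_smul (p : Lau Γ) (X : Fam Γ (𝓛 U)) :
    mapFam g (p • X) = p • mapFam g X := by
  induction p using lau_induction generalizing X with
  | hm h => funext k; simp [mapFam]
  | hc c => funext k; simp [mapFam]
  | ha r r' hr hr' =>
    rw [add_smul, add_smul, ← hr, ← hr']; funext k; exact map_add g _ _
  | hmul r r' hr hr' => rw [mul_smul, mul_smul, hr, hr']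

theorem mapFam_rp (x y : ℤ → 𝓛 U) :
    mapFam g (rp x y) = rp (fun k => g (x k)) fun k => g (y k) :=
  funext fun _ => map_mul g _ _

theorem mapFam_pr (x y : ℤ → 𝓛 U) :
    mapFam g (pr x y) = pr (fun k => g (x k)) fun k => g (y k) :=
  funext fun _ => map_mul g _ _

theorem map_relation {x y : ℤ → 𝓛 U} {p p' : Lau (ℤ × ℤ)}
    (h : p • rp x y = p' • pr x y) :
    p • rp (fun k => g (x k)) (fun k => g (y k)) =
      p' • pr (fun k => g (x k)) fun k => g (y k) := by
  rw [← mapFam_rp, ← mapFam_pr, ← mapFam_smul, ← mapFam_smul, h]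

theorem map_sixWords (q : ℂ) (X Y F : ℤ → 𝓛 U) (k₁ k₂ l : ℤ) :
    g (sixWords q X Y F k₁ k₂ l) =
      sixWords q (fun k => g (X k)) (fun k => g (Y k)) (fun k => g (F k)) k₁ k₂ l := by
  simp [sixWords]

variable {n : ℕ} {q d s r : ℂ}

theorem TSys.map {e φ η ζ ζp : ZMod n → ℤ → 𝓛 U} (T : TSys n q d s r e φ η ζ ζp) :
    TSys n q d s r (fun i k => g (e i k)) (fun i k => g (φ i k)) (fun i k => g (η i k))
      (fun i k => g (ζ i k)) (fun i k => g (ζp i k)) := by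
  refine
    { η_neg := fun i k hk => by rw [T.η_neg i k hk, map_zero]
      ζp_neg := fun i k hk => by rw [T.ζp_neg i k hk, map_zero]
      ζ_pos := fun i k hk => by rw [T.ζ_pos i k hk, map_zero]
      ζp_η := fun i => ?_
      η_η := fun i j k l => (T.η_η i j k l).map g
      ζ_ζ := fun i j k l => (T.ζ_ζ i j k l).map g
      η_e := fun i j => map_relation g (T.η_e i j)
      η_φ := fun i j => map_relation g (T.η_φ i j)
      e_ζ := fun i j => map_relation g (T.e_ζ i j)
      φ_ζ := fun i j => map_relation g (T.φ_ζ i j)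
      η_ζ := fun i j => map_relation g (T.η_ζ i j)
      e_φ := fun i j hij k l => (T.e_φ i j hij k l).map g
      e_φ_self := fun i k l => ?_
      e_e := fun i j => map_relation g (T.e_e i j)
      φ_φ := fun i j => map_relation g (T.φ_φ i j)
      e_e_far := fun i j h h1 h2 k l => (T.e_e_far i j h h1 h2 k l).map g
      φ_φ_far := fun i j h h1 h2 k l => (T.φ_φ_far i j h h1 h2 k l).map g
      serre_e := fun i j h k₁ k₂ l => ?_
      serre_φ := fun i j h k₁ k₂ l => ?_ }
  · funext k
    have hz : ∀ a ∉ Finset.Icc 0 k, ζp i a * η i (k - a) = 0 := fun a ha => by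
      rw [Finset.mem_Icc, not_and_or, not_le, not_le] at ha
      rcases ha with ha | ha
      · rw [T.ζp_neg i a ha, zero_mul]
      · rw [T.η_neg i _ (by omega), mul_zero]
    have h1 := congrFun (T.ζp_η i) k
    rw [cvi_apply, locSum_eq_sum (Finset.Icc 0 k) hz] at h1
    rw [cvi_apply, locSum_eq_sum (Finset.Icc 0 k) fun a ha => by
      rw [← map_mul, hz a ha, map_zero]]
    simp only [← map_mul, ← map_sum, h1]
    by_cases hk : k = 0
    · subst hk; simp [oneCur]
    · rw [oneCur_of_ne hk, oneCur_of_ne hk, map_zero]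
  · rw [← map_mul, ← map_mul, ← map_sub, T.e_φ_self, map_smul, map_sub, map_smul, map_smul]
  · rw [← map_sixWords, T.serre_e i j h, map_zero]
  · rw [← map_sixWords, T.serre_φ i j h, map_zero]

variable {V W : Type*} [AddCommGroup V] [Module ℂ V] [AddCommGroup W] [Module ℂ W]

theorem Truncated.opR {x : ℤ → 𝓛 W} (hx : Truncated x) :
    Truncated fun k => opR V (x k) := fun u => by
  induction u using TensorProduct.induction_on with
  | zero => exact ⟨0, fun _ _ => map_zero _⟩
  | tmul v w =>
    obtain ⟨N, hN⟩ := hx w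
    exact ⟨N, fun k hk => by simp [_root_.opR, hN k hk]⟩
  | add a b ha hb =>
    obtain ⟨M, hM⟩ := ha
    obtain ⟨N, hN⟩ := hb
    exact ⟨max M N, fun k hk => by
      rw [map_add, hM k (lt_of_le_of_lt (le_max_left _ _) hk),
        hN k (lt_of_le_of_lt (le_max_right _ _) hk), add_zero]⟩

theorem opR_smul (c : ℂ) (b : 𝓛 W) : opR V (c • b) = c • opR V b :=
  map_smul (opRHom (V := V)) c b

theorem opR_mul (a b : 𝓛 W) : opR V (a * b) = opR V a * opR V b :=
  map_mul (opRHom (V := V)) a b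

theorem opR_dl {c : ℂ} {σ : Γ} {X : Fam Γ (𝓛 W)} (h : DlLF σ X) :
    mapFam (opRHom (V := V)) (dl c σ X) = dl c σ (mapFam opRHom X) := by
  funext k
  rw [mapFam, opRHom_apply, dl, opR_locSum ((h k).smul _), dl]
  simp only [opR_smul]
  rfl

theorem opR_serreTail (s a b : ℂ) {K F K' : ℤ → 𝓛 W} (hK : ∀ k, 0 < k → K k = 0)
    (hK' : Truncated K') (h0 : ∀ k, k < 0 → K' k = 0) (hF : Truncated F) (k₁ k₂ l : ℤ) :
    opR V (serreTail s a b K F K' k₁ k₂ l) =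
      serreTail s a b (fun k => opR V (K k)) (fun k => opR V (F k)) (fun k => opR V (K' k))
        k₁ k₂ l := by
  have l₁ := (locFin_serreTail_left a s hK hK' F k₁ k₂ l).comp_injective
    (Equiv.prodComm ℤ ℕ).injective
  have l₂ := (locFin_serreTail_right b s hK hK' h0 hF k₁ k₂ l).comp_injective
    (Equiv.prodComm ℤ ℕ).injective
  simp only [Equiv.prodComm_apply, Prod.fst_swap, Prod.snd_swap] at l₁ l₂
  rw [serreTail, serreTail, ← opRHom_apply, map_add, opRHom_apply, opRHom_apply, opR_locSum l₁,
    opR_locSum l₂]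
  simp only [opR_smul, opR_mul]

theorem KSys.opR {E Kp Km : ZMod n → ℤ → 𝓛 W} (K : KSys n q d s E Kp Km) :
    KSys n q d s (fun i k => opR V (E i k)) (fun i k => opR V (Kp i k))
      (fun i k => opR V (Km i k)) := by
  refine
    { truncated_E := fun i => (K.truncated_E i).opR
      truncated_Kp := fun i => (K.truncated_Kp i).opR
      Kp_neg := fun i k hk => by rw [K.Kp_neg i k hk, ← opRHom_apply, map_zero]
      Km_pos := fun i k hk => by rw [K.Km_pos i k hk, ← opRHom_apply, map_zero]
      Kp_Kp := fun i j k l => (K.Kp_Kp i j k l).map opRHom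
      Km_Km := fun i j k l => (K.Km_Km i j k l).map opRHom
      Kp_Km := fun i j => map_relation opRHom (K.Kp_Km i j)
      Kp_E := fun i j => map_relation opRHom (K.Kp_E i j)
      E_Km := fun i j => map_relation opRHom (K.E_Km i j)
      E_E := fun i j hij => map_relation opRHom (K.E_E i j hij)
      E_E_self := fun i k l => ?_
      E_E_far := fun i j h h1 h2 k l => (K.E_E_far i j h h1 h2 k l).map opRHom
      serre_succ := fun i k₁ k₂ l => ?_
      serre_pred := fun i k₁ k₂ l => ?_ }
  · have lf := dlLF_of_truncated (K.Km_pos i) (K.truncated_Kp i)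
    have h := congrArg (opRHom (V := V)) (K.E_E_self i k l)
    have e1 : ∀ X Y : Fam (ℤ × ℤ) (𝓛 W), opRHom (V := V) ((X - Y) (k, l)) =
        (mapFam opRHom X - mapFam opRHom Y : Fam (ℤ × ℤ) (𝓛 (V ⊗[ℂ] W))) (k, l) :=
      fun X Y => map_sub _ _ _
    have e2 : ∀ (X : Fam (ℤ × ℤ) (𝓛 W)) p, opRHom (V := V) (X p) =
        mapFam opRHom X p := fun _ _ => rfl
    rw [e1, map_smul, map_add, e2, e2, mapFam_smul, mapFam_smul, mapFam_smul, opR_dl lf,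
      mapFam_pr, mapFam_rp, mapFam_pr] at h
    exact h
  · have h := congrArg (opRHom (V := V)) (K.serre_succ i k₁ k₂ l)
    rw [map_sixWords, map_neg, map_add, opRHom_apply, opRHom_apply,
      opR_serreTail _ _ _ (K.Km_pos i) (K.truncated_Kp i) (K.Kp_neg i) (K.truncated_E _),
      opR_serreTail _ _ _ (K.Km_pos i) (K.truncated_Kp i) (K.Kp_neg i) (K.truncated_E _)] at h
    exact h
  · have h := congrArg (opRHom (V := V)) (K.serre_pred i k₁ k₂ l)
    rw [map_sixWords, map_neg, map_add, opRHom_apply, opRHom_apply,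
      opR_serreTail _ _ _ (K.Km_pos i) (K.truncated_Kp i) (K.Kp_neg i) (K.truncated_E _),
      opR_serreTail _ _ _ (K.Km_pos i) (K.truncated_Kp i) (K.Kp_neg i) (K.truncated_E _)] at h
    exact h

end Lifting

/-! ## Modules over `ℰ_n` in polynomial form -/

section Scaling

variable {U : Type*} [AddCommGroup U] [Module ℂ U] {n : ℕ} {q d : ℂ}

/-- The distribution `X(z/α, w/β)`. -/
def scaleFam (α β : ℂ) (X : Fam (ℤ × ℤ) (𝓛 U)) : Fam (ℤ × ℤ) (𝓛 U) :=
  fun p => (α ^ p.1 * β ^ p.2) • X p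

variable {α β : ℂ}

theorem lw_smul_scaleFam (hα : α ≠ 0) (hβ : β ≠ 0) (x y : ℂ)
    (X : Fam (ℤ × ℤ) (𝓛 U)) :
    lw x (y * (α⁻¹ * β)) • scaleFam α β X = β • scaleFam α β (lw x y • X) := by
  funext ⟨k, l⟩
  simp only [lw_smul_apply, scaleFam, fam_smul_apply, smul_sub, smul_smul, zpow_add_one₀ hα,
    zpow_add_one₀ hβ]
  congr 2
  · ring
  · field_simp

theorem den_smul_scaleFam (hα : α ≠ 0) (hβ : β ≠ 0) (i j : ZMod n) {s t : ℂ}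
    (ht : s * (α⁻¹ * β) = t) (X : Fam (ℤ × ℤ) (𝓛 U)) :
    den q d i j t • scaleFam α β X = β • scaleFam α β (den q d i j s • X) := by
  rw [den, den, ← lw_smul_scaleFam hα hβ, ← ht, mul_assoc]

theorem num_smul_scaleFam (hα : α ≠ 0) (hβ : β ≠ 0) (i j : ZMod n) {s t : ℂ}
    (ht : s * (α⁻¹ * β) = t) (X : Fam (ℤ × ℤ) (𝓛 U)) :
    num q d i j t • scaleFam α β X = β • scaleFam α β (num q d i j s • X) := by
  rw [num, num, ← lw_smul_scaleFam hα hβ, ← ht, mul_assoc]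

theorem scaleCur_inv_apply (c : ℂ) (x : ℤ → 𝓛 U) (k : ℤ) :
    scaleCur c⁻¹ x k = c ^ k • x k := by rw [scaleCur, inv_zpow', neg_neg]

theorem rp_scaleCur (x y : ℤ → 𝓛 U) :
    rp (scaleCur α⁻¹ x) (scaleCur β⁻¹ y) = scaleFam α β (rp x y) := by
  funext ⟨k, l⟩
  simp only [rp_apply, scaleCur_inv_apply, scaleFam, smul_mul_smul_comm, mul_comm (β ^ l)]

theorem pr_scaleCur (x y : ℤ → 𝓛 U) :
    pr (scaleCur α⁻¹ x) (scaleCur β⁻¹ y) = scaleFam α β (pr x y) := by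
  funext ⟨k, l⟩
  simp only [pr_apply, scaleCur_inv_apply, scaleFam, smul_mul_smul_comm]

theorem den_num_scale (hα : α ≠ 0) (hβ : β ≠ 0) {i j : ZMod n} {s t : ℂ}
    (ht : s * (α⁻¹ * β) = t) {x y : ℤ → 𝓛 U}
    (h : den q d i j s • rp x y = num q d i j s • pr x y) :
    den q d i j t • rp (scaleCur α⁻¹ x) (scaleCur β⁻¹ y) =
      num q d i j t • pr (scaleCur α⁻¹ x) (scaleCur β⁻¹ y) := by
  rw [rp_scaleCur, pr_scaleCur, den_smul_scaleFam hα hβ i j ht, num_smul_scaleFam hα hβ i j ht, h]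

theorem num_den_scale (hα : α ≠ 0) (hβ : β ≠ 0) {i j : ZMod n} {s t : ℂ}
    (ht : s * (α⁻¹ * β) = t) {x y : ℤ → 𝓛 U}
    (h : num q d i j s • rp x y = den q d i j s • pr x y) :
    num q d i j t • rp (scaleCur α⁻¹ x) (scaleCur β⁻¹ y) =
      den q d i j t • pr (scaleCur α⁻¹ x) (scaleCur β⁻¹ y) := by
  rw [rp_scaleCur, pr_scaleCur, den_smul_scaleFam hα hβ i j ht, num_smul_scaleFam hα hβ i j ht, h]

theorem num_den_mul_scale (hα : α ≠ 0) (hβ : β ≠ 0) {i j : ZMod n} {s t s' t' : ℂ}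
    (ht : s * (α⁻¹ * β) = t) (ht' : s' * (α⁻¹ * β) = t') {x y : ℤ → 𝓛 U}
    (h : (num q d i j s * den q d i j s') • rp x y = (den q d i j s * num q d i j s') • pr x y) :
    (num q d i j t * den q d i j t') • rp (scaleCur α⁻¹ x) (scaleCur β⁻¹ y) =
      (den q d i j t * num q d i j t') • pr (scaleCur α⁻¹ x) (scaleCur β⁻¹ y) := by
  have key : ∀ {p p' P P' : Lau (ℤ × ℤ)} (X : Fam (ℤ × ℤ) (𝓛 U)),
      (∀ X : Fam (ℤ × ℤ) (𝓛 U), P • scaleFam α β X = β • scaleFam α β (p • X)) →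
      (∀ X : Fam (ℤ × ℤ) (𝓛 U), P' • scaleFam α β X = β • scaleFam α β (p' • X)) →
      (P * P') • scaleFam α β X = β • β • scaleFam α β ((p * p') • X) := fun {p p' P P'} X hp hp' => by
    have hs : ∀ (Y : Fam (ℤ × ℤ) (𝓛 U)), β • scaleFam α β Y = scaleFam α β (β • Y) :=
      fun Y => by funext k; simp only [fam_smul_apply, scaleFam, smul_comm β]
    have hs' : ∀ (p : Lau (ℤ × ℤ)) (Y : Fam (ℤ × ℤ) (𝓛 U)),
        p • (β • Y) = β • (p • Y) := fun p Y => by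
      have e : ∀ Z : Fam (ℤ × ℤ) (𝓛 U),
          β • Z = (cst β : Lau (ℤ × ℤ)) • Z := fun Z => by
        funext k; rw [cst_smul_apply, fam_smul_apply]
      rw [e, e, smul_comm]
    rw [mul_smul, hp', hs', hp, mul_smul]
  rw [rp_scaleCur, pr_scaleCur,
    key _ (num_smul_scaleFam hα hβ i j ht) (den_smul_scaleFam hα hβ i j ht'), h,
    ← key _ (den_smul_scaleFam hα hβ i j ht) (num_smul_scaleFam hα hβ i j ht')]

theorem sixWords_scaleCur (c : ℂ) (x y f : ℤ → 𝓛 U) (k₁ k₂ l : ℤ) :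
    sixWords q (scaleCur c x) (scaleCur c y) (scaleCur c f) k₁ k₂ l =
      (c ^ (-k₁) * c ^ (-k₂) * c ^ (-l)) • sixWords q x y f k₁ k₂ l := by
  simp only [sixWords, scaleCur, smul_mul_smul_comm]
  module

end Scaling

namespace EnOps

variable {n : ℕ} {V : Type*} [AddCommGroup V] [Module ℂ V] {q d : ℂ}

theorem posModes_neg (c : ℂ) (h : ℤ → 𝓛 V) : posModes (-c) h = -posModes c h := by
  ext1 m
  simp only [posModes, map_neg, PowerSeries.coeff_mk]
  split_ifs <;> simp

theorem coeff_zero_posModes (c : ℂ) (h : ℤ → 𝓛 V) :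
    PowerSeries.coeff 0 (posModes c h) = 0 := by simp [posModes]

theorem coeff_zero_negModes (c : ℂ) (h : ℤ → 𝓛 V) :
    PowerSeries.coeff 0 (negModes c h) = 0 := by simp [negModes]

/-- The power series of `ψ_i^+`. -/
def serP (q : ℂ) (X : EnOps n V) (i : ZMod n) : PowerSeries (𝓛 V) :=
  PowerSeries.C (X.qh (alphaBar i)) * formalExp (posModes (q - q⁻¹) (X.h i))

/-- The power series of the inverse of `ψ_i^+`. -/
def serPInv (q : ℂ) (X : EnOps n V) (i : ZMod n) : PowerSeries (𝓛 V) :=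
  formalExp (posModes (-(q - q⁻¹)) (X.h i)) * PowerSeries.C (X.qh (-alphaBar i))

theorem psiP_eq (X : EnOps n V) (i : ZMod n) : X.psiP q i = curP (X.serP q i) := rfl
theorem psiPInv_eq (X : EnOps n V) (i : ZMod n) : X.psiPInv q i = curP (X.serPInv q i) := rfl

namespace IsAdmissible

variable [NeZero n] {X : EnOps n V} {𝒱 : ℤ → Submodule ℂ V} (h : X.IsAdmissible q d 𝒱)
include h

theorem qh_mul_neg (a : LatticeP n) : X.qh a * X.qh (-a) = 1 := by
  rw [h.qh_add, add_neg_cancel, h.qh_zero]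

theorem qh_neg_mul (a : LatticeP n) : X.qh (-a) * X.qh a = 1 := by
  rw [h.qh_add, neg_add_cancel, h.qh_zero]

theorem serP_mul_serPInv (i : ZMod n) : X.serP q i * X.serPInv q i = 1 := by
  rw [serP, serPInv, mul_assoc, ← mul_assoc (formalExp _), posModes_neg,
    formalExp_mul_neg (coeff_zero_posModes _ _), one_mul, ← map_mul, h.qh_mul_neg, map_one]

theorem serPInv_mul_serP (i : ZMod n) : X.serPInv q i * X.serP q i = 1 := by
  rw [serP, serPInv, mul_assoc, ← mul_assoc (PowerSeries.C _), ← map_mul, h.qh_neg_mul, map_one,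
    one_mul, posModes_neg, formalExp_neg_mul (coeff_zero_posModes _ _)]

theorem hasDegree_psiPInv (i k) : HasDegree 𝒱 (X.psiPInv q i k) k :=
  ((SerDeg.posModes (h.deg_h i)).formalExp.mul (SerDeg.C (h.deg_qh _))).curP k

omit h in
theorem commute_curP_inv {A B : PowerSeries (𝓛 V)} (h₁ : A * B = 1) (h₂ : B * A = 1)
    {a : 𝓛 V} (ha : ∀ k, Commute (curP A k) a) (k : ℤ) : Commute (curP B k) a := by
  have hA : Commute A (PowerSeries.C a) := by
    ext1 m
    rw [PowerSeries.coeff_mul_C, PowerSeries.coeff_C_mul, ← curP_apply_natCast]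
    exact ha m
  have hB : Commute B (PowerSeries.C a) := by
    have h3 : B * (A * PowerSeries.C a) * B = B * (PowerSeries.C a * A) * B := by rw [hA.eq]
    rw [← mul_assoc, h₂, one_mul, mul_assoc, mul_assoc, h₁, mul_one] at h3
    exact h3.symm
  have := congrArg (fun P => curP P k) hB.eq
  simp only [curP] at this ⊢
  split_ifs at this ⊢
  · rw [PowerSeries.coeff_mul_C, PowerSeries.coeff_C_mul] at this
    exact this
  · exact Commute.zero_left a

theorem psiPInv_comm (i j k l) : Commute (X.psiPInv q i k) (X.psiPInv q j l) :=
  commute_curP_inv (h.serP_mul_serPInv i) (h.serPInv_mul_serP i) (fun k =>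
    (commute_curP_inv (h.serP_mul_serPInv j) (h.serPInv_mul_serP j)
      (fun l => h.psiP_psiP j i l k) l).symm) k

variable (hn : 3 ≤ n) (hq : q ≠ 0) (hd : d ≠ 0)
include hn hq hd

theorem e_psiP_rel (i j) : den q d i j (X.lvl : ℂ)⁻¹ • rp (X.e i) (X.psiP q j) =
    num q d i j (X.lvl : ℂ)⁻¹ • pr (X.e i) (X.psiP q j) := by
  refine relation_of_G hn hq hd (evZ_pr_of_neg fun k hk => curP_of_neg _ hk) ?_
  funext ⟨k, l⟩
  rw [← actWZ_eq_ts]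
  exact h.psiP_e j i l k

theorem f_psiP_rel (i j) : num q d i j 1 • rp (X.f i) (X.psiP q j) =
    den q d i j 1 • pr (X.f i) (X.psiP q j) := by
  refine relation_of_inv_G hn hq hd (evZ_pr_of_neg fun k hk => curP_of_neg _ hk) ?_
  funext ⟨k, l⟩
  rw [rescale_one_GSeries, ← actWZ_eq_ts]
  exact h.psiP_f j i l k

theorem psiM_e_rel (i j) : den q d i j 1 • rp (X.psiM q i) (X.e j) =
    num q d i j 1 • pr (X.psiM q i) (X.e j) := by
  refine relation_of_G hn hq hd (evZ_pr_of_pos fun k hk => curM_of_pos _ hk) ?_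
  funext ⟨k, l⟩
  rw [rescale_one_GSeries, ← actZW_eq_ts]
  exact h.e_psiM i j k l

theorem psiM_f_rel (i j) : num q d i j (X.lvl : ℂ) • rp (X.psiM q i) (X.f j) =
    den q d i j (X.lvl : ℂ) • pr (X.psiM q i) (X.f j) := by
  refine relation_of_inv_G hn hq hd (evZ_pr_of_pos fun k hk => curM_of_pos _ hk) ?_
  funext ⟨k, l⟩
  rw [← actZW_eq_ts]
  exact h.f_psiM i j k l

theorem psiM_psiP_rel (i j) : (num q d i j (X.lvl : ℂ) * den q d i j (X.lvl : ℂ)⁻¹) •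
      rp (X.psiM q i) (X.psiP q j) =
    (den q d i j (X.lvl : ℂ) * num q d i j (X.lvl : ℂ)⁻¹) • pr (X.psiM q i) (X.psiP q j) := by
  refine relation_of_inv_G_G hn hq hd (evZ_pr_of_pos fun k hk => curM_of_pos _ hk) ?_
  funext ⟨k, l⟩
  rw [← actWZ_eq_ts]
  exact h.psiP_psiM j i l k

theorem e_e_rel (i j) : den q d i j 1 • rp (X.e i) (X.e j) = num q d i j 1 • pr (X.e i) (X.e j) := by
  rw [← sub_eq_zero]
  funext ⟨k, l⟩
  rw [E_E_iff, h.e_e]; rfl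

theorem f_f_rel (i j) : num q d i j 1 • rp (X.f i) (X.f j) = den q d i j 1 • pr (X.f i) (X.f j) := by
  rw [← sub_eq_zero]
  funext ⟨k, l⟩
  have h1 := congrArg (fun x => dCoef d i j • x) (h.f_f i j k l)
  simp only [smul_add, smul_smul, dCoef_mul_dCoef hn hd, one_smul, smul_zero] at h1
  simp only [fam_sub_apply, den, num, lw_smul_apply, rp_apply, pr_apply, one_smul, mul_one,
    mul_smul, fam_zero_apply]
  rw [← neg_eq_zero, ← h1]
  module

/-- The rescaled currents of an admissible `ℰ_n`-module satisfy the polynomial relations. -/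
theorem tSys {c : ℂ} (hc : c ≠ 0) :
    TSys n q d (c ^ 2) ((X.lvl * c : ℂ) ^ 2) (fun i => scaleCur c (X.e i))
      (fun i => scaleCur (X.lvl * c : ℂ)⁻¹ (X.f i))
      (fun i => scaleCur (X.lvl * c : ℂ)⁻¹ (X.psiPInv q i))
      (fun i => scaleCur c (X.psiM q i))
      (fun i => scaleCur (X.lvl * c : ℂ)⁻¹ (X.psiP q i)) := by
  have hX : (X.lvl : ℂ) ≠ 0 := X.lvl.ne_zero
  have ha : (X.lvl * c : ℂ) ≠ 0 := mul_ne_zero hX hc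
  set a : ℂ := X.lvl * c with ha'
  have hcc : c = (c⁻¹)⁻¹ := (inv_inv c).symm
  have hci : c⁻¹ ≠ 0 := inv_ne_zero hc
  have eP : ∀ i, scaleCur a⁻¹ (X.psiP q i) = curP (resc a (X.serP q i)) := fun i => by
    rw [psiP_eq, scaleCur_curP, inv_inv]
  have eI : ∀ i, scaleCur a⁻¹ (X.psiPInv q i) = curP (resc a (X.serPInv q i)) := fun i => by
    rw [psiPInv_eq, scaleCur_curP, inv_inv]
  have i₁ : ∀ i, resc a (X.serP q i) * resc a (X.serPInv q i) = 1 := fun i => by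
    rw [← resc_mul, h.serP_mul_serPInv, resc_one]
  have i₂ : ∀ i, resc a (X.serPInv q i) * resc a (X.serP q i) = 1 := fun i => by
    rw [← resc_mul, h.serPInv_mul_serP, resc_one]
  have half : ∀ {A : 𝓛 V}, (2⁻¹ : ℂ) • A = 0 → A = 0 := fun hA =>
    (smul_eq_zero.1 hA).resolve_left (by norm_num)
  refine
    { η_neg := fun i k hk => by rw [eI, curP_of_neg _ hk]
      ζp_neg := fun i k hk => by rw [eP, curP_of_neg _ hk]
      ζ_pos := fun i k hk => by
        rw [scaleCur, show X.psiM q i k = 0 from curM_of_pos _ hk, smul_zero]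
      ζp_η := fun i => ?_
      η_η := fun i j k l => ((h.psiPInv_comm i j k l).smul_left _).smul_right _
      ζ_ζ := fun i j k l => (Commute.smul_left (h.psiM_psiM i j k l) _).smul_right _
      η_e := fun i j => ?_
      η_φ := fun i j => ?_
      e_ζ := fun i j => ?_
      φ_ζ := fun i j => ?_
      η_ζ := fun i j => ?_
      e_φ := fun i j hij k l => ?_
      e_φ_self := fun i k l => ?_
      e_e := fun i j => ?_
      φ_φ := fun i j => ?_
      e_e_far := fun i j h0 h1 h2 k l =>
        (Commute.smul_left (h.e_e_far i j h0 h1 h2 k l) _).smul_right _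
      φ_φ_far := fun i j h0 h1 h2 k l =>
        (Commute.smul_left (h.f_f_far i j h0 h1 h2 k l) _).smul_right _
      serre_e := fun i j hij k₁ k₂ l => ?_
      serre_φ := fun i j hij k₁ k₂ l => ?_ }
  · have h1 := convCur_curP (resc a (X.serP q i)) (resc a (X.serPInv q i))
    rw [i₁, ← eP, ← eI] at h1
    funext k
    refine (congrFun h1 k).trans ?_
    rcases lt_trichotomy k 0 with hk | hk | hk
    · rw [curP_of_neg _ hk, oneCur_of_ne hk.ne]
    · subst hk; simp [curP, oneCur]
    · rw [oneCur_of_ne hk.ne', curP, if_pos hk.le, PowerSeries.coeff_one, if_neg (by omega)]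
  · rw [eI]
    refine relation_inv (i₂ j) (i₁ j) ?_
    rw [← eP, hcc]
    refine den_num_scale hci ha ?_ (h.e_psiP_rel hn hq hd i j)
    rw [ha', inv_inv]; field_simp
  · rw [eI]
    refine relation_inv (i₂ j) (i₁ j) ?_
    rw [← eP]
    exact num_den_scale ha ha (by field_simp) (h.f_psiP_rel hn hq hd i j)
  · rw [hcc]
    exact den_num_scale hci hci (by field_simp) (h.psiM_e_rel hn hq hd i j)
  · rw [hcc]
    refine num_den_scale hci ha ?_ (h.psiM_f_rel hn hq hd i j)
    rw [ha', inv_inv]; field_simp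
  · rw [eI]
    refine relation_inv (i₂ j) (i₁ j) ?_
    rw [← eP, hcc]
    refine num_den_mul_scale hci ha ?_ ?_ (h.psiM_psiP_rel hn hq hd i j)
    · rw [ha', inv_inv]; field_simp
    · rw [ha', inv_inv]; field_simp
  · have := h.e_f i j k l
    rw [if_neg hij, sub_eq_zero] at this
    exact (Commute.smul_left this _).smul_right _
  · have := h.e_f i i k l
    rw [if_pos rfl] at this
    simp only [scaleCur_inv_apply]
    simp only [scaleCur, smul_mul_smul_comm, mul_comm (a ^ l)]
    rw [← smul_sub, this, smul_comm]
    congr 1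
    rw [smul_sub, smul_smul, smul_smul, smul_smul, smul_smul, ha']
    congr 2
    · rw [mul_zpow, mul_zpow, zpow_add₀ hX, zpow_add₀ hc, ← zpow_natCast c 2, ← zpow_mul]
      rw [show ((2 : ℕ) : ℤ) * -k = -k + -k by push_cast; ring, zpow_add₀ hc, zpow_neg]
      field_simp
    · rw [mul_pow, mul_zpow, mul_zpow, neg_add, zpow_add₀ hc, ← zpow_natCast c 2,
        ← zpow_natCast (X.lvl : ℂ) 2, ← zpow_mul, ← zpow_mul]
      rw [show ((2 : ℕ) : ℤ) * l = l + l by push_cast; ring, zpow_add₀ hc, zpow_add₀ hX, zpow_neg,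
        zpow_neg]
      field_simp
  · rw [hcc]
    exact den_num_scale hci hci (by field_simp) (h.e_e_rel hn hq hd i j)
  · exact num_den_scale ha ha (by field_simp) (h.f_f_rel hn hq hd i j)
  · rw [sixWords_scaleCur, half ((serreLHS_eq_sixWords hq _ _ _ _ _).symm.trans
      (h.serre_e i j hij k₁ k₂ l)), smul_zero]
  · rw [sixWords_scaleCur, half ((serreLHS_eq_sixWords hq _ _ _ _ _).symm.trans
      (h.serre_f i j hij k₁ k₂ l)), smul_zero]

end IsAdmissible

end EnOps

/-! ## The action on a tensor product -/

section NormalHoms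

variable {U U' : Type*} [AddCommGroup U] [Module ℂ U] [AddCommGroup U'] [Module ℂ U']

/-- A homomorphism of operator algebras which preserves locally finite sums. -/
def IsNormal (g : 𝓛 U →ₐ[ℂ] 𝓛 U') : Prop :=
  ∀ f : ℤ → 𝓛 U, LocFin f →
    LocFin (fun i => g (f i)) ∧ g (locSum f) = locSum fun i => g (f i)

variable {g : 𝓛 U →ₐ[ℂ] 𝓛 U'}

theorem IsNormal.cviLF (hg : IsNormal g) {x y : ℤ → 𝓛 U} (h : CviLF x y) :
    CviLF (fun k => g (x k)) fun k => g (y k) := fun k => by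
  have := (hg _ (h k)).1
  simpa only [map_mul] using this

theorem IsNormal.map_cvi (hg : IsNormal g) {x y : ℤ → 𝓛 U} (h : CviLF x y) :
    (fun k => g (cvi x y k)) = cvi (fun k => g (x k)) fun k => g (y k) := by
  funext k
  have := (hg _ (h k)).2
  simp only [map_mul] at this
  exact this

theorem isNormal_conj (T : U ≃ₗ[ℂ] U') : IsNormal (T.conjAlgEquiv ℂ).toAlgHom := fun f hf => by
  have hl : LocFin fun i => (T.conjAlgEquiv ℂ).toAlgHom (f i) :=
    fun u => (hf (T.symm u)).subset fun i hi h0 => hi (by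
      simp only at h0
      change T (f i (T.symm u)) = 0
      rw [h0, map_zero])
  refine ⟨hl, LinearMap.ext fun u => ?_⟩
  rw [locSum_apply hl]
  change T (locSum f (T.symm u)) = _
  rw [locSum_apply hf]
  exact map_finsum T (hf (T.symm u))

variable {V W : Type*} [AddCommGroup V] [Module ℂ V] [AddCommGroup W] [Module ℂ W]

theorem isNormal_opRHom : IsNormal (opRHom : 𝓛 W →ₐ[ℂ] 𝓛 (V ⊗[ℂ] W)) :=
  fun _ hf => ⟨hf.opR, opR_locSum hf⟩

theorem isNormal_opLHom : IsNormal (opLHom : 𝓛 V →ₐ[ℂ] 𝓛 (V ⊗[ℂ] W)) :=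
  fun f hf => by
    have hl : LocFin fun i => (opLHom : _ →ₐ[ℂ] 𝓛 (V ⊗[ℂ] W)) (f i) :=
      LocFin.of_tmul fun v w => (hf v).subset fun i hi h0 => hi (by
        simp only at h0
        simp [opLHom_apply, opL, h0])
    refine ⟨hl, TensorProduct.ext' fun v w => ?_⟩
    rw [locSum_apply hl]
    simp only [opLHom_apply, opL, TensorProduct.map_tmul, LinearMap.id_apply, locSum_apply hf]
    exact map_finsum ((TensorProduct.mk ℂ V W).flip w) (hf v)

theorem Truncated.opL {x : ℤ → 𝓛 V} (hx : Truncated x) :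
    Truncated fun k => opL W (x k) := fun u => by
  induction u using TensorProduct.induction_on with
  | zero => exact ⟨0, fun _ _ => map_zero _⟩
  | tmul v w =>
    obtain ⟨N, hN⟩ := hx v
    exact ⟨N, fun k hk => by simp [_root_.opL, hN k hk]⟩
  | add a b ha hb =>
    obtain ⟨M, hM⟩ := ha
    obtain ⟨N, hN⟩ := hb
    exact ⟨max M N, fun k hk => by
      rw [map_add, hM k (lt_of_le_of_lt (le_max_left _ _) hk),
        hN k (lt_of_le_of_lt (le_max_right _ _) hk), add_zero]⟩

theorem Truncated.scaleCur {x : ℤ → 𝓛 U} (hx : Truncated x) (c : ℂ) :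
    Truncated (scaleCur c x) := fun u => by
  obtain ⟨N, hN⟩ := hx u
  exact ⟨N, fun k hk => by simp [_root_.scaleCur, hN k hk]⟩

theorem cviLF_scaleCur {x y : ℤ → 𝓛 U} (h : CviLF x y) (c c' : ℂ) :
    CviLF (scaleCur c x) (scaleCur c' y) := fun k => by
  have h1 : LocFin fun a => x a * y (k - a) := h k
  have := h1.smul fun a => c ^ (-a) * c' ^ (-(k - a))
  simpa only [scaleCur, smul_mul_smul_comm, AddMonoidHom.id_apply] using this

theorem cvi_scaleCur {x y : ℤ → 𝓛 U} (h : CviLF x y) {c : ℂ} (hc : c ≠ 0) :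
    cvi (scaleCur c x) (scaleCur c y) = scaleCur c (cvi x y) := by
  funext k
  have h1 : LocFin fun a => x a * y (k - a) := h k
  rw [cvi_apply, scaleCur, cvi_apply, ← locSum_smul h1]
  congr 1; funext a
  rw [scaleCur, scaleCur, smul_mul_smul_comm, ← zpow_add₀ hc]
  congr 2; ring

theorem scaleCur_scaleCur (c c' : ℂ) (x : ℤ → 𝓛 U) :
    scaleCur c (scaleCur c' x) = scaleCur (c * c') x := by
  funext k; simp only [scaleCur, smul_smul, mul_zpow]

theorem scaleCur_neg (c : ℂ) (x : ℤ → 𝓛 U) : scaleCur c (-x) = -scaleCur c x := by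
  funext k; simp [scaleCur]

theorem cvi_neg_left {x y : ℤ → 𝓛 U} (h : CviLF x y) : cvi (-x) y = -cvi x y := by
  funext k
  have := locSum_neg (h k)
  simp only [cvi_apply, fam_neg_apply, neg_mul]
  exact this

theorem tensorCur_eq_cvi (A : ℤ → 𝓛 V) (B : ℤ → 𝓛 W) :
    tensorCur A B = cvi (fun k => opL W (A k)) fun k => opR V (B k) := tensorCur_eq A B

theorem locFin_tensorTerms_iff {A : ℤ → 𝓛 V} {B : ℤ → 𝓛 W} :
    (∀ k, LocFin (tensorTerms A B k)) ↔
      CviLF (fun k => opL W (A k)) fun k => opR V (B k) := by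
  rw [tensorTerms_eq]; rfl

theorem serL_mul (A B : PowerSeries (𝓛 V)) :
    serL W (A * B) = serL W A * serL W B := map_mul _ _ _

theorem serR_mul (A B : PowerSeries (𝓛 W)) :
    serR V (A * B) = serR V A * serR V B := map_mul _ _ _

theorem serL_formalExp (A : PowerSeries (𝓛 V)) :
    serL W (formalExp A) = formalExp (serL W A) := map_formalExp _ _

theorem serR_formalExp (B : PowerSeries (𝓛 W)) :
    serR V (formalExp B) = formalExp (serR V B) := map_formalExp _ _

theorem C_map_eq (x : 𝓛 V) (y : 𝓛 W) :
    PowerSeries.C (TensorProduct.map x y) = serL W (PowerSeries.C x) * serR V (PowerSeries.C y) := by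
  rw [serL, serR, PowerSeries.map_C, PowerSeries.map_C, ← map_mul, map_eq_opL_mul_opR]; rfl

theorem formalExp_serL_add_serR {A : PowerSeries (𝓛 V)}
    {B : PowerSeries (𝓛 W)} (hA : PowerSeries.coeff 0 A = 0)
    (hB : PowerSeries.coeff 0 B = 0) :
    formalExp (serL W A + serR V B) = serL W (formalExp A) * serR V (formalExp B) := by
  rw [formalExp_add (by rw [PowerSeries.coeff_map, hA, map_zero])
    (by rw [PowerSeries.coeff_map, hB, map_zero]) (serL_serR_commute A B), serL_formalExp,
    serR_formalExp]

theorem serL_mul_serR_mul (A A' : PowerSeries (𝓛 V))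
    (B B' : PowerSeries (𝓛 W)) :
    serL W A * serR V B * (serL W A' * serR V B') = serL W (A * A') * serR V (B * B') := by
  rw [serL_mul, serR_mul, mul_assoc, ← mul_assoc (serR V B), ← (serL_serR_commute A' B).eq]
  simp only [mul_assoc]

theorem C_map_mul_formalExp (x : 𝓛 V) (y : 𝓛 W)
    {A : PowerSeries (𝓛 V)} {B : PowerSeries (𝓛 W)}
    (hA : PowerSeries.coeff 0 A = 0) (hB : PowerSeries.coeff 0 B = 0) :
    PowerSeries.C (TensorProduct.map x y) * formalExp (serL W A + serR V B) =
      serL W (PowerSeries.C x * formalExp A) * serR V (PowerSeries.C y * formalExp B) := by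
  rw [C_map_eq, formalExp_serL_add_serR hA hB, serL_mul_serR_mul]

theorem formalExp_mul_C_map (x : 𝓛 V) (y : 𝓛 W)
    {A : PowerSeries (𝓛 V)} {B : PowerSeries (𝓛 W)}
    (hA : PowerSeries.coeff 0 A = 0) (hB : PowerSeries.coeff 0 B = 0) :
    formalExp (serL W A + serR V B) * PowerSeries.C (TensorProduct.map x y) =
      serL W (formalExp A * PowerSeries.C x) * serR V (formalExp B * PowerSeries.C y) := by
  rw [C_map_eq, formalExp_serL_add_serR hA hB, serL_mul_serR_mul]

end NormalHoms

section Comodule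

variable {n : ℕ} {q d : ℂ} {V W : Type*} [AddCommGroup V] [Module ℂ V] [AddCommGroup W]
  [Module ℂ W]

theorem coeff_zero_resc {A : PowerSeries (𝓛 V)} (hA : PowerSeries.coeff 0 A = 0)
    (c : ℂ) : PowerSeries.coeff 0 (resc c A) = 0 := by rw [coeff_resc, hA, smul_zero]

theorem posModes_comod (q c : ℂ) (X : EnOps n V) (Y : KnOps n W) (i : ZMod n) :
    posModes c ((KnOps.comod q X Y).H i) =
      serL W (resc (X.lvl * Y.lvl : ℂ) (posModes (-c) (X.h i))) + serR V (posModes c (Y.H i)) := by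
  ext1 m
  rw [map_add, PowerSeries.coeff_map, PowerSeries.coeff_map, coeff_resc]
  simp only [posModes, PowerSeries.coeff_mk]
  split_ifs with hm
  · simp
  · have hm' : (0 : ℤ) < m := by exact_mod_cast Nat.pos_of_ne_zero hm
    simp only [KnOps.comod, if_pos hm', zpow_natCast, RingHom.coe_coe, map_smul, opLHom_apply,
      opRHom_apply]
    module

theorem negModes_comod (q c : ℂ) (X : EnOps n V) (Y : KnOps n W) (i : ZMod n) :
    negModes c ((KnOps.comod q X Y).H i) =
      serL W (resc (Y.lvl : ℂ) (negModes c (X.h i))) + serR V (negModes c (Y.H i)) := by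
  ext1 m
  rw [map_add, PowerSeries.coeff_map, PowerSeries.coeff_map, coeff_resc]
  simp only [negModes, PowerSeries.coeff_mk]
  split_ifs with hm
  · simp
  · have hm' : ¬ (0 : ℤ) < -m := by omega
    simp only [KnOps.comod, if_neg hm', neg_neg, zpow_natCast, RingHom.coe_coe, map_smul,
      opLHom_apply, opRHom_apply]
    module

theorem comod_Km (X : EnOps n V) (Y : KnOps n W) (i : ZMod n) :
    (KnOps.comod q X Y).Km q i = tensorCur (scaleCur (Y.lvl : ℂ) (X.psiM q i)) (Y.Km q i) := by
  rw [KnOps.Km, negModes_comod, EnOps.psiM, scaleCur_curM, KnOps.Km, tensorCur_curM, resc_mul,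
    resc_C, resc_formalExp, ← C_map_mul_formalExp
      _ _ (coeff_zero_resc (EnOps.coeff_zero_negModes _ _) _) (EnOps.coeff_zero_negModes _ _)]
  rfl

namespace EnOps.IsAdmissible

variable [NeZero n] {X : EnOps n V} {𝒱 : ℤ → Submodule ℂ V} (h : X.IsAdmissible q d 𝒱)
include h

theorem C_qh_comm (i : ZMod n) :
    PowerSeries.C (X.qh (-alphaBar i)) * formalExp (posModes (-(q - q⁻¹)) (X.h i)) =
      X.serPInv q i := by
  have h1 : ∀ k, Commute (curP (X.serP q i) k) (X.qh (-alphaBar i)) := fun k => by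
    have h2 := h.qh_psiP (-alphaBar i) i k
    have h3 := congrArg (· * X.qh (-alphaBar i)) h2
    simp only [mul_assoc, neg_neg, h.qh_mul_neg, mul_one] at h3
    exact h3.symm
  have h2 : Commute (X.serPInv q i) (PowerSeries.C (X.qh (-alphaBar i))) := by
    ext1 m
    rw [PowerSeries.coeff_mul_C, PowerSeries.coeff_C_mul, ← curP_apply_natCast]
    exact commute_curP_inv (h.serP_mul_serPInv i) (h.serPInv_mul_serP i) h1 m
  have h3 := congrArg (· * PowerSeries.C (X.qh (alphaBar i))) h2.eq
  simp only [serPInv, mul_assoc, ← map_mul, h.qh_neg_mul, map_one, mul_one] at h3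
  rw [← h3, serPInv]

theorem comod_Kp (Y : KnOps n W) (i : ZMod n) :
    (KnOps.comod q X Y).Kp q i =
      tensorCur (scaleCur (X.lvl * Y.lvl : ℂ)⁻¹ (X.psiPInv q i)) (Y.Kp q i) := by
  rw [KnOps.Kp, posModes_comod, psiPInv_eq, ← h.C_qh_comm, scaleCur_curP, inv_inv, KnOps.Kp,
    tensorCur_curP, resc_mul, resc_C, resc_formalExp, ← C_map_mul_formalExp
      _ _ (coeff_zero_resc (EnOps.coeff_zero_posModes _ _) _) (EnOps.coeff_zero_posModes _ _)]
  rfl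

theorem truncated_psiPInv (i) : Truncated (X.psiPInv q i) :=
  Truncated.of_raises h.grading.filt fun k => (h.hasDegree_psiPInv i k).raises

theorem cviLF_f_psiPInv (i) : CviLF (X.f i) (X.psiPInv q i) :=
  cviLF_of_nonneg (h.truncated_psiPInv i) fun _ hk => curP_of_neg _ hk

theorem scaleCur_fTilde {c : ℂ} (hc : c ≠ 0) (i) :
    scaleCur c⁻¹ (X.fTilde q i) =
      -cvi (scaleCur (X.lvl * c : ℂ)⁻¹ (X.f i)) (scaleCur (X.lvl * c : ℂ)⁻¹ (X.psiPInv q i)) := by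
  rw [cvi_scaleCur (h.cviLF_f_psiPInv i) (inv_ne_zero (mul_ne_zero X.lvl.ne_zero hc)),
    show X.fTilde q i = -scaleCur (X.lvl : ℂ)⁻¹ (cvi (X.f i) (X.psiPInv q i)) from rfl,
    scaleCur_neg, scaleCur_scaleCur, mul_inv, mul_comm c⁻¹]

theorem hasDegree_fTilde (i k) : HasDegree 𝒱 (X.fTilde q i k) k :=
  ((HasDegree.locSum fun a => ((h.deg_f i a).mul (h.hasDegree_psiPInv i (k - a))).congr
    (by ring)).smul _).neg

/-- The two systems of currents on the tensor product. -/
theorem pairSys (hn : 3 ≤ n) (hq : q ≠ 0) (hd : d ≠ 0) {Y : KnOps n W} {𝒲 : ℤ → Submodule ℂ W}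
    (h' : Y.IsAdmissible q d 𝒲) :
    PairSys n q d ((Y.lvl : ℂ) ^ 2) ((X.lvl * Y.lvl : ℂ) ^ 2)
      (fun i k => opL W (scaleCur (Y.lvl : ℂ) (X.e i) k))
      (fun i k => opL W (scaleCur (X.lvl * Y.lvl : ℂ)⁻¹ (X.f i) k))
      (fun i k => opL W (scaleCur (X.lvl * Y.lvl : ℂ)⁻¹ (X.psiPInv q i) k))
      (fun i k => opL W (scaleCur (Y.lvl : ℂ) (X.psiM q i) k))
      (fun i k => opL W (scaleCur (X.lvl * Y.lvl : ℂ)⁻¹ (X.psiP q i) k))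
      (fun i k => opR V (Y.E i k)) (fun i k => opR V (Y.Kp q i k)) (fun i k => opR V (Y.Km q i k))
      (h.grading.leftFilt W) (h'.grading.rightFilt V) (h.grading.tensor h'.grading).filt where
  T := (h.tSys hn hq hd Y.lvl.ne_zero).map opLHom
  K := (h'.kSys hn hq hd).opR
  e_E _ _ _ _ := opL_opR_commute _ _
  e_Kp _ _ _ _ := opL_opR_commute _ _
  e_Km _ _ _ _ := opL_opR_commute _ _
  φ_E _ _ _ _ := opL_opR_commute _ _
  φ_Kp _ _ _ _ := opL_opR_commute _ _
  φ_Km _ _ _ _ := opL_opR_commute _ _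
  η_E _ _ _ _ := opL_opR_commute _ _
  η_Kp _ _ _ _ := opL_opR_commute _ _
  η_Km _ _ _ _ := opL_opR_commute _ _
  ζ_E _ _ _ _ := opL_opR_commute _ _
  ζ_Kp _ _ _ _ := opL_opR_commute _ _
  ζ_Km _ _ _ _ := opL_opR_commute _ _
  Φ_e i k := ((h.deg_e i k).smul _).opL_left.raises
  Φ_φ i k := ((h.deg_f i k).smul _).opL_left.raises
  Φ_η i k := ((h.hasDegree_psiPInv i k).smul _).opL_left.raises
  Φ_E _ _ := (HasDegree.opR_left _).raises
  Φ_Kp _ _ := (HasDegree.opR_left _).raises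
  Φ_Km _ _ := (HasDegree.opR_left _).raises
  Ψ_φ _ _ := (HasDegree.opL_right _).raises
  Ψ_η _ _ := (HasDegree.opL_right _).raises
  Ψ_E i k := (h'.deg_E i k).opR_right.raises
  Ψ_Kp i k := (hasDegree_Kp h'.deg_H h'.deg_Kp0 i k).opR_right.raises
  Ω_e i k := ((h.deg_e i k).smul _).opL.raises
  Ω_φ i k := ((h.deg_f i k).smul _).opL.raises
  Ω_η i k := ((h.hasDegree_psiPInv i k).smul _).opL.raises
  Ω_E i k := (h'.deg_E i k).opR.raises
  Ω_Kp i k := (hasDegree_Kp h'.deg_H h'.deg_Kp0 i k).opR.raises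
  Ω_Km i k := (hasDegree_Km h'.deg_H h'.deg_Km0 i k).opR.raises

theorem opL_scaleCur_fTilde (W : Type*) [AddCommGroup W] [Module ℂ W] {c : ℂ} (hc : c ≠ 0) (i) :
    (fun k => opL W (scaleCur c⁻¹ (X.fTilde q i) k)) =
      -cvi (fun k => opL W (scaleCur (X.lvl * c : ℂ)⁻¹ (X.f i) k))
        fun k => opL W (scaleCur (X.lvl * c : ℂ)⁻¹ (X.psiPInv q i) k) := by
  have := (isNormal_opLHom (W := W)).map_cvi (cviLF_scaleCur (h.cviLF_f_psiPInv i)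
    (X.lvl * c : ℂ)⁻¹ (X.lvl * c : ℂ)⁻¹)
  simp only [opLHom_apply] at this
  rw [← this, h.scaleCur_fTilde hc]
  funext k
  exact map_neg (opLHom (W := W)) _

theorem comod_E (hn : 3 ≤ n) (hq : q ≠ 0) (hd : d ≠ 0) {Y : KnOps n W} {𝒲 : ℤ → Submodule ℂ W}
    (h' : Y.IsAdmissible q d 𝒲) :
    (KnOps.comod q X Y).E = coE (fun i k => opL W (scaleCur (Y.lvl : ℂ) (X.e i) k))
      (fun i k => opL W (scaleCur (X.lvl * Y.lvl : ℂ)⁻¹ (X.f i) k))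
      (fun i k => opL W (scaleCur (X.lvl * Y.lvl : ℂ)⁻¹ (X.psiPInv q i) k))
      (fun i k => opR V (Y.E i k)) (fun i k => opR V (Y.Kp q i k))
      (fun i k => opR V (Y.Km q i k)) := by
  have S := h.pairSys hn hq hd h'
  funext i k
  have e3 : tensorCur (scaleCur (Y.lvl : ℂ)⁻¹ (X.fTilde q i)) (Y.Kp q i) =
      -cvi (cvi (fun k => opL W (scaleCur (X.lvl * Y.lvl : ℂ)⁻¹ (X.f i) k))
        fun k => opL W (scaleCur (X.lvl * Y.lvl : ℂ)⁻¹ (X.psiPInv q i) k))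
        fun k => opR V (Y.Kp q i k) := by
    rw [tensorCur_eq_cvi, h.opL_scaleCur_fTilde W Y.lvl.ne_zero, cvi_neg_left (S.lf_D i)]
  rw [KnOps.comod]
  simp only [e3, tensorCur_eq_cvi]
  rfl

theorem locFin_tensorTerms_Kp (hn : 3 ≤ n) (hq : q ≠ 0) (hd : d ≠ 0) {Y : KnOps n W}
    {𝒲 : ℤ → Submodule ℂ W} (h' : Y.IsAdmissible q d 𝒲) (A : ℤ → 𝓛 V) (i k) :
    LocFin (tensorTerms A (Y.Kp q i) k) :=
  locFin_tensorTerms_iff.2 (cviLF_of_nonneg ((h'.kSys hn hq hd).truncated_Kp i).opR fun k hk => by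
    rw [(h'.kSys hn hq hd).Kp_neg i k hk, ← opRHom_apply, map_zero]) k

theorem comod_isAdmissible (hn : 3 ≤ n) (hq : q ≠ 0) (hd : d ≠ 0) (hqq : q - q⁻¹ ≠ 0)
    {Y : KnOps n W} {𝒲 : ℤ → Submodule ℂ W} (h' : Y.IsAdmissible q d 𝒲) :
    (KnOps.comod q X Y).IsAdmissible q d (tensorGrading 𝒱 𝒲) := by
  have S := h.pairSys hn hq hd h'
  have c1 : ((KnOps.comod q X Y).lvl : ℂ) = X.lvl * Y.lvl := rfl
  have hE := h.comod_E hn hq hd h'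
  refine KnOps.isAdmissible_of_kSys hn hq hd (h.grading.tensor h'.grading) (fun i k => ?_)
    (fun i r hr => ?_) (fun i => ?_) (fun i => ?_) ?_
  · refine HasDegree.add (HasDegree.add ?_ (h'.deg_E i k).opR) ?_
    · exact HasDegree.tensorCur (A := scaleCur (Y.lvl : ℂ) (X.e i)) (B := Y.Km q i)
        (fun k => (h.deg_e i k).smul _) (hasDegree_Km h'.deg_H h'.deg_Km0 i) k
    · exact HasDegree.tensorCur (A := scaleCur (Y.lvl : ℂ)⁻¹ (X.fTilde q i)) (B := Y.Kp q i)
        (fun k => (h.hasDegree_fTilde i k).smul _) (hasDegree_Kp h'.deg_H h'.deg_Kp0 i) k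
  · simp only [KnOps.comod]
    split_ifs with h0
    · exact ((h.deg_h i r hr).opL.smul _).neg.add (h'.deg_H i r hr).opR
    · exact ((h.deg_h i r hr).opL.smul _).add (h'.deg_H i r hr).opR
  · exact ((h.deg_qh (-alphaBar i)).map_tensor (h'.deg_Kp0 i)).congr (zero_add 0)
  · exact ((h.deg_qh (-alphaBar i)).map_tensor (h'.deg_Km0 i)).congr (zero_add 0)
  · have e1 : (KnOps.comod q X Y).Kp q = fun i => cvi
        (fun k => opL W (scaleCur (X.lvl * Y.lvl : ℂ)⁻¹ (X.psiPInv q i) k))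
        fun k => opR V (Y.Kp q i k) := funext fun i => by
      rw [h.comod_Kp, tensorCur_eq_cvi]
    have e2 : (KnOps.comod q X Y).Km q = fun i => cvi
        (fun k => opL W (scaleCur (Y.lvl : ℂ) (X.psiM q i) k))
        fun k => opR V (Y.Km q i k) := funext fun i => by
      rw [comod_Km, tensorCur_eq_cvi]
    rw [c1, hE, e1, e2]
    exact S.coaction hn hq hd hqq (pow_ne_zero _ Y.lvl.ne_zero)

theorem isUnit_map_qh (a : LatticeP n) {y : 𝓛 W} (hy : IsUnit y) :
    IsUnit (TensorProduct.map (X.qh a) y) := by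
  rw [map_eq_opL_mul_opR]
  have : IsUnit (X.qh a) := ⟨⟨X.qh a, X.qh (-a), h.qh_mul_neg a, h.qh_neg_mul a⟩, rfl⟩
  exact (this.map (opLHom (W := W))).mul (hy.map (opRHom (V := V)))

end EnOps.IsAdmissible

end Comodule

/-! ## Associativity of products of currents -/

section Associativity

variable {U : Type*} [AddCommGroup U] [Module ℂ U] {x y z : ℤ → 𝓛 U}

/-- The sums in `x(z)y(z)z(z)` are locally finite. -/
def TripleLF (x y z : ℤ → 𝓛 U) : Prop :=
  ∀ k, LocFin fun p : ℤ × ℤ => x p.1 * y p.2 * z (k - p.1 - p.2)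

theorem cvi_assoc (hxy : CviLF x y) (hyz : CviLF y z) (h : TripleLF x y z) :
    cvi (cvi x y) z = cvi x (cvi y z) := by
  funext k
  have e1 : ∀ c, cvi x y c * z (k - c) = locSum fun a => x a * y (c - a) * z (k - c) := fun c =>
    locSum_mul (hxy c) _
  have e2 : ∀ a, x a * cvi y z (k - a) = locSum fun b => x a * y b * z (k - a - b) := fun a => by
    refine (mul_locSum (hyz (k - a)) _).trans ?_
    simp only [← mul_assoc]
    rfl
  let σ : ℤ × ℤ ≃ ℤ × ℤ :=
    { toFun := fun p => (p.2, p.1 - p.2)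
      invFun := fun p => (p.1 + p.2, p.1)
      left_inv := fun p => by ext <;> simp
      right_inv := fun p => by ext <;> simp }
  have h' : LocFin fun p : ℤ × ℤ => x p.2 * y (p.1 - p.2) * z (k - p.1) := by
    have := (h k).comp_injective σ.injective
    refine (congrArg LocFin (funext fun p => ?_)).mp this
    change x p.2 * y (p.1 - p.2) * z (k - p.2 - (p.1 - p.2)) = _
    congr 2; ring
  rw [cvi_apply, cvi_apply]
  simp only [e1, e2]
  rw [← locSum_prod (f := fun p : ℤ × ℤ => x p.2 * y (p.1 - p.2) * z (k - p.1)) h',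
    ← locSum_prod (f := fun p : ℤ × ℤ => x p.1 * y p.2 * z (k - p.1 - p.2)) (h k),
    ← locSum_equiv σ (fun p : ℤ × ℤ => x p.1 * y p.2 * z (k - p.1 - p.2))]
  congr 1; funext p
  change _ = x p.2 * y (p.1 - p.2) * z (k - p.2 - (p.1 - p.2))
  congr 2; ring

theorem cvi_comm (hc : ∀ a b, Commute (x a) (y b)) : cvi x y = cvi y x := by
  funext k
  rw [cvi_apply, cvi_apply, ← locSum_equiv (Equiv.subLeft k)]
  congr 1; funext a
  simp only [Equiv.subLeft_apply, sub_sub_cancel]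
  exact (hc _ _).eq

theorem bounded_of_truncated {x : ℤ → 𝓛 U} (hx : Truncated x) {S : Set U}
    (hS : S.Finite) : ∃ N : ℤ, ∀ u ∈ S, ∀ k, N < k → x k u = 0 := by
  choose N hN using hx
  obtain ⟨B, hB⟩ := (hS.image N).bddAbove
  exact ⟨B, fun u hu k hk => hN u k (lt_of_le_of_lt (hB ⟨u, hu, rfl⟩) hk)⟩

theorem tripleLF_of_nonneg (hy : Truncated y) (hy0 : ∀ k, k < 0 → y k = 0) (hz : Truncated z)
    (hz0 : ∀ k, k < 0 → z k = 0) : TripleLF x y z := fun k u => by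
  obtain ⟨M, hM⟩ := hz u
  obtain ⟨N, hN⟩ := bounded_of_truncated hy ((Set.finite_Icc (0 : ℤ) M).image fun c => z c u)
  refine ((Set.finite_Icc (k - N - M) k).prod (Set.finite_Icc 0 N)).subset fun p hp => ?_
  simp only [Function.mem_support, Module.End.mul_apply] at hp
  have f1 : k - p.1 - p.2 ≤ M := by
    by_contra hc; exact hp (by rw [hM _ (by omega), map_zero, map_zero])
  have f2 : 0 ≤ k - p.1 - p.2 := by
    by_contra hc; exact hp (by rw [hz0 _ (by omega)]; simp)
  have f3 : 0 ≤ p.2 := by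
    by_contra hc; exact hp (by rw [hy0 _ (by omega)]; simp)
  have f4 : p.2 ≤ N := by
    by_contra hc
    exact hp (by rw [hN _ ⟨_, ⟨f2, f1⟩, rfl⟩ _ (by omega), map_zero])
  simp only [Set.mem_prod, Set.mem_Icc]
  omega

theorem tripleLF_of_commute_left (hx : Truncated x) (hy : Truncated y) (hz : Truncated z)
    (hz0 : ∀ k, k < 0 → z k = 0) (hc : ∀ a b, Commute (x a) (y b)) : TripleLF x y z :=
    fun k u => by
  obtain ⟨M, hM⟩ := hz u
  obtain ⟨N, hN⟩ := bounded_of_truncated hy ((Set.finite_Icc (0 : ℤ) M).image fun c => z c u)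
  obtain ⟨L, hL⟩ := bounded_of_truncated hx ((Set.finite_Icc (0 : ℤ) M).image fun c => z c u)
  refine ((Set.finite_Icc (k - N - M) L).prod (Set.finite_Icc (k - L - M) N)).subset
    fun p hp => ?_
  simp only [Function.mem_support] at hp
  have f1 : k - p.1 - p.2 ≤ M := by
    by_contra hc; exact hp (by rw [Module.End.mul_apply, hM _ (by omega), map_zero])
  have f2 : 0 ≤ k - p.1 - p.2 := by
    by_contra hc; exact hp (by rw [hz0 _ (by omega)]; simp)
  have f3 : p.1 ≤ L := by
    by_contra h
    exact hp (by rw [(hc _ _).eq, Module.End.mul_apply, Module.End.mul_apply,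
      hL _ ⟨_, ⟨f2, f1⟩, rfl⟩ _ (by omega), map_zero])
  have f4 : p.2 ≤ N := by
    by_contra h
    exact hp (by rw [Module.End.mul_apply, Module.End.mul_apply,
      hN _ ⟨_, ⟨f2, f1⟩, rfl⟩ _ (by omega), map_zero])
  simp only [Set.mem_prod, Set.mem_Icc]
  omega

theorem tripleLF_of_commute (hx : Truncated x) (hy : Truncated y) (hz : Truncated z)
    (hxy : ∀ a b, Commute (x a) (y b)) (hxz : ∀ a b, Commute (x a) (z b))
    (hyz : ∀ a b, Commute (y a) (z b)) : TripleLF x y z := fun k u => by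
  obtain ⟨M, hM⟩ := hz u
  obtain ⟨N, hN⟩ := hy u
  obtain ⟨L, hL⟩ := hx u
  refine ((Set.finite_Icc (k - N - M) L).prod (Set.finite_Icc (k - L - M) N)).subset
    fun p hp => ?_
  simp only [Function.mem_support] at hp
  have f1 : k - p.1 - p.2 ≤ M := by
    by_contra hc; exact hp (by rw [Module.End.mul_apply, hM _ (by omega), map_zero])
  have f3 : p.1 ≤ L := by
    by_contra h
    exact hp (by rw [((hxy p.1 p.2)).eq, mul_assoc, (hxz _ _).eq, ← mul_assoc,
      Module.End.mul_apply, hL _ (by omega), map_zero])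
  have f4 : p.2 ≤ N := by
    by_contra h
    exact hp (by rw [mul_assoc, (hyz _ _).eq, ← mul_assoc, Module.End.mul_apply,
      hN _ (by omega), map_zero])
  simp only [Set.mem_prod, Set.mem_Icc]
  omega

theorem truncated_cvi_of_nonneg (hx : Truncated x) (hy : Truncated y)
    (hy0 : ∀ k, k < 0 → y k = 0) : Truncated (cvi x y) := fun u => by
  obtain ⟨M, hM⟩ := hy u
  obtain ⟨N, hN⟩ := bounded_of_truncated hx ((Set.finite_Icc (0 : ℤ) M).image fun c => y c u)
  refine ⟨N + M, fun k hk => ?_⟩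
  rw [show cvi x y k u = _ from locSum_apply (cviLF_of_nonneg hy hy0 k) u]
  refine (finsum_congr fun a => ?_).trans finsum_zero
  rw [Module.End.mul_apply, AddMonoidHom.id_apply]
  rcases lt_or_ge M (k - a) with h | h
  · rw [hM _ h, map_zero]
  rcases lt_or_ge (k - a) 0 with h' | h'
  · rw [hy0 _ h', LinearMap.zero_apply, map_zero]
  · exact hN _ ⟨_, ⟨h', h⟩, rfl⟩ _ (by omega)

theorem cvi_neg_of_nonneg (hx0 : ∀ k, k < 0 → x k = 0) (hy0 : ∀ k, k < 0 → y k = 0) (k : ℤ)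
    (hk : k < 0) : cvi x y k = 0 := by
  rw [cvi_apply, ← locSum_zero (ι := ℤ)]
  congr 1; funext a
  rcases lt_or_ge a 0 with h | h
  · rw [hx0 a h, zero_mul]
  · rw [hy0 (k - a) (by omega), mul_zero]

/-- If `P I = 1`, then `(x + P y)(I J) = (x I) J + y J`, where `y` commutes with `P` and `I`. -/
theorem add_cvi_mul_cvi {x y P I J : ℤ → 𝓛 U} (hP : Truncated P)
    (hI : Truncated I) (hI0 : ∀ k, k < 0 → I k = 0)
    (hJ : Truncated J) (hJ0 : ∀ k, k < 0 → J k = 0) (hy : Truncated y)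
    (hPI : cvi P I = oneCur U) (hPIc : ∀ a b, Commute (P a) (I b))
    (hPy : ∀ a b, Commute (P a) (y b)) (hIy : ∀ a b, Commute (I a) (y b))
    (hPJ : ∀ a b, Commute (P a) (J b)) (hIJ : ∀ a b, Commute (I a) (J b)) :
    cvi (x + cvi P y) (cvi I J) = cvi (cvi x I) J + cvi y J := by
  have tIJ : Truncated (cvi I J) := truncated_cvi_of_nonneg hI hJ hJ0
  have nIJ := cvi_neg_of_nonneg hI0 hJ0
  have lyJ : CviLF y J := cviLF_of_nonneg hJ hJ0
  have lPy : CviLF P y := cviLF_of_truncated hP hy hPy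
  have lIy : CviLF I y := cviLF_of_truncated hI hy hIy
  have lyI : CviLF y I := cviLF_of_nonneg hI hI0
  have lIJ : CviLF I J := cviLF_of_nonneg hJ hJ0
  have tyJ : Truncated (cvi y J) := truncated_cvi_of_nonneg hy hJ hJ0
  have cI : ∀ a b, Commute (I a) (cvi y J b) := fun a b =>
    (commute_cvi lyJ (fun b => (hIy a b).symm) (fun b => (hIJ a b).symm) b).symm
  have cP : ∀ a b, Commute (P a) (cvi y J b) := fun a b =>
    (commute_cvi lyJ (fun b => (hPy a b).symm) (fun b => (hPJ a b).symm) b).symm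
  rw [cvi_add_left (cviLF_of_nonneg tIJ nIJ) (cviLF_of_nonneg tIJ nIJ)]
  congr 1
  · exact (cvi_assoc (cviLF_of_nonneg hI hI0) lIJ (tripleLF_of_nonneg hI hI0 hJ hJ0)).symm
  · rw [cvi_assoc lPy (cviLF_of_nonneg tIJ nIJ) (tripleLF_of_commute_left hP hy tIJ nIJ hPy),
      ← cvi_assoc lyI lIJ (tripleLF_of_nonneg hI hI0 hJ hJ0), ← cvi_comm hIy,
      cvi_assoc lIy lyJ (tripleLF_of_commute_left hI hy hJ hJ0 hIy),
      ← cvi_assoc (cviLF_of_nonneg hI hI0) (cviLF_of_truncated hI tyJ cI)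
        (tripleLF_of_commute hP hI tyJ hPIc cP cI), hPI, cvi_oneCur]

end Associativity

/-! ## Coassociativity -/

section Coassociativity

variable {n : ℕ} [NeZero n] {q d : ℂ}
variable {V₁ V₂ W : Type*} [AddCommGroup V₁] [Module ℂ V₁] [AddCommGroup V₂] [Module ℂ V₂]
  [AddCommGroup W] [Module ℂ W]

theorem posModes_tensor (q c : ℂ) (X₁ : EnOps n V₁) (X₂ : EnOps n V₂) (i : ZMod n) :
    posModes c ((EnOps.tensor q X₁ X₂).h i) =
      serL V₂ (posModes c (X₁.h i)) + serR V₁ (resc (X₁.lvl : ℂ)⁻¹ (posModes c (X₂.h i))) := by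
  ext1 m
  rw [map_add, PowerSeries.coeff_map, PowerSeries.coeff_map, coeff_resc]
  simp only [posModes, PowerSeries.coeff_mk]
  split_ifs with hm
  · simp
  · have hm' : (0 : ℤ) < m := by exact_mod_cast Nat.pos_of_ne_zero hm
    simp only [EnOps.tensor, if_pos hm', zpow_neg, zpow_natCast, inv_pow, RingHom.coe_coe,
      map_smul, opLHom_apply, opRHom_apply]
    module

theorem psiPInv_tensor (X₁ : EnOps n V₁) (X₂ : EnOps n V₂) (i : ZMod n) :
    (EnOps.tensor q X₁ X₂).psiPInv q i =
      tensorCur (X₁.psiPInv q i) (scaleCur (X₁.lvl : ℂ) (X₂.psiPInv q i)) := by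
  rw [EnOps.psiPInv, posModes_tensor, EnOps.psiPInv, EnOps.psiPInv, scaleCur_curP, tensorCur_curP,
    resc_mul, resc_C, resc_formalExp, ← formalExp_mul_C_map _ _ (EnOps.coeff_zero_posModes _ _)
      (coeff_zero_resc (EnOps.coeff_zero_posModes _ _) _)]
  rfl

theorem scaleCur_add {c : ℂ} (x y : ℤ → 𝓛 V₁) :
    scaleCur c (x + y) = scaleCur c x + scaleCur c y := by
  funext k; simp [scaleCur]

theorem opL_scaleCur (c : ℂ) (x : ℤ → 𝓛 V₁) :
    (fun k => opL V₂ (scaleCur c x k)) = scaleCur c fun k => opL V₂ (x k) :=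
  funext fun _ => map_smul (opLHom (W := V₂)) _ _

theorem opR_scaleCur (c : ℂ) (x : ℤ → 𝓛 V₂) :
    (fun k => opR V₁ (scaleCur c x k)) = scaleCur c fun k => opR V₁ (x k) :=
  funext fun _ => map_smul (opRHom (V := V₁)) _ _

variable {X₁ : EnOps n V₁} {𝒱₁ : ℤ → Submodule ℂ V₁} {X₂ : EnOps n V₂}
  {𝒱₂ : ℤ → Submodule ℂ V₂}

theorem scaleCur_zero_of_neg {x : ℤ → 𝓛 V₁} (hx : ∀ k, k < 0 → x k = 0) (c : ℂ) (k : ℤ)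
    (hk : k < 0) : scaleCur c x k = 0 := by rw [scaleCur, hx k hk, smul_zero]

theorem EnOps.IsAdmissible.truncated_f (h : X₁.IsAdmissible q d 𝒱₁) (i) : Truncated (X₁.f i) :=
  Truncated.of_raises h.grading.filt fun k => (h.deg_f i k).raises

theorem EnOps.IsAdmissible.truncated_e (h : X₁.IsAdmissible q d 𝒱₁) (i) : Truncated (X₁.e i) :=
  Truncated.of_raises h.grading.filt fun k => (h.deg_e i k).raises

theorem EnOps.IsAdmissible.truncated_fTilde (h : X₁.IsAdmissible q d 𝒱₁) (i) :
    Truncated (X₁.fTilde q i) :=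
  Truncated.of_raises h.grading.filt fun k => (h.hasDegree_fTilde i k).raises

theorem EnOps.IsAdmissible.truncated_psiP (h : X₁.IsAdmissible q d 𝒱₁) (i) :
    Truncated (X₁.psiP q i) :=
  Truncated.of_raises h.grading.filt fun k =>
    (((SerDeg.C (h.deg_qh _)).mul (SerDeg.posModes (h.deg_h i)).formalExp).curP k).raises

theorem EnOps.psiM_pos (X : EnOps n V₁) (i k) (hk : 0 < k) : X.psiM q i k = 0 := curM_of_pos _ hk

theorem EnOps.psiPInv_neg (X : EnOps n V₁) (i k) (hk : k < 0) : X.psiPInv q i k = 0 :=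
  curP_of_neg _ hk

theorem EnOps.IsAdmissible.cvi_psiP_psiPInv (h : X₁.IsAdmissible q d 𝒱₁) (i) :
    cvi (X₁.psiP q i) (X₁.psiPInv q i) = oneCur V₁ := by
  refine (convCur_curP (X₁.serP q i) (X₁.serPInv q i)).trans ?_
  rw [h.serP_mul_serPInv]
  funext k
  rcases lt_trichotomy k 0 with hk | hk | hk
  · rw [curP_of_neg _ hk, oneCur_of_ne hk.ne]
  · subst hk; simp [curP, oneCur]
  · rw [oneCur_of_ne hk.ne', curP, if_pos hk.le, PowerSeries.coeff_one, if_neg (by omega)]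

theorem EnOps.IsAdmissible.psiP_psiPInv_comm (h : X₁.IsAdmissible q d 𝒱₁) (i a b) :
    Commute (X₁.psiP q i a) (X₁.psiPInv q i b) :=
  (commute_curP_inv (h.serP_mul_serPInv i) (h.serPInv_mul_serP i)
    (fun k => h.psiP_psiP i i k a) b).symm

theorem opL_oneCur : (fun k => opL V₂ (oneCur V₁ k)) = oneCur (V₁ ⊗[ℂ] V₂) := by
  funext k
  by_cases hk : k = 0
  · subst hk; simp only [oneCur, Pi.single_eq_same]; exact map_one (opLHom (W := V₂))
  · rw [oneCur_of_ne hk, oneCur_of_ne hk]; exact map_zero (opLHom (W := V₂))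

theorem opL_zero_of {p : ℤ → Prop} {x : ℤ → 𝓛 V₁} (hx : ∀ k, p k → x k = 0) (k : ℤ)
    (hk : p k) : opL V₂ (x k) = 0 := by
  rw [hx k hk, ← opLHom_apply, map_zero]

theorem opR_zero_of {p : ℤ → Prop} {x : ℤ → 𝓛 V₂} (hx : ∀ k, p k → x k = 0) (k : ℤ)
    (hk : p k) : opR V₁ (x k) = 0 := by
  rw [hx k hk, ← opRHom_apply, map_zero]

/-- `f̃_i(z)` acts on a tensor product as `f̃_i(C₂⁻¹z) ⊗ ψ_i^+(C₂⁻¹z)⁻¹ + 1 ⊗ f̃_i(z)`. -/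
theorem fTilde_tensor (h₁ : X₁.IsAdmissible q d 𝒱₁) (h₂ : X₂.IsAdmissible q d 𝒱₂) (i : ZMod n) :
    (EnOps.tensor q X₁ X₂).fTilde q i =
      tensorCur (scaleCur (X₂.lvl : ℂ)⁻¹ (X₁.fTilde q i))
        (scaleCur (X₂.lvl : ℂ)⁻¹ (X₂.psiPInv q i)) + fun k => opR V₁ (X₂.fTilde q i k) := by
  have n₁ : (X₁.lvl : ℂ) ≠ 0 := X₁.lvl.ne_zero
  have n₂ : (X₂.lvl : ℂ) ≠ 0 := X₂.lvl.ne_zero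
  set x : ℤ → 𝓛 (V₁ ⊗[ℂ] V₂) := fun k => opL V₂ (X₁.f i k) with hx
  set P : ℤ → 𝓛 (V₁ ⊗[ℂ] V₂) := fun k => opL V₂ (X₁.psiP q i k)
  set I : ℤ → 𝓛 (V₁ ⊗[ℂ] V₂) := fun k => opL V₂ (X₁.psiPInv q i k) with hI
  set y : ℤ → 𝓛 (V₁ ⊗[ℂ] V₂) := fun k => opR V₁ (X₂.f i k) with hy
  set J : ℤ → 𝓛 (V₁ ⊗[ℂ] V₂) := fun k => opR V₁ (X₂.psiPInv q i k) with hJ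
  have lxI : CviLF x I := isNormal_opLHom.cviLF (h₁.cviLF_f_psiPInv i)
  have lyJ : CviLF y J := isNormal_opRHom.cviLF (h₂.cviLF_f_psiPInv i)
  have tJ : Truncated J := (h₂.truncated_psiPInv i).opR
  have nJ : ∀ k, k < 0 → J k = 0 := opR_zero_of (X₂.psiPInv_neg i)
  have lxIJ : CviLF (cvi x I) J := cviLF_of_nonneg tJ nJ
  have key : cvi (x + cvi P (scaleCur (X₁.lvl : ℂ) y)) (cvi I (scaleCur (X₁.lvl : ℂ) J)) =
      cvi (cvi x I) (scaleCur (X₁.lvl : ℂ) J) +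
        cvi (scaleCur (X₁.lvl : ℂ) y) (scaleCur (X₁.lvl : ℂ) J) := by
    have c : ∀ (a : 𝓛 V₁) (b : 𝓛 V₂) (t : ℂ),
        Commute (opL V₂ a) (t • opR V₁ b) := fun a b t => (opL_opR_commute a b).smul_right t
    refine add_cvi_mul_cvi (h₁.truncated_psiP i).opL
      (h₁.truncated_psiPInv i).opL (opL_zero_of (X₁.psiPInv_neg i)) (tJ.scaleCur _)
      (scaleCur_zero_of_neg nJ _) ((h₂.truncated_f i).opR.scaleCur _) ?_
      (fun a b => (h₁.psiP_psiPInv_comm i a b).map opLHom) (fun _ _ => c _ _ _)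
      (fun _ _ => c _ _ _) (fun _ _ => c _ _ _) fun _ _ => c _ _ _
    have hlf : CviLF (X₁.psiP q i) (X₁.psiPInv q i) :=
      cviLF_of_nonneg (h₁.truncated_psiPInv i) (X₁.psiPInv_neg i)
    have := (isNormal_opLHom (W := V₂)).map_cvi hlf
    rw [h₁.cvi_psiP_psiPInv] at this
    exact this.symm.trans opL_oneCur
  have ef : (EnOps.tensor q X₁ X₂).f i = x + cvi P (scaleCur (X₁.lvl : ℂ) y) := by
    have : (EnOps.tensor q X₁ X₂).f i =
      x + tensorCur (X₁.psiP q i) (scaleCur (X₁.lvl : ℂ) (X₂.f i)) := rfl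
    rw [this, tensorCur_eq_cvi, opR_scaleCur]
  have ep : (EnOps.tensor q X₁ X₂).psiPInv q i = cvi I (scaleCur (X₁.lvl : ℂ) J) := by
    rw [psiPInv_tensor, tensorCur_eq_cvi, opR_scaleCur]
  have el : ((EnOps.tensor q X₁ X₂).lvl : ℂ)⁻¹ = (X₂.lvl : ℂ)⁻¹ * (X₁.lvl : ℂ)⁻¹ :=
    mul_inv_rev (X₁.lvl : ℂ) (X₂.lvl : ℂ)
  have eI : (fun k => opL V₂ (X₁.fTilde q i k)) = -scaleCur (X₁.lvl : ℂ)⁻¹ (cvi x I) := by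
    have : (fun k => opL V₂ (cvi (X₁.f i) (X₁.psiPInv q i) k)) = cvi x I :=
      (isNormal_opLHom (W := V₂)).map_cvi (h₁.cviLF_f_psiPInv i)
    rw [← this, ← opL_scaleCur]
    funext k; exact map_neg (opLHom (W := V₂)) _
  have eJ : (fun k => opR V₁ (X₂.fTilde q i k)) = -scaleCur (X₂.lvl : ℂ)⁻¹ (cvi y J) := by
    have : (fun k => opR V₁ (cvi (X₂.f i) (X₂.psiPInv q i) k)) = cvi y J :=
      (isNormal_opRHom (V := V₁)).map_cvi (h₂.cviLF_f_psiPInv i)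
    rw [← this, ← opR_scaleCur]
    funext k; exact map_neg (opRHom (V := V₁)) _
  have e0 : (EnOps.tensor q X₁ X₂).fTilde q i = -scaleCur ((EnOps.tensor q X₁ X₂).lvl : ℂ)⁻¹
      (cvi ((EnOps.tensor q X₁ X₂).f i) ((EnOps.tensor q X₁ X₂).psiPInv q i)) := rfl
  have n12 := mul_ne_zero (inv_ne_zero n₂) (inv_ne_zero n₁)
  have lz : CviLF (cvi x I) (scaleCur (X₁.lvl : ℂ) J) :=
    cviLF_of_nonneg (tJ.scaleCur _) (scaleCur_zero_of_neg nJ _)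
  rw [e0, ef, ep, key, el, scaleCur_add, ← cvi_scaleCur lz n12,
    ← cvi_scaleCur (cviLF_scaleCur lyJ _ _) n12, scaleCur_scaleCur, scaleCur_scaleCur,
    inv_mul_cancel_right₀ n₁, cvi_scaleCur lyJ (inv_ne_zero n₂), tensorCur_eq_cvi, opL_scaleCur,
    opR_scaleCur, eI, eJ, scaleCur_neg, scaleCur_scaleCur,
    cvi_neg_left (cviLF_scaleCur lxIJ _ _), neg_add]

end Coassociativity

section AssocCurrents

variable {V₁ V₂ W : Type*} [AddCommGroup V₁] [Module ℂ V₁] [AddCommGroup V₂] [Module ℂ V₂]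
  [AddCommGroup W] [Module ℂ W]

/-- Transport of operators along `(V₁ ⊗ V₂) ⊗ W ≅ V₁ ⊗ (V₂ ⊗ W)`. -/
def assocHom (V₁ V₂ W : Type*) [AddCommGroup V₁] [Module ℂ V₁] [AddCommGroup V₂] [Module ℂ V₂]
    [AddCommGroup W] [Module ℂ W] :
    𝓛 ((V₁ ⊗[ℂ] V₂) ⊗[ℂ] W) →ₐ[ℂ] 𝓛 (V₁ ⊗[ℂ] (V₂ ⊗[ℂ] W)) :=
  ((TensorProduct.assoc ℂ V₁ V₂ W).conjAlgEquiv ℂ).toAlgHom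

theorem assocHom_apply_assoc (a : 𝓛 ((V₁ ⊗[ℂ] V₂) ⊗[ℂ] W)) (u) :
    assocHom V₁ V₂ W a (TensorProduct.assoc ℂ V₁ V₂ W u) = TensorProduct.assoc ℂ V₁ V₂ W (a u) :=
  congrArg (fun t => TensorProduct.assoc ℂ V₁ V₂ W (a t))
    ((TensorProduct.assoc ℂ V₁ V₂ W).symm_apply_apply u)

theorem assocHom_map (a : 𝓛 V₁) (b : 𝓛 V₂) (c : 𝓛 W) :
    assocHom V₁ V₂ W (TensorProduct.map (TensorProduct.map a b) c) =
      TensorProduct.map a (TensorProduct.map b c) := by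
  refine LinearMap.ext fun u => ?_
  obtain ⟨t, rfl⟩ := (TensorProduct.assoc ℂ V₁ V₂ W).surjective u
  rw [assocHom_apply_assoc]
  exact (LinearMap.congr_fun (TensorProduct.map_map_comp_assoc_eq a b c) t).symm

theorem assocHom_opL_opL (a : 𝓛 V₁) :
    assocHom V₁ V₂ W (opL W (opL V₂ a)) = opL (V₂ ⊗[ℂ] W) a := by
  rw [opL, opL, assocHom_map, TensorProduct.map_id, opL]

theorem assocHom_opL_opR (b : 𝓛 V₂) :
    assocHom V₁ V₂ W (opL W (opR V₁ b)) = opR V₁ (opL W b) := assocHom_map _ _ _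

theorem assocHom_opR (c : 𝓛 W) :
    assocHom V₁ V₂ W (opR (V₁ ⊗[ℂ] V₂) c) = opR V₁ (opR V₂ c) := by
  rw [opR, ← TensorProduct.map_id, assocHom_map, opR, opR]

variable {A : ℤ → 𝓛 V₁} {B : ℤ → 𝓛 V₂} {C : ℤ → 𝓛 W}

theorem cviLF_tensor (hA : Truncated A) (hB : Truncated B) :
    CviLF (fun k => opL V₂ (A k)) fun k => opR V₁ (B k) :=
  cviLF_of_truncated hA.opL hB.opR fun _ _ => opL_opR_commute _ _

theorem truncated_cvi_of_commute {U : Type*} [AddCommGroup U] [Module ℂ U]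
    {x y : ℤ → 𝓛 U} (hx : Truncated x) (hy : Truncated y)
    (hc : ∀ a b, Commute (x a) (y b)) : Truncated (cvi x y) := fun u => by
  obtain ⟨M, hM⟩ := hx u
  obtain ⟨N, hN⟩ := hy u
  refine ⟨M + N, fun k hk => ?_⟩
  rw [show cvi x y k u = _ from locSum_apply (cviLF_of_truncated hx hy hc k) u]
  refine (finsum_congr fun a => ?_).trans finsum_zero
  rw [AddMonoidHom.id_apply]
  rcases lt_or_ge M a with h | h
  · rw [(hc _ _).eq, Module.End.mul_apply, hM a h, map_zero]
  · rw [Module.End.mul_apply, hN (k - a) (by omega), map_zero]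

theorem Truncated.tensorCur (hA : Truncated A) (hB : Truncated B) :
    Truncated (_root_.tensorCur A B) := by
  rw [tensorCur_eq_cvi]
  exact truncated_cvi_of_commute hA.opL hB.opR fun _ _ => opL_opR_commute _ _

theorem opL_tensorCur (hA : Truncated A) (hB : Truncated B) :
    (fun k => opL W (tensorCur A B k)) =
      cvi (fun k => opL W (opL V₂ (A k))) fun k => opL W (opR V₁ (B k)) := by
  rw [tensorCur_eq_cvi]
  exact (isNormal_opLHom (W := W)).map_cvi (cviLF_tensor hA hB)

theorem opR_tensorCur (hB : Truncated B) (hC : Truncated C) :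
    (fun k => opR V₁ (tensorCur B C k)) =
      cvi (fun k => opR V₁ (opL W (B k))) fun k => opR V₁ (opR V₂ (C k)) := by
  rw [tensorCur_eq_cvi]
  exact (isNormal_opRHom (V := V₁)).map_cvi (cviLF_tensor hB hC)

theorem isNormal_assocHom : IsNormal (assocHom V₁ V₂ W) := isNormal_conj _

theorem assocHom_tensorCur_tensorCur (hA : Truncated A) (hB : Truncated B) (hC : Truncated C) :
    (fun k => assocHom V₁ V₂ W (tensorCur (tensorCur A B) C k)) =
      tensorCur A (tensorCur B C) := by
  have h12 := isNormal_assocHom.map_cvi (isNormal_opLHom (W := W) |>.cviLF (cviLF_tensor hA hB))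
  have l12 := isNormal_assocHom.cviLF (isNormal_opLHom (W := W) |>.cviLF (cviLF_tensor hA hB))
  simp only [opLHom_apply, assocHom_opL_opL, assocHom_opL_opR] at h12 l12
  have c12 : ∀ a b, Commute (opL (V₂ ⊗[ℂ] W) (A a)) (opR V₁ (opL W (B b))) := fun _ _ =>
    opL_opR_commute _ _
  have l23 : CviLF (fun k => opR V₁ (opL W (B k))) fun k => opR V₁ (opR V₂ (C k)) :=
    isNormal_opRHom.cviLF (cviLF_tensor hB hC)
  rw [tensorCur_eq_cvi (tensorCur A B),
    isNormal_assocHom.map_cvi (cviLF_tensor (hA.tensorCur hB) hC)]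
  simp only [assocHom_opR, congrFun (opL_tensorCur (W := W) hA hB)]
  rw [h12, tensorCur_eq_cvi A, opR_tensorCur hB hC]
  exact cvi_assoc l12 l23 (tripleLF_of_commute hA.opL hB.opL.opR hC.opR.opR c12
    (fun _ _ => opL_opR_commute _ _) fun a b => (opL_opR_commute (B a) (C b)).map opRHom)

theorem assocHom_tensorCur_opR (hB : Truncated B) (hC : Truncated C) :
    (fun k => assocHom V₁ V₂ W (tensorCur (fun k => opR V₁ (B k)) C k)) =
      fun k => opR V₁ (tensorCur B C k) := by
  rw [tensorCur_eq_cvi, isNormal_assocHom.map_cvi (cviLF_tensor hB.opR hC), opR_tensorCur hB hC]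
  simp only [assocHom_opR, assocHom_opL_opR]

theorem tensorCur_add_left {A A' : ℤ → 𝓛 V₁} (hA : Truncated A) (hA' : Truncated A')
    (hB : Truncated B) : tensorCur (A + A') B = tensorCur A B + tensorCur A' B := by
  rw [tensorCur_eq_cvi, tensorCur_eq_cvi, tensorCur_eq_cvi,
    ← cvi_add_left (cviLF_tensor hA hB) (cviLF_tensor hA' hB)]
  congr 1
  funext k
  exact map_add (opLHom (W := V₂)) _ _

theorem scaleCur_tensorCur {c : ℂ} (hc : c ≠ 0) (hA : Truncated A) (hB : Truncated B) :
    scaleCur c (tensorCur A B) = tensorCur (scaleCur c A) (scaleCur c B) := by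
  rw [tensorCur_eq_cvi, tensorCur_eq_cvi, opL_scaleCur, opR_scaleCur,
    cvi_scaleCur (cviLF_tensor hA hB) hc]

end AssocCurrents

section CoassociativityE

variable {n : ℕ} [NeZero n] {q d : ℂ}
variable {V₁ V₂ W : Type*} [AddCommGroup V₁] [Module ℂ V₁] [AddCommGroup V₂] [Module ℂ V₂]
  [AddCommGroup W] [Module ℂ W]
variable {X₁ : EnOps n V₁} {𝒱₁ : ℤ → Submodule ℂ V₁} {X₂ : EnOps n V₂}
  {𝒱₂ : ℤ → Submodule ℂ V₂} {Y : KnOps n W} {𝒲 : ℤ → Submodule ℂ W}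

theorem EnOps.truncated_psiM (X : EnOps n V₁) (i) : Truncated (X.psiM q i) :=
  Truncated.of_pos (X.psiM_pos i)

theorem KnOps.truncated_Km (Y : KnOps n W) (i) : Truncated (Y.Km q i) :=
  Truncated.of_pos fun _ hk => curM_of_pos _ hk

theorem KnOps.IsAdmissible.truncated_Kp (h : Y.IsAdmissible q d 𝒲) (i) : Truncated (Y.Kp q i) :=
  Truncated.of_raises h.grading.filt fun k => (hasDegree_Kp h.deg_H h.deg_Kp0 i k).raises

theorem comod_E_apply (X : EnOps n V₁) (Y : KnOps n W) (i) : (KnOps.comod q X Y).E i =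
    tensorCur (scaleCur (Y.lvl : ℂ) (X.e i)) (Y.Km q i) + (fun k => opR V₁ (Y.E i k)) +
      tensorCur (scaleCur (Y.lvl : ℂ)⁻¹ (X.fTilde q i)) (Y.Kp q i) := rfl

theorem tensor_e_apply (X₁ : EnOps n V₁) (X₂ : EnOps n V₂) (i) : (EnOps.tensor q X₁ X₂).e i =
    tensorCur (scaleCur (X₂.lvl : ℂ) (X₁.e i)) (X₂.psiM q i) + fun k => opR V₁ (X₂.e i k) := rfl

theorem assocHom_comod_E (h₁ : X₁.IsAdmissible q d 𝒱₁) (h₂ : X₂.IsAdmissible q d 𝒱₂)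
    (h : Y.IsAdmissible q d 𝒲) (i : ZMod n) :
    (fun k => assocHom V₁ V₂ W ((KnOps.comod q (EnOps.tensor q X₁ X₂) Y).E i k)) =
      (KnOps.comod q X₁ (KnOps.comod q X₂ Y)).E i := by
  have nY : (Y.lvl : ℂ) ≠ 0 := Y.lvl.ne_zero
  have te₁ := h₁.truncated_e i
  have te₂ := h₂.truncated_e i
  have tf₁ := h₁.truncated_fTilde i
  have tf₂ := h₂.truncated_fTilde i
  have tm := X₂.truncated_psiM (q := q) i
  have tp := h₂.truncated_psiPInv i
  have tKp := h.truncated_Kp i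
  have tKm := Y.truncated_Km (q := q) i
  have e1 : tensorCur (scaleCur (Y.lvl : ℂ) ((EnOps.tensor q X₁ X₂).e i)) (Y.Km q i) =
      tensorCur (tensorCur (scaleCur (X₂.lvl * Y.lvl : ℂ) (X₁.e i))
        (scaleCur (Y.lvl : ℂ) (X₂.psiM q i))) (Y.Km q i) +
      tensorCur (fun k => opR V₁ (scaleCur (Y.lvl : ℂ) (X₂.e i) k)) (Y.Km q i) := by
    rw [tensor_e_apply, scaleCur_add, scaleCur_tensorCur nY (te₁.scaleCur _) tm,
      scaleCur_scaleCur, mul_comm (Y.lvl : ℂ), ← opR_scaleCur, tensorCur_add_left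
        ((te₁.scaleCur _).tensorCur (tm.scaleCur _)) (te₂.scaleCur _).opR tKm]
  have e2 : tensorCur (scaleCur (Y.lvl : ℂ)⁻¹ ((EnOps.tensor q X₁ X₂).fTilde q i)) (Y.Kp q i) =
      tensorCur (tensorCur (scaleCur (X₂.lvl * Y.lvl : ℂ)⁻¹ (X₁.fTilde q i))
        (scaleCur (X₂.lvl * Y.lvl : ℂ)⁻¹ (X₂.psiPInv q i))) (Y.Kp q i) +
      tensorCur (fun k => opR V₁ (scaleCur (Y.lvl : ℂ)⁻¹ (X₂.fTilde q i) k)) (Y.Kp q i) := by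
    rw [fTilde_tensor h₁ h₂, scaleCur_add, scaleCur_tensorCur (inv_ne_zero nY) (tf₁.scaleCur _)
      (tp.scaleCur _), scaleCur_scaleCur, scaleCur_scaleCur, mul_inv_rev, ← opR_scaleCur,
      tensorCur_add_left ((tf₁.scaleCur _).tensorCur (tp.scaleCur _)) (tf₂.scaleCur _).opR tKp]
  have f1 := assocHom_tensorCur_tensorCur (te₁.scaleCur (X₂.lvl * Y.lvl : ℂ))
    (tm.scaleCur (Y.lvl : ℂ)) tKm
  have f2 := assocHom_tensorCur_tensorCur (tf₁.scaleCur (X₂.lvl * Y.lvl : ℂ)⁻¹)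
    (tp.scaleCur (X₂.lvl * Y.lvl : ℂ)⁻¹) tKp
  have f3 := assocHom_tensorCur_opR (V₁ := V₁) (te₂.scaleCur (Y.lvl : ℂ)) tKm
  have f4 := assocHom_tensorCur_opR (V₁ := V₁) (tf₂.scaleCur (Y.lvl : ℂ)⁻¹) tKp
  have el : ((KnOps.comod q X₂ Y).lvl : ℂ) = X₂.lvl * Y.lvl := rfl
  funext k
  rw [comod_E_apply, comod_E_apply, comod_E_apply X₂, comod_Km, h₂.comod_Kp, e1, e2, el, ← f1,
    ← f2]
  simp only [Pi.add_apply, map_add, assocHom_opR]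
  rw [congrFun f3 k, congrFun f4 k]
  simp only [← opRHom_apply, map_add]
  abel

theorem comod_tensor_intertwines (h₁ : X₁.IsAdmissible q d 𝒱₁) (h₂ : X₂.IsAdmissible q d 𝒱₂)
    (h : Y.IsAdmissible q d 𝒲) : (KnOps.comod q (EnOps.tensor q X₁ X₂) Y).Intertwines
      (KnOps.comod q X₁ (KnOps.comod q X₂ Y)) (TensorProduct.assoc ℂ V₁ V₂ W) where
  lvl := mul_assoc _ _ _
  E i k w := by
    rw [← assocHom_comod_E h₁ h₂ h, assocHom_apply_assoc]
  H i r hr w := by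
    rw [← assocHom_apply_assoc]
    congr 1
    simp only [KnOps.comod, EnOps.tensor, Units.val_mul]
    have e : ∀ a : 𝓛 (V₁ ⊗[ℂ] V₂), opL W a = opLHom a := fun _ => rfl
    have e' : ∀ a : 𝓛 (V₂ ⊗[ℂ] W), opR V₁ a = opRHom a := fun _ => rfl
    have n₁ : (X₁.lvl : ℂ) ≠ 0 := X₁.lvl.ne_zero
    have k₁ : assocHom V₁ V₂ W (opLHom (opL V₂ (X₁.h i r))) = opL (V₂ ⊗[ℂ] W) (X₁.h i r) :=
      assocHom_opL_opL _
    have k₂ : assocHom V₁ V₂ W (opLHom (opR V₁ (X₂.h i r))) = opRHom (opL W (X₂.h i r)) :=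
      assocHom_opL_opR _
    have k₃ : assocHom V₁ V₂ W (opR (V₁ ⊗[ℂ] V₂) (Y.H i r)) = opRHom (opR V₂ (Y.H i r)) :=
      assocHom_opR _
    split_ifs
    · have m₁ : ∀ a, assocHom V₁ V₂ W (-a) = -assocHom V₁ V₂ W a := fun a => map_neg _ a
      have m₂ : ∀ a, opRHom (V := V₁) (W := V₂ ⊗[ℂ] W) (-a) = -opRHom a := fun a => map_neg _ a
      simp only [e, e', m₁, m₂, map_add, map_smul, k₁, k₂, k₃,
        smul_add, smul_smul, mul_zpow, zpow_neg]
      have : (X₁.lvl : ℂ) ^ r ≠ 0 := zpow_ne_zero r n₁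
      rw [show (X₁.lvl : ℂ) ^ r * (X₂.lvl : ℂ) ^ r * (Y.lvl : ℂ) ^ r * ((X₁.lvl : ℂ) ^ r)⁻¹ =
        (X₂.lvl : ℂ) ^ r * (Y.lvl : ℂ) ^ r by field_simp, mul_assoc]
      abel
    · simp only [e, e', map_add, map_smul, k₁, k₂, k₃,
        smul_add, smul_smul, mul_zpow, mul_comm]
      abel
  Kp0 i w := by
    rw [← assocHom_apply_assoc]
    exact LinearMap.congr_fun (assocHom_map _ _ _) _
  Km0 i w := by
    rw [← assocHom_apply_assoc]
    exact LinearMap.congr_fun (assocHom_map _ _ _) _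

end CoassociativityE

section Gradings

variable {V₁ V₂ W : Type*} [AddCommGroup V₁] [Module ℂ V₁] [AddCommGroup V₂] [Module ℂ V₂]
  [AddCommGroup W] [Module ℂ W]

theorem tmul_mem_tensorGrading {𝒱 : ℤ → Submodule ℂ V₁} {𝒲 : ℤ → Submodule ℂ W} {a b k : ℤ}
    (hk : a + b = k) {v : V₁} {w : W} (hv : v ∈ 𝒱 a) (hw : w ∈ 𝒲 b) :
    v ⊗ₜ[ℂ] w ∈ tensorGrading 𝒱 𝒲 k :=
  Submodule.mem_iSup_of_mem a (Submodule.apply_mem_map₂ _ hv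
    (by rwa [show k - a = b by omega]))

theorem tensorGrading_le {𝒱 : ℤ → Submodule ℂ V₁} {𝒲 : ℤ → Submodule ℂ W} {k : ℤ}
    {S : Submodule ℂ (V₁ ⊗[ℂ] W)}
    (hS : ∀ a b, a + b = k → ∀ v ∈ 𝒱 a, ∀ w ∈ 𝒲 b, v ⊗ₜ[ℂ] w ∈ S) : tensorGrading 𝒱 𝒲 k ≤ S :=
  iSup_le fun a => Submodule.map₂_le.2 fun v hv w hw => hS a (k - a) (by omega) v hv w hw

theorem map_assoc_tensorGrading (𝒱₁ : ℤ → Submodule ℂ V₁) (𝒱₂ : ℤ → Submodule ℂ V₂)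
    (𝒲 : ℤ → Submodule ℂ W) (k : ℤ) :
    (tensorGrading (tensorGrading 𝒱₁ 𝒱₂) 𝒲 k).map
      (TensorProduct.assoc ℂ V₁ V₂ W : _ →ₗ[ℂ] _) =
      tensorGrading 𝒱₁ (tensorGrading 𝒱₂ 𝒲) k := by
  apply le_antisymm
  · rw [Submodule.map_le_iff_le_comap]
    refine tensorGrading_le fun a b hab x hx w hw => ?_
    have : tensorGrading 𝒱₁ 𝒱₂ a ≤ ((tensorGrading 𝒱₁ (tensorGrading 𝒱₂ 𝒲) k).comap
        (TensorProduct.assoc ℂ V₁ V₂ W : _ →ₗ[ℂ] _)).comap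
          ((TensorProduct.mk ℂ (V₁ ⊗[ℂ] V₂) W).flip w) :=
      tensorGrading_le fun c e hce v₁ h₁ v₂ h₂ =>
        tmul_mem_tensorGrading (b := e + b) (by omega) h₁ (tmul_mem_tensorGrading rfl h₂ hw)
    exact this hx
  · refine tensorGrading_le fun a b hab v hv x hx => ?_
    have : tensorGrading 𝒱₂ 𝒲 b ≤ ((tensorGrading (tensorGrading 𝒱₁ 𝒱₂) 𝒲 k).map
        (TensorProduct.assoc ℂ V₁ V₂ W : _ →ₗ[ℂ] _)).comap (TensorProduct.mk ℂ V₁ _ v) :=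
      tensorGrading_le fun c e hce v₂ h₂ w hw => ⟨(v ⊗ₜ v₂) ⊗ₜ w,
        tmul_mem_tensorGrading (a := a + c) (by omega) (tmul_mem_tensorGrading rfl hv h₂) hw, rfl⟩
    exact this hx

theorem map_lid_tensorGrading (𝒲 : ℤ → Submodule ℂ W) (k : ℤ) :
    (tensorGrading EnOps.trivialGrading 𝒲 k).map (TensorProduct.lid ℂ W : _ →ₗ[ℂ] _) = 𝒲 k := by
  apply le_antisymm
  · rw [Submodule.map_le_iff_le_comap]
    refine tensorGrading_le fun a b hab c hc w hw => ?_
    by_cases ha : a = 0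
    · have hb : b = k := by omega
      exact (𝒲 k).smul_mem c (hb ▸ hw)
    · rw [EnOps.trivialGrading, if_neg ha, Submodule.mem_bot] at hc
      simp [hc]
  · intro w hw
    refine ⟨(1 : ℂ) ⊗ₜ w, tmul_mem_tensorGrading (a := 0) (zero_add k) ?_ hw, one_smul ℂ w⟩
    simp [EnOps.trivialGrading]

end Gradings

section Counit

variable {n : ℕ} {q : ℂ} {W : Type*} [AddCommGroup W] [Module ℂ W] (Y : KnOps n W)

theorem tensorCur_zero_left {V : Type*} [AddCommGroup V] [Module ℂ V]
    (B : ℤ → 𝓛 W) (k : ℤ) : tensorCur (0 : ℤ → 𝓛 V) B k = 0 := by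
  rw [tensorCur, ← locSum_zero (ι := ℤ)]
  congr 1; funext a
  exact TensorProduct.map_zero_left _

theorem trivial_fTilde (i : ZMod n) : (EnOps.trivial n).fTilde q i = 0 := by
  funext k
  have : convCur ((EnOps.trivial n).f i) ((EnOps.trivial n).psiPInv q i) k = 0 := by
    rw [convCur, ← locSum_zero (ι := ℤ)]
    congr 1
  rw [EnOps.fTilde, scaleCur, this, smul_zero, neg_zero, Pi.zero_apply]

theorem comod_trivial_intertwines :
    (KnOps.comod q (EnOps.trivial n) Y).Intertwines Y (TensorProduct.lid ℂ W) := by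
  have hR : ∀ (b : 𝓛 W) (u), TensorProduct.lid ℂ W (opR ℂ b u) =
      b (TensorProduct.lid ℂ W u) := fun b u => by
    induction u using TensorProduct.induction_on with
    | zero => simp
    | tmul c w => simp [opR]
    | add u v hu hv => simp only [map_add, hu, hv]
  have h0 : ∀ c : ℂ, scaleCur c (0 : ℤ → 𝓛 ℂ) = 0 := fun c => by
    funext k; simp [scaleCur]
  refine ⟨one_mul _, fun i k w => ?_, fun i r hr w => ?_, fun i w => hR _ _, fun i w => hR _ _⟩
  · rw [← hR]
    simp only [KnOps.comod, trivial_fTilde, h0, tensorCur_zero_left, add_zero]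
    rw [show (EnOps.trivial n).e i = 0 from rfl, h0, tensorCur_zero_left, zero_add]
  · rw [← hR]
    have : opL W ((EnOps.trivial n).h i r) = 0 := TensorProduct.map_zero_left _
    simp only [KnOps.comod, this, smul_zero, neg_zero, zero_add, ite_self]

end Counit

end

theorem theorem3p3 (n : ℕ) [NeZero n] (hn : 3 ≤ n) (q d : ℂ) (hq : q ≠ 0) (hd : d ≠ 0)
    (hgen : ∀ i j : ℤ, (q⁻¹ * d) ^ i * (q ^ 2) ^ j = 1 → i = 0 ∧ j = 0) :
    -- the module structure on `V ⊗ W`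
    (∀ (V : Type u) [AddCommGroup V] [Module ℂ V] (W : Type w) [AddCommGroup W] [Module ℂ W]
      (X : EnOps n V) (𝒱 : ℤ → Submodule ℂ V) (Y : KnOps n W) (𝒲 : ℤ → Submodule ℂ W),
      X.IsAdmissible q d 𝒱 → Y.IsAdmissible q d 𝒲 →
      ∀ C₁ C₂ : ℂ, (X.lvl : ℂ) = C₁ → (Y.lvl : ℂ) = C₂ →
      C₂ ^ 2 ≠ 1 → C₂ ^ 2 ≠ -1 → C₂ ^ 2 ≠ q ^ 2 → C₂ ^ 2 ≠ (q⁻¹) ^ 2 →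
      (C₁ * C₂) ^ 2 ≠ 1 → (C₁ * C₂) ^ 2 ≠ -1 →
      (C₁ * C₂) ^ 2 ≠ q ^ 2 → (C₁ * C₂) ^ 2 ≠ (q⁻¹) ^ 2 →
      -- the Fourier coefficients of all the series involved are locally finite sums
      (∀ i k, LocFin (convTerms (X.f i) (X.psiPInv q i) k)) ∧
      (∀ i k, LocFin (tensorTerms (scaleCur C₂ (X.e i)) (Y.Km q i) k)) ∧
      (∀ i k, LocFin (tensorTerms (scaleCur C₂⁻¹ (X.fTilde q i)) (Y.Kp q i) k)) ∧
      (∀ i k, LocFin (tensorTerms (scaleCur (C₁⁻¹ * C₂⁻¹) (X.psiPInv q i)) (Y.Kp q i) k)) ∧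
      (∀ i k, LocFin (tensorTerms (scaleCur C₂ (X.psiM q i)) (Y.Km q i) k)) ∧
      -- the currents and `C` act by the stated formulas
      (∀ i k, (KnOps.comod q X Y).E i k =
        tensorCur (scaleCur C₂ (X.e i)) (Y.Km q i) k + opR V (Y.E i k)
          + tensorCur (scaleCur C₂⁻¹ (X.fTilde q i)) (Y.Kp q i) k) ∧
      (∀ i k, (KnOps.comod q X Y).Kp q i k =
        tensorCur (scaleCur (C₁⁻¹ * C₂⁻¹) (X.psiPInv q i)) (Y.Kp q i) k) ∧
      (∀ i k, (KnOps.comod q X Y).Km q i k =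
        tensorCur (scaleCur C₂ (X.psiM q i)) (Y.Km q i) k) ∧
      ((KnOps.comod q X Y).lvl : ℂ) = C₁ * C₂ ∧
      -- they make `V ⊗ W` an admissible module
      (KnOps.comod q X Y).IsAdmissible q d (tensorGrading 𝒱 𝒲) ∧
      -- invertibility of the zero modes is inherited
      (∀ i, IsUnit (Y.Kp0 i) → IsUnit ((KnOps.comod q X Y).Kp0 i)) ∧
      (∀ i, IsUnit (Y.Km0 i) → IsUnit ((KnOps.comod q X Y).Km0 i))) ∧
    -- coassociativity
    (∀ (V₁ : Type u) [AddCommGroup V₁] [Module ℂ V₁] (V₂ : Type v) [AddCommGroup V₂] [Module ℂ V₂]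
      (W : Type w) [AddCommGroup W] [Module ℂ W]
      (X₁ : EnOps n V₁) (𝒱₁ : ℤ → Submodule ℂ V₁) (X₂ : EnOps n V₂) (𝒱₂ : ℤ → Submodule ℂ V₂)
      (Y : KnOps n W) (𝒲 : ℤ → Submodule ℂ W),
      X₁.IsAdmissible q d 𝒱₁ → X₂.IsAdmissible q d 𝒱₂ → Y.IsAdmissible q d 𝒲 →
      (KnOps.comod q (EnOps.tensor q X₁ X₂) Y).Intertwines
        (KnOps.comod q X₁ (KnOps.comod q X₂ Y)) (TensorProduct.assoc ℂ V₁ V₂ W) ∧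
      ∀ k, (tensorGrading (tensorGrading 𝒱₁ 𝒱₂) 𝒲 k).map
          (TensorProduct.assoc ℂ V₁ V₂ W : _ →ₗ[ℂ] _) =
        tensorGrading 𝒱₁ (tensorGrading 𝒱₂ 𝒲) k) ∧
    -- counit property
    (∀ (W : Type w) [AddCommGroup W] [Module ℂ W] (Y : KnOps n W) (𝒲 : ℤ → Submodule ℂ W),
      Y.IsAdmissible q d 𝒲 →
      (KnOps.comod q (EnOps.trivial n) Y).Intertwines Y (TensorProduct.lid ℂ W) ∧
      ∀ k, (tensorGrading EnOps.trivialGrading 𝒲 k).map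
          (TensorProduct.lid ℂ W : _ →ₗ[ℂ] _) = 𝒲 k) := by
  have hqq : q - q⁻¹ ≠ 0 := fun h0 => by
    have h1 : q ^ 2 = 1 := by
      rw [sq]; nth_rewrite 2 [sub_eq_zero.1 h0]; exact mul_inv_cancel₀ hq
    have := (hgen 0 1 (by rw [zpow_zero, zpow_one, h1, one_mul])).2
    omega
  refine ⟨?_, ?_, ?_⟩
  · rintro V _ _ W _ _ X 𝒱 Y 𝒲 h h' C₁ C₂ rfl rfl - - - - - - - -
    have S := h.pairSys hn hq hd h'
    rw [← mul_inv]
    refine ⟨fun i k => ?_, fun i => locFin_tensorTerms_iff.2 (S.lf_A i), fun i k =>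
      h.locFin_tensorTerms_Kp hn hq hd h' _ i k, fun i k =>
      h.locFin_tensorTerms_Kp hn hq hd h' _ i k, fun i => locFin_tensorTerms_iff.2 (S.lf_κm i),
      fun _ _ => rfl, fun i k => ?_, fun i k => ?_, rfl, h.comod_isAdmissible hn hq hd hqq h',
      fun i hi => h.isUnit_map_qh _ hi, fun i hi => h.isUnit_map_qh _ hi⟩
    · exact h.cviLF_f_psiPInv i k
    · rw [h.comod_Kp]
    · rw [comod_Km]
  · intro V₁ _ _ V₂ _ _ W _ _ X₁ 𝒱₁ X₂ 𝒱₂ Y 𝒲 h₁ h₂ h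
    exact ⟨comod_tensor_intertwines h₁ h₂ h, map_assoc_tensorGrading 𝒱₁ 𝒱₂ 𝒲⟩
  · intro W _ _ Y 𝒲 _
    exact ⟨comod_trivial_intertwines Y, map_lid_tensorGrading 𝒲⟩
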